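/- Let $g\ge 0$, $n\ge 1$ and, for $1\le j\le n$, let $p_j,q_j,r_j,s_j$ be integers with $p_js_j-q_jr_j=1$ and $p_j\ne 0$. Put $P=\prod_j p_j$, $H=P\sum_j q_j/p_j$, and assume $H\neq 0$. Let $X$ be the Seifert manifold obtained by $(p_j,q_j)$ surgeries on the loops $P_j\times S^1$ in $\Sigma_g\times S^1$, and let $K=k+2$. *The invariant.* Put $s(p,q)=\frac1{4q}\sum_{j=1}^{|q|-1}\cot\frac{\pi j}{q}\cot\frac{\pi pj}{q}$ and $\Phi\begin{pmatrix}p&r\\q&s\end{pmatrix}=\frac{p+s}{q}-12s(p,q)$ (and $\Phi=r/s$ if $q=0$). For $q\ne 0$ let $$\tilde U^{(p,q)}_{\alpha\beta}=\frac{i\,\mathrm{sign}(q)}{\sqrt{2K|q|}}e^{-\frac{i\pi}{4}\Phi}\sum_{\mu=\pm1}\sum_{m=0}^{|q|-1}\mu\exp\Big[\frac{i\pi}{2Kq}\big(p\alpha^2-2\alpha(2Km+\mu\beta)+s(2Km+\mu\beta)^2\big)\Big],$$ and for $q=0$ let $\tilde U_{\alpha\beta}=\delta_{\alpha\beta}e^{-\frac{i\pi}{4}\Phi}e^{\frac{i\pi}{2K}rs\alpha^2}$.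 Let $\tilde S_{\alpha\beta}=\sqrt{2/K}\,\sin(\pi\alpha\beta/K)$, $N^g_{\alpha_1\ldots\alpha_n}=\sum_{\beta=1}^{K-1}\tilde S_{\beta1}^{-(n+2g-2)}\prod_j\tilde S_{\alpha_j\beta}$ and $$Z(X;k)=e^{i\phi_{\rm fr}}\sum_{1\le\alpha_1,\ldots,\alpha_n\le K-1}N^g_{\alpha_1\ldots\alpha_n}\prod_{j=1}^n\tilde U^{(p_j,q_j)}_{\alpha_j1},\qquad \phi_{\rm fr}=\frac\pi4\Big(1-\frac2K\Big)\Big[\sum_j\Phi\begin{pmatrix}-q_j&-s_j\\p_j&r_j\end{pmatrix}+3\,\mathrm{sign}\frac HP\Big].$$ *Notation.* $\beta_{\rm st}=2K\frac PH\big(m_0-\sum_j\frac{m_j}{p_j}\big)$; $E_K=\exp\big[-\frac{i\pi}{2K}\big(3\,\mathrm{sign}\frac HP+\sum_j(12s(q_j,p_j)-\frac{q_j}{p_j})\big)\big]$; $\theta_j=\frac{r_j}{p_j}m'_j-\frac12s_jl$; $a(\mu')=\sum_j\frac{\mu'_jm'_j}{p_j}$ for $\mu'\in\{\pm1\}^n$;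 $W=\exp\big[2\pi iK\sum_j\big(\frac{r_j}{p_j}m_j'^2-\frac14s_jq_jl^2\big)\big]$. $\mathrm{Sym}_\pm(x)$ is $2$ if $x=0$ and $1$ otherwise; $\mathrm{Sym}_{\mathbb Z\pm}(x)$ is $2$ if $2x\in\mathbb Z$ and $1$ otherwise; $\mathrm{sign}(0)=0$. Fractional powers are principal. *Index sets.* $I^{\rm red}$: all $(m,m_0)\in\mathbb Z^n\times\mathbb Z$ with $0\le m_j<|p_j|$ and $0<\beta_{\rm st}<K$ (a condition independent of $K$). For $l=0,1$ consider the $m'$ with $m'_j\in\mathbb Z+\frac12q_jl$ and $0\le m'_j\le\frac{|p_j|}2$; $I^{\rm irr}_l$ consists of those with $a(\mu')\notin\mathbb Z$ for all $\mu'$, and $I^{\rm sp}_l$ of those with $a(\mu')\in\mathbb Z$ for some $\mu'$. *Terms.* Formally, $$Z^{\rm (red.)}_{m;m_0}=(-1)^n\frac2{\sqrt{|H|}}\Big(\frac K2\Big)^{g-\frac12}\mathrm{sign}(P)\,e^{\frac{i\pi}2\mathrm{sign}\frac HP}\exp\Big[2\pi iK\Big(\sum_j\frac{r_j}{p_j}m_j^2+\frac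 PH\big(m_0-\sum_j\tfrac{m_j}{p_j}\big)^2\Big)\Big]E_K\sum_{l'\ge0}\frac1{l'!}\Big(\frac1{8\pi iK}\frac PH\Big)^{l'}\partial_\phi^{2l'}\frac{\prod_j\sin\big(\frac{2\pi}{p_j}(r_jm_j-\phi)\big)}{\sin^{n+2g-2}(2\pi\phi)}\Big|_{\phi=\frac{\beta_{\rm st}}{2K}},$$ $$Z^{\rm (irr.)}_{m';l}=\frac{(-1)^{n(l+1)}i\pi}{\prod_j\mathrm{Sym}_{\mathbb Z\pm}(m'_j/p_j)}\Big(\frac K2\Big)^{g-1}\frac{\mathrm{sign}P}{\sqrt{|P|}}e^{\frac{3i\pi}4\mathrm{sign}\frac HP}\,W\,E_K\,R_{m';l}(K),$$ $$R_{m';l}(K)=\frac i2(-2)^n\mathop{\rm Res}_{\beta=0}\frac{e^{-\frac{i\pi}{2K}\frac HP\beta^2}\cot(\pi\beta)}{\sin^{n+2g-2}(\frac\pi K\beta)}\prod_j\Big[i\sin(2\pi\theta_j)\cos\frac{\pi\beta}{Kp_j}\sin\frac{2\pi\beta m'_j}{p_j}+\cos(2\pi\theta_j)\sin\frac{\pi\beta}{Kp_j}\cos\frac{2\pi\beta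 m'_j}{p_j}\Big]$$ $$\qquad-\sum_{\mu'}\sum_{0\le m_0\le|a|}\frac{\mathrm{sign}(a)}{\mathrm{Sym}_\pm(m_0)\mathrm{Sym}_\pm(m_0-|a|)}\mathop{\rm Res}_{\beta=0}\frac{e^{-\frac{i\pi}{2K}\frac HP\beta^2+2\pi i\beta\,\mathrm{sign}(a)(m_0-|a|)}}{\sin^{n+2g-2}(\frac\pi K\beta)}\prod_j\mu'_j\sin\Big[2\pi\Big(\theta_j-\frac{\beta}{2K}\frac{\mu'_j}{p_j}\Big)\Big],\quad a=a(\mu'),$$ $$Z^{\rm (irr.\,sp.)}_{m';l}=Z^{\rm (irr.)}_{m';l}+\frac{(-1)^{n(l+1)}K^g}{2^{n+3g-3}\pi^{n+2g-2}}\frac{\mathrm{sign}P}{\sqrt{|P|}}\frac{e^{\frac{3i\pi}4\mathrm{sign}\frac HP}}{\prod_j\mathrm{Sym}_{\mathbb Z\pm}(m'_j/p_j)}\,W\,E_K\sum_{l'\ge0,\ l'-n\in2\mathbb Z}\Big(\frac1{2\pi iK}\frac PH\Big)^{\frac{l'-n-2g+3}2}\frac{\Gamma(\frac{l'-n-2g+3}2)}{l'!}$$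 $$\qquad\times\partial_\phi^{l'}\Big\{\Big(\frac{2\pi\phi}{\sin2\pi\phi}\Big)^{n+2g-2}\sum_{\mu':\,a(\mu')\in\mathbb Z}\prod_j\sin\Big[2\pi\Big(\frac{r_j\mu'_jm'_j-\phi}{p_j}-\frac12s_jl\Big)\Big]\Big\}\Big|_{\phi=0}.$$ **Proposition.** The sets $I^{\rm red},I^{\rm irr}_l,I^{\rm sp}_l$ are finite. For every $l\in\{0,1\}$ and $m'\in I^{\rm irr}_l\cup I^{\rm sp}_l$ the residue factor $R_{m';l}(K)$, $K\ge2$, is $K^{n+2g-2}$ times a polynomial in $1/K$ whose coefficients do not depend on $K$. As $k\to\infty$, $Z(X;k)$ has the asymptotic expansion, to all orders in $1/K$, $$Z(X;k)\sim\sum_{(m,m_0)\in I^{\rm red}}Z^{\rm (red.)}_{m;m_0}+\sum_{l=0,1}\sum_{m'\in I^{\rm irr}_l}Z^{\rm (irr.)}_{m';l}+\sum_{l=0,1}\sum_{m'\in I^{\rm sp}_l}Z^{\rm (irr.\,sp.)}_{m';l},$$ which means: for every $N\ge0$, if the series in $Z^{\rm (red.)}$ are cut to $l'<N$ and the series in $Z^{\rm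 (irr.\,sp.)}$ to $l'<2N+n+2g-2$ (so that in both cases precisely the terms of order $K^{g-\frac12-i}$ with $i<N$ are kept), the difference of the two sides is $O(K^{g-\frac12-N})$ as $k\to\infty$, for fixed $g,p,q,r,s,N$. -/

import Mathlib

namespace SeifertWRT

section Definitions

open scoped Real Topology
open Complex (I)

/-! ### Residues and symmetry counts -/

/-- The residue of `f` at the (isolated) singularity `z₀`: the limit, as the radius goes to `0`, of
`(2πi)⁻¹` times the integral of `f` over a small circle around `z₀`. -/
noncomputable def residue (f : ℂ → ℂ) (z₀ : ℂ) : ℂ :=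
  Filter.limUnder (𝓝[>] (0 : ℝ)) fun ρ : ℝ => (2 * π * I)⁻¹ * ∮ z in C(z₀, ρ), f z

/-- `Sym_±(x)`: the number of elements of the reflection group `{1, -1}` which fix `x`. -/
noncomputable def symPM (x : ℚ) : ℕ :=
  Nat.card {e : ℤˣ // ((e : ℤ) : ℚ) * x = x}

/-- `Sym_{ℤ±}(x)`: the number of elements `y ↦ ± y + a`, `a ∈ ℤ`, of the group of affine
reflections which fix `x`. -/
noncomputable def symZPM (x : ℚ) : ℕ :=
  Nat.card {h : ℤˣ × ℤ // ((h.1 : ℤ) : ℚ) * x + (h.2 : ℚ) = x}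

theorem symPM_eq (x : ℚ) : symPM x = if x = 0 then 2 else 1 := by
  unfold symPM
  rw [Nat.card_eq_fintype_card, Fintype.card_subtype]
  have hu : (Finset.univ : Finset ℤˣ) = {1, -1} := by decide
  rw [hu, Finset.filter_insert, Finset.filter_singleton]
  by_cases hx : x = 0
  · simp [hx]
  · have : ¬ (-x = x) := fun h => hx (by linarith)
    simp [hx, this]

theorem symZPM_eq (x : ℚ) [Decidable (∃ a : ℤ, 2 * x = a)] :
    symZPM x = if ∃ a : ℤ, 2 * x = a then 2 else 1 := by
  unfold symZPM
  have key : ∀ h : ℤˣ × ℤ, ((h.1 : ℤ) : ℚ) * x + (h.2 : ℚ) = x ↔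
      h = (1, 0) ∨ (h.1 = -1 ∧ 2 * x = h.2) := by
    rintro ⟨e, a⟩
    rcases Int.units_eq_one_or e with rfl | rfl
    · simp
    · simp only [Units.val_neg, Units.val_one, Int.cast_neg, Int.cast_one, Prod.mk.injEq,
        true_and]
      constructor
      · intro h
        right
        linarith
      · rintro (⟨h, -⟩ | h)
        · exact absurd h (by decide)
        · linarith
  have hset : Nat.card {h : ℤˣ × ℤ // ((h.1 : ℤ) : ℚ) * x + (h.2 : ℚ) = x} =
      Set.ncard {h : ℤˣ × ℤ | h = (1, 0) ∨ (h.1 = -1 ∧ 2 * x = h.2)} := by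
    rw [← Nat.card_coe_set_eq]
    exact Nat.card_congr (Equiv.subtypeEquivRight key)
  rw [hset]
  split_ifs with hx
  · obtain ⟨a, ha⟩ := hx
    have : {h : ℤˣ × ℤ | h = (1, 0) ∨ (h.1 = -1 ∧ 2 * x = h.2)} = {(1, 0), (-1, a)} := by
      ext ⟨e, b⟩
      simp only [Set.mem_ofPred_eq, Set.mem_insert_iff, Set.mem_singleton_iff, Prod.mk.injEq, ha,
        Int.cast_inj]
      tauto
    rw [this, Set.ncard_pair]
    intro h
    exact absurd (congrArg Prod.fst h) (show ¬ ((1 : ℤˣ) = -1) by decide)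
  · have : {h : ℤˣ × ℤ | h = (1, 0) ∨ (h.1 = -1 ∧ 2 * x = h.2)} = {(1, 0)} := by
      ext ⟨e, b⟩
      simp only [Set.mem_ofPred_eq, Set.mem_singleton_iff, or_iff_left_iff_imp]
      rintro ⟨-, h⟩
      exact absurd ⟨b, h⟩ hx
    rw [this, Set.ncard_singleton]

/-! ### The surgery formula for the `SU(2)` invariant

`K = k + 2` throughout. -/

/-- The Dedekind sum `s(p, q) = (1 / 4q) ∑_{j=1}^{|q|-1} cot(π j / q) cot(π p j / q)`. -/
noncomputable def dedekindSum (p q : ℤ) : ℝ :=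
  1 / (4 * q) * ∑ j ∈ Finset.Ico 1 q.natAbs,
    Real.cot (π * ((j : ℝ) / q)) * Real.cot (π * ((p : ℝ) * j / q))

/-- The Rademacher function of the matrix with rows `(p, r)` and `(q, s)`; for `q = 0` it has its
standard value `r / s`. -/
noncomputable def rademacher (p r q s : ℤ) : ℝ :=
  if q = 0 then (r : ℝ) / s else ((p : ℝ) + s) / q - 12 * dedekindSum p q

/-- The matrix elements `Ũ_{αβ}` representing the matrix with rows `(p, r)` and `(q, s)` of
`SL(2, ℤ)`. For `q = 0` this matrix is, up to sign, the `rs`-th power of the matrix with rows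
`(1, 1)` and `(0, 1)`, which is represented by a diagonal matrix. -/
noncomputable def surgeryMatrix (K : ℕ) (p r q s : ℤ) (α β : ℕ) : ℂ :=
  if q = 0 then
    if α = β then
      Complex.exp (-(I * π / 4) * (rademacher p r q s : ℂ)) *
        Complex.exp (I * π / (2 * K) * (r * s) * (α : ℂ) ^ 2)
    else 0
  else
    I * (q.sign : ℂ) / ((√(2 * K * |(q : ℝ)|) : ℝ) : ℂ) *
      Complex.exp (-(I * π / 4) * (rademacher p r q s : ℂ)) *
      ∑ μ : ℤˣ, ∑ m ∈ Finset.range q.natAbs, ((μ : ℤ) : ℂ) *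
        Complex.exp (I * π / (2 * K * q) *
          (p * (α : ℂ) ^ 2 - 2 * α * (2 * K * m + ((μ : ℤ) : ℂ) * β)
            + s * (2 * K * m + ((μ : ℤ) : ℂ) * β) ^ 2))

/-- `S̃_{αβ} = √(2/K) sin(π α β / K)`. -/
noncomputable def sMatrix (K α β : ℕ) : ℝ :=
  √(2 / (K : ℝ)) * Real.sin (π / K * α * β)

/-- The Verlinde number `N^g_{α₁,…,αₙ}`, which is the invariant of `Σ_g × S¹` with `n` loops
`P_j × S¹` in the representations of dimensions `α_j`. -/
noncomputable def verlinde {n : ℕ} (g K : ℕ) (α : Fin n → ℕ) : ℝ :=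
  ∑ β ∈ Finset.Icc 1 (K - 1),
    (∏ j, sMatrix K (α j) β) / sMatrix K β 1 ^ ((n : ℤ) + 2 * g - 2)

/-- The data of the rational surgeries on `n` fibers of `Σ_g × S¹`: the numbers
`(p_j, q_j)`, together with `r_j, s_j` such that `p_j s_j - q_j r_j = 1`; `p_j ≠ 0`. -/
structure SeifertData (n : ℕ) where
  p : Fin n → ℤ
  q : Fin n → ℤ
  r : Fin n → ℤ
  s : Fin n → ℤ
  det_eq_one : ∀ j, p j * s j - q j * r j = 1
  p_ne_zero : ∀ j, p j ≠ 0

namespace SeifertData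

variable {n : ℕ} (D : SeifertData n)

/-- `P = ∏ p_j`. -/
def P : ℤ := ∏ j, D.p j

/-- `H = P ∑ q_j / p_j`. -/
def H : ℚ := D.P * ∑ j, (D.q j : ℚ) / D.p j

/-- `sign P`. -/
def signP : ℤ := D.P.sign

/-- `sign (H / P)`. -/
def signHP : ℤ := SignType.sign (D.H / D.P)

/-- The framing correction `φ_fr`. The matrix with rows `(-q, -s)` and `(p, r)` is the product of
`S` (rows `(0, -1)` and `(1, 0)`) and the matrix with rows `(p, r)` and `(q, s)`. -/
noncomputable def framingPhase (K : ℕ) : ℝ :=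
  π / 4 * (1 - 2 / K) *
    (∑ j, rademacher (-D.q j) (-D.s j) (D.p j) (D.r j) + 3 * D.signHP)

/-- The invariant `Z(X; k)`, `K = k + 2`, of the Seifert manifold `X` over a surface of genus `g`,
given by the surgery formula. -/
noncomputable def invariant (g K : ℕ) : ℂ :=
  Complex.exp (I * D.framingPhase K) *
    ∑ α ∈ Fintype.piFinset fun _ : Fin n => Finset.Icc 1 (K - 1),
      (verlinde g K α : ℂ) * ∏ j, surgeryMatrix K (D.p j) (D.r j) (D.q j) (D.s j) (α j) 1

/-! ### The contributions -/

/-- The exponential `exp[-(iπ/2K) (3 sign(H/P) + ∑_j (12 s(q_j, p_j) - q_j / p_j))]`. -/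
noncomputable def framingFactor (K : ℕ) : ℂ :=
  Complex.exp (-(I * π / (2 * K)) *
    (3 * D.signHP + ∑ j, (12 * (dedekindSum (D.q j) (D.p j) : ℂ) - (D.q j : ℂ) / D.p j)))

/-- `φ_st = β_st / 2K`, where `β_st = 2K (P/H) (m₀ - ∑_j m_j / p_j)` is the stationary phase
point. -/
def phiSt (m : Fin n → ℤ) (m₀ : ℤ) : ℚ :=
  D.P / D.H * (m₀ - ∑ j, (m j : ℚ) / D.p j)

/-- The indices `(m, m₀)` with `0 ≤ m_j < |p_j|` and `0 < β_st < K`. -/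
def redIndex : Set ((Fin n → ℤ) × ℤ) :=
  {x | (∀ j, 0 ≤ x.1 j ∧ x.1 j < |D.p j|) ∧ 0 < D.phiSt x.1 x.2 ∧ D.phiSt x.1 x.2 < 1 / 2}

/-- `Z^{(red.)}_{m; m₀}`, with the series in `1/K` cut after its first `N` terms. -/
noncomputable def zRed (g K N : ℕ) (m : Fin n → ℤ) (m₀ : ℤ) : ℂ :=
  (-1) ^ n * (2 / ((√|(D.H : ℝ)| : ℝ) : ℂ)) * (((K / 2 : ℝ) ^ ((g : ℝ) - 1 / 2) : ℝ) : ℂ) *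
    D.signP * Complex.exp (I * π / 2 * D.signHP) *
    Complex.exp (2 * π * I * K * (∑ j, (D.r j : ℂ) / D.p j * (m j : ℂ) ^ 2 +
      (D.P : ℂ) / D.H * (m₀ - ∑ j, (m j : ℂ) / D.p j) ^ 2)) *
    D.framingFactor K *
    ∑ l' ∈ Finset.range N, 1 / (Nat.factorial l' : ℂ) *
      (1 / (8 * π * I * K) * ((D.P : ℂ) / D.H)) ^ l' *
      iteratedDeriv (2 * l')
        (fun φ : ℂ => (∏ j, Complex.sin (2 * π / D.p j * (D.r j * m j - φ))) /
          Complex.sin (2 * π * φ) ^ ((n : ℤ) + 2 * g - 2))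
        (D.phiSt m m₀ : ℂ)

/-- `∑_j μ_j m'_j / p_j` for signs `μ_j = ±1`. -/
def signedSum (m' : Fin n → ℚ) (μ : Fin n → ℤˣ) : ℚ :=
  ∑ j, ((μ j : ℤ) : ℚ) * m' j / D.p j

/-- The vectors `m'` with `0 ≤ m'_j ≤ |p_j| / 2` and `m'_j ∈ ℤ + q_j l / 2`. -/
def primeIndex (l : ℕ) : Set (Fin n → ℚ) :=
  {m' | ∀ j, 0 ≤ m' j ∧ m' j ≤ |(D.p j : ℚ)| / 2 ∧ ∃ a : ℤ, m' j = a + (D.q j : ℚ) * l / 2}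

/-- The indices `m'` for which no signed sum `∑_j ± m'_j / p_j` is an integer. -/
def irrIndex (l : ℕ) : Set (Fin n → ℚ) :=
  {m' | m' ∈ D.primeIndex l ∧ ∀ μ : Fin n → ℤˣ, ¬ ∃ a : ℤ, D.signedSum m' μ = a}

/-- The indices `m'` for which some signed sum `∑_j ± m'_j / p_j` is an integer. -/
def irrSpIndex (l : ℕ) : Set (Fin n → ℚ) :=
  {m' | m' ∈ D.primeIndex l ∧ ∃ μ : Fin n → ℤˣ, ∃ a : ℤ, D.signedSum m' μ = a}

/-- `exp[2πiK ∑_j (r_j m'_j² / p_j - s_j q_j l² / 4)]`. -/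
noncomputable def primePhase (K l : ℕ) (m' : Fin n → ℚ) : ℂ :=
  Complex.exp (2 * π * I * K * ∑ j, ((D.r j : ℂ) / D.p j * (m' j : ℂ) ^ 2 -
    1 / 4 * D.s j * D.q j * (l : ℂ) ^ 2))

/-- `r_j m'_j / p_j - s_j l / 2`. -/
noncomputable def angle (l : ℕ) (m' : Fin n → ℚ) (j : Fin n) : ℂ :=
  (D.r j : ℂ) / D.p j * (m' j : ℂ) - 1 / 2 * D.s j * l

/-- The regular residue, containing the cotangent. -/
noncomputable def regularResidue (g K l : ℕ) (m' : Fin n → ℚ) : ℂ :=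
  I / 2 * (-2) ^ n * residue (fun β : ℂ =>
    Complex.exp (-(I * π / (2 * K)) * ((D.H : ℂ) / D.P) * β ^ 2) /
      Complex.sin (π / K * β) ^ ((n : ℤ) + 2 * g - 2) * Complex.cot (π * β) *
    ∏ j,
      (I * Complex.sin (2 * π * D.angle l m' j) * Complex.cos (π / K * (β / D.p j)) *
          Complex.sin (2 * π * β * (m' j / D.p j)) +
        Complex.cos (2 * π * D.angle l m' j) * Complex.sin (π / K * (β / D.p j)) *
          Complex.cos (2 * π * β * (m' j / D.p j)))) 0

/-- The singular residues: with `a = ∑_j μ'_j m'_j / p_j`, the sum over the signs `μ'` and over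
the integers `0 ≤ m₀ ≤ |a|`, weighted by `sign a / (Sym_±(m₀) Sym_±(m₀ - |a|))`. -/
noncomputable def singularResidue (g K l : ℕ) (m' : Fin n → ℚ) : ℂ :=
  -∑ μ : Fin n → ℤˣ, ∑ m₀ ∈ Finset.range (⌊|D.signedSum m' μ|⌋₊ + 1),
    ((SignType.sign (D.signedSum m' μ) : ℤ) : ℂ) /
      ((symPM m₀ : ℂ) * (symPM (m₀ - |D.signedSum m' μ|) : ℂ)) *
    residue (fun β : ℂ =>
      Complex.exp (-(I * π / (2 * K)) * ((D.H : ℂ) / D.P) * β ^ 2 +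
          2 * π * I * β * ((SignType.sign (D.signedSum m' μ) : ℤ) : ℂ) *
            ((m₀ : ℂ) - ((|D.signedSum m' μ| : ℚ) : ℂ))) /
        Complex.sin (π / K * β) ^ ((n : ℤ) + 2 * g - 2) *
      ∏ j, ((μ j : ℤ) : ℂ) *
        Complex.sin (2 * π * (D.angle l m' j - β / (2 * K) * (((μ j : ℤ) : ℂ) / D.p j)))) 0

/-- The part of `Z^{(irr.)}` which consists of residues. -/
noncomputable def irrResidue (g K l : ℕ) (m' : Fin n → ℚ) : ℂ :=
  D.regularResidue g K l m' + D.singularResidue g K l m'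

/-- `∏_j Sym_{ℤ±}(m'_j / p_j)`. -/
noncomputable def symFactor (m' : Fin n → ℚ) : ℂ :=
  ∏ j, (symZPM (m' j / D.p j) : ℂ)

/-- `Z^{(irr.)}_{m'; l}`. -/
noncomputable def zIrr (g K l : ℕ) (m' : Fin n → ℚ) : ℂ :=
  (-1) ^ (n * (l + 1)) * I * π / D.symFactor m' * (K / 2 : ℂ) ^ ((g : ℤ) - 1) *
    (D.signP / ((√|(D.P : ℝ)| : ℝ) : ℂ)) * Complex.exp (I * (3 / 4) * π * D.signHP) *
    D.primePhase K l m' * D.framingFactor K * D.irrResidue g K l m'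

/-- The function `2πφ / sin(2πφ)`, with the value `1` at its removable singularity `φ = 0`. -/
noncomputable def overSin (φ : ℂ) : ℂ :=
  if φ = 0 then 1 else 2 * π * φ / Complex.sin (2 * π * φ)

open scoped Classical in
/-- `Z^{(irr. sp.)}_{m'; l}`, with the series in `l'` restricted to the powers
`K^{g - 1/2 - i}`, `i < N`, of `K`, that is to `l' < 2N + n + 2g - 2`. -/
noncomputable def zIrrSp (g K N l : ℕ) (m' : Fin n → ℚ) : ℂ :=
  D.zIrr g K l m' +
    (-1) ^ (n * (l + 1)) * (K : ℂ) ^ g /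
        ((2 : ℂ) ^ ((n : ℤ) + 3 * g - 3) * (π : ℂ) ^ ((n : ℤ) + 2 * g - 2)) *
      (D.signP / ((√|(D.P : ℝ)| : ℝ) : ℂ)) *
      (Complex.exp (I * (3 / 4) * π * D.signHP) / D.symFactor m') *
      D.primePhase K l m' * D.framingFactor K *
      ∑ l' ∈ (Finset.range (2 * N + n + 2 * g)).filter
          (fun l' : ℕ => Even (l' + n) ∧ l' + 2 < 2 * N + n + 2 * g),
        (1 / (2 * π * I * K) * ((D.P : ℂ) / D.H)) ^ (((l' : ℂ) - n - 2 * g + 3) / 2) *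
          (Complex.Gamma (((l' : ℂ) - n - 2 * g + 3) / 2) / (Nat.factorial l' : ℂ)) *
          iteratedDeriv l'
            (fun φ : ℂ => overSin φ ^ ((n : ℤ) + 2 * g - 2) *
              ∑ μ ∈ (Finset.univ : Finset (Fin n → ℤˣ)).filter
                  (fun μ => ∃ a : ℤ, D.signedSum m' μ = a),
                ∏ j, Complex.sin (2 * π *
                  ((D.r j * ((μ j : ℤ) : ℂ) * (m' j : ℂ) - φ) / D.p j - 1 / 2 * D.s j * l)))
            0

end SeifertData

end Definitions

end SeifertWRT

/-! The invariant is first rewritten as an exact finite sum of line integrals and residues.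
Estimates enter only at the end, through Laplace's method.

Exact part. For a fixed summation index `β` of the Verlinde number, the sums over the `α_j`
separate, and each one is the composition of `S̃` with a surgery matrix. Reciprocity for quadratic
Gauss sums evaluates it as a sum over residues modulo `p_j`, and Dedekind reciprocity matches the
phases (`sum_sMatrix_mul_surgeryMatrix`). Hence, up to a prefactor (`amplitude`), the invariant is a
sum over `0 < β < K` and over vectors `m` modulo `p` of a phase times `osc · exp(-2πi c β)`, where
`c = ∑ m_j / p_j` and `osc` is a Gaussian of exponent `-(iπ/2K)(H/P)β²` times sines and a power of
`1 / sin(πβ/K)` (`invariant_eq_sum_fiberSum`, `prod_fiberSum_div`).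

The sum over `β` is a difference of integrals along two lines in the direction of steepest descent,
through `1/2` and `K - 1/2`, against a kernel with poles at the integers (`sum_osc_eq`). The
numerator of the kernel may be any mean of exponentials `exp(2πiNz)`. On the first line it is
adapted to `c`, on the second to `c + H/2P`. The price of the change is a finite sum of Gaussian
integrals, indexed by the integers `m₀` between `c` and `c + H/2P`, with stationary points `2Kφ`, `φ
= (m₀ - c) P/H`. Those with `0 < φ < 1/2` give the reducible contributions. Those with `φ = 0` or
`1/2` occur with weight `1/2` and are kept with the boundary lines.

Translation by `K` carries the second line to the one through `-1/2` and changes `l = 0` into `l =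
1` (`primePhase_mul_osc_add`). With the adapted kernel each boundary term depends on `m` modulo `p`
only, so the sum over `m` folds into a sum over `m'` and signs `μ` (`sum_fold`). Summand and kernel
are respectively even and odd under `(m', z) ↦ (-m', -z)`. After summation over the signs, the
integrals through `1/2` and `-1/2` are therefore opposite, and each is half their difference, which
is a residue at `0` (`sum_boundaryTerm`). Splitting the kernel into a cotangent and exponentials
gives the two kinds of residues (`irrResidue_eq`). The end points `φ = 0, 1/2` survive exactly when
a signed sum is an integer. The outcome is `invariant_eq`.

Asymptotic part. A reducible integral is moved to its stationary point and expanded by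
`isBigO_laplace`. An end point integral has a pole of order up to `n + 2g - 2` at the stationary
point itself. Its Taylor terms are Gaussian moments of possibly negative even order, computed by a
two-sided recursion (`moment_even`), and its remainder is holomorphic at `0` and is again bounded by
Laplace's method (`isBigO_spRemainder`). The residues need no expansion: they depend on `K`
polynomially, because the integrand is a function of `z/K` and `z²/K` times a factor free of `K`
(`exists_polynomial_residue`). -/

namespace SeifertWRT

open scoped Real Topology
open Complex (I)
open Filter MeasureTheory

/-! ### Residues through principal parts -/

/-- `f` has near `z₀` an analytic part plus a finite principal part with residue `c`. -/
def HasRes (f : ℂ → ℂ) (z₀ c : ℂ) : Prop :=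
  ∃ (m : ℕ) (a : ℕ → ℂ) (g : ℂ → ℂ), AnalyticAt ℂ g z₀ ∧ a 0 = c ∧
    ∀ᶠ z in 𝓝[≠] z₀, f z = g z + ∑ k ∈ Finset.range (m + 1), a k / (z - z₀) ^ (k + 1)

theorem analyticAt_dslope {h : ℂ → ℂ} {z₀ : ℂ} (hh : AnalyticAt ℂ h z₀) :
    AnalyticAt ℂ (dslope h z₀) z₀ := by
  obtain ⟨p, hp⟩ := hh
  exact ⟨_, hp.has_fpower_series_dslope_fslope⟩

/-- Division of `h` by `z - z₀` leaves `dslope h z₀` and splits off `h z₀`, which becomes the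
coefficient of the highest pole. -/
theorem exists_principal_part (z₀ : ℂ) (n : ℕ) : ∀ h : ℂ → ℂ, AnalyticAt ℂ h z₀ →
    ∃ (a : ℕ → ℂ) (g : ℂ → ℂ), AnalyticAt ℂ g z₀ ∧ ∀ z, z ≠ z₀ →
      h z / (z - z₀) ^ n = g z + ∑ k ∈ Finset.range n, a k / (z - z₀) ^ (k + 1) := by
  induction n with
  | zero => exact fun h hh => ⟨0, h, hh, by simp⟩
  | succ n ih =>
    intro h hh
    obtain ⟨a, g, hg, hag⟩ := ih _ (analyticAt_dslope hh)
    refine ⟨fun k => if k = n then h z₀ else a k, g, hg, fun z hz => ?_⟩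
    have hz' : z - z₀ ≠ 0 := sub_ne_zero.mpr hz
    rw [Finset.sum_range_succ]
    beta_reduce
    rw [if_pos rfl, Finset.sum_congr rfl (g := fun k => a k / (z - z₀) ^ (k + 1)),
      ← add_assoc, ← hag z hz, dslope_of_ne _ hz, slope_def_field]
    · field_simp
      ring
    · intro k hk
      rw [if_neg (Finset.mem_range.mp hk).ne]

theorem exists_hasRes {f : ℂ → ℂ} {z₀ : ℂ} (hf : MeromorphicAt f z₀) : ∃ c, HasRes f z₀ c := by
  obtain ⟨n, hn⟩ := hf
  -- The superfluous factor `z - z₀` makes the number of coefficients `n + 1`, so that `a 0` is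
  -- defined by the expansion even for `n = 0`.
  obtain ⟨a, g, hg, h⟩ := exists_principal_part z₀ (n + 1) (fun z => (z - z₀) * ((z - z₀) ^ n • f z))
    (by fun_prop)
  refine ⟨a 0, n, a, g, hg, rfl, ?_⟩
  filter_upwards [self_mem_nhdsWithin] with z hz
  have hz' : z - z₀ ≠ 0 := sub_ne_zero.mpr hz
  rw [← h z hz]
  simp only [smul_eq_mul]
  field_simp
  ring

/-- The expression is constant for small `ρ`: the analytic part integrates to zero by Cauchy's
theorem, the poles of order at least two have primitives, and only `1 / (z - z₀)` is left. -/
theorem HasRes.tendsto {f : ℂ → ℂ} {z₀ c : ℂ} (hf : HasRes f z₀ c) :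
    Tendsto (fun ρ : ℝ => (2 * π * I)⁻¹ * ∮ z in C(z₀, ρ), f z) (𝓝[>] (0 : ℝ)) (𝓝 c) := by
  obtain ⟨m, a, g, hg, rfl, h⟩ := hf
  have hgd : ∀ᶠ z in 𝓝 z₀, DifferentiableAt ℂ g z :=
    hg.eventually_analyticAt.mono fun z hz => hz.differentiableAt
  rw [eventually_nhdsWithin_iff] at h
  obtain ⟨ε, hε, hb⟩ := Metric.eventually_nhds_iff_ball.mp (h.and hgd)
  refine tendsto_const_nhds.congr' ?_
  filter_upwards [Ioo_mem_nhdsGT hε] with ρ hρ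
  have hsub : Metric.closedBall z₀ ρ ⊆ Metric.ball z₀ ε := Metric.closedBall_subset_ball hρ.2
  have hsph : ∀ z ∈ Metric.sphere z₀ ρ, z ≠ z₀ := by
    rintro z hz rfl
    simp at hz
    exact hρ.1.ne hz
  have hgc : ContinuousOn g (Metric.closedBall z₀ ρ) := fun z hz =>
    (hb z (hsub hz)).2.continuousAt.continuousWithinAt
  have hg0 : (∮ z in C(z₀, ρ), g z) = 0 :=
    Complex.circleIntegral_eq_zero_of_differentiable_on_off_countable hρ.1.le
      Set.countable_empty hgc fun z hz =>
        (hb z (hsub (Metric.ball_subset_closedBall hz.1))).2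
  have hterm : ∀ k, CircleIntegrable (fun z => a k / (z - z₀) ^ (k + 1)) z₀ ρ := fun k =>
    ContinuousOn.circleIntegrable hρ.1.le <| by
      refine ContinuousOn.div continuousOn_const (by fun_prop) fun z hz => ?_
      exact pow_ne_zero _ (sub_ne_zero.mpr (hsph z hz))
  rw [circleIntegral.integral_congr hρ.1.le (g := fun z => g z +
      ∑ k ∈ Finset.range (m + 1), a k / (z - z₀) ^ (k + 1))
      (fun z hz => (hb z (hsub (Metric.sphere_subset_closedBall hz))).1 (hsph z hz)),
    circleIntegral.integral_add
      ((hgc.mono Metric.sphere_subset_closedBall).circleIntegrable hρ.1.le)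
      (CircleIntegrable.fun_sum _ fun k _ => hterm k), hg0, zero_add,
    circleIntegral.integral_fun_sum fun k _ => hterm k, Finset.sum_range_succ',
    Finset.sum_eq_zero, zero_add]
  · simp only [zero_add, pow_one, div_eq_mul_inv]
    rw [circleIntegral.integral_const_mul, circleIntegral.integral_sub_center_inv _ hρ.1.ne']
    have : (2 * π * I : ℂ) ≠ 0 := by simp [Real.pi_ne_zero]
    field_simp
  · intro k _
    have := circleIntegral.integral_sub_zpow_of_ne (n := -((k : ℤ) + 2)) (by omega) z₀ z₀ ρ
    simp only [div_eq_mul_inv]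
    rw [circleIntegral.integral_const_mul]
    simp only [zpow_neg] at this
    norm_cast at this
    rw [this, mul_zero]

theorem HasRes.residue_eq {f : ℂ → ℂ} {z₀ c : ℂ} (hf : HasRes f z₀ c) : residue f z₀ = c :=
  hf.tendsto.limUnder_eq

theorem hasRes_residue {f : ℂ → ℂ} {z₀ : ℂ} (hf : MeromorphicAt f z₀) :
    HasRes f z₀ (residue f z₀) := by
  obtain ⟨c, hc⟩ := exists_hasRes hf
  rwa [hc.residue_eq]

theorem HasRes.congr {f g : ℂ → ℂ} {z₀ c : ℂ} (hf : HasRes f z₀ c) (h : f =ᶠ[𝓝[≠] z₀] g) :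
    HasRes g z₀ c := by
  obtain ⟨m, a, g', hg, ha, h'⟩ := hf
  exact ⟨m, a, g', hg, ha, by filter_upwards [h, h'] with z h1 h2; rw [← h1, h2]⟩

theorem residue_congr {f g : ℂ → ℂ} {z₀ : ℂ} (hf : MeromorphicAt f z₀) (h : f =ᶠ[𝓝[≠] z₀] g) :
    residue f z₀ = residue g z₀ :=
  ((hasRes_residue hf).congr h).residue_eq.symm

theorem residue_const_mul {f : ℂ → ℂ} {z₀ : ℂ} (hf : MeromorphicAt f z₀) (c : ℂ) :
    residue (fun z => c * f z) z₀ = c * residue f z₀ := by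
  refine Tendsto.limUnder_eq ?_
  refine ((hasRes_residue hf).tendsto.const_mul c).congr fun ρ => ?_
  rw [circleIntegral.integral_const_mul]
  ring

theorem MeromorphicAt.eventually_circleIntegrable {f : ℂ → ℂ} {z₀ : ℂ} (hf : MeromorphicAt f z₀) :
    ∀ᶠ ρ in 𝓝[>] (0 : ℝ), CircleIntegrable f z₀ ρ := by
  have := hf.eventually_analyticAt
  rw [eventually_nhdsWithin_iff] at this
  obtain ⟨ε, hε, hb⟩ := Metric.eventually_nhds_iff_ball.mp this
  filter_upwards [Ioo_mem_nhdsGT hε] with ρ hρ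
  refine ContinuousOn.circleIntegrable hρ.1.le fun z hz => ?_
  refine (hb z ?_ ?_).continuousAt.continuousWithinAt
  · exact Metric.closedBall_subset_ball hρ.2 (Metric.sphere_subset_closedBall hz)
  · rintro rfl
    simp at hz
    exact hρ.1.ne hz

theorem residue_sum {ι : Type*} (s : Finset ι) {f : ι → ℂ → ℂ} {z₀ : ℂ}
    (hf : ∀ i ∈ s, MeromorphicAt (f i) z₀) :
    residue (fun z => ∑ i ∈ s, f i z) z₀ = ∑ i ∈ s, residue (f i) z₀ := by
  refine Tendsto.limUnder_eq ?_
  refine (tendsto_finsetSum s fun i hi => (hasRes_residue (hf i hi)).tendsto).congr' ?_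
  have : ∀ᶠ ρ in 𝓝[>] (0 : ℝ), ∀ i ∈ s, CircleIntegrable (f i) z₀ ρ :=
    (Filter.eventually_all_finset s).mpr fun i hi => MeromorphicAt.eventually_circleIntegrable (hf i hi)
  filter_upwards [this] with ρ hρ
  rw [circleIntegral.integral_fun_sum hρ, Finset.mul_sum]

theorem residue_add {f g : ℂ → ℂ} {z₀ : ℂ} (hf : MeromorphicAt f z₀) (hg : MeromorphicAt g z₀) :
    residue (fun z => f z + g z) z₀ = residue f z₀ + residue g z₀ := by
  have := residue_sum (Finset.univ : Finset (Fin 2)) (f := ![f, g]) (z₀ := z₀) (by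
    intro i _
    fin_cases i
    · exact hf
    · exact hg)
  simpa using this

theorem residue_eq_zero_of_isBigO {f : ℂ → ℂ} {z₀ : ℂ}
    (h : f =O[𝓝[≠] z₀] (fun _ => (1 : ℝ))) : residue f z₀ = 0 := by
  refine Tendsto.limUnder_eq ?_
  obtain ⟨C, hC⟩ := h.bound
  rw [eventually_nhdsWithin_iff] at hC
  obtain ⟨ε, hε, hb⟩ := Metric.eventually_nhds_iff_ball.mp hC
  refine squeeze_zero_norm' (a := fun ρ : ℝ => ρ * C) ?_ ?_
  · filter_upwards [Ioo_mem_nhdsGT hε] with ρ hρ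
    have := circleIntegral.norm_two_pi_i_inv_smul_integral_le_of_norm_le_const (f := f) (c := z₀)
      (R := ρ) (C := C) hρ.1.le fun z hz => by
        have := hb z (Metric.closedBall_subset_ball hρ.2 (Metric.sphere_subset_closedBall hz)) (by
          rintro rfl
          simp at hz
          exact hρ.1.ne hz)
        simpa using this
    simpa using this
  · have : Tendsto (fun ρ : ℝ => ρ * C) (𝓝 0) (𝓝 (0 * C)) := tendsto_id.mul_const C
    rw [zero_mul] at this
    exact this.mono_left nhdsWithin_le_nhds

/-! ### Vertical lines on both sides of a pole -/

theorem tendsto_norm_line (x : ℝ) : Tendsto (fun y : ℝ => ‖(x : ℂ) + y * I‖) (cocompact ℝ) atTop := by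
  refine tendsto_atTop_mono (f := fun y : ℝ => ‖y‖) (fun y => ?_) tendsto_norm_cocompact_atTop
  have := Complex.abs_im_le_norm ((x : ℂ) + y * I)
  simpa using this

theorem line_ne_zero {x : ℝ} (hx : x ≠ 0) (y : ℝ) : (x : ℂ) + y * I ≠ 0 := by
  intro h
  have := congrArg Complex.re h
  simp at this
  exact hx this

theorem hasDerivAt_line (x : ℂ) (c : ℂ) (y : ℝ) : HasDerivAt (fun y : ℝ => x + y * c) c y := by
  have := ((Complex.ofRealCLM.hasDerivAt (x := y)).mul_const c).const_add x
  simpa using this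

/-- The primitive tends to zero at both ends of the line, so poles of higher order do not contribute
to a difference of vertical integrals. -/
theorem tendsto_integral_one_div_line_pow {x : ℝ} (hx : x ≠ 0) (k : ℕ) :
    Tendsto (fun Y : ℝ => ∫ y in -Y..Y, 1 / ((x : ℂ) + y * I) ^ (k + 2)) atTop (𝓝 0) := by
  have hd : ∀ y : ℝ, HasDerivAt (fun y : ℝ => -(((k : ℂ) + 1) * I)⁻¹ * (((x : ℂ) + y * I) ^ (k + 1))⁻¹)
      (1 / ((x : ℂ) + y * I) ^ (k + 2)) y := by
    intro y
    have h0 := line_ne_zero hx y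
    have h1 := (((hasDerivAt_line x I y).pow (k + 1)).inv (pow_ne_zero _ h0)).const_mul
      (-(((k : ℂ) + 1) * I)⁻¹)
    refine h1.congr_deriv ?_
    have hk : (k : ℂ) + 1 ≠ 0 := by exact_mod_cast k.succ_ne_zero
    have hI := Complex.I_ne_zero
    push_cast
    simp only [Pi.pow_apply]
    generalize (x : ℂ) + y * I = w at h0
    field_simp
    ring
  have hi : ∀ Y : ℝ, ∫ y in -Y..Y, 1 / ((x : ℂ) + y * I) ^ (k + 2) =
      -(((k : ℂ) + 1) * I)⁻¹ * (((x : ℂ) + Y * I) ^ (k + 1))⁻¹ -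
      -(((k : ℂ) + 1) * I)⁻¹ * (((x : ℂ) + (-Y : ℝ) * I) ^ (k + 1))⁻¹ := by
    intro Y
    refine intervalIntegral.integral_eq_sub_of_hasDerivAt (fun y _ => hd y) ?_
    refine Continuous.intervalIntegrable ?_ _ _
    refine Continuous.div continuous_const (by fun_prop) fun y => pow_ne_zero _ (line_ne_zero hx y)
  simp only [hi]
  have hz : Tendsto (fun y : ℝ => (((x : ℂ) + y * I) ^ (k + 1))⁻¹) (cocompact ℝ) (𝓝 0) := by
    rw [tendsto_zero_iff_norm_tendsto_zero]
    simp only [norm_inv, norm_pow]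
    exact tendsto_inv_atTop_zero.comp ((tendsto_pow_atTop k.succ_ne_zero).comp (tendsto_norm_line x))
  have h1 := (hz.mono_left atTop_le_cocompact).const_mul (-(((k : ℂ) + 1) * I)⁻¹)
  have h2 := ((hz.mono_left atBot_le_cocompact).comp tendsto_neg_atTop_atBot).const_mul
    (-(((k : ℂ) + 1) * I)⁻¹)
  simpa using h1.sub h2

/-- The integrand decays only like `1 / |y|`, so the limit has to be symmetric. The primitive is `-i
log`, and at the conjugate end points the real parts of the logarithms cancel, which leaves `2 arg(x
+ iY)`. -/
theorem tendsto_integral_one_div_line_of_pos {x : ℝ} (hx : 0 < x) :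
    Tendsto (fun Y : ℝ => ∫ y in -Y..Y, 1 / ((x : ℂ) + y * I)) atTop (𝓝 π) := by
  have hs : ∀ y : ℝ, (x : ℂ) + y * I ∈ Complex.slitPlane := fun y => Or.inl (by simpa using hx)
  have hd : ∀ y : ℝ, HasDerivAt (fun y : ℝ => -I * Complex.log ((x : ℂ) + y * I))
      (1 / ((x : ℂ) + y * I)) y := by
    intro y
    have h0 := line_ne_zero hx.ne' y
    have h1 := ((hasDerivAt_line x I y).clog_real (hs y)).const_mul (-I)
    refine h1.congr_deriv ?_
    rw [mul_div_assoc', neg_mul, Complex.I_mul_I, neg_neg]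
  have hi : ∀ Y : ℝ, ∫ y in -Y..Y, 1 / ((x : ℂ) + y * I) =
      ((2 * Complex.arg ((x : ℂ) + Y * I) : ℝ) : ℂ) := by
    intro Y
    rw [intervalIntegral.integral_eq_sub_of_hasDerivAt (fun y _ => hd y)]
    · have hc : (x : ℂ) + (-Y : ℝ) * I = (starRingEnd ℂ) ((x : ℂ) + Y * I) := by
        simp
      rw [hc, Complex.log_conj _ (Complex.mem_slitPlane_iff_arg.mp (hs Y)).1]
      apply Complex.ext <;> simp [Complex.log_im]; ring
    · refine Continuous.intervalIntegrable ?_ _ _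
      exact Continuous.div continuous_const (by fun_prop) fun y => line_ne_zero hx.ne' y
  simp only [hi]
  -- Scaling by `1/Y` turns the limit of the argument at infinity into continuity of the argument at
  -- `i`.
  have hI : Tendsto (fun Y : ℝ => Complex.arg (((x / Y : ℝ) : ℂ) + I)) atTop (𝓝 (π / 2)) := by
    rw [← Complex.arg_I]
    have hc : ContinuousAt Complex.arg I := Complex.continuousAt_arg (by simp [Complex.slitPlane])
    refine hc.tendsto.comp ?_
    have : Tendsto (fun Y : ℝ => ((x / Y : ℝ) : ℂ)) atTop (𝓝 ((0 : ℝ) : ℂ)) :=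
      (Complex.continuous_ofReal.tendsto 0).comp (tendsto_const_nhds.div_atTop tendsto_id)
    simpa using this.add_const I
  have : Tendsto (fun Y : ℝ => ((2 * Complex.arg (((x / Y : ℝ) : ℂ) + I) : ℝ) : ℂ)) atTop
      (𝓝 ((2 * (π / 2) : ℝ) : ℂ)) := (Complex.continuous_ofReal.tendsto _).comp (hI.const_mul 2)
  rw [show (2 * (π / 2) : ℝ) = π by ring] at this
  refine this.congr' ?_
  filter_upwards [eventually_gt_atTop (0 : ℝ)] with Y hY
  rw [← Complex.arg_real_mul (((x / Y : ℝ) : ℂ) + I) hY]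
  congr 3
  have : (Y : ℂ) ≠ 0 := by exact_mod_cast hY.ne'
  push_cast
  field_simp

theorem tendsto_integral_one_div_line_of_neg {x : ℝ} (hx : x < 0) :
    Tendsto (fun Y : ℝ => ∫ y in -Y..Y, 1 / ((x : ℂ) + y * I)) atTop (𝓝 (-π)) := by
  have := (tendsto_integral_one_div_line_of_pos (neg_pos.mpr hx)).neg
  refine this.congr fun Y => ?_
  rw [← intervalIntegral.integral_neg]
  have hneg := intervalIntegral.integral_comp_neg (a := -Y) (b := Y)
    (fun y : ℝ => 1 / ((x : ℂ) + y * I))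
  rw [neg_neg] at hneg
  rw [← hneg]
  refine intervalIntegral.integral_congr fun y _ => ?_
  have h0 := line_ne_zero hx.ne (-y)
  have h1 := line_ne_zero (neg_ne_zero.mpr hx.ne) y
  push_cast at h0 h1 ⊢
  rw [← div_neg]
  congr 1
  ring

/-- Subtract the principal part. The rest is holomorphic in the strip and tends to zero at both
ends, so Cauchy's theorem on tall rectangles makes its two integrals agree in the limit. Of the
principal part only `c / z` counts, with `πc` on the right and `-πc` on the left. -/
theorem tendsto_sub_vertical {F : ℂ → ℂ} {a b : ℝ} {c : ℂ} (ha : a < 0) (hb : 0 < b)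
    (hF : HasRes F 0 c)
    (hd : ∀ z : ℂ, z ≠ 0 → a ≤ z.re → z.re ≤ b → DifferentiableAt ℂ F z)
    (hdec : ∀ ε > 0, ∃ Y₀ : ℝ, ∀ x ∈ Set.Icc a b, ∀ y : ℝ, Y₀ ≤ |y| → ‖F (x + y * I)‖ ≤ ε) :
    Tendsto (fun Y : ℝ => (∫ y in -Y..Y, F (b + y * I)) - ∫ y in -Y..Y, F (a + y * I)) atTop
      (𝓝 (2 * π * c)) := by
  classical
  obtain ⟨m, α, g, hg, rfl, h⟩ := hF
  set R : ℂ → ℂ := fun z => ∑ k ∈ Finset.range (m + 1), α k / z ^ (k + 1) with hR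
  set G : ℂ → ℂ := fun z => if z = 0 then g 0 else F z - R z with hG
  have hG0 : G =ᶠ[𝓝 0] g := by
    rw [eventually_nhdsWithin_iff] at h
    filter_upwards [h] with z hz
    by_cases hz0 : z = 0
    · simp [hG, hz0]
    · have := hz hz0
      simp only [sub_zero] at this
      simp [hG, hz0, this, hR]
  have hRd : ∀ z : ℂ, z ≠ 0 → DifferentiableAt ℂ R z := by
    intro z hz
    refine DifferentiableAt.fun_sum fun k _ => ?_
    exact (differentiableAt_const _).div (by fun_prop) (pow_ne_zero _ hz)
  have hGd : ∀ z : ℂ, a ≤ z.re → z.re ≤ b → DifferentiableAt ℂ G z := by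
    intro z h1 h2
    by_cases hz : z = 0
    · rw [hz]
      exact hg.differentiableAt.congr_of_eventuallyEq hG0
    · refine ((hd z hz h1 h2).sub (hRd z hz)).congr_of_eventuallyEq ?_
      filter_upwards [isOpen_ne.mem_nhds hz] with w hw
      simp [hG, hw]
  have hGdec : ∀ ε > 0, ∃ Y₀ : ℝ, ∀ x ∈ Set.Icc a b, ∀ y : ℝ, Y₀ ≤ |y| → ‖G (x + y * I)‖ ≤ ε := by
    intro ε hε
    obtain ⟨Y₁, h1⟩ := hdec (ε / 2) (half_pos hε)
    set A := ∑ k ∈ Finset.range (m + 1), ‖α k‖ with hA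
    have hA0 : 0 ≤ A := Finset.sum_nonneg fun _ _ => norm_nonneg _
    refine ⟨max (max Y₁ 1) (2 * A / ε), fun x hx y hy => ?_⟩
    have hy1 : Y₁ ≤ |y| := (le_max_left _ _).trans ((le_max_left _ _).trans hy)
    have hy2 : 1 ≤ |y| := (le_max_right _ _).trans ((le_max_left _ _).trans hy)
    have hy3 : 2 * A / ε ≤ |y| := (le_max_right _ _).trans hy
    have hn : |y| ≤ ‖(x : ℂ) + y * I‖ := by
      have := Complex.abs_im_le_norm ((x : ℂ) + y * I)
      simpa using this
    have hz : (x : ℂ) + y * I ≠ 0 := by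
      rw [← norm_pos_iff]
      linarith
    have hRb : ‖R (x + y * I)‖ ≤ A / |y| := by
      rw [hA, Finset.sum_div]
      refine (norm_sum_le _ _).trans (Finset.sum_le_sum fun k _ => ?_)
      rw [norm_div, norm_pow]
      refine div_le_div_of_nonneg_left (norm_nonneg _) (by linarith) ?_
      refine hn.trans ?_
      exact le_self_pow₀ (hy2.trans hn) k.succ_ne_zero
    have : A / |y| ≤ ε / 2 := by
      rw [div_le_iff₀ (by linarith)]
      rw [div_le_iff₀ hε] at hy3
      linarith
    have hGv : G (x + y * I) = F (x + y * I) - R (x + y * I) := by simp only [hG, if_neg hz]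
    rw [hGv]
    refine (norm_sub_le _ _).trans ?_
    linarith [h1 x hx y hy1]
  have hab : a ≤ b := by linarith
  have hrect : ∀ Y : ℝ, (∫ y in -Y..Y, G (b + y * I)) - ∫ y in -Y..Y, G (a + y * I) =
      I * ((∫ x in a..b, G (x + (-Y : ℝ) * I)) - ∫ x in a..b, G (x + Y * I)) := by
    intro Y
    have := Complex.integral_boundary_rect_eq_zero_of_differentiableOn G ⟨a, -Y⟩ ⟨b, Y⟩ (by
      intro z hz
      have hz1 := hz.1
      simp only [Set.mem_preimage, Set.uIcc_of_le hab] at hz1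
      exact (hGd z hz1.1 hz1.2).differentiableWithinAt)
    simp only [smul_eq_mul] at this
    linear_combination (-I) * this + ((∫ y in -Y..Y, G (b + y * I)) - ∫ y in -Y..Y, G (a + y * I)) * Complex.I_sq
  have hG_lim : Tendsto (fun Y : ℝ => (∫ y in -Y..Y, G (b + y * I)) - ∫ y in -Y..Y, G (a + y * I))
      atTop (𝓝 0) := by
    rw [Metric.tendsto_atTop]
    intro ε hε
    have hε' : 0 < ε / (4 * (b - a)) := by
      have : 0 < b - a := by linarith
      positivity
    obtain ⟨Y₀, hY⟩ := hGdec _ hε'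
    refine ⟨|Y₀|, fun Y hY1 => ?_⟩
    have hYabs : Y₀ ≤ |Y| := (le_abs_self _).trans (hY1.trans (le_abs_self _))
    rw [dist_zero_right, hrect, norm_mul, Complex.norm_I, one_mul]
    have key : ∀ t : ℝ, Y₀ ≤ |t| → ‖∫ x in a..b, G (x + (t : ℝ) * I)‖ ≤ ε / (4 * (b - a)) * |b - a| := by
      intro t ht
      refine intervalIntegral.norm_integral_le_of_norm_le_const fun x hx => ?_
      rw [Set.uIoc_of_le hab] at hx
      exact hY x ⟨hx.1.le, hx.2⟩ t ht
    refine (norm_sub_le _ _).trans_lt ?_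
    have e : ε / (4 * (b - a)) * |b - a| = ε / 4 := by
      rw [abs_of_pos (by linarith)]
      have : b - a ≠ 0 := by linarith
      field_simp
    have k1 := key (-Y) (by rwa [abs_neg])
    have k2 := key Y hYabs
    rw [e] at k1 k2
    linarith
  have hR_line : ∀ x : ℝ, x ≠ 0 → ∀ Y : ℝ, ∫ y in -Y..Y, R (x + y * I) =
      ∑ k ∈ Finset.range (m + 1), α k * ∫ y in -Y..Y, 1 / ((x : ℂ) + y * I) ^ (k + 1) := by
    intro x hx Y
    simp only [hR]
    rw [intervalIntegral.integral_finsetSum]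
    · refine Finset.sum_congr rfl fun k _ => ?_
      rw [← intervalIntegral.integral_const_mul]
      simp only [mul_one_div]
    · intro k _
      refine Continuous.intervalIntegrable ?_ _ _
      exact Continuous.div continuous_const (by fun_prop) fun y => pow_ne_zero _ (line_ne_zero hx y)
  have hR_lim : ∀ x : ℝ, x ≠ 0 → ∀ l : ℂ,
      Tendsto (fun Y : ℝ => ∫ y in -Y..Y, 1 / ((x : ℂ) + y * I)) atTop (𝓝 l) →
      Tendsto (fun Y : ℝ => ∫ y in -Y..Y, R (x + y * I)) atTop (𝓝 (α 0 * l)) := by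
    intro x hx l hl
    simp only [hR_line x hx, Finset.sum_range_succ', zero_add, pow_one]
    have : Tendsto (fun Y : ℝ => ∑ k ∈ Finset.range m,
        α (k + 1) * ∫ y in -Y..Y, 1 / ((x : ℂ) + y * I) ^ (k + 1 + 1)) atTop
        (𝓝 (∑ k ∈ Finset.range m, α (k + 1) * 0)) :=
      tendsto_finsetSum _ fun k _ => (tendsto_integral_one_div_line_pow hx k).const_mul _
    simpa using this.add (hl.const_mul (α 0))
  have hsplit : ∀ x : ℝ, x ≠ 0 → a ≤ x → x ≤ b → ∀ Y : ℝ, ∫ y in -Y..Y, F (x + y * I) =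
      (∫ y in -Y..Y, G (x + y * I)) + ∫ y in -Y..Y, R (x + y * I) := by
    intro x hx h1 h2 Y
    rw [← intervalIntegral.integral_add]
    · refine intervalIntegral.integral_congr fun y _ => ?_
      simp [hG, line_ne_zero hx y]
    · refine Continuous.intervalIntegrable (continuous_iff_continuousAt.mpr fun y => ?_) _ _
      have := (hGd (x + y * I) (by simpa using h1) (by simpa using h2)).continuousAt
      exact ContinuousAt.comp (f := fun y : ℝ => (x : ℂ) + y * I) this (by fun_prop)
    · refine Continuous.intervalIntegrable (continuous_iff_continuousAt.mpr fun y => ?_) _ _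
      have := (hRd (x + y * I) (line_ne_zero hx y)).continuousAt
      exact ContinuousAt.comp (f := fun y : ℝ => (x : ℂ) + y * I) this (by fun_prop)
  have hfin := hG_lim.add ((hR_lim b hb.ne' _ (tendsto_integral_one_div_line_of_pos hb)).sub
    (hR_lim a ha.ne _ (tendsto_integral_one_div_line_of_neg ha)))
  have hval : 0 + (α 0 * (π : ℂ) - α 0 * -(π : ℂ)) = 2 * π * α 0 := by ring
  rw [hval] at hfin
  refine hfin.congr fun Y => ?_
  rw [hsplit b hb.ne' hab le_rfl, hsplit a ha.ne le_rfl hab]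
  ring

/-! ### Integrals along slanted lines -/

/-- The integral of `f` along the line through the real point `x` in the direction `v`. -/
noncomputable def lineInt (v : ℂ) (f : ℂ → ℂ) (x : ℝ) : ℂ := ∫ y : ℝ, f (x + v * y)

/-- Exponential decay along the lines in the direction `v`. -/
def LineDecay (v : ℂ) (f : ℂ → ℂ) : Prop :=
  ∀ R : ℝ, ∃ C c : ℝ, 0 < c ∧ ∀ x y : ℝ, |x| ≤ R → 1 ≤ |y| →
    ‖f (x + v * y)‖ ≤ C * Real.exp (-c * |y|)

/-- At most exponential growth along the lines in the direction `v`, away from the real axis. -/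
def ExpGrowth (v : ℂ) (f : ℂ → ℂ) : Prop :=
  ∀ R : ℝ, ∃ C : ℝ, ∀ x y : ℝ, |x| ≤ R → 1 ≤ |y| → ‖f (x + v * y)‖ ≤ Real.exp (C * |y|)

theorem integrable_of_continuous_of_decay {f : ℝ → ℂ} (hf : Continuous f) {C c : ℝ} (hc : 0 < c)
    (h : ∀ y : ℝ, 1 ≤ |y| → ‖f y‖ ≤ C * Real.exp (-c * |y|)) : Integrable f := by
  refine hf.locallyIntegrable.integrable_of_isBigO_cocompact ?_
    (integrable_inv_one_add_sq.integrableAtFilter _)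
  -- This constant gives `κ (1 + y²) ≤ 1 + (c|y|)²/2 ≤ exp(c|y|)`.
  set κ := min 1 (c ^ 2 / 2) with hκ
  have hκ0 : 0 < κ := lt_min one_pos (by positivity)
  refine Asymptotics.IsBigO.of_bound (|C| / κ) ?_
  have h1 : ∀ᶠ y : ℝ in cocompact ℝ, 1 ≤ ‖y‖ :=
    tendsto_norm_cocompact_atTop.eventually (eventually_ge_atTop 1)
  filter_upwards [h1] with y hy
  rw [Real.norm_eq_abs] at hy
  refine (h y hy).trans ?_
  have hq := Real.quadratic_le_exp_of_nonneg (x := c * |y|) (by positivity)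
  have hge : κ * (1 + y ^ 2) ≤ Real.exp (c * |y|) := by
    have e1 : κ ≤ 1 := min_le_left _ _
    have e2 : κ * y ^ 2 ≤ c ^ 2 / 2 * y ^ 2 :=
      mul_le_mul_of_nonneg_right (min_le_right _ _) (sq_nonneg y)
    have e3 : (c * |y|) ^ 2 / 2 = c ^ 2 / 2 * y ^ 2 := by rw [mul_pow, sq_abs]; ring
    have e4 : 0 ≤ c * |y| := by positivity
    linarith
  have hn : ‖(1 + y ^ 2)⁻¹‖ = (1 + y ^ 2)⁻¹ := Real.norm_of_nonneg (by positivity)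
  rw [neg_mul, Real.exp_neg, hn, div_mul_eq_mul_div,
    mul_div_assoc]
  refine mul_le_mul (le_abs_self C) ?_ (by positivity) (abs_nonneg C)
  rw [inv_le_comm₀ (Real.exp_pos _) (by positivity)]
  rw [inv_div, div_inv_eq_mul]
  exact hge

theorem LineDecay.integrable {v : ℂ} {f : ℂ → ℂ} (hf : LineDecay v f) {x : ℝ}
    (hc : ∀ y : ℝ, DifferentiableAt ℂ f (x + v * y)) : Integrable fun y : ℝ => f (x + v * y) := by
  obtain ⟨C, c, hc0, h⟩ := hf |x|
  refine integrable_of_continuous_of_decay (continuous_iff_continuousAt.mpr fun y => ?_) hc0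
    fun y hy => h x y le_rfl hy
  exact ContinuousAt.comp (f := fun y : ℝ => (x : ℂ) + v * y) (hc y).continuousAt (by fun_prop)

theorem HasRes.comp_affine {f : ℂ → ℂ} {z₀ c l : ℂ} (hl : l ≠ 0) (hf : HasRes f z₀ c) :
    HasRes (fun w => f (z₀ + l * w)) 0 (c / l) := by
  obtain ⟨m, a, g, hg, rfl, h⟩ := hf
  refine ⟨m, fun k => a k / l ^ (k + 1), fun w => g (z₀ + l * w), ?_, by simp, ?_⟩
  · refine AnalyticAt.fun_comp (g := g) ?_ (by fun_prop)
    simpa using hg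
  · have ht : Tendsto (fun w : ℂ => z₀ + l * w) (𝓝[≠] 0) (𝓝[≠] z₀) := by
      refine tendsto_nhdsWithin_iff.mpr ⟨?_, ?_⟩
      · have : Tendsto (fun w : ℂ => z₀ + l * w) (𝓝 0) (𝓝 (z₀ + l * 0)) :=
          Continuous.tendsto (by fun_prop) _
        simp only [mul_zero, add_zero] at this
        exact this.mono_left nhdsWithin_le_nhds
      · filter_upwards [self_mem_nhdsWithin] with w hw
        simpa [hl] using hw
    filter_upwards [ht.eventually h] with w hw
    rw [hw]
    congr 1
    refine Finset.sum_congr rfl fun k _ => ?_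
    rw [add_sub_cancel_left, sub_zero, mul_pow, div_div]

/-- The residue theorem for slanted lines. The substitution `z = z₀ + l w` with `l = -iv` makes them
vertical. It also shifts the parameter along each line, which does not change the full integral. -/
theorem lineInt_sub_lineInt {v : ℂ} (hv : 0 < v.im) {f : ℂ → ℂ} {a b z₀ : ℝ} (ha : a < z₀)
    (hb : z₀ < b) (hm : MeromorphicAt f z₀)
    (hd : ∀ x ∈ Set.Icc a b, ∀ y : ℝ, (x : ℂ) + v * y ≠ z₀ → DifferentiableAt ℂ f (x + v * y))
    (hdec : LineDecay v f) :
    v * (lineInt v f b - lineInt v f a) = 2 * π * I * residue f z₀ := by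
  have hv0 : v ≠ 0 := by
    rintro rfl
    simp at hv
  set N := Complex.normSq v with hN
  have hNpos : 0 < N := Complex.normSq_pos.mpr hv0
  -- `α + iγ` is `1 / l`; `α > 0` is the condition that the substitution keeps the order of the two
  -- lines.
  set α : ℝ := v.im / N with hα
  set γ : ℝ := v.re / N with hγ
  have hαpos : 0 < α := div_pos hv hNpos
  set l : ℂ := -(I * v) with hl
  have hl0 : l ≠ 0 := by simp [hl, hv0]
  have hlαγ : l * (α + γ * I) = 1 := by
    have hN' : (N : ℂ) ≠ 0 := by exact_mod_cast hNpos.ne'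
    have hconj : starRingEnd ℂ v = v.re - v.im * I := Complex.ext (by simp) (by simp)
    have e1 : ((α : ℂ) + γ * I) = I * (starRingEnd ℂ v) / N := by
      rw [hα, hγ]
      push_cast
      rw [hconj]
      field_simp
      linear_combination (v.im : ℂ) * Complex.I_sq
    rw [e1, hl]
    field_simp
    rw [show -(I ^ 2 * v * (starRingEnd ℂ) v) = v * (starRingEnd ℂ) v by rw [Complex.I_sq]; ring,
      Complex.mul_conj]
  have hpt : ∀ x y : ℝ, (x : ℂ) + v * y =
      z₀ + l * ((((x - z₀) * α : ℝ) : ℂ) + ((y + (x - z₀) * γ : ℝ) : ℂ) * I) := by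
    intro x y
    push_cast
    have e2 : l * I = v := by
      rw [hl]
      linear_combination (-v) * Complex.I_sq
    linear_combination (-((x : ℂ) - z₀)) * hlαγ - (y : ℂ) * e2
  have hpt' : ∀ x' y' : ℝ, (z₀ : ℂ) + l * ((x' : ℂ) + y' * I) =
      ((z₀ + x' / α : ℝ) : ℂ) + v * ((y' - x' / α * γ : ℝ) : ℂ) := by
    intro x' y'
    rw [hpt]
    have : (z₀ + x' / α - z₀) * α = x' := by field_simp; ring
    rw [this]
    have : y' - x' / α * γ + (z₀ + x' / α - z₀) * γ = y' := by ring
    rw [this]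
  set F : ℂ → ℂ := fun w => f (z₀ + l * w) with hF
  have hFline : ∀ x y : ℝ, f (x + v * y) =
      F ((((x - z₀) * α : ℝ) : ℂ) + ((y + (x - z₀) * γ : ℝ) : ℂ) * I) := by
    intro x y
    rw [hF, hpt x y]
  have hlim := tendsto_sub_vertical (F := F) (a := (a - z₀) * α) (b := (b - z₀) * α)
    (by nlinarith) (by nlinarith) ((hasRes_residue hm).comp_affine hl0) (by
      intro w hw h1 h2
      have hdw : DifferentiableAt ℂ f (z₀ + l * w) := by
        have e : w = (w.re : ℂ) + w.im * I := (Complex.re_add_im w).symm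
        have e2 := hpt' w.re w.im
        rw [← e] at e2
        have hne : (z₀ : ℂ) + l * w ≠ z₀ := by simp [hl0, hw]
        rw [e2] at hne ⊢
        refine hd _ ⟨?_, ?_⟩ _ hne
        · have := (le_div_iff₀ hαpos).mpr h1
          linarith
        · have := (div_le_iff₀ hαpos).mpr h2
          linarith
      exact DifferentiableAt.fun_comp' (g := f) w hdw (by fun_prop)) (by
      intro ε hε
      obtain ⟨C, c, hc, h⟩ := hdec (|a| + |b|)
      have ht : Tendsto (fun t : ℝ => C * Real.exp (-c * t)) atTop (𝓝 (C * 0)) := by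
        refine Tendsto.const_mul C (Real.tendsto_exp_atBot.comp ?_)
        exact tendsto_id.const_mul_atTop_of_neg (by linarith)
      rw [mul_zero] at ht
      obtain ⟨T, hT⟩ := eventually_atTop.mp (ht.eventually (eventually_le_nhds hε))
      refine ⟨max T 1 + (|a - z₀| + |b - z₀|) * |γ|, fun x' hx' y' hy' => ?_⟩
      have hx1 : a ≤ z₀ + x' / α := by
        have := (le_div_iff₀ hαpos).mpr hx'.1
        linarith
      have hx2 : z₀ + x' / α ≤ b := by
        have := (div_le_iff₀ hαpos).mpr hx'.2
        linarith
      have hxx : |x' / α| ≤ |a - z₀| + |b - z₀| := by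
        rw [abs_le]
        constructor
        · have := neg_abs_le (a - z₀)
          have := abs_nonneg (b - z₀)
          linarith
        · have := le_abs_self (b - z₀)
          have := abs_nonneg (a - z₀)
          linarith
      have hyy : max T 1 ≤ |y' - x' / α * γ| := by
        have h1 := abs_sub_abs_le_abs_sub y' (x' / α * γ)
        rw [abs_mul] at h1
        have := mul_le_mul_of_nonneg_right hxx (abs_nonneg γ)
        linarith
      rw [hF]
      simp only
      rw [hpt']
      refine (h _ _ ?_ ((le_max_right _ _).trans hyy)).trans (hT _ ((le_max_left _ _).trans hyy))
      rw [abs_le]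
      constructor
      · have := neg_abs_le a
        have := abs_nonneg b
        linarith
      · have := le_abs_self b
        have := abs_nonneg a
        linarith)
  have hint : ∀ x ∈ Set.Icc a b, x ≠ z₀ → Integrable (fun y : ℝ => f (x + v * y)) := by
    intro x hx hxz
    refine hdec.integrable fun y => hd x hx y fun h => hxz ?_
    have him := congrArg Complex.im h
    have hre := congrArg Complex.re h
    simp only [Complex.add_im, Complex.ofReal_im, Complex.mul_im, Complex.ofReal_re, mul_zero,
      zero_add, mul_eq_zero, hv.ne', false_or] at him
    simpa [him] using hre
  have hlimx : ∀ x ∈ Set.Icc a b, x ≠ z₀ → Tendsto (fun Y : ℝ => ∫ y in -Y..Y,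
      F ((((x - z₀) * α : ℝ) : ℂ) + y * I)) atTop (𝓝 (lineInt v f x)) := by
    intro x hx hxz
    have hi := hint x hx hxz
    simp only [hFline x] at hi
    have e : lineInt v f x = ∫ y : ℝ, F ((((x - z₀) * α : ℝ) : ℂ) + y * I) := by
      rw [lineInt]
      simp only [hFline x]
      exact integral_add_right_eq_self
        (fun y : ℝ => F ((((x - z₀) * α : ℝ) : ℂ) + y * I)) ((x - z₀) * γ)
    have hi' : Integrable fun y : ℝ => F ((((x - z₀) * α : ℝ) : ℂ) + y * I) := by
      have := hi.comp_add_right (-((x - z₀) * γ))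
      simpa using this
    rw [e]
    exact intervalIntegral_tendsto_integral hi' tendsto_neg_atTop_atBot tendsto_id
  have hab : a ≤ b := (ha.trans hb).le
  have huniq := tendsto_nhds_unique hlim
    ((hlimx b ⟨hab, le_rfl⟩ hb.ne').sub (hlimx a ⟨le_rfl, hab⟩ ha.ne))
  rw [← huniq, hl]
  have hI := Complex.I_ne_zero
  field_simp
  linear_combination (-residue f z₀) * Complex.I_sq

theorem residue_eq_zero_of_analyticAt {f : ℂ → ℂ} {z₀ : ℂ} (h : AnalyticAt ℂ f z₀) :
    residue f z₀ = 0 :=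
  residue_eq_zero_of_isBigO ((h.continuousAt.norm.isBoundedUnder_le.isBigO_one ℝ).mono
    nhdsWithin_le_nhds)

/-- The midpoint of `a` and `b` is treated as a pole with residue zero. -/
theorem lineInt_eq_lineInt {v : ℂ} (hv : 0 < v.im) {f : ℂ → ℂ} {a b : ℝ} (hab : a < b) {U : Set ℂ}
    (hU : IsOpen U) (hd : DifferentiableOn ℂ f U) (hs : ∀ x ∈ Set.Icc a b, ∀ y : ℝ, (x : ℂ) + v * y ∈ U)
    (hdec : LineDecay v f) : lineInt v f a = lineInt v f b := by
  have hv0 : v ≠ 0 := by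
    rintro rfl
    simp at hv
  have hm : (((a + b) / 2 : ℝ) : ℂ) ∈ U := by
    simpa using hs ((a + b) / 2) ⟨by linarith, by linarith⟩ 0
  have han : AnalyticAt ℂ f (((a + b) / 2 : ℝ) : ℂ) := hd.analyticAt (hU.mem_nhds hm)
  have := lineInt_sub_lineInt hv (z₀ := (a + b) / 2) (by linarith) (by linarith) han.meromorphicAt
    (fun x hx y _ => hd.differentiableAt (hU.mem_nhds (hs x hx y))) hdec
  rw [residue_eq_zero_of_analyticAt han, mul_zero, mul_eq_zero, sub_eq_zero] at this
  exact (this.resolve_left hv0).symm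

/-! ### Growth of exponentials and sines -/

theorem ExpGrowth.mul {v : ℂ} {f g : ℂ → ℂ} (hf : ExpGrowth v f) (hg : ExpGrowth v g) :
    ExpGrowth v fun z => f z * g z := by
  intro R
  obtain ⟨C, h1⟩ := hf R
  obtain ⟨C', h2⟩ := hg R
  refine ⟨C + C', fun x y hx hy => ?_⟩
  rw [norm_mul, add_mul, Real.exp_add]
  exact mul_le_mul (h1 x y hx hy) (h2 x y hx hy) (norm_nonneg _) (Real.exp_pos _).le

/-- Since `|y| ≥ 1`, a constant prefactor is absorbed by a larger exponent. For this reason the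
definition can do without one, and products are bounded by adding exponents. -/
theorem ExpGrowth.of_le {v : ℂ} {f : ℂ → ℂ} (h : ∀ R : ℝ, ∃ A C : ℝ, ∀ x y : ℝ, |x| ≤ R → 1 ≤ |y| →
    ‖f (x + v * y)‖ ≤ A * Real.exp (C * |y|)) : ExpGrowth v f := by
  intro R
  obtain ⟨A, C, h1⟩ := h R
  refine ⟨|A| + C, fun x y hx hy => (h1 x y hx hy).trans ?_⟩
  rw [add_mul, Real.exp_add]
  refine mul_le_mul_of_nonneg_right ?_ (Real.exp_pos _).le
  have := Real.add_one_le_exp (|A| * |y|)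
  have := le_mul_of_one_le_right (abs_nonneg A) hy
  have := le_abs_self A
  linarith

theorem ExpGrowth.const (v c : ℂ) : ExpGrowth v fun _ => c :=
  ExpGrowth.of_le fun _ => ⟨‖c‖, 0, fun _ _ _ _ => by simp⟩

theorem ExpGrowth.add {v : ℂ} {f g : ℂ → ℂ} (hf : ExpGrowth v f) (hg : ExpGrowth v g) :
    ExpGrowth v fun z => f z + g z := by
  refine ExpGrowth.of_le fun R => ?_
  obtain ⟨C, h1⟩ := hf R
  obtain ⟨C', h2⟩ := hg R
  refine ⟨2, max C C', fun x y hx hy => ?_⟩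
  have e1 : Real.exp (C * |y|) ≤ Real.exp (max C C' * |y|) :=
    Real.exp_le_exp.mpr (mul_le_mul_of_nonneg_right (le_max_left _ _) (abs_nonneg _))
  have e2 : Real.exp (C' * |y|) ≤ Real.exp (max C C' * |y|) :=
    Real.exp_le_exp.mpr (mul_le_mul_of_nonneg_right (le_max_right _ _) (abs_nonneg _))
  have := norm_add_le (f (x + v * y)) (g (x + v * y))
  linarith [h1 x y hx hy, h2 x y hx hy]

theorem ExpGrowth.prod {v : ℂ} {ι : Type*} (s : Finset ι) {f : ι → ℂ → ℂ}
    (h : ∀ i ∈ s, ExpGrowth v (f i)) : ExpGrowth v fun z => ∏ i ∈ s, f i z := by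
  classical
  induction s using Finset.induction_on with
  | empty => simpa using ExpGrowth.const v 1
  | insert i s hi ih =>
    simp only [Finset.prod_insert hi]
    exact (h i (Finset.mem_insert_self _ _)).mul (ih fun j hj => h j (Finset.mem_insert_of_mem hj))

theorem ExpGrowth.sum {v : ℂ} {ι : Type*} (s : Finset ι) {f : ι → ℂ → ℂ}
    (h : ∀ i ∈ s, ExpGrowth v (f i)) : ExpGrowth v fun z => ∑ i ∈ s, f i z := by
  classical
  induction s using Finset.induction_on with
  | empty => simpa using ExpGrowth.const v 0
  | insert i s hi ih =>
    simp only [Finset.sum_insert hi]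
    exact (h i (Finset.mem_insert_self _ _)).add (ih fun j hj => h j (Finset.mem_insert_of_mem hj))

theorem ExpGrowth.pow {v : ℂ} {f : ℂ → ℂ} (h : ExpGrowth v f) (n : ℕ) :
    ExpGrowth v fun z => f z ^ n := by
  simpa using ExpGrowth.prod (Finset.range n) (f := fun _ => f) fun _ _ => h

theorem ExpGrowth.zpow {v : ℂ} {f : ℂ → ℂ} (h : ExpGrowth v f) (h' : ExpGrowth v fun z => (f z)⁻¹)
    (n : ℤ) : ExpGrowth v fun z => f z ^ n := by
  cases n with
  | ofNat n => simpa using h.pow n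
  | negSucc n => simpa [zpow_negSucc] using h'.pow (n + 1)

theorem ExpGrowth.cexp (v a b : ℂ) : ExpGrowth v fun z => Complex.exp (a * z + b) := by
  refine ExpGrowth.of_le fun R => ⟨Real.exp (‖a‖ * |R| + ‖b‖), ‖a‖ * ‖v‖, fun x y hx hy => ?_⟩
  rw [Complex.norm_exp, ← Real.exp_add]
  refine Real.exp_le_exp.mpr ((Complex.re_le_norm _).trans ?_)
  refine (norm_add_le _ _).trans ?_
  rw [norm_mul]
  have h1 : ‖(x : ℂ) + v * y‖ ≤ |R| + ‖v‖ * |y| := by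
    refine (norm_add_le _ _).trans ?_
    rw [norm_mul, Complex.norm_real, Complex.norm_real, Real.norm_eq_abs, Real.norm_eq_abs]
    linarith [le_abs_self R]
  have := mul_le_mul_of_nonneg_left h1 (norm_nonneg a)
  nlinarith

theorem ExpGrowth.sin (v a b : ℂ) : ExpGrowth v fun z => Complex.sin (a * z + b) := by
  have h1 := ExpGrowth.cexp v (-(a * I)) (-(b * I))
  have h2 := ExpGrowth.cexp v (a * I) (b * I)
  have := (h1.add ((ExpGrowth.const v (-1)).mul h2)).mul (ExpGrowth.const v (I / 2))
  refine (funext fun z => ?_ : (fun z => Complex.sin (a * z + b)) = _) ▸ this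
  rw [Complex.sin]
  ring_nf

/-- The reason is `|sin z| ≥ sinh |Im z| ≥ |Im z|`. It controls `1 / sin` on slanted lines away from
the real axis. -/
theorem norm_sin_ge (z : ℂ) : |z.im| ≤ ‖Complex.sin z‖ := by
  have h : ‖Complex.exp (-z * I)‖ - ‖Complex.exp (z * I)‖ ≤ 2 * ‖Complex.sin z‖ ∧
      ‖Complex.exp (z * I)‖ - ‖Complex.exp (-z * I)‖ ≤ 2 * ‖Complex.sin z‖ := by
    have e : 2 * ‖Complex.sin z‖ = ‖Complex.exp (-z * I) - Complex.exp (z * I)‖ := by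
      rw [Complex.sin, norm_div, norm_mul, Complex.norm_I]
      norm_num
      ring
    rw [e]
    exact ⟨norm_sub_norm_le _ _, by rw [norm_sub_rev]; exact norm_sub_norm_le _ _⟩
  rw [Complex.norm_exp, Complex.norm_exp] at h
  simp only [Complex.mul_re, Complex.neg_re, Complex.I_re, mul_zero, Complex.neg_im, Complex.I_im,
    mul_one, neg_neg, zero_sub] at h
  have h1 := Real.self_le_sinh_iff (x := |z.im|)
  have h2 := h1.mpr (abs_nonneg _)
  rw [Real.sinh_eq] at h2
  rcases abs_cases z.im with ⟨e, _⟩ | ⟨e, _⟩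
  · rw [e] at h2 ⊢
    linarith [h.1]
  · rw [e, neg_neg] at h2
    rw [e]
    linarith [h.2]

theorem ExpGrowth.inv_sin {v : ℂ} (hv : 0 < v.im) {a : ℝ} (ha : 0 < a) :
    ExpGrowth v fun z => (Complex.sin (a * z))⁻¹ := by
  refine ExpGrowth.of_le fun R => ⟨(a * v.im)⁻¹, 0, fun x y hx hy => ?_⟩
  rw [zero_mul, Real.exp_zero, mul_one, norm_inv]
  refine inv_anti₀ (mul_pos ha hv) ((?_ : _ ≤ _).trans (norm_sin_ge _))
  have : ((a : ℂ) * (x + v * y)).im = a * v.im * y := by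
    simp
    ring
  rw [this, abs_mul, abs_of_pos (mul_pos ha hv)]
  exact le_mul_of_one_le_right (mul_pos ha hv).le hy

/-- The sign of `Re(b v²)` makes the Gaussian decay like `exp(-κy²)` along the line, which beats the
cross term and every exponential, uniformly for bounded `x`. -/
theorem ExpGrowth.gaussian_mul {v b : ℂ} (hb : (b * v ^ 2).re < 0) {f : ℂ → ℂ} (hf : ExpGrowth v f) :
    LineDecay v fun z => Complex.exp (b * z ^ 2) * f z := by
  intro R
  obtain ⟨C, h⟩ := hf R
  set κ := -(b * v ^ 2).re with hκ
  have hκ0 : 0 < κ := by linarith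
  set B := C + 2 * ‖b‖ * |R| * ‖v‖ with hB
  refine ⟨Real.exp (‖b‖ * R ^ 2 + (B + 1) ^ 2 / (4 * κ)), 1, one_pos, fun x y hx hy => ?_⟩
  rw [norm_mul, Complex.norm_exp, ← Real.exp_add]
  have hre : (b * (x + v * y) ^ 2).re ≤ ‖b‖ * R ^ 2 + 2 * ‖b‖ * |R| * ‖v‖ * |y| - κ * y ^ 2 := by
    have e : (b * (x + v * y) ^ 2) = b * ((x ^ 2 : ℝ) : ℂ) + ((2 * x * y : ℝ) : ℂ) * (b * v) +
        ((y ^ 2 : ℝ) : ℂ) * (b * v ^ 2) := by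
      push_cast
      ring
    rw [e, Complex.add_re, Complex.add_re, Complex.re_ofReal_mul, Complex.re_ofReal_mul]
    have h1 : (b * ((x ^ 2 : ℝ) : ℂ)).re ≤ ‖b‖ * R ^ 2 := by
      refine (Complex.re_le_norm _).trans ?_
      rw [norm_mul, Complex.norm_real, Real.norm_eq_abs, abs_of_nonneg (sq_nonneg x)]
      refine mul_le_mul_of_nonneg_left ?_ (norm_nonneg _)
      exact sq_le_sq' (by linarith [neg_abs_le x]) ((le_abs_self x).trans hx)
    have h2 : 2 * x * y * (b * v).re ≤ 2 * ‖b‖ * |R| * ‖v‖ * |y| := by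
      refine (le_abs_self _).trans ?_
      rw [abs_mul, abs_mul, abs_mul, abs_two]
      have k1 := Complex.abs_re_le_norm (b * v)
      rw [norm_mul] at k1
      have k2 : |x| ≤ |R| := hx.trans (le_abs_self R)
      calc 2 * |x| * |y| * |(b * v).re| ≤ 2 * |R| * |y| * (‖b‖ * ‖v‖) := by gcongr
        _ = _ := by ring
    have h3 : y ^ 2 * (b * v ^ 2).re = -(κ * y ^ 2) := by rw [hκ]; ring
    linarith
  -- Complete the square in `(B + 1)|y| - κy²`; the extra `1` is the rate of decay that is kept.
  have hquad : B * |y| - κ * y ^ 2 ≤ (B + 1) ^ 2 / (4 * κ) - |y| := by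
    have : (B + 1) * |y| - κ * |y| ^ 2 ≤ (B + 1) ^ 2 / (4 * κ) := by
      rw [le_div_iff₀ (by positivity)]
      nlinarith [sq_nonneg (B + 1 - 2 * κ * |y|)]
    rw [sq_abs] at this
    linarith
  calc Real.exp (b * (x + v * y) ^ 2).re * ‖f (x + v * y)‖
      ≤ Real.exp (‖b‖ * R ^ 2 + 2 * ‖b‖ * |R| * ‖v‖ * |y| - κ * y ^ 2) * Real.exp (C * |y|) := by
        gcongr
        exact h x y hx hy
    _ ≤ _ := by
        rw [← Real.exp_add]
        refine Real.exp_le_exp.mpr ?_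
        have : B * |y| = C * |y| + 2 * ‖b‖ * |R| * ‖v‖ * |y| := by rw [hB]; ring
        linarith

theorem LineDecay.mono {v : ℂ} {f g : ℂ → ℂ} (hf : LineDecay v f) (h : ∀ z, g z = f z) :
    LineDecay v g := by
  rwa [funext h]

/-! ### The kernel `1 / (1 - exp (2πiz))` and sums over integers -/

theorem hasRes_div {h : ℂ → ℂ} {z₀ : ℂ} (hh : AnalyticAt ℂ h z₀) :
    HasRes (fun z => h z / (z - z₀)) z₀ (h z₀) := by
  refine ⟨0, fun _ => h z₀, dslope h z₀, analyticAt_dslope hh, rfl, ?_⟩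
  filter_upwards [self_mem_nhdsWithin] with z hz
  have hz' : z - z₀ ≠ 0 := sub_ne_zero.mpr hz
  rw [dslope_of_ne _ hz, slope_def_field]
  simp only [zero_add, Finset.range_one, Finset.sum_singleton, pow_one]
  field_simp
  ring

theorem one_sub_cexp_ne_zero {z : ℂ} (h : ∀ n : ℤ, z ≠ n) :
    1 - Complex.exp (2 * π * I * z) ≠ 0 := by
  intro h0
  obtain ⟨n, hn⟩ := Complex.exp_eq_one_iff.mp (sub_eq_zero.mp h0).symm
  have h2 : (2 * π * I : ℂ) ≠ 0 := by simp [Real.pi_ne_zero]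
  refine h n (mul_left_cancel₀ h2 ?_)
  rw [hn]
  ring

theorem cexp_two_pi_int (n : ℤ) : Complex.exp (2 * π * I * n) = 1 :=
  Complex.exp_eq_one_iff.mpr ⟨n, by ring⟩

/-- The denominator has a simple zero with derivative `-2πi` at every integer. -/
theorem hasRes_kernel {N : ℂ → ℂ} (β : ℤ) (hN : AnalyticAt ℂ N β) :
    HasRes (fun z => N z / (1 - Complex.exp (2 * π * I * z))) β (-N β / (2 * π * I)) := by
  set e : ℂ → ℂ := fun z => 1 - Complex.exp (2 * π * I * z) with he
  have hea : AnalyticAt ℂ e β := by fun_prop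
  have heβ : e β = 0 := by simp [he, cexp_two_pi_int]
  have hder : HasDerivAt e (-(2 * π * I)) β := by
    have h1 := (((hasDerivAt_id (β : ℂ)).const_mul (2 * π * I)).cexp).const_sub 1
    simpa [he, cexp_two_pi_int] using h1
  have hu : dslope e β β = -(2 * π * I) := by rw [dslope_same, hder.deriv]
  have hu0 : dslope e β β ≠ 0 := by
    rw [hu]
    simp [Real.pi_ne_zero]
  have := hasRes_div (hN.div (analyticAt_dslope hea) hu0)
  simp only [Pi.div_apply, hu] at this
  rw [neg_div, ← div_neg]
  refine this.congr ?_
  filter_upwards [self_mem_nhdsWithin] with z hz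
  rw [dslope_of_ne _ hz, slope_def_field, heβ, sub_zero]
  have hz' : z - β ≠ 0 := sub_ne_zero.mpr hz
  rw [div_div, div_mul_cancel₀ _ hz']

/-- The factorization `1 - exp(2πiz) = -2i exp(πiz) sin(πz)` reduces this to the bound for `1 /
sin`. -/
theorem ExpGrowth.kernel {v : ℂ} (hv : 0 < v.im) :
    ExpGrowth v fun z => (1 - Complex.exp (2 * π * I * z))⁻¹ := by
  have h := ((ExpGrowth.cexp v (-(π * I)) 0).mul (ExpGrowth.inv_sin hv Real.pi_pos)).mul
    (ExpGrowth.const v (I / 2))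
  refine (funext fun z => ?_ : (fun z => (1 - Complex.exp (2 * π * I * z))⁻¹) = _) ▸ h
  have e : 1 - Complex.exp (2 * π * I * z) =
      -(2 * I) * (Complex.exp (π * I * z) * Complex.sin (π * z)) := by
    rw [Complex.sin]
    have h1 : Complex.exp (π * I * z) * Complex.exp (-(π * z) * I) = 1 := by
      rw [← Complex.exp_add]
      ring_nf
      exact Complex.exp_zero
    have h2 : Complex.exp (π * I * z) * Complex.exp (π * z * I) = Complex.exp (2 * π * I * z) := by
      rw [← Complex.exp_add]
      ring_nf
    linear_combination (-1 : ℂ) * h1 + h2 + (Complex.exp (π * I * z) * Complex.exp (-(π * z) * I) -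
      Complex.exp (π * I * z) * Complex.exp (π * z * I)) * Complex.I_sq
  rw [e, mul_inv, mul_inv, ← Complex.exp_neg, add_zero, neg_mul]
  have : (-(2 * I))⁻¹ = I / 2 := by
    rw [inv_neg, mul_inv, Complex.inv_I]
    ring
  rw [this]
  ring

theorem line_eq_real {v : ℂ} (hv : 0 < v.im) {x y t : ℝ} (h : (x : ℂ) + v * y = t) :
    y = 0 ∧ x = t := by
  have him := congrArg Complex.im h
  have hre := congrArg Complex.re h
  simp only [Complex.add_im, Complex.ofReal_im, Complex.mul_im, Complex.ofReal_re, mul_zero,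
    zero_add, mul_eq_zero, hv.ne', false_or] at him
  refine ⟨him, ?_⟩
  simpa [him] using hre

/-- The line is moved across one integer at a time. It stops at half-integers, so that no pole lies
on it. -/
theorem lineInt_kernel_sum {v : ℂ} (hv : 0 < v.im) {N : ℂ → ℂ} {U : Set ℂ} (hU : IsOpen U)
    (hN : DifferentiableOn ℂ N U) (A : ℤ) (n : ℕ)
    (hs : ∀ x ∈ Set.Icc (A - 1 / 2 : ℝ) (A + n - 1 / 2), ∀ y : ℝ, (x : ℂ) + v * y ∈ U)
    (hdec : LineDecay v fun z => N z / (1 - Complex.exp (2 * π * I * z))) :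
    v * (lineInt v (fun z => N z / (1 - Complex.exp (2 * π * I * z))) (A + n - 1 / 2) -
      lineInt v (fun z => N z / (1 - Complex.exp (2 * π * I * z))) (A - 1 / 2)) =
    -∑ i ∈ Finset.range n, N ((A + i : ℤ) : ℂ) := by
  induction n with
  | zero => simp
  | succ n ih =>
    have ih' := ih fun x hx y => hs x ⟨hx.1, hx.2.trans (by push_cast; linarith)⟩ y
    have hn0 : (0 : ℝ) ≤ n := n.cast_nonneg
    have hβ : ((A + n : ℤ) : ℂ) ∈ U := by
      have := hs (A + n) ⟨by linarith, by push_cast; linarith⟩ 0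
      simpa using this
    have hres := hasRes_kernel (A + n) (hN.analyticAt (hU.mem_nhds hβ))
    have hm : MeromorphicAt (fun z => N z / (1 - Complex.exp (2 * π * I * z)))
        (((A + n : ℤ) : ℝ) : ℂ) := by
      have := (hN.analyticAt (hU.mem_nhds hβ)).meromorphicAt
      have h2 : MeromorphicAt (fun z : ℂ => 1 - Complex.exp (2 * π * I * z)) ((A + n : ℤ) : ℂ) :=
        AnalyticAt.meromorphicAt (by fun_prop)
      rw [Complex.ofReal_intCast]
      exact this.div h2
    have key := lineInt_sub_lineInt hv (a := A + n - 1 / 2) (b := A + (n + 1 : ℕ) - 1 / 2)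
      (z₀ := ((A + n : ℤ) : ℝ)) (by push_cast; linarith) (by push_cast; linarith) hm (by
        intro x hx y hne
        have hz : (x : ℂ) + v * y ∈ U := hs x ⟨by linarith [hx.1], hx.2⟩ y
        refine (hN.differentiableAt (hU.mem_nhds hz)).div (by fun_prop) ?_
        refine one_sub_cexp_ne_zero fun k hk => ?_
        have hk' : (x : ℂ) + v * y = ((k : ℝ) : ℂ) := by simpa using hk
        obtain ⟨hy, hx'⟩ := line_eq_real hv hk'
        have h1 : (A : ℝ) + n - 1 / 2 ≤ k := hx' ▸ hx.1
        have h2 : (k : ℝ) ≤ A + (n + 1 : ℕ) - 1 / 2 := hx' ▸ hx.2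
        have h3 : A + n = k := by
          have h4 : ((A + n : ℤ) : ℝ) < (k + 1 : ℤ) := by push_cast; linarith
          have h5 : ((k : ℤ) : ℝ) < (A + n + 1 : ℤ) := by push_cast at h2 ⊢; linarith
          have h6 := Int.cast_lt.mp h4
          have h7 := Int.cast_lt.mp h5
          omega
        exact hne (by rw [hk', h3])) hdec
    rw [Complex.ofReal_intCast, hres.residue_eq] at key
    rw [Finset.sum_range_succ, neg_add, ← ih']
    have h2 : (2 * π * I : ℂ) ≠ 0 := by simp [Real.pi_ne_zero]
    rw [mul_div_cancel₀ _ h2] at key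
    linear_combination key

/-! ### Reciprocity for quadratic Gauss sums -/

theorem integral_line_gaussian {v : ℂ} {a : ℂ} (hva : (a * v ^ 2).re < 0) (b : ℂ) (x : ℝ) :
    lineInt v (fun z => Complex.exp (a * z ^ 2 + b * z)) x =
      (π / -(a * v ^ 2)) ^ (1 / 2 : ℂ) * Complex.exp (-(b ^ 2 / (4 * a))) := by
  have hv0 : v ≠ 0 := by
    rintro rfl
    simp at hva
  have ha0 : a ≠ 0 := by
    rintro rfl
    simp at hva
  rw [lineInt]
  have := integral_cexp_quadratic hva (v * (2 * a * x + b)) (a * x ^ 2 + b * x)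
  rw [← integral_congr_ae (Eventually.of_forall fun y : ℝ => ?_)] at this
  · rw [this]
    congr 2
    field_simp
    ring
  · congr 1
    ring

theorem cexp_pi_I_mul_even {m : ℤ} (hm : Even m) : Complex.exp (π * I * m) = 1 := by
  obtain ⟨k, rfl⟩ := hm
  rw [← cexp_two_pi_int k]
  push_cast
  ring_nf

theorem cpow_half_ofReal {x : ℝ} (hx : 0 ≤ x) : (x : ℂ) ^ (1 / 2 : ℂ) = ((√x : ℝ) : ℂ) := by
  rw [Real.sqrt_eq_rpow, Complex.ofReal_cpow hx]
  norm_num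

/-- Mordell's contour argument. The left side is a sum of residues of a Gaussian over `1 -
exp(2πiz)`, hence a difference of integrals along lines at distance `c`. By quasi-periodicity of the
Gaussian this difference is a geometric sum without denominator, and each term is a Gaussian
integral. -/
theorem gauss_reciprocity_pos {a c : ℕ} (ha : 0 < a) (hc : 0 < c) {b : ℤ}
    (hab : Even ((a : ℤ) * c + b)) :
    ∑ n ∈ Finset.range c, Complex.exp (π * I * (a * (n : ℂ) ^ 2 + b * n) / c) =
      ((√((c : ℝ) / a) : ℝ) : ℂ) * Complex.exp (π * I / 4 * (1 - (b : ℂ) ^ 2 / (a * c))) *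
        ∑ n ∈ Finset.range a, Complex.exp (-(π * I) * (c * (n : ℂ) ^ 2 + b * n) / a) := by
  have ha' : (a : ℂ) ≠ 0 := by exact_mod_cast ha.ne'
  have hc' : (c : ℂ) ≠ 0 := by exact_mod_cast hc.ne'
  -- As `v² = i`, the exponent `πi a z² / c` is real and negative along this direction.
  set v : ℂ := Complex.exp (π * I / 4) with hv
  have hv2 : v ^ 2 = I := by
    rw [hv, ← Complex.exp_nat_mul]
    have : ((2 : ℕ) : ℂ) * (π * I / 4) = π / 2 * I := by push_cast; ring
    rw [this, Complex.exp_pi_div_two_mul_I]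
  have hvim : 0 < v.im := by
    have : v = Complex.exp ((π / 4 : ℝ) * I) := by
      rw [hv]
      congr 1
      push_cast
      ring
    rw [this, Complex.exp_ofReal_mul_I_im]
    exact Real.sin_pos_of_pos_of_lt_pi (by positivity) (by linarith [Real.pi_pos])
  set α : ℂ := π * I * a / c with hα
  have hαv : α * v ^ 2 = ((-(π * a / c) : ℝ) : ℂ) := by
    rw [hv2, hα]
    push_cast
    linear_combination ((π : ℂ) * a / c) * Complex.I_sq
  have hαre : (α * v ^ 2).re < 0 := by
    rw [hαv, Complex.ofReal_re]
    have : (0 : ℝ) < π * a / c := by positivity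
    linarith
  set N : ℂ → ℂ := fun z => Complex.exp (α * z ^ 2 + π * I * b / c * z) with hN
  have hNd : Differentiable ℂ N := by fun_prop
  have hdec : LineDecay v fun z => N z / (1 - Complex.exp (2 * π * I * z)) := by
    refine (ExpGrowth.gaussian_mul hαre
      ((ExpGrowth.cexp v (π * I * b / c) 0).mul (ExpGrowth.kernel hvim))).mono fun z => ?_
    rw [hN]
    simp only
    rw [Complex.exp_add, add_zero]
    ring
  have hsum := lineInt_kernel_sum hvim isOpen_univ hNd.differentiableOn 0 c (fun _ _ _ => trivial) hdec
  have hdecN : ∀ k : ℕ, LineDecay v fun z => Complex.exp (α * z ^ 2 + (π * I * b / c + 2 * π * I * k) * z) := by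
    intro k
    refine (ExpGrowth.gaussian_mul hαre
      (ExpGrowth.cexp v (π * I * b / c + 2 * π * I * k) 0)).mono fun z => ?_
    rw [Complex.exp_add, add_zero]
  have hne : ∀ y : ℝ, 1 - Complex.exp (2 * π * I * (((-(1 / 2) : ℝ) : ℂ) + v * y)) ≠ 0 := by
    intro y
    refine one_sub_cexp_ne_zero fun k hk => ?_
    have hk' : ((-(1 / 2) : ℝ) : ℂ) + v * y = ((k : ℝ) : ℂ) := by simpa using hk
    have h2 := (line_eq_real hvim hk').2
    have h3 : ((2 * k : ℤ) : ℝ) = ((-1 : ℤ) : ℝ) := by push_cast; linarith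
    have := Int.cast_injective h3
    omega
  -- The translate `N(z + c)` is `exp(πi(ac + b)) exp(2πiaz) N(z)`. The parity condition removes the
  -- first factor, and `exp(2πiaz) - 1` is divisible by the denominator.
  have hshift : ∀ z : ℂ, 1 - Complex.exp (2 * π * I * z) ≠ 0 →
      N (z + c) / (1 - Complex.exp (2 * π * I * (z + c))) - N z / (1 - Complex.exp (2 * π * I * z)) =
      -∑ k ∈ Finset.range a, Complex.exp (α * z ^ 2 + (π * I * b / c + 2 * π * I * k) * z) := by
    intro z hz
    have e1 : Complex.exp (2 * π * I * (z + c)) = Complex.exp (2 * π * I * z) := by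
      rw [mul_add, Complex.exp_add]
      have := cexp_two_pi_int c
      rw [Int.cast_natCast] at this
      rw [this, mul_one]
    have e2 : N (z + c) = N z * Complex.exp (2 * π * I * z) ^ a := by
      rw [hN]
      simp only
      rw [← Complex.exp_nat_mul, ← Complex.exp_add]
      have h1 := cexp_pi_I_mul_even hab
      rw [← mul_one (Complex.exp (_ + _ + _)), ← h1, ← Complex.exp_add]
      congr 1
      rw [hα]
      push_cast
      field_simp
      ring
    have e3 : ∑ k ∈ Finset.range a, Complex.exp (α * z ^ 2 + (π * I * b / c + 2 * π * I * k) * z) =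
        N z * ∑ k ∈ Finset.range a, Complex.exp (2 * π * I * z) ^ k := by
      rw [Finset.mul_sum]
      refine Finset.sum_congr rfl fun k _ => ?_
      rw [hN]
      simp only
      rw [← Complex.exp_nat_mul, ← Complex.exp_add]
      congr 1
      ring
    rw [e1, e2, e3, ← sub_div, div_eq_iff hz]
    have := geom_sum_mul (Complex.exp (2 * π * I * z)) a
    linear_combination (-(N z)) * this
  have hdiff : lineInt v (fun z => N z / (1 - Complex.exp (2 * π * I * z))) (((0 : ℤ) : ℝ) + c - 1 / 2) -
      lineInt v (fun z => N z / (1 - Complex.exp (2 * π * I * z))) (((0 : ℤ) : ℝ) - 1 / 2) =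
      -∑ k ∈ Finset.range a,
        lineInt v (fun z => Complex.exp (α * z ^ 2 + (π * I * b / c + 2 * π * I * k) * z)) (-(1 / 2)) := by
    have hid : ∀ m : ℤ, Integrable fun y : ℝ => N (((m - 1 / 2 : ℝ) : ℂ) + v * y) /
        (1 - Complex.exp (2 * π * I * (((m - 1 / 2 : ℝ) : ℂ) + v * y))) := by
      intro m
      refine hdec.integrable fun y => (hNd _).div (by fun_prop) ?_
      refine one_sub_cexp_ne_zero fun k hk => ?_
      have hk' : ((m - 1 / 2 : ℝ) : ℂ) + v * y = ((k : ℝ) : ℂ) := by simpa using hk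
      have h2 := (line_eq_real hvim hk').2
      have h3 : ((2 * m - 1 : ℤ) : ℝ) = ((2 * k : ℤ) : ℝ) := by push_cast; linarith
      have := Int.cast_injective h3
      omega
    have hi0 := hid 0
    have hic := hid c
    have ex0 : ((0 : ℤ) : ℝ) - 1 / 2 = -(1 / 2) := by norm_num
    have exc : ((0 : ℤ) : ℝ) + c - 1 / 2 = ((c : ℤ) : ℝ) - 1 / 2 := by simp
    rw [ex0] at hi0 ⊢
    rw [exc]
    rw [lineInt, lineInt, ← integral_sub hic hi0]
    unfold lineInt
    rw [← integral_finsetSum, ← integral_neg]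
    · refine integral_congr_ae (Eventually.of_forall fun y => ?_)
      have := hshift _ (hne y)
      simp only
      rw [← this]
      congr 2
      · congr 1
        push_cast
        ring
      · congr 3
        push_cast
        ring
    · intro k _
      exact (hdecN k).integrable fun y => by fun_prop
  rw [hdiff] at hsum
  -- Completing the square turns the linear coefficient `πib/c + 2πik` into the `k`-th term of the
  -- dual sum.
  have hgauss : ∀ k : ℕ,
      lineInt v (fun z => Complex.exp (α * z ^ 2 + (π * I * b / c + 2 * π * I * k) * z)) (-(1 / 2)) =
      ((√((c : ℝ) / a) : ℝ) : ℂ) * (Complex.exp (-(π * I / 4) * ((b : ℂ) ^ 2 / (a * c))) *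
        Complex.exp (-(π * I) * (c * (k : ℂ) ^ 2 + b * k) / a)) := by
    intro k
    rw [integral_line_gaussian hαre, hαv, ← Complex.exp_add, ← cpow_half_ofReal (by positivity)]
    congr 2
    · push_cast
      have : (π : ℂ) ≠ 0 := by exact_mod_cast Real.pi_ne_zero
      field_simp
    · rw [hα]
      have : (π : ℂ) ≠ 0 := by exact_mod_cast Real.pi_ne_zero
      have hI := Complex.I_ne_zero
      field_simp
      ring
  simp only [hgauss, ← Finset.mul_sum] at hsum
  have hL : ∑ n ∈ Finset.range c, Complex.exp (π * I * (a * (n : ℂ) ^ 2 + b * n) / c) =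
      ∑ i ∈ Finset.range c, N ((0 + i : ℤ) : ℂ) := by
    refine Finset.sum_congr rfl fun n _ => ?_
    rw [hN, hα]
    simp only
    congr 1
    push_cast
    ring
  have hR : Complex.exp (π * I / 4 * (1 - (b : ℂ) ^ 2 / (a * c))) =
      v * Complex.exp (-(π * I / 4) * ((b : ℂ) ^ 2 / (a * c))) := by
    rw [hv, ← Complex.exp_add]
    congr 1
    ring
  rw [hL, hR]
  linear_combination hsum

theorem sum_range_mul_of_isCoprime {N : ℕ} {f : ℤ → ℂ} (hf : Function.Periodic f N) {u : ℤ}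
    (hu : IsCoprime u N) :
    ∑ n ∈ Finset.range N, f (u * n) = ∑ n ∈ Finset.range N, f n := by
  rcases Nat.eq_zero_or_pos N with rfl | hN
  · simp
  have hN' : (0 : ℤ) < N := by exact_mod_cast hN
  have hmap : ∀ n ∈ Finset.range N, ((u * n) % N).toNat ∈ Finset.range N := fun n _ => by
    have h1 := Int.emod_lt_of_pos (u * n) hN'
    have h2 := Int.emod_nonneg (u * n) hN'.ne'
    rw [Finset.mem_range]
    omega
  have hinj : Set.InjOn (fun n : ℕ => ((u * n) % N).toNat) (Finset.range N) := by
    intro n hn m hm h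
    have h2 := Int.emod_nonneg (u * n) hN'.ne'
    have h3 := Int.emod_nonneg (u * m) hN'.ne'
    have h4 : (u * n) % N = (u * m) % N := by
      simp only at h
      omega
    have h5 : (N : ℤ) ∣ u * (n - m) := by
      rw [mul_sub]
      exact Int.ModEq.dvd h4.symm
    have h6 : (N : ℤ) ∣ n - m := hu.symm.dvd_of_dvd_mul_left h5
    have hn' := Finset.mem_range.mp hn
    have hm' := Finset.mem_range.mp hm
    obtain ⟨k, hk⟩ := h6
    have : k = 0 := by
      by_contra hk0
      rcases lt_or_gt_of_ne hk0 with h7 | h7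
      · nlinarith
      · nlinarith
    subst this
    simp only [mul_zero] at hk
    omega
  refine Finset.sum_nbij (fun n : ℕ => ((u * n) % N).toNat) hmap hinj
    (Finset.surjOn_of_injOn_of_card_le _ hmap hinj le_rfl) fun n _ => ?_
  rw [Int.toNat_of_nonneg (Int.emod_nonneg _ hN'.ne')]
  have := hf.int_mul (u * n / N) ((u * n) % N)
  rw [← this]
  congr 1
  rw [Int.cast_id, mul_comm (u * n / N : ℤ)]
  exact (Int.emod_add_mul_ediv _ _).symm

/-- Changing the signs of `a`, `b` and `c` together changes neither side, so `c > 0` may be assumed;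
then a negative `a` is reached by complex conjugation. -/
theorem gauss_reciprocity {a c b : ℤ} (ha : a ≠ 0) (hc : c ≠ 0) (hab : Even (a * c + b)) :
    ∑ n ∈ Finset.range c.natAbs, Complex.exp (π * I * (a * (n : ℂ) ^ 2 + b * n) / c) =
      ((√(|(c : ℝ) / a|) : ℝ) : ℂ) *
        Complex.exp (π * I / 4 * ((a * c).sign - (b : ℂ) ^ 2 / (a * c))) *
        ∑ n ∈ Finset.range a.natAbs, Complex.exp (-(π * I) * (c * (n : ℂ) ^ 2 + b * n) / a) := by
  wlog hc0 : 0 < c generalizing a b c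
  · have h := this (a := -a) (c := -c) (b := -b) (neg_ne_zero.mpr ha) (neg_ne_zero.mpr hc) (by
      rw [neg_mul_neg]
      have := hab.sub (even_two_mul b)
      rwa [show a * c + b - 2 * b = a * c + -b by ring] at this) (by omega)
    simp only [Int.natAbs_neg, neg_mul_neg, Int.cast_neg, neg_sq, neg_div_neg_eq] at h
    refine Eq.trans (Finset.sum_congr rfl fun x _ => ?_)
      (h.trans (congrArg₂ (· * ·) rfl (Finset.sum_congr rfl fun x _ => ?_)))
    · rw [div_neg, ← neg_div]
      congr 2
      ring
    · rw [div_neg, ← neg_div]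
      congr 2
      ring
  obtain ⟨c, rfl⟩ := Int.eq_ofNat_of_zero_le hc0.le
  have hc1 : 0 < c := by exact_mod_cast hc0
  rcases lt_or_gt_of_ne ha with ha0 | ha0
  · obtain ⟨a', ha'⟩ := Int.eq_ofNat_of_zero_le (neg_nonneg.mpr ha0.le)
    obtain rfl : a = -(a' : ℤ) := by omega
    have ha1 : 0 < a' := by omega
    have h := congrArg (starRingEnd ℂ) (gauss_reciprocity_pos (b := -b) ha1 hc1 (by
      have := hab.neg
      rwa [show -(-(a' : ℤ) * (c : ℕ) + b) = a' * c + -b by ring] at this))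
    simp only [map_mul, map_sum, ← Complex.exp_conj, map_div₀, map_add, map_sub, map_pow, map_neg,
      map_one, map_natCast, map_intCast, Complex.conj_I, Complex.conj_ofReal, Int.cast_neg,
      map_ofNat] at h
    have hsg : (-(a' : ℤ) * (c : ℤ)).sign = -1 :=
      Int.sign_eq_neg_one_of_neg (by nlinarith [mul_pos (Int.natCast_pos.mpr ha1) (Int.natCast_pos.mpr hc1)])
    simp only [Int.natAbs_neg, Int.natAbs_natCast, hsg, Int.cast_neg, Int.cast_natCast, Int.cast_one,
      abs_div, abs_neg, Nat.abs_cast]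
    refine Eq.trans (Finset.sum_congr rfl fun x _ => ?_)
      (h.trans (congrArg₂ (· * ·) (congrArg₂ (· * ·) rfl (congrArg _ ?_))
        ?_))
    · congr 2
      ring
    · rw [neg_mul (a' : ℂ), div_neg]
      ring
    -- Conjugation leaves `-b` in the dual sum; the reflection `x ↦ -x` modulo `a'` restores `b`.
    · have hper : Function.Periodic (fun x : ℤ => Complex.exp (π * I * (c * (x : ℂ) ^ 2 + b * x) / a'))
          (a' : ℤ) := by
        intro x
        have ha'' : (a' : ℂ) ≠ 0 := by exact_mod_cast ha1.ne'
        have h1 := cexp_pi_I_mul_even (m := 2 * (c * x) + (c * a' + b)) (by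
          refine (even_two_mul _).add ?_
          have := (even_two_mul ((a' : ℤ) * c)).add hab
          rwa [show 2 * ((a' : ℤ) * c) + (-(a' : ℤ) * (c : ℕ) + b) = c * a' + b by ring] at this)
        simp only
        rw [← mul_one (Complex.exp (π * I * (c * (x : ℂ) ^ 2 + b * x) / a')), ← h1, ← Complex.exp_add]
        congr 1
        push_cast
        field_simp
        ring
      have hs := sum_range_mul_of_isCoprime hper (u := -1) (isCoprime_one_left.neg_left)
      refine Eq.trans (Finset.sum_congr rfl fun x _ => ?_)
        (hs.trans (Finset.sum_congr rfl fun x _ => ?_))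
      · congr 2
        push_cast
        ring
      · rw [div_neg, ← neg_div]
        congr 2
        push_cast
        ring
  · obtain ⟨a, rfl⟩ := Int.eq_ofNat_of_zero_le ha0.le
    have ha1 : 0 < a := by exact_mod_cast ha0
    have h := gauss_reciprocity_pos ha1 hc1 hab
    have hsg : ((a : ℤ) * (c : ℤ)).sign = 1 := Int.sign_eq_one_of_pos (by positivity)
    simp only [Int.natAbs_natCast, hsg, Int.cast_natCast, Int.cast_one, abs_div, Nat.abs_cast]
    exact h

/-! ### Reciprocity for Dedekind sums -/

theorem cot_pi_add_one (x : ℝ) : Real.cot (π * (x + 1)) = Real.cot (π * x) := by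
  rw [Real.cot_eq_cos_div_sin, Real.cot_eq_cos_div_sin, mul_add, mul_one, Real.cos_add_pi,
    Real.sin_add_pi, neg_div_neg_eq]

theorem cot_neg (x : ℝ) : Real.cot (-x) = -Real.cot x := by
  rw [Real.cot_eq_cos_div_sin, Real.cot_eq_cos_div_sin, Real.cos_neg, Real.sin_neg, div_neg]

theorem cot_pi_zero : Real.cot (π * 0) = 0 := by
  simp [Real.cot_eq_cos_div_sin]

theorem cot_pi_one : Real.cot (π * 1) = 0 := by
  simp [Real.cot_eq_cos_div_sin]

theorem sum_cot_div (N : ℕ) : ∑ j ∈ Finset.Ico 1 N, Real.cot (π * ((j : ℝ) / N)) = 0 := by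
  have h : ∑ j ∈ Finset.Ico 1 N, Real.cot (π * ((j : ℝ) / N)) =
      ∑ j ∈ Finset.Ico 1 N, -Real.cot (π * ((j : ℝ) / N)) := by
    refine Finset.sum_nbij' (fun j => N - j) (fun j => N - j) ?_ ?_ ?_ ?_ ?_
    · intro j hj
      rw [Finset.mem_Ico] at hj ⊢
      omega
    · intro j hj
      rw [Finset.mem_Ico] at hj ⊢
      omega
    · intro j hj
      rw [Finset.mem_Ico] at hj
      omega
    · intro j hj
      rw [Finset.mem_Ico] at hj
      omega
    · intro j hj
      rw [Finset.mem_Ico] at hj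
      have hN : (N : ℝ) ≠ 0 := by
        have : 0 < N := by omega
        positivity
      have h1 := cot_pi_add_one ((j : ℝ) / N - 1)
      rw [sub_add_cancel] at h1
      rw [h1, ← cot_neg, ← mul_neg, Nat.cast_sub hj.2.le]
      congr 2
      field_simp
      ring
  rw [Finset.sum_neg_distrib] at h
  linarith

/-- The addition theorem of the cotangent without its denominator. Summed over pairs of angles, it
gives both `sum_cot_sq` and Dedekind reciprocity. -/
theorem cot_mul_cot_sub_one {A B : ℝ} (hA : Real.sin A ≠ 0) (hB : Real.sin B ≠ 0)
    (hAB : Real.sin (A + B) ≠ 0) :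
    Real.cot A * Real.cot B - 1 = Real.cot (A + B) * (Real.cot A + Real.cot B) := by
  simp only [Real.cot_eq_cos_div_sin]
  field_simp
  rw [Real.sin_add, Real.cos_add]
  ring

theorem sin_pi_mul_ne_zero {x : ℝ} (h : ∀ n : ℤ, x ≠ n) : Real.sin (π * x) ≠ 0 := by
  intro h0
  obtain ⟨n, hn⟩ := Real.sin_eq_zero_iff.mp h0
  refine h n (mul_left_cancel₀ Real.pi_ne_zero ?_)
  rw [← hn]
  ring

theorem div_ne_int {j N : ℕ} (h0 : 0 < j) (hN : j < N) (n : ℤ) : (j : ℝ) / N ≠ n := by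
  intro h
  have hN' : (0 : ℝ) < N := by exact_mod_cast h0.trans hN
  rw [div_eq_iff hN'.ne'] at h
  have h' : (j : ℤ) = n * N := by exact_mod_cast h
  have h1 : 0 < n := by
    by_contra hn
    nlinarith
  nlinarith

theorem sum_cot_shift {N : ℕ} (hN : 0 < N) (j : ℕ) :
    ∑ k ∈ Finset.range N, Real.cot (π * ((j + k : ℝ) / N)) = 0 := by
  have hN' : (N : ℝ) ≠ 0 := by positivity
  induction j with
  | zero =>
    rw [Finset.range_eq_Ico, Finset.sum_eq_sum_Ico_succ_bot hN]
    simp only [CharP.cast_eq_zero, zero_add, zero_div, cot_pi_zero]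
    exact sum_cot_div N
  | succ j ih =>
    have h1 := Finset.sum_range_succ (fun k : ℕ => Real.cot (π * ((j + k : ℝ) / N))) N
    have h2 := Finset.sum_range_succ' (fun k : ℕ => Real.cot (π * ((j + k : ℝ) / N))) N
    rw [ih] at h1
    have h3 : Real.cot (π * ((j + N : ℝ) / N)) = Real.cot (π * ((j + (0 : ℕ) : ℝ) / N)) := by
      rw [← cot_pi_add_one (((j : ℝ) + (0 : ℕ)) / N)]
      congr 2
      push_cast
      field_simp
      ring
    rw [h1, h3] at h2
    have h4 : ∑ k ∈ Finset.range N, Real.cot (π * (((j + 1 : ℕ) + k : ℝ) / N)) =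
        ∑ k ∈ Finset.range N, Real.cot (π * ((j + (k + 1 : ℕ) : ℝ) / N)) :=
      Finset.sum_congr rfl fun k _ => by
        congr 2
        push_cast
        ring
    rw [h4]
    linarith

theorem sum_cot_shift_Ico {N : ℕ} (hN : 0 < N) (j : ℕ) :
    ∑ k ∈ Finset.Ico 1 N, Real.cot (π * ((j : ℝ) / N + k / N)) = -Real.cot (π * ((j : ℝ) / N)) := by
  have := sum_cot_shift hN j
  rw [Finset.range_eq_Ico, Finset.sum_eq_sum_Ico_succ_bot hN] at this
  simp only [CharP.cast_eq_zero, add_zero, zero_add, add_div] at this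
  linarith

/-- Sum the addition theorem over all angles `πj/N`, `πk/N`. The sums of single cotangents vanish,
and a full period of `cot(A + B)` sums to zero, so that its sum over `k ≠ 0` is `-cot A`. -/
theorem sum_cot_sq {N : ℕ} (hN : 0 < N) :
    ∑ j ∈ Finset.Ico 1 N, Real.cot (π * ((j : ℝ) / N)) ^ 2 = ((N : ℝ) - 1) * (N - 2) / 3 := by
  set C := ∑ j ∈ Finset.Ico 1 N, Real.cot (π * ((j : ℝ) / N)) ^ 2 with hC
  -- For `j + k = N` the addition theorem fails. There the right side is zero because the quotient
  -- `cot π` has the value zero, and the left side without the correction is `-1 - cot²`.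
  have hpt : ∀ j ∈ Finset.Ico 1 N, ∀ k ∈ Finset.Ico 1 N,
      Real.cot (π * ((j : ℝ) / N)) * Real.cot (π * ((k : ℝ) / N)) - 1 +
        (if k = N - j then 1 + Real.cot (π * ((j : ℝ) / N)) ^ 2 else 0) =
      Real.cot (π * ((j : ℝ) / N + k / N)) *
        (Real.cot (π * ((j : ℝ) / N)) + Real.cot (π * ((k : ℝ) / N))) := by
    intro j hj k hk
    rw [Finset.mem_Ico] at hj hk
    have hN' : (N : ℝ) ≠ 0 := by positivity
    split_ifs with h
    · have e1 : (j : ℝ) / N + k / N = 1 := by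
        rw [h, Nat.cast_sub hj.2.le]
        field_simp
        ring
      have e2 : (k : ℝ) / N = -(j / N) + 1 := by linarith
      rw [e1, cot_pi_one, e2, cot_pi_add_one, mul_neg, cot_neg]
      ring
    · rw [add_zero, mul_add π]
      refine cot_mul_cot_sub_one (sin_pi_mul_ne_zero (div_ne_int (by omega) hj.2))
        (sin_pi_mul_ne_zero (div_ne_int (by omega) hk.2)) ?_
      rw [← mul_add]
      refine sin_pi_mul_ne_zero fun n hn => ?_
      rw [← add_div, div_eq_iff hN'] at hn
      have hn' : (j + k : ℤ) = n * N := by exact_mod_cast hn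
      have h1 : 0 < n := by
        by_contra h0
        have : n * (N : ℤ) ≤ 0 := mul_nonpos_of_nonpos_of_nonneg (by omega) (by omega)
        omega
      have h2 : n < 2 := by
        by_contra h0
        have : 2 * (N : ℤ) ≤ n * N := by nlinarith
        omega
      have : n = 1 := by omega
      subst this
      omega
  have hrow : ∀ j ∈ Finset.Ico 1 N, Real.cot (π * ((j : ℝ) / N)) ^ 2 - (N - 2) =
      -Real.cot (π * ((j : ℝ) / N)) ^ 2 + ∑ k ∈ Finset.Ico 1 N,
        Real.cot (π * ((j : ℝ) / N + k / N)) * Real.cot (π * ((k : ℝ) / N)) := by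
    intro j hj
    have h1 := Finset.sum_congr rfl (hpt j hj)
    simp only [mul_add (Real.cot (π * ((j : ℝ) / N + _))), Finset.sum_add_distrib,
      Finset.sum_sub_distrib, ← Finset.mul_sum, ← Finset.sum_mul, sum_cot_div,
      sum_cot_shift_Ico hN, Finset.sum_const, Nat.card_Ico, nsmul_eq_mul, mul_one] at h1
    rw [Finset.sum_ite_eq', if_pos (by rw [Finset.mem_Ico] at hj ⊢; omega), Nat.cast_sub hN,
      Nat.cast_one] at h1
    linarith
  have htot := Finset.sum_congr rfl hrow
  rw [Finset.sum_sub_distrib, Finset.sum_add_distrib, Finset.sum_neg_distrib, Finset.sum_comm] at htot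
  have hcol : ∀ k ∈ Finset.Ico 1 N, ∑ j ∈ Finset.Ico 1 N,
      Real.cot (π * ((j : ℝ) / N + k / N)) * Real.cot (π * ((k : ℝ) / N)) =
      -Real.cot (π * ((k : ℝ) / N)) ^ 2 := by
    intro k _
    rw [← Finset.sum_mul]
    simp only [add_comm _ ((k : ℝ) / N)]
    rw [sum_cot_shift_Ico hN]
    ring
  rw [Finset.sum_congr rfl hcol, Finset.sum_neg_distrib, ← hC, Finset.sum_const, Nat.card_Ico,
    nsmul_eq_mul, Nat.cast_sub hN, Nat.cast_one] at htot
  linarith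

/-- Every summand is a geometric sum over the common denominator `y^N - 1`; summation over the roots
of unity leaves only the constant terms. -/
theorem sum_inv_root_mul_sub_one {N : ℕ} (hN : 0 < N) {y : ℂ} (hy : y ^ N ≠ 1) :
    ∑ k ∈ Finset.range N, (y * Complex.exp (2 * π * I / N) ^ k - 1)⁻¹ = N / (y ^ N - 1) := by
  set ζ := Complex.exp (2 * π * I / N) with hζ
  have hprim : IsPrimitiveRoot ζ N := Complex.isPrimitiveRoot_exp N hN.ne'
  have hy' : y ^ N - 1 ≠ 0 := sub_ne_zero.mpr hy
  have hterm : ∀ k : ℕ, (y * ζ ^ k - 1)⁻¹ = (∑ r ∈ Finset.range N, y ^ r * (ζ ^ r) ^ k) / (y ^ N - 1) := by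
    intro k
    have hpow : (y * ζ ^ k) ^ N = y ^ N := by
      rw [mul_pow, ← pow_mul, mul_comm k, pow_mul, hprim.pow_eq_one, one_pow, mul_one]
    have hg := mul_geom_sum (y * ζ ^ k) N
    rw [hpow] at hg
    have hne : y * ζ ^ k - 1 ≠ 0 := by
      intro h0
      rw [h0, zero_mul] at hg
      exact hy' hg.symm
    rw [inv_eq_one_div, div_eq_div_iff hne hy', one_mul, ← hg, mul_comm]
    congr 1
    refine Finset.sum_congr rfl fun r _ => ?_
    rw [mul_pow, ← pow_mul, ← pow_mul, mul_comm k]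
  simp only [hterm]
  rw [← Finset.sum_div, Finset.sum_comm]
  congr 1
  rw [Finset.sum_eq_single 0]
  · simp
  · intro r hr hr0
    rw [← Finset.mul_sum]
    have h1 : ζ ^ r ≠ 1 := hprim.pow_ne_one_of_pos_of_lt hr0 (Finset.mem_range.mp hr)
    have h2 := mul_geom_sum (ζ ^ r) N
    rw [← pow_mul, mul_comm r, pow_mul, hprim.pow_eq_one, one_pow, sub_self, mul_eq_zero] at h2
    rw [h2.resolve_left (sub_ne_zero.mpr h1), mul_zero]
  · intro h
    exact absurd (Finset.mem_range.mpr hN) h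

theorem cot_pi_eq_exp {x : ℝ} (h : Real.sin (π * x) ≠ 0) :
    ((Real.cot (π * x) : ℝ) : ℂ) = I * (1 + 2 * (Complex.exp (2 * π * I * x) - 1)⁻¹) := by
  have hs : Complex.sin (π * x) ≠ 0 := by
    have : ((Real.sin (π * x) : ℝ) : ℂ) ≠ 0 := by exact_mod_cast h
    simpa using this
  rw [Real.cot_eq_cos_div_sin]
  push_cast
  have e : Complex.exp (2 * π * I * x) - 1 = 2 * I * Complex.sin (π * x) * Complex.exp (π * x * I) := by
    have h1 : Complex.exp (2 * π * I * x) = Complex.exp (π * x * I) * Complex.exp (π * x * I) := by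
      rw [← Complex.exp_add]
      ring_nf
    have h2 : Complex.exp (-(π * x) * I) * Complex.exp (π * x * I) = 1 := by
      rw [← Complex.exp_add]
      simp
    rw [Complex.sin, h1]
    linear_combination h2 - (Complex.exp (-(π * x) * I) * Complex.exp (π * x * I) -
      Complex.exp (π * x * I) * Complex.exp (π * x * I)) * Complex.I_sq
  rw [e]
  have hI := Complex.I_ne_zero
  have hE := Complex.exp_ne_zero (π * x * I)
  have hcs : Complex.exp (π * x * I) = Complex.cos (π * x) + Complex.sin (π * x) * I :=
    Complex.exp_mul_I _
  field_simp
  have hcs2 : Complex.sin (π * x) ^ 2 + Complex.cos (π * x) ^ 2 = 1 := Complex.sin_sq_add_cos_sq _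
  rw [hcs]
  linear_combination hcs2 - (Complex.sin (π * x) ^ 2) * Complex.I_sq

/-- The multiplication formula of the cotangent: `cot(πx)` is affine in `1 / (exp(2πix) - 1)`, and
these fractions are summed by `sum_inv_root_mul_sub_one`. -/
theorem sum_cot_mul {N : ℕ} (hN : 0 < N) {x : ℝ} (hx : ∀ n : ℤ, N * x ≠ n) :
    ∑ k ∈ Finset.range N, Real.cot (π * (x + k / N)) = N * Real.cot (π * (N * x)) := by
  have hN' : (N : ℝ) ≠ 0 := by positivity
  have hNc : (N : ℂ) ≠ 0 := by exact_mod_cast hN.ne'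
  have h1 : ∀ k : ℕ, Real.sin (π * (x + k / N)) ≠ 0 := by
    intro k
    refine sin_pi_mul_ne_zero fun n hn => ?_
    refine hx (N * n - k) ?_
    push_cast
    rw [← hn]
    field_simp
    ring
  have h2 : Real.sin (π * (N * x)) ≠ 0 := sin_pi_mul_ne_zero hx
  have hy : Complex.exp (2 * π * I * x) ^ N ≠ 1 := by
    rw [← Complex.exp_nat_mul]
    intro h0
    obtain ⟨n, hn⟩ := Complex.exp_eq_one_iff.mp h0
    refine hx n ?_
    have h3 : (2 * π * I : ℂ) ≠ 0 := by simp [Real.pi_ne_zero]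
    have : ((N * x : ℝ) : ℂ) = ((n : ℝ) : ℂ) := by
      refine mul_left_cancel₀ h3 ?_
      push_cast
      linear_combination hn
    exact_mod_cast this
  have key := sum_inv_root_mul_sub_one hN hy
  have : ((∑ k ∈ Finset.range N, Real.cot (π * (x + k / N)) : ℝ) : ℂ) =
      ((N * Real.cot (π * (N * x)) : ℝ) : ℂ) := by
    rw [Complex.ofReal_sum, Complex.ofReal_mul, cot_pi_eq_exp h2]
    simp only [cot_pi_eq_exp (h1 _)]
    rw [← Finset.mul_sum, Finset.sum_add_distrib, ← Finset.mul_sum]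
    have e1 : ∀ k : ℕ, Complex.exp (2 * π * I * ((x + k / N : ℝ) : ℂ)) =
        Complex.exp (2 * π * I * x) * Complex.exp (2 * π * I / N) ^ k := by
      intro k
      rw [← Complex.exp_nat_mul, ← Complex.exp_add]
      congr 1
      push_cast
      field_simp
    have e2 : Complex.exp (2 * π * I * ((N * x : ℝ) : ℂ)) = Complex.exp (2 * π * I * x) ^ N := by
      rw [← Complex.exp_nat_mul]
      congr 1
      push_cast
      ring
    simp only [e1, e2]
    rw [key]
    simp only [Finset.sum_const, Finset.card_range, nsmul_eq_mul, mul_one, div_eq_mul_inv]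
    push_cast
    ring
  exact_mod_cast this

/-- Sum the addition theorem over the angles `πj/p` and `πk/q`. By the multiplication formula, the
inner sum of `cot(A + B)` over `k` is `q cot(πqj/p) - cot(πj/p)`. Multiplied by `cot(πj/p)` and
summed over `j`, it gives one Dedekind sum and a sum of squares. The other half is symmetric. -/
theorem dedekindSum_reciprocity_pos {p q : ℕ} (hp : 0 < p) (hq : 0 < q) (hpq : Nat.Coprime p q) :
    12 * (dedekindSum p q + dedekindSum q p) = (1 + (p : ℝ) ^ 2 + (q : ℝ) ^ 2) / (p * q) - 3 := by
  have hp' : (p : ℝ) ≠ 0 := by positivity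
  have hq' : (q : ℝ) ≠ 0 := by positivity
  have hnot : ∀ {a b : ℕ}, 0 < a → Nat.Coprime a b → ∀ j ∈ Finset.Ico 1 a, ∀ n : ℤ,
      (b : ℝ) * ((j : ℝ) / a) ≠ n := by
    intro a b ha hab j hj n hn
    rw [Finset.mem_Ico] at hj
    have ha' : (a : ℝ) ≠ 0 := by positivity
    rw [mul_div_assoc', div_eq_iff ha'] at hn
    have hn' : (b * j : ℤ) = n * a := by exact_mod_cast hn
    have : a ∣ b * j := by
      have : (a : ℤ) ∣ ((b * j : ℕ) : ℤ) := ⟨n, by push_cast; rw [hn']; ring⟩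
      exact_mod_cast this
    have := Nat.le_of_dvd (by omega) (hab.dvd_of_dvd_mul_left this)
    omega
  have hsum : ∀ {a b : ℕ}, 0 < a → 0 < b → Nat.Coprime a b → ∀ j ∈ Finset.Ico 1 a,
      ∑ k ∈ Finset.Ico 1 b, Real.cot (π * ((j : ℝ) / a + k / b)) =
        b * Real.cot (π * ((b : ℝ) * j / a)) - Real.cot (π * ((j : ℝ) / a)) := by
    intro a b ha hb hab j hj
    have := sum_cot_mul hb (hnot ha hab j hj)
    rw [Finset.range_eq_Ico, Finset.sum_eq_sum_Ico_succ_bot hb] at this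
    simp only [CharP.cast_eq_zero, zero_div, add_zero, zero_add] at this
    rw [mul_div_assoc (b : ℝ)]
    linarith
  have hpt : ∀ j ∈ Finset.Ico 1 p, ∀ k ∈ Finset.Ico 1 q,
      Real.cot (π * ((j : ℝ) / p)) * Real.cot (π * ((k : ℝ) / q)) - 1 =
      Real.cot (π * ((j : ℝ) / p + k / q)) * Real.cot (π * ((j : ℝ) / p)) +
        Real.cot (π * ((j : ℝ) / p + k / q)) * Real.cot (π * ((k : ℝ) / q)) := by
    intro j hj k hk
    have hj' := Finset.mem_Ico.mp hj
    have hk' := Finset.mem_Ico.mp hk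
    rw [← mul_add, mul_add π]
    refine cot_mul_cot_sub_one (sin_pi_mul_ne_zero (div_ne_int (by omega) hj'.2))
      (sin_pi_mul_ne_zero (div_ne_int (by omega) hk'.2)) ?_
    rw [← mul_add]
    refine sin_pi_mul_ne_zero fun n hn => hnot hp hpq j hj (q * n - k) ?_
    push_cast
    rw [← hn]
    field_simp
    ring
  have htot := Finset.sum_congr rfl fun j hj => Finset.sum_congr rfl (hpt j hj)
  have hL : ∑ j ∈ Finset.Ico 1 p, ∑ k ∈ Finset.Ico 1 q,
      (Real.cot (π * ((j : ℝ) / p)) * Real.cot (π * ((k : ℝ) / q)) - 1) = -(((p : ℝ) - 1) * (q - 1)) := by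
    simp only [Finset.sum_sub_distrib, ← Finset.mul_sum, sum_cot_div, mul_zero, Finset.sum_const,
      Nat.card_Ico, nsmul_eq_mul, mul_one, Nat.cast_sub hp, Nat.cast_sub hq]
    push_cast
    ring
  have hR1 : ∑ j ∈ Finset.Ico 1 p, ∑ k ∈ Finset.Ico 1 q,
      Real.cot (π * ((j : ℝ) / p + k / q)) * Real.cot (π * ((j : ℝ) / p)) =
      4 * p * q * dedekindSum q p - ((p : ℝ) - 1) * (p - 2) / 3 := by
    have : ∀ j ∈ Finset.Ico 1 p, ∑ k ∈ Finset.Ico 1 q,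
        Real.cot (π * ((j : ℝ) / p + k / q)) * Real.cot (π * ((j : ℝ) / p)) =
        q * (Real.cot (π * ((j : ℝ) / p)) * Real.cot (π * ((q : ℝ) * j / p))) -
          Real.cot (π * ((j : ℝ) / p)) ^ 2 := by
      intro j hj
      rw [← Finset.sum_mul, hsum hp hq hpq j hj]
      ring
    rw [Finset.sum_congr rfl this, Finset.sum_sub_distrib, ← Finset.mul_sum, sum_cot_sq hp, dedekindSum]
    simp only [Int.natAbs_natCast, Int.cast_natCast]
    field_simp
  have hR2 : ∑ j ∈ Finset.Ico 1 p, ∑ k ∈ Finset.Ico 1 q,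
      Real.cot (π * ((j : ℝ) / p + k / q)) * Real.cot (π * ((k : ℝ) / q)) =
      4 * p * q * dedekindSum p q - ((q : ℝ) - 1) * (q - 2) / 3 := by
    rw [Finset.sum_comm]
    have : ∀ k ∈ Finset.Ico 1 q, ∑ j ∈ Finset.Ico 1 p,
        Real.cot (π * ((j : ℝ) / p + k / q)) * Real.cot (π * ((k : ℝ) / q)) =
        p * (Real.cot (π * ((k : ℝ) / q)) * Real.cot (π * ((p : ℝ) * k / q))) -
          Real.cot (π * ((k : ℝ) / q)) ^ 2 := by
      intro k hk
      rw [← Finset.sum_mul]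
      simp only [add_comm _ ((k : ℝ) / q)]
      rw [hsum hq hp hpq.symm k hk]
      ring
    rw [Finset.sum_congr rfl this, Finset.sum_sub_distrib, ← Finset.mul_sum, sum_cot_sq hq, dedekindSum]
    simp only [Int.natAbs_natCast, Int.cast_natCast]
    field_simp
  simp only [Finset.sum_add_distrib] at htot
  rw [hL, hR1, hR2] at htot
  field_simp
  linarith

theorem dedekindSum_neg_left (p q : ℤ) : dedekindSum (-p) q = -dedekindSum p q := by
  unfold dedekindSum
  rw [← mul_neg, ← Finset.sum_neg_distrib]
  congr 1
  refine Finset.sum_congr rfl fun j _ => ?_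
  rw [← mul_neg, ← cot_neg]
  congr 2
  push_cast
  ring

theorem dedekindSum_neg_right (p q : ℤ) : dedekindSum p (-q) = -dedekindSum p q := by
  unfold dedekindSum
  rw [Int.natAbs_neg, Int.cast_neg, mul_neg, div_neg, neg_mul]
  congr 2
  refine Finset.sum_congr rfl fun j _ => ?_
  rw [div_neg, div_neg, mul_neg, mul_neg, cot_neg, cot_neg, neg_mul_neg]

theorem dedekindSum_reciprocity {p q : ℤ} (hp : p ≠ 0) (hq : q ≠ 0) (hpq : IsCoprime p q) :
    12 * (dedekindSum p q + dedekindSum q p) =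
      (1 + (p : ℝ) ^ 2 + (q : ℝ) ^ 2) / (p * q) - 3 * (p * q).sign := by
  wlog hp0 : 0 < p generalizing p
  · have := this (p := -p) (neg_ne_zero.mpr hp) hpq.neg_left (by omega)
    rw [dedekindSum_neg_left, dedekindSum_neg_right, neg_mul, Int.sign_neg] at this
    push_cast at this
    rw [neg_sq, neg_mul (p : ℝ), div_neg] at this
    linarith
  wlog hq0 : 0 < q generalizing q
  · have := this (q := -q) (neg_ne_zero.mpr hq) hpq.neg_right (by omega)
    rw [dedekindSum_neg_left, dedekindSum_neg_right, mul_neg, Int.sign_neg] at this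
    push_cast at this
    rw [neg_sq, mul_neg (p : ℝ), div_neg] at this
    linarith
  obtain ⟨p, rfl⟩ := Int.eq_ofNat_of_zero_le hp0.le
  obtain ⟨q, rfl⟩ := Int.eq_ofNat_of_zero_le hq0.le
  rw [Int.sign_eq_one_of_pos (mul_pos hp0 hq0)]
  have := dedekindSum_reciprocity_pos (p := p) (q := q) (by exact_mod_cast hp0)
    (by exact_mod_cast hq0) (Nat.isCoprime_iff_coprime.mp hpq)
  simpa using this

/-! ### Composition of the surgery matrices with `S̃` -/

theorem cexp_congr {a b : ℂ} (n : ℤ) (h : a = b + 2 * π * I * n) : Complex.exp a = Complex.exp b := by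
  rw [h, Complex.exp_add, cexp_two_pi_int, mul_one]

theorem isCoprime_natAbs {a q : ℤ} (h : IsCoprime a q) : IsCoprime a (q.natAbs : ℤ) := by
  rcases Int.natAbs_eq q with hq | hq
  · rwa [← hq]
  · rw [show (q.natAbs : ℤ) = -q by omega]
    exact h.neg_right

theorem sum_range_mul_eq (f : ℤ → ℂ) (M N : ℕ) :
    ∑ y ∈ Finset.range (M * N), f y =
      ∑ α ∈ Finset.range M, ∑ t ∈ Finset.range N, f (α + M * t) := by
  rw [Finset.sum_comm]
  induction N with
  | zero => simp
  | succ N ih =>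
    rw [Nat.mul_succ, Finset.sum_range_add, ih, Finset.sum_range_succ]
    congr 1
    refine Finset.sum_congr rfl fun x _ => ?_
    congr 1
    push_cast
    ring

/-- An odd function of period `2K` vanishes at `0` and `K`, and the terms `α` and `2K - α` of the
sum over a full period combine to `2i sin`. The full period is what a Gauss sum requires. -/
theorem sum_sin_mul_odd {K : ℕ} (hK : 0 < K) (β : ℕ) {u : ℤ → ℂ} (hu : Function.Periodic u (2 * K : ℕ))
    (ho : ∀ x, u (-x) = -u x) :
    2 * I * ∑ α ∈ Finset.Icc 1 (K - 1), Complex.sin (π / K * α * β) * u α =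
      ∑ α ∈ Finset.range (2 * K), Complex.exp (π * I / K * α * β) * u α := by
  have hK' : (K : ℂ) ≠ 0 := by exact_mod_cast hK.ne'
  have h0 : u 0 = 0 := by
    have := ho 0
    simp only [neg_zero] at this
    linear_combination (1 / 2) * this
  have hK0 : u K = 0 := by
    have h1 := ho K
    have h2 := hu (-(K : ℤ))
    rw [show -(K : ℤ) + (2 * K : ℕ) = K by push_cast; ring] at h2
    linear_combination (1 / 2) * h2 + (1 / 2) * h1
  have hIcc : Finset.Icc 1 (K - 1) = Finset.Ico 1 K := by
    ext x
    simp only [Finset.mem_Icc, Finset.mem_Ico]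
    omega
  have hsplit : ∑ α ∈ Finset.range (2 * K), Complex.exp (π * I / K * α * β) * u α =
      ∑ α ∈ Finset.Ico 1 K, Complex.exp (π * I / K * α * β) * u α +
      ∑ α ∈ Finset.Ico (K + 1) (2 * K), Complex.exp (π * I / K * α * β) * u α := by
    rw [Finset.range_eq_Ico, Finset.sum_eq_sum_Ico_succ_bot (by omega),
      ← Finset.sum_Ico_consecutive _ (show 0 + 1 ≤ K by omega) (show K ≤ 2 * K by omega),
      Finset.sum_eq_sum_Ico_succ_bot (show K < 2 * K by omega)]
    simp only [Nat.cast_zero, h0, hK0, mul_zero, zero_add]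
  have hrefl : ∑ α ∈ Finset.Ico (K + 1) (2 * K), Complex.exp (π * I / K * α * β) * u α =
      ∑ α ∈ Finset.Ico 1 K, -(Complex.exp (-(π * I / K * α * β)) * u α) := by
    refine Finset.sum_nbij' (fun j => 2 * K - j) (fun j => 2 * K - j) ?_ ?_ ?_ ?_ ?_
    · intro j hj
      rw [Finset.mem_Ico] at hj ⊢
      omega
    · intro j hj
      rw [Finset.mem_Ico] at hj ⊢
      omega
    · intro j hj
      rw [Finset.mem_Ico] at hj
      omega
    · intro j hj
      rw [Finset.mem_Ico] at hj
      omega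
    · intro j hj
      rw [Finset.mem_Ico] at hj
      have e1 : ((2 * K - j : ℕ) : ℤ) = -(j : ℤ) + (2 * K : ℕ) := by omega
      have e2 : ((2 * K - j : ℕ) : ℂ) = 2 * K - j := by
        rw [Nat.cast_sub hj.2.le]
        push_cast
        ring
      rw [e1, hu, ho, e2, mul_neg, neg_neg]
      congr 1
      refine cexp_congr (β : ℤ) ?_
      push_cast
      field_simp
      ring
  rw [hsplit, hrefl, hIcc, ← Finset.sum_add_distrib, Finset.mul_sum]
  refine Finset.sum_congr rfl fun α _ => ?_
  rw [Complex.sin]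
  have e1 : (π / K * α * β : ℂ) * I = π * I / K * α * β := by ring
  have e2 : -(π / K * α * β : ℂ) * I = -(π * I / K * α * β) := by ring
  rw [e1, e2]
  linear_combination (Complex.exp (-(π * I / K * α * β)) - Complex.exp (π * I / K * α * β)) * u α *
    Complex.I_sq

/-- The transformed surgery vector, up to a constant: the contribution of a single fiber to the
coefficient of the loop in the representation of dimension `β`. -/
noncomputable def fiberSum (K : ℕ) (p q r : ℤ) (β : ℂ) : ℂ :=
  ∑ m ∈ Finset.range p.natAbs, Complex.exp (-(π * I) * q * β ^ 2 / (2 * K * p)) *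
    Complex.exp (2 * π * I * (K * r * (m : ℂ) ^ 2 - β * m) / p) *
    Complex.sin (2 * π / p * (r * m - β / (2 * K)))

/-- This is Dedekind reciprocity for the matrix and its product with `S`. The defect `3 sign(pq)`
meets the eighth root of unity produced by the Gauss sum. -/
theorem rademacher_sub {p q r s : ℤ} (hdet : p * s - q * r = 1) (hp : p ≠ 0) (hq : q ≠ 0) :
    rademacher p r q s - rademacher (-q) (-s) p r = 3 * (p * q).sign := by
  have hpq : IsCoprime p q := ⟨s, -r, by linarith⟩
  have h := dedekindSum_reciprocity hp hq hpq
  have hp' : (p : ℝ) ≠ 0 := by exact_mod_cast hp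
  have hq' : (q : ℝ) ≠ 0 := by exact_mod_cast hq
  have hdet' : (p : ℝ) * s - q * r = 1 := by exact_mod_cast hdet
  rw [rademacher, rademacher, if_neg hq, if_neg hp, dedekindSum_neg_left]
  have e : ((p : ℝ) + s) / q - ((-q : ℤ) + r : ℝ) / p = (1 + (p : ℝ) ^ 2 + (q : ℝ) ^ 2) / (p * q) := by
    push_cast
    field_simp
    linear_combination hdet'
  linarith

/-- A substitution modulo `q` turns the exponent into a function of `α + 2Kt` alone. The sums over
`α` modulo `2K` and `t` modulo `q` then merge into one Gauss sum modulo `2Kq`, whose dual is a sum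
modulo `p`. The difference over the sign `μ` becomes the sine in `fiberSum`. -/
theorem sum_sin_mul_surgery {K : ℕ} (hK : 0 < K) {p q r s : ℤ} (hdet : p * s - q * r = 1) (hp : p ≠ 0)
    (hq : q ≠ 0) (β : ℕ) :
    ∑ α ∈ Finset.Icc 1 (K - 1), Complex.sin (π / K * α * β) *
      ∑ μ : ℤˣ, ∑ m ∈ Finset.range q.natAbs, ((μ : ℤ) : ℂ) *
        Complex.exp (I * π / (2 * K * q) *
          (p * ((α : ℕ) : ℂ) ^ 2 - 2 * α * (2 * K * m + ((μ : ℤ) : ℂ) * (1 : ℕ))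
            + s * (2 * K * m + ((μ : ℤ) : ℂ) * (1 : ℕ)) ^ 2)) =
    -((√(|2 * K * (q : ℝ) / p|) : ℝ) : ℂ) * Complex.exp (π * I / 4 * (p * q).sign) *
      Complex.exp (π * I * r / (2 * K * p)) * fiberSum K p q r β := by
  have hK' : (K : ℂ) ≠ 0 := by exact_mod_cast hK.ne'
  have hp' : (p : ℂ) ≠ 0 := by exact_mod_cast hp
  have hq' : (q : ℂ) ≠ 0 := by exact_mod_cast hq
  have hdet' : (p : ℂ) * s - q * r = 1 := by exact_mod_cast hdet
  have hμ2 : ∀ μ : ℤˣ, ((μ : ℤ) : ℂ) ^ 2 = 1 := fun μ => by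
    rcases Int.units_eq_one_or μ with rfl | rfl <;> simp
  set Γ : ℤˣ → ℤ → ℂ := fun μ y =>
    Complex.exp (I * π / (2 * K * q) * (p * (y : ℂ) ^ 2 - 2 * ((μ : ℤ) : ℂ) * y + s)) with hΓ
  have hΓper : ∀ μ (y t : ℤ), Γ μ (y + 2 * K * q * t) = Γ μ y := by
    intro μ y t
    refine cexp_congr (2 * p * y * t + 2 * K * q * p * t ^ 2 - (μ : ℤ) * t - p * y * t - K * q * p * t ^ 2) ?_
    push_cast
    field_simp
    ring
  have hΓq : ∀ μ (y : ℤ), Function.Periodic (fun t : ℤ => Γ μ (y + 2 * K * t)) (q.natAbs : ℤ) := by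
    intro μ y t
    simp only
    rcases Int.natAbs_eq q with h | h
    · rw [← h, ← hΓper μ (y + 2 * K * t) 1]
      congr 1
      ring
    · have h' : (q.natAbs : ℤ) = -q := by omega
      rw [h', ← hΓper μ (y + 2 * K * t) (-1)]
      congr 1
      ring
  set u : ℤ → ℂ := fun α => ∑ μ : ℤˣ, ((μ : ℤ) : ℂ) * ∑ t ∈ Finset.range q.natAbs, Γ μ (α + 2 * K * t)
    with hu
  have hcop : ∀ e : ℤ, IsUnit e → IsCoprime (e * s) (q.natAbs : ℤ) := by
    intro e he
    have h1 : IsCoprime s q := ⟨p, -r, by linarith⟩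
    exact isCoprime_natAbs ((isCoprime_mul_unit_left_left he _ _).mpr h1)
  -- The substitution is `t = -s m`; as `ps` is `1` modulo `q`, the quadratic form in `α` and `m`
  -- becomes `p (α + 2Kt)²` up to multiples of the period.
  have hu1 : ∀ α : ℕ, ∑ μ : ℤˣ, ∑ m ∈ Finset.range q.natAbs, ((μ : ℤ) : ℂ) *
        Complex.exp (I * π / (2 * K * q) *
          (p * ((α : ℕ) : ℂ) ^ 2 - 2 * α * (2 * K * m + ((μ : ℤ) : ℂ) * (1 : ℕ))
            + s * (2 * K * m + ((μ : ℤ) : ℂ) * (1 : ℕ)) ^ 2)) = u α := by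
    intro α
    rw [hu]
    refine Finset.sum_congr rfl fun μ _ => ?_
    rw [← Finset.mul_sum, ← sum_range_mul_of_isCoprime (hΓq μ α) (hcop (-1) (by simp))]
    congr 1
    refine Finset.sum_congr rfl fun m _ => ?_
    refine cexp_congr (r * m * α - K * s * m ^ 2 * r) ?_
    push_cast
    field_simp
    linear_combination (4 * α * K * m - 4 * (K : ℂ) ^ 2 * m ^ 2 * s) * hdet' +
      (s : ℂ) * hμ2 μ
  have huper : Function.Periodic u (2 * K : ℕ) := by
    intro α
    rw [hu]
    refine Finset.sum_congr rfl fun μ _ => ?_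
    congr 1
    have h1 := Finset.sum_range_succ (fun t : ℕ => Γ μ (α + 2 * K * t)) q.natAbs
    have h2 := Finset.sum_range_succ' (fun t : ℕ => Γ μ (α + 2 * K * t)) q.natAbs
    have h3 : Γ μ (α + 2 * K * (q.natAbs : ℕ)) = Γ μ (α + 2 * K * (0 : ℕ)) := by
      have := hΓq μ α 0
      simpa using this
    rw [h1, h3, add_left_inj] at h2
    rw [h2]
    refine Finset.sum_congr rfl fun t _ => ?_
    congr 1
    push_cast
    ring
  have huodd : ∀ α, u (-α) = -u α := by
    intro α
    rw [hu]
    simp only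
    rw [← Equiv.sum_comp (Equiv.neg ℤˣ), ← Finset.sum_neg_distrib]
    refine Finset.sum_congr rfl fun μ _ => ?_
    rw [Equiv.neg_apply, Units.val_neg, Int.cast_neg, neg_mul]
    congr 2
    rw [← sum_range_mul_of_isCoprime (hΓq μ α) (u := -1) isCoprime_one_left.neg_left]
    refine Finset.sum_congr rfl fun t _ => ?_
    rw [hΓ]
    simp only
    congr 1
    push_cast
    ring
  have h2I : (2 * I : ℂ) ≠ 0 := by simp
  refine mul_left_cancel₀ h2I ?_
  simp only [hu1]
  rw [sum_sin_mul_odd hK β huper huodd]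
  -- the sum over `α` modulo `2K` and `t` modulo `q` is a sum over `y` modulo `2Kq`
  have hcomb : ∑ α ∈ Finset.range (2 * K), Complex.exp (π * I / K * α * β) * u α =
      ∑ μ : ℤˣ, ((μ : ℤ) : ℂ) * ∑ y ∈ Finset.range (2 * K * q.natAbs),
        Complex.exp (π * I / K * y * β) * Γ μ y := by
    have h1 : ∀ μ : ℤˣ, ∑ y ∈ Finset.range (2 * K * q.natAbs), Complex.exp (π * I / K * y * β) * Γ μ y =
        ∑ α ∈ Finset.range (2 * K), ∑ t ∈ Finset.range q.natAbs,
          Complex.exp (π * I / K * α * β) * Γ μ (α + 2 * K * t) := by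
      intro μ
      have := sum_range_mul_eq (fun y => Complex.exp (π * I / K * y * β) * Γ μ y) (2 * K) q.natAbs
      simp only [Int.cast_natCast] at this
      rw [this]
      refine Finset.sum_congr rfl fun α _ => Finset.sum_congr rfl fun t _ => ?_
      push_cast
      congr 1
      refine cexp_congr (t * β) ?_
      push_cast
      field_simp
    simp only [h1, hu, Finset.mul_sum]
    rw [Finset.sum_comm]
    refine Finset.sum_congr rfl fun μ _ => Finset.sum_congr rfl fun α _ =>
      Finset.sum_congr rfl fun t _ => ?_
    ring
  rw [hcomb]
  have hrec : ∀ μ : ℤˣ, ∑ y ∈ Finset.range (2 * K * q.natAbs), Complex.exp (π * I / K * y * β) * Γ μ y =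
      ((√(|2 * K * (q : ℝ) / p|) : ℝ) : ℂ) * Complex.exp (π * I / 4 * (p * q).sign) *
      Complex.exp (π * I * r / (2 * K * p)) * ∑ m ∈ Finset.range p.natAbs,
        Complex.exp (-(π * I) * q * (β : ℂ) ^ 2 / (2 * K * p)) *
        (Complex.exp (2 * π * I * (K * r * (m : ℂ) ^ 2 - β * m) / p) *
        Complex.exp (-(((μ : ℤ) : ℂ) * (2 * π / p * (r * m - β / (2 * K)) * I)))) := by
    intro μ
    have hc0 : (2 * K * q : ℤ) ≠ 0 := by
      have : (K : ℤ) ≠ 0 := by exact_mod_cast hK.ne'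
      positivity
    -- The linear coefficient collects `qβ` from the sine and `-μ` from the surgery matrix. It is
    -- even, like the modulus, so the parity condition holds.
    have hG := gauss_reciprocity (a := p) (c := 2 * K * q) (b := 2 * (q * β - μ)) hp hc0
      ⟨p * K * q + (q * β - μ), by ring⟩
    have hnat : (2 * K * q : ℤ).natAbs = 2 * K * q.natAbs := by
      rw [Int.natAbs_mul, Int.natAbs_mul]
      simp
    have hsg : (p * (2 * K * q)).sign = (p * q).sign := by
      have : (0 : ℤ) < 2 * K := by positivity
      rw [show p * (2 * K * q) = (2 * K) * (p * q) by ring, Int.sign_mul, Int.sign_eq_one_of_pos this,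
        one_mul]
    rw [hnat, hsg] at hG
    have e1 : ∑ y ∈ Finset.range (2 * K * q.natAbs), Complex.exp (π * I / K * y * β) * Γ μ y =
        Complex.exp (π * I * s / (2 * K * q)) * ∑ y ∈ Finset.range (2 * K * q.natAbs),
          Complex.exp (π * I * (p * (y : ℂ) ^ 2 + ((2 * (q * β - μ) : ℤ) : ℂ) * y) / ((2 * K * q : ℤ) : ℂ)) := by
      rw [Finset.mul_sum]
      refine Finset.sum_congr rfl fun y _ => ?_
      rw [hΓ]
      simp only
      rw [← Complex.exp_add, ← Complex.exp_add]
      congr 1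
      push_cast
      field_simp
      ring
    rw [e1, hG]
    have hfper : Function.Periodic (fun m : ℤ => Complex.exp (2 * π * I * (K * r * (m : ℂ) ^ 2 - β * m) / p) *
        Complex.exp (-(((μ : ℤ) : ℂ) * (2 * π / p * (r * m - β / (2 * K)) * I)))) (p.natAbs : ℤ) := by
      have hperp : Function.Periodic (fun m : ℤ =>
          Complex.exp (2 * π * I * (K * r * (m : ℂ) ^ 2 - β * m) / p) *
          Complex.exp (-(((μ : ℤ) : ℂ) * (2 * π / p * (r * m - β / (2 * K)) * I)))) p := by
        intro m
        simp only
        rw [← Complex.exp_add, ← Complex.exp_add]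
        refine cexp_congr (2 * K * r * m + K * r * p - β - μ * r) ?_
        push_cast
        field_simp
        ring
      rcases Int.natAbs_eq p with h | h
      · rwa [← h]
      · have h' : (p.natAbs : ℤ) = -p := by omega
        rw [h']
        exact hperp.neg
    -- The dual sum runs over `n` modulo `p`; the index of `fiberSum` is `m = q n`.
    have hcop2 : IsCoprime q (p.natAbs : ℤ) := isCoprime_natAbs ⟨-r, s, by linarith⟩
    have hf := sum_range_mul_of_isCoprime hfper hcop2
    simp only [Int.cast_natCast] at hf
    rw [← Finset.mul_sum, ← hf]
    have e2 : ∀ n : ℕ, Complex.exp (π * I * s / (2 * K * q)) *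
        (Complex.exp (π * I / 4 * (((p * q).sign : ℤ) - ((2 * (q * β - μ) : ℤ) : ℂ) ^ 2 / (p * ((2 * K * q : ℤ) : ℂ)))) *
          Complex.exp (-(π * I) * (((2 * K * q : ℤ) : ℂ) * (n : ℂ) ^ 2 + ((2 * (q * β - μ) : ℤ) : ℂ) * n) / p)) =
        Complex.exp (π * I / 4 * (p * q).sign) * Complex.exp (π * I * r / (2 * K * p)) *
          Complex.exp (-(π * I) * q * (β : ℂ) ^ 2 / (2 * K * p)) *
        (Complex.exp (2 * π * I * (K * r * (((q * n : ℤ)) : ℂ) ^ 2 - β * ((q * n : ℤ) : ℂ)) / p) *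
        Complex.exp (-(((μ : ℤ) : ℂ) * (2 * π / p * (r * ((q * n : ℤ) : ℂ) - β / (2 * K)) * I)))) := by
      intro n
      simp only [← Complex.exp_add]
      refine cexp_congr (-(K * q * s * n ^ 2) + μ * s * n) ?_
      have hr : (r : ℂ) = (p * s - 1) / q := by
        rw [eq_div_iff hq']
        linear_combination (-1 : ℂ) * hdet'
      push_cast
      rw [hr]
      field_simp
      linear_combination (-(4 : ℂ)) * hμ2 μ
    have habs : |((2 * K * q : ℤ) : ℝ) / p| = |2 * K * (q : ℝ) / p| := by push_cast; rfl
    rw [habs]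
    have e3 := Finset.sum_congr (rfl : Finset.range p.natAbs = _) fun n _ => e2 n
    simp only [← Finset.mul_sum] at e3
    linear_combination ((√(|2 * K * (q : ℝ) / p|) : ℝ) : ℂ) * e3
  simp only [hrec]
  rw [fiberSum, Fintype.sum_eq_add (1 : ℤˣ) (-1) (by decide) (by
    rintro x ⟨h1, h2⟩
    exact absurd (Int.units_eq_one_or x) (by tauto))]
  simp only [Units.val_one, Units.val_neg, Int.cast_one, Int.cast_neg, one_mul, neg_one_mul, neg_neg]
  have hsin : ∀ X Y t : ℂ, X * (Y * Complex.exp (-(t * I))) - X * (Y * Complex.exp (t * I)) =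
      -(2 * I) * (X * Y * Complex.sin t) := by
    intro X Y t
    rw [Complex.sin, neg_mul t I]
    linear_combination X * Y * (Complex.exp (-(t * I)) - Complex.exp (t * I)) * Complex.I_sq
  have hsum := Finset.sum_congr (rfl : Finset.range p.natAbs = _) fun m _ =>
    hsin (Complex.exp (-(π * I) * q * (β : ℂ) ^ 2 / (2 * K * p)))
      (Complex.exp (2 * π * I * (K * r * (m : ℂ) ^ 2 - β * m) / p))
      (2 * π / p * (r * m - β / (2 * K)))
  rw [Finset.sum_sub_distrib] at hsum
  replace hsum := hsum.trans (Finset.mul_sum _ _ _).symm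
  linear_combination ((√(|2 * K * (q : ℝ) / p|) : ℝ) : ℂ) * Complex.exp (π * I / 4 * (p * q).sign) *
      Complex.exp (π * I * r / (2 * K * p)) * hsum

/-- The product represents `S` times the surgery matrix, whose lower left entry is `p`; this
explains why the sum runs modulo `p`. For `q = 0` the surgery matrix is diagonal and `p = ±1`, so
`fiberSum` has a single term and the claim is a direct computation. -/
theorem sum_sMatrix_mul_surgeryMatrix {K : ℕ} (hK : 2 ≤ K) {p q r s : ℤ} (hdet : p * s - q * r = 1)
    (hp : p ≠ 0) (β : ℕ) :
    ∑ α ∈ Finset.Icc 1 (K - 1), (sMatrix K α β : ℂ) * surgeryMatrix K p r q s α 1 =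
      -1 * ((√(2 / (K : ℝ)) : ℝ) : ℂ) * ((p.sign : ℂ) / ((√|(p : ℝ)| : ℝ) : ℂ)) *
        Complex.exp (-(I * π / 4) * (rademacher (-q) (-s) p r : ℂ) + π * I * r / (2 * K * p)) *
        fiberSum K p q r β := by
  have hK0 : 0 < K := by omega
  have hKr : (0 : ℝ) < K := by exact_mod_cast hK0
  have hK' : (K : ℂ) ≠ 0 := by exact_mod_cast hK0.ne'
  have hS : ∀ α : ℕ, (sMatrix K α β : ℂ) = ((√(2 / (K : ℝ)) : ℝ) : ℂ) * Complex.sin (π / K * α * β) := by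
    intro α
    rw [sMatrix]
    push_cast
    rfl
  by_cases hq : q = 0
  · subst hq
    have hps : p * s = 1 := by linarith
    have hU : ∀ α : ℕ, surgeryMatrix K p r 0 s α 1 = if α = 1 then
        Complex.exp (-(I * π / 4) * (rademacher p r 0 s : ℂ)) *
        Complex.exp (I * π / (2 * K) * (r * s)) else 0 := by
      intro α
      rw [surgeryMatrix, if_pos rfl]
      split_ifs with h
      · subst h
        simp
      · rfl
    simp only [hU, hS, mul_ite, mul_zero]
    rw [Finset.sum_ite_eq', if_pos (by rw [Finset.mem_Icc]; omega)]
    have hpu : p = 1 ∨ p = -1 := Int.isUnit_iff.mp (IsUnit.of_mul_eq_one _ hps)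
    rcases hpu with rfl | rfl
    · have hs1 : s = 1 := by linarith
      subst hs1
      simp only [rademacher, fiberSum, dedekindSum]
      norm_num
      rw [← Complex.exp_add, show (2 * π * (β / (2 * K)) : ℂ) = π / K * β by field_simp]
      rw [show -(I * π / 4 * r) + I * π / (2 * K) * r = -(I * π / 4 * r) + π * I * r / (2 * K) by ring]
      ring
    · have hs1 : s = -1 := by linarith
      subst hs1
      simp only [rademacher, fiberSum, dedekindSum]
      norm_num
      rw [← Complex.exp_add, show (2 * π / (-1) * (β / (2 * K)) : ℂ) = -(π / K * β) by field_simp,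
        Complex.sin_neg]
      rw [show -(I * π / 4 * (r / -1)) + π * I * r / -(2 * K) =
        -(I * π / 4 * (r / -1)) + -(I * π / (2 * K) * r) by rw [div_neg]; ring]
      ring
  · have hU : ∀ α : ℕ, surgeryMatrix K p r q s α 1 =
        (I * (q.sign : ℂ) / ((√(2 * K * |(q : ℝ)|) : ℝ) : ℂ) *
      Complex.exp (-(I * π / 4) * (rademacher p r q s : ℂ))) *
      ∑ μ : ℤˣ, ∑ m ∈ Finset.range q.natAbs, ((μ : ℤ) : ℂ) *
        Complex.exp (I * π / (2 * K * q) *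
          (p * (α : ℂ) ^ 2 - 2 * α * (2 * K * m + ((μ : ℤ) : ℂ) * (1 : ℕ))
            + s * (2 * K * m + ((μ : ℤ) : ℂ) * (1 : ℕ)) ^ 2)) := fun α => by
      rw [surgeryMatrix, if_neg hq]
    have hfac : ∀ (a b : ℂ) (f g : ℕ → ℂ), ∑ α ∈ Finset.Icc 1 (K - 1), a * f α * (b * g α) =
        a * b * ∑ α ∈ Finset.Icc 1 (K - 1), f α * g α := by
      intro a b f g
      rw [Finset.mul_sum]
      exact Finset.sum_congr rfl fun α _ => by ring
    simp only [hU, hS]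
    rw [hfac, sum_sin_mul_surgery hK0 hdet hp hq β]
    have hpr : (0 : ℝ) < |(p : ℝ)| := abs_pos.mpr (by exact_mod_cast hp)
    have hqr : (0 : ℝ) < |(q : ℝ)| := abs_pos.mpr (by exact_mod_cast hq)
    have hsq : √(|2 * K * (q : ℝ) / p|) = √(2 * K * |(q : ℝ)|) / √|(p : ℝ)| := by
      rw [abs_div, abs_mul, abs_of_pos (by positivity : (0 : ℝ) < 2 * K), Real.sqrt_div (by positivity)]
    have hsq0 : ((√(2 * K * |(q : ℝ)|) : ℝ) : ℂ) ≠ 0 := by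
      rw [Complex.ofReal_ne_zero]
      positivity
    have hsp0 : ((√|(p : ℝ)| : ℝ) : ℂ) ≠ 0 := by
      rw [Complex.ofReal_ne_zero]
      positivity
    -- The two Rademacher values differ by `3 sign(pq)`. With the phase of the Gauss sum this leaves
    -- `exp(-iπ sign(pq)/2) = -i sign(pq)`, which turns `i sign q` into `sign p`.
    have hph : Complex.exp (-(I * π / 4) * (rademacher p r q s : ℂ)) * Complex.exp (π * I / 4 * (p * q).sign) *
        Complex.exp (π * I * r / (2 * K * p)) * (I * q.sign) =
        p.sign * Complex.exp (-(I * π / 4) * (rademacher (-q) (-s) p r : ℂ) + π * I * r / (2 * K * p)) := by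
      have h1 := rademacher_sub hdet hp hq
      have h2 : rademacher p r q s = rademacher (-q) (-s) p r + 3 * (p * q).sign := by linarith
      rw [h2, Int.sign_mul]
      have e1 : Complex.exp (-(I * π / 4) * ((rademacher (-q) (-s) p r + 3 * ((p.sign * q.sign : ℤ) : ℝ) : ℝ) : ℂ)) *
          Complex.exp (π * I / 4 * ((p.sign * q.sign : ℤ) : ℂ)) * Complex.exp (π * I * r / (2 * K * p)) =
          Complex.exp (-(I * π / 4) * (rademacher (-q) (-s) p r : ℂ) + π * I * r / (2 * K * p)) *
            Complex.exp (-(π / 2 * I * ((p.sign * q.sign : ℤ) : ℂ))) := by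
        rw [← Complex.exp_add, ← Complex.exp_add, ← Complex.exp_add]
        congr 1
        push_cast
        ring
      rw [e1]
      have e2 : ∀ e : ℤ, e = 1 ∨ e = -1 → Complex.exp (-(π / 2 * I * (e : ℂ))) = -I * e := by
        rintro e (rfl | rfl)
        · rw [Int.cast_one, mul_one, mul_one, Complex.exp_neg, Complex.exp_pi_div_two_mul_I, Complex.inv_I]
        · rw [Int.cast_neg, Int.cast_one, mul_neg_one, neg_neg, Complex.exp_pi_div_two_mul_I]
          ring
      have hqs : q.sign = 1 ∨ q.sign = -1 := by
        rcases lt_or_gt_of_ne hq with h | h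
        · exact Or.inr (Int.sign_eq_neg_one_of_neg h)
        · exact Or.inl (Int.sign_eq_one_of_pos h)
      have hps : p.sign = 1 ∨ p.sign = -1 := by
        rcases lt_or_gt_of_ne hp with h | h
        · exact Or.inr (Int.sign_eq_neg_one_of_neg h)
        · exact Or.inl (Int.sign_eq_one_of_pos h)
      rw [e2 _ (by rcases hqs with h | h <;> rcases hps with h' | h' <;> simp [h, h'])]
      have hq2 : (q.sign : ℂ) ^ 2 = 1 := by rcases hqs with h | h <;> simp [h]
      push_cast
      linear_combination (p.sign * Complex.exp (-(I * π / 4) * (rademacher (-q) (-s) p r : ℂ) +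
        π * I * r / (2 * K * p))) * (hq2 - (q.sign : ℂ) ^ 2 * Complex.I_sq)
    rw [hsq]
    push_cast
    generalize Complex.exp (-(I * π / 4) * (rademacher p r q s : ℂ)) = x₁ at hph ⊢
    generalize Complex.exp (π * I / 4 * (p * q).sign) = x₂ at hph ⊢
    generalize Complex.exp (π * I * r / (2 * K * p)) = x₃ at hph ⊢
    generalize Complex.exp (-(I * π / 4) * (rademacher (-q) (-s) p r : ℂ) + π * I * r / (2 * K * p)) = x₄ at hph ⊢
    field_simp
    linear_combination (-((√(2 / (K : ℝ)) : ℝ) : ℂ) * fiberSum K p q r β) * hph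

theorem sign_prod {ι : Type*} (s : Finset ι) (f : ι → ℤ) : (∏ i ∈ s, f i).sign = ∏ i ∈ s, (f i).sign := by
  classical
  induction s using Finset.induction_on with
  | empty => simp
  | insert a s ha ih => rw [Finset.prod_insert ha, Finset.prod_insert ha, Int.sign_mul, ih]

theorem sqrt_abs_prod {ι : Type*} (s : Finset ι) (f : ι → ℤ) :
    √|((∏ i ∈ s, f i : ℤ) : ℝ)| = ∏ i ∈ s, √|(f i : ℝ)| := by
  classical
  induction s using Finset.induction_on with
  | empty => simp
  | insert a s ha ih =>
    rw [Finset.prod_insert ha, Finset.prod_insert ha, Int.cast_mul, abs_mul, Real.sqrt_mul (abs_nonneg _), ih]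

namespace SeifertData

variable {n : ℕ} (D : SeifertData n)

/-- The common prefactor of the invariant and of all its asymptotic contributions. -/
noncomputable def amplitude (g K : ℕ) : ℂ :=
  (-1) ^ n * (D.signP / ((√|(D.P : ℝ)| : ℝ) : ℂ)) * Complex.exp (I * (3 / 4) * π * D.signHP) *
    D.framingFactor K * (K / 2 : ℂ) ^ ((g : ℤ) - 1)

/-- Each `α_j` enters the Verlinde formula through one factor `S̃_{α_j β}`, so for fixed `β` the sum
over all `α` is a product over the fibers. -/
theorem invariant_eq_sum_fiberSum (g : ℕ) {K : ℕ} (hK : 2 ≤ K) :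
    D.invariant g K = D.amplitude g K * ∑ β ∈ Finset.Icc 1 (K - 1),
      (∏ j, fiberSum K (D.p j) (D.q j) (D.r j) β) / Complex.sin (π / K * β) ^ ((n : ℤ) + 2 * g - 2) := by
  have hK0 : 0 < K := by omega
  have hKr : (0 : ℝ) < K := by exact_mod_cast hK0
  have hK' : (K : ℂ) ≠ 0 := by exact_mod_cast hK0.ne'
  set w : ℂ := ((√(2 / (K : ℝ)) : ℝ) : ℂ) with hw
  have hw0 : w ≠ 0 := by
    rw [hw, Complex.ofReal_ne_zero]
    positivity
  have hw2 : w ^ 2 = (K / 2 : ℂ)⁻¹ := by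
    rw [hw, ← Complex.ofReal_pow, Real.sq_sqrt (by positivity)]
    push_cast
    rw [inv_div]
  have hV : ∀ α : Fin n → ℕ, (verlinde g K α : ℂ) = ∑ β ∈ Finset.Icc 1 (K - 1),
      (∏ j, (sMatrix K (α j) β : ℂ)) * (w ^ (-((n : ℤ) + 2 * g - 2)) *
        (Complex.sin (π / K * β) ^ ((n : ℤ) + 2 * g - 2))⁻¹) := by
    intro α
    rw [verlinde]
    push_cast
    refine Finset.sum_congr rfl fun β _ => ?_
    rw [div_eq_mul_inv]
    congr 1
    rw [sMatrix]
    push_cast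
    rw [mul_one, mul_zpow, mul_inv, zpow_neg]
  have h1 : D.invariant g K = Complex.exp (I * D.framingPhase K) * ∑ β ∈ Finset.Icc 1 (K - 1),
      (∏ j, ∑ α ∈ Finset.Icc 1 (K - 1), (sMatrix K α β : ℂ) *
        surgeryMatrix K (D.p j) (D.r j) (D.q j) (D.s j) α 1) *
      (w ^ (-((n : ℤ) + 2 * g - 2)) * (Complex.sin (π / K * β) ^ ((n : ℤ) + 2 * g - 2))⁻¹) := by
    rw [invariant]
    congr 1
    simp only [hV, Finset.sum_mul]
    rw [Finset.sum_comm]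
    refine Finset.sum_congr rfl fun β _ => ?_
    rw [Finset.prod_univ_sum, Finset.sum_mul]
    refine Finset.sum_congr rfl fun α _ => ?_
    rw [Finset.prod_mul_distrib]
    ring
  rw [h1, Finset.mul_sum, Finset.mul_sum]
  refine Finset.sum_congr rfl fun β _ => ?_
  rw [Finset.prod_congr rfl fun j _ =>
    sum_sMatrix_mul_surgeryMatrix hK (D.det_eq_one j) (D.p_ne_zero j) β]
  simp only [Finset.prod_mul_distrib, Finset.prod_const, Finset.card_univ, Fintype.card_fin,
    Finset.prod_div_distrib]
  rw [← Complex.exp_sum, amplitude, signP, P, sign_prod, sqrt_abs_prod]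
  push_cast
  rw [← hw]
  -- The part of the framing phase without `1/K` cancels the Rademacher functions and leaves `3π
  -- sign(H/P)/4`. In its `1/K` part the terms `r_j/p_j` cancel against `exp(πi r_j / 2Kp_j)`.
  have hph : Complex.exp (I * D.framingPhase K) * Complex.exp (∑ j,
      (-(I * π / 4) * (rademacher (-D.q j) (-D.s j) (D.p j) (D.r j) : ℂ) + π * I * D.r j / (2 * K * D.p j))) =
      Complex.exp (I * (3 / 4) * π * D.signHP) * D.framingFactor K := by
    rw [framingFactor, framingPhase, ← Complex.exp_add, ← Complex.exp_add]
    congr 1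
    have hR : ∀ j, (rademacher (-D.q j) (-D.s j) (D.p j) (D.r j) : ℂ) =
        (12 * (dedekindSum (D.q j) (D.p j) : ℂ) - (D.q j : ℂ) / D.p j) + (D.r j : ℂ) / D.p j := by
      intro j
      rw [rademacher, if_neg (D.p_ne_zero j), dedekindSum_neg_left]
      push_cast
      ring
    have hR2 : ∑ j, π * I * D.r j / (2 * K * D.p j) = (π * I / (2 * K)) * ∑ j, (D.r j : ℂ) / D.p j := by
      rw [Finset.mul_sum]
      refine Finset.sum_congr rfl fun j _ => ?_
      field_simp
    rw [Finset.sum_add_distrib, hR2, ← Finset.mul_sum]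
    push_cast
    simp only [hR]
    rw [Finset.sum_add_distrib]
    field_simp
    ring
  -- With `w = √(2/K)`: one factor `w` for every fiber, and the power from the denominator of the
  -- Verlinde formula.
  have hww : w ^ n * w ^ (-((n : ℤ) + 2 * g - 2)) = (K / 2 : ℂ) ^ ((g : ℤ) - 1) := by
    rw [← inv_inv (K / 2 : ℂ), ← hw2, ← zpow_natCast w n, ← zpow_add₀ hw0, inv_zpow, ← zpow_neg,
      ← zpow_natCast w 2, ← zpow_mul]
    congr 1
    push_cast
    ring
  rw [div_eq_mul_inv (∏ j, fiberSum _ _ _ _ _)]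
  rw [← hww]
  linear_combination ((-1) ^ n * w ^ n * ((∏ j, ((D.p j).sign : ℂ)) / ∏ j, ((√|(D.p j : ℝ)| : ℝ) : ℂ)) *
    (∏ j, fiberSum K (D.p j) (D.q j) (D.r j) β) * (w ^ (-((n : ℤ) + 2 * g - 2)) *
      (Complex.sin (π / K * β) ^ ((n : ℤ) + 2 * g - 2))⁻¹)) * hph

end SeifertData

/-! ### The sawtooth kernel -/

/-- The mean of the two exponentials `exp(2πiNz)`, `N = ⌈a⌉` and `N = ⌊a⌋ + 1`. -/
noncomputable def sawNum (a : ℚ) (z : ℂ) : ℂ :=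
  (Complex.exp (2 * π * I * ⌈a⌉ * z) + Complex.exp (2 * π * I * (⌊a⌋ + 1 : ℤ) * z)) / 2

/-- A kernel with simple poles at the integers, depending on `a` modulo `1` only. -/
noncomputable def sawKernel (a : ℚ) (z : ℂ) : ℂ :=
  Complex.exp (-(2 * π * I) * a * z) * sawNum a z / (1 - Complex.exp (2 * π * I * z))

theorem sawKernel_add_int (a : ℚ) (k : ℤ) (z : ℂ) : sawKernel (a + k) z = sawKernel a z := by
  rw [sawKernel, sawKernel, sawNum, sawNum, Int.ceil_add_intCast, Int.floor_add_intCast]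
  congr 1
  rw [mul_div_assoc', mul_div_assoc', mul_add, mul_add, ← Complex.exp_add, ← Complex.exp_add,
    ← Complex.exp_add, ← Complex.exp_add]
  push_cast
  congr 2
  · congr 1
    ring
  · congr 1
    ring

theorem sawNum_add_int (a : ℚ) (k : ℤ) (z : ℂ) : sawNum a (k + z) = sawNum a z := by
  have e : ∀ m : ℤ, Complex.exp (2 * π * I * m * (k + z)) = Complex.exp (2 * π * I * m * z) := fun m =>
    cexp_congr (m * k) (by push_cast; ring)
  rw [sawNum, sawNum, e, e]

theorem sawNum_int (a : ℚ) (k : ℤ) : sawNum a k = 1 := by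
  have := sawNum_add_int a k 0
  rw [add_zero] at this
  rw [this]
  simp [sawNum]

/-- This oddness is the reason for the mean of two exponentials: `N ↦ 1 - N` exchanges the exponents
`⌈a⌉, ⌊a⌋ + 1` of `a` with those of `-a`. -/
theorem sawKernel_neg (a : ℚ) (z : ℂ) : sawKernel (-a) (-z) = -sawKernel a z := by
  rw [sawKernel, sawKernel, sawNum, sawNum, Int.ceil_neg, Int.floor_neg]
  have e0 : (1 : ℂ) - Complex.exp (2 * π * I * -z) =
      -(Complex.exp (-(2 * π * I * z)) * (1 - Complex.exp (2 * π * I * z))) := by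
    rw [mul_sub, ← Complex.exp_add, mul_neg]
    simp
  rw [e0, div_neg, neg_inj, mul_comm (Complex.exp (-(2 * π * I * z))), ← div_div,
    div_eq_mul_inv _ (Complex.exp _), ← Complex.exp_neg, div_mul_eq_mul_div]
  congr 1
  rw [mul_div_assoc', mul_div_assoc', div_mul_eq_mul_div, mul_add, mul_add, add_mul, ← Complex.exp_add,
    ← Complex.exp_add, ← Complex.exp_add, ← Complex.exp_add, ← Complex.exp_add, ← Complex.exp_add, add_comm]
  push_cast
  congr 2
  · congr 1
    ring
  · congr 1
    ring

theorem sum_Ico_cexp {M N : ℤ} (h : M ≤ N) {z : ℂ} (hz : 1 - Complex.exp (2 * π * I * z) ≠ 0) :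
    (Complex.exp (2 * π * I * N * z) - Complex.exp (2 * π * I * M * z)) / (1 - Complex.exp (2 * π * I * z)) =
      -∑ m ∈ Finset.Ico M N, Complex.exp (2 * π * I * m * z) := by
  induction N, h using Int.leInduction with
  | base => simp
  | succ N hN ih =>
    have hs : Finset.Ico M (N + 1) = insert N (Finset.Ico M N) := by
      ext x
      simp only [Finset.mem_Ico, Finset.mem_insert]
      omega
    rw [hs, Finset.sum_insert (by simp), neg_add, ← ih, div_eq_iff hz, add_mul, div_mul_cancel₀ _ hz]
    have : Complex.exp (2 * π * I * (N + 1 : ℤ) * z) =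
        Complex.exp (2 * π * I * N * z) * Complex.exp (2 * π * I * z) := by
      rw [← Complex.exp_add]
      push_cast
      ring_nf
    rw [this]
    ring

/-- Each of the two exponentials contributes a geometric sum. The two ranges differ only in whether
they contain an integral `c` or `b`, so the mean gives these end points the weight `1/2`. -/
theorem sawNum_sub_of_lt {b c : ℚ} (h : c < b) {z : ℂ} (hz : 1 - Complex.exp (2 * π * I * z) ≠ 0) :
    (sawNum b z - sawNum c z) / (1 - Complex.exp (2 * π * I * z)) =
      -∑ m ∈ Finset.Icc ⌈c⌉ ⌊b⌋, (if (m : ℚ) = c ∨ (m : ℚ) = b then 1 / 2 else 1 : ℂ) *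
        Complex.exp (2 * π * I * m * z) := by
  have h1 := sum_Ico_cexp (Int.ceil_mono h.le) hz
  have h2 := sum_Ico_cexp (add_le_add_left (Int.floor_mono h.le) 1) hz
  have e : (sawNum b z - sawNum c z) / (1 - Complex.exp (2 * π * I * z)) =
      1 / 2 * ((Complex.exp (2 * π * I * ⌈b⌉ * z) - Complex.exp (2 * π * I * ⌈c⌉ * z)) /
        (1 - Complex.exp (2 * π * I * z)) +
      (Complex.exp (2 * π * I * (⌊b⌋ + 1 : ℤ) * z) - Complex.exp (2 * π * I * (⌊c⌋ + 1 : ℤ) * z)) /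
        (1 - Complex.exp (2 * π * I * z))) := by
    rw [sawNum, sawNum]
    ring
  rw [e, h1, h2]
  have s1 : Finset.Ico ⌈c⌉ ⌈b⌉ = (Finset.Icc ⌈c⌉ ⌊b⌋).filter fun m : ℤ => (m : ℚ) ≠ b := by
    ext m
    simp only [Finset.mem_Ico, Finset.mem_filter, Finset.mem_Icc, Int.ceil_le, Int.lt_ceil, Int.le_floor]
    exact ⟨fun h => ⟨⟨h.1, h.2.le⟩, h.2.ne⟩, fun h => ⟨h.1.1, lt_of_le_of_ne h.1.2 h.2⟩⟩
  have s2 : Finset.Ico (⌊c⌋ + 1) (⌊b⌋ + 1) = (Finset.Icc ⌈c⌉ ⌊b⌋).filter fun m : ℤ => (m : ℚ) ≠ c := by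
    ext m
    simp only [Finset.mem_Ico, Finset.mem_filter, Finset.mem_Icc, Int.ceil_le, Int.lt_add_one_iff,
      Int.le_floor, Int.add_one_le_iff, Int.floor_lt]
    exact ⟨fun h => ⟨⟨h.1.le, h.2⟩, h.1.ne'⟩, fun h => ⟨lt_of_le_of_ne h.1.1 h.2.symm, h.1.2⟩⟩
  rw [s1, s2, ← neg_add, mul_neg, neg_inj, Finset.sum_filter, Finset.sum_filter, ← Finset.sum_add_distrib,
    Finset.mul_sum]
  refine Finset.sum_congr rfl fun m _ => ?_
  by_cases hb : (m : ℚ) = b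
  · have hc : ¬ (m : ℚ) = c := fun hc => h.ne (hc.symm.trans hb)
    rw [if_neg (not_not.mpr hb), if_pos hc, if_pos (Or.inr hb), zero_add]
  · by_cases hc : (m : ℚ) = c
    · rw [if_pos hb, if_neg (not_not.mpr hc), if_pos (Or.inl hc), add_zero]
    · rw [if_pos hb, if_pos hc, if_neg (by tauto)]
      ring

theorem one_sub_cexp_eq (z : ℂ) : 1 - Complex.exp (2 * π * I * z) =
    -(2 * I) * (Complex.exp (π * I * z) * Complex.sin (π * z)) := by
  rw [Complex.sin]
  have e1 : -(π * z : ℂ) * I = -(π * I * z) := by ring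
  have e2 : (π * z : ℂ) * I = π * I * z := by ring
  have e3 : (2 * π * I * z : ℂ) = π * I * z + π * I * z := by ring
  rw [e1, e2, e3, Complex.exp_add, Complex.exp_neg]
  have := Complex.exp_ne_zero (π * I * z)
  field_simp
  linear_combination (1 - Complex.exp (π * I * z) ^ 2) * Complex.I_sq

theorem sawKernel_zero (z : ℂ) : sawKernel 0 z = I / 2 * Complex.cot (π * z) := by
  have h : sawNum 0 z = Complex.exp (π * I * z) * Complex.cos (π * z) := by
    rw [sawNum, Complex.cos]
    have e1 : -(π * z : ℂ) * I = -(π * I * z) := by ring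
    have e2 : (π * z : ℂ) * I = π * I * z := by ring
    have e3 : (2 * π * I * z : ℂ) = π * I * z + π * I * z := by ring
    simp only [Int.ceil_zero, Int.floor_zero, Int.cast_zero, mul_zero, zero_mul, Complex.exp_zero, zero_add,
      Int.cast_one, mul_one]
    rw [e1, e2, e3, Complex.exp_add, Complex.exp_neg]
    have := Complex.exp_ne_zero (π * I * z)
    field_simp
    ring
  rw [sawKernel, h, one_sub_cexp_eq, Complex.cot]
  have hx := Complex.exp_ne_zero (π * I * z)
  simp only [Rat.cast_zero, mul_zero, zero_mul, Complex.exp_zero, one_mul]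
  rw [show -(2 * I) * (Complex.exp (π * I * z) * Complex.sin (π * z)) =
    Complex.exp (π * I * z) * (-(2 * I) * Complex.sin (π * z)) by ring, mul_div_mul_left _ _ hx,
    ← div_div, div_neg, div_eq_mul_inv _ (2 * I), mul_inv, Complex.inv_I]
  ring

/-- Compare the numerators belonging to `a` and to `0`. The half weights of the end points `m = 0`
and `m = a` are the symmetry factors. -/
theorem sawKernel_eq_of_pos {a : ℚ} (ha : 0 < a) {z : ℂ} (hz : 1 - Complex.exp (2 * π * I * z) ≠ 0) :
    sawKernel a z = Complex.exp (-(2 * π * I) * a * z) * sawKernel 0 z -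
      ∑ m ∈ Finset.range (⌊a⌋₊ + 1), 1 / ((symPM m : ℂ) * (symPM (m - a) : ℂ)) *
        Complex.exp (2 * π * I * z * (m - a)) := by
  have h := sawNum_sub_of_lt ha hz
  have h0 : sawKernel 0 z = sawNum 0 z / (1 - Complex.exp (2 * π * I * z)) := by
    rw [sawKernel]
    simp
  have hs : ∑ m ∈ Finset.Icc ⌈(0 : ℚ)⌉ ⌊a⌋, (if (m : ℚ) = 0 ∨ (m : ℚ) = a then 1 / 2 else 1 : ℂ) *
        Complex.exp (2 * π * I * m * z) = ∑ m ∈ Finset.range (⌊a⌋₊ + 1),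
        (1 / ((symPM m : ℂ) * (symPM (m - a) : ℂ))) * Complex.exp (2 * π * I * m * z) := by
    symm
    refine Finset.sum_nbij (fun m : ℕ => (m : ℤ)) ?_ ?_ ?_ ?_
    · intro m hm
      rw [Finset.mem_range, Nat.lt_succ_iff, Nat.le_floor_iff ha.le] at hm
      rw [Finset.mem_Icc, Int.ceil_zero, Int.le_floor]
      exact ⟨by positivity, by exact_mod_cast hm⟩
    · intro x _ y _ hxy
      exact Int.ofNat.inj hxy
    · intro m hm
      rw [Finset.coe_Icc, Set.mem_Icc, Int.ceil_zero, Int.le_floor] at hm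
      lift m to ℕ using hm.1
      refine ⟨m, ?_, rfl⟩
      rw [Finset.coe_range, Set.mem_Iio, Nat.lt_succ_iff, Nat.le_floor_iff ha.le]
      exact_mod_cast hm.2
    · intro m _
      rw [symPM_eq, symPM_eq]
      simp only [Int.cast_natCast, sub_eq_zero]
      congr 1
      by_cases h1 : (m : ℚ) = 0
      · have h2 : ¬ (m : ℚ) = a := fun h2 => ha.ne (h1.symm.trans h2)
        simp [h1, ha.ne]
      · by_cases h2 : (m : ℚ) = a
        · simp [h2, ha.ne']
        · rw [if_neg h1, if_neg h2, if_neg (by tauto)]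
          norm_num
  rw [hs] at h
  have hk : sawKernel a z - Complex.exp (-(2 * π * I) * a * z) * sawKernel 0 z =
      Complex.exp (-(2 * π * I) * a * z) * ((sawNum a z - sawNum 0 z) / (1 - Complex.exp (2 * π * I * z))) := by
    rw [h0, sawKernel]
    ring
  rw [h, mul_neg, Finset.mul_sum] at hk
  rw [sub_eq_iff_eq_add] at hk
  rw [hk, neg_add_eq_sub]
  congr 1
  refine Finset.sum_congr rfl fun m _ => ?_
  rw [mul_left_comm, ← Complex.exp_add]
  ring_nf

/-- The cotangent part leads to the regular residue and the exponentials to the singular ones.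
Negative `a` is reduced to positive `a` by oddness, which accounts for the sign of `a` in the
coefficients and exponents. -/
theorem sawKernel_eq (a : ℚ) {z : ℂ} (hz : 1 - Complex.exp (2 * π * I * z) ≠ 0) :
    sawKernel a z = Complex.exp (-(2 * π * I) * a * z) * (I / 2 * Complex.cot (π * z)) -
      ∑ m ∈ Finset.range (⌊|a|⌋₊ + 1), ((SignType.sign a : ℤ) : ℂ) /
        ((symPM m : ℂ) * (symPM (m - |a|) : ℂ)) *
        Complex.exp (2 * π * I * z * ((SignType.sign a : ℤ) : ℂ) * (m - ((|a| : ℚ) : ℂ))) := by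
  rw [← sawKernel_zero]
  rcases lt_trichotomy a 0 with ha | rfl | ha
  · have hz' : 1 - Complex.exp (2 * π * I * -z) ≠ 0 := by
      intro h
      refine hz ?_
      rw [sub_eq_zero, mul_neg, Complex.exp_neg, eq_comm, inv_eq_one] at h
      rw [h, sub_self]
    have h := sawKernel_eq_of_pos (neg_pos.mpr ha) hz'
    have h0 := sawKernel_neg 0 z
    rw [neg_zero] at h0
    rw [sawKernel_neg, h0] at h
    rw [abs_of_neg ha, sign_neg ha]
    simp only [SignType.coe_neg, SignType.coe_one, Int.cast_neg, Int.cast_one]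
    rw [← neg_inj, h, neg_sub, sub_eq_neg_add]
    rw [sub_eq_add_neg, ← Finset.sum_neg_distrib]
    congr 1
    · refine Finset.sum_congr rfl fun m _ => ?_
      rw [neg_div, neg_mul]
      push_cast
      ring_nf
    · push_cast
      ring_nf
  · simp
  · rw [sawKernel_eq_of_pos ha hz, abs_of_pos ha, sign_pos ha]
    simp

/-! ### The oscillating summand -/

theorem sin_line_ne_zero {v : ℂ} (hv : 0 < v.im) {K : ℕ} (hK : 0 < K) {x : ℝ} (hx : ∀ k : ℤ, x ≠ k * K)
    (y : ℝ) : Complex.sin (π / K * (x + v * y)) ≠ 0 := by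
  intro h
  obtain ⟨k, hk⟩ := Complex.sin_eq_zero_iff.mp h
  have hK' : (K : ℂ) ≠ 0 := by exact_mod_cast hK.ne'
  have hpi : (π : ℂ) ≠ 0 := by exact_mod_cast Real.pi_ne_zero
  have : (x : ℂ) + v * y = ((k * K : ℝ) : ℂ) := by
    push_cast
    field_simp at hk
    linear_combination hk
  obtain ⟨-, h2⟩ := line_eq_real hv this
  exact hx k h2

theorem ne_int_mul_of_mem_Ioo {K : ℕ} {x : ℝ} (h0 : 0 < x) (h1 : x < K) (k : ℤ) : x ≠ k * K := by
  rintro rfl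
  have hK : (0 : ℝ) < K := h0.trans h1
  have h2 : (0 : ℝ) < k := pos_of_mul_pos_left h0 hK.le
  have h3 : (k : ℝ) < 1 := by
    by_contra! h
    nlinarith
  have h4 : 0 < k := by exact_mod_cast h2
  have h5 : k < 1 := by exact_mod_cast h3
  omega

namespace SeifertData

variable {n : ℕ} (D : SeifertData n)

/-- The rational Euler number `H / P = ∑ q_j / p_j`. -/
def slope : ℚ := D.H / D.P

theorem P_ne_zero : D.P ≠ 0 := Finset.prod_ne_zero_iff.mpr fun j _ => D.p_ne_zero j

theorem slope_eq_sum : D.slope = ∑ j, (D.q j : ℚ) / D.p j := by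
  have : (D.P : ℚ) ≠ 0 := by exact_mod_cast D.P_ne_zero
  rw [slope, H, mul_div_cancel_left₀ _ this]

theorem slope_ne_zero (hH : D.H ≠ 0) : D.slope ≠ 0 :=
  div_ne_zero hH (by exact_mod_cast D.P_ne_zero)

/-- The direction of the path of steepest descent. -/
noncomputable def dir : ℂ := I * Complex.exp (I * π / 4 * D.signHP)

theorem dir_eq : D.dir = I * Complex.exp ((π / 4 * D.signHP : ℝ) * I) := by
  rw [dir]
  push_cast
  ring_nf

theorem norm_dir : ‖D.dir‖ = 1 := by
  rw [dir_eq, norm_mul, Complex.norm_exp_ofReal_mul_I, Complex.norm_I, mul_one]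

theorem signHP_eq (hH : D.H ≠ 0) : D.signHP = 1 ∧ 0 < D.slope ∨ D.signHP = -1 ∧ D.slope < 0 := by
  rcases lt_or_gt_of_ne (D.slope_ne_zero hH) with h | h
  · refine Or.inr ⟨?_, h⟩
    rw [signHP, ← slope, sign_neg h]
    rfl
  · refine Or.inl ⟨?_, h⟩
    rw [signHP, ← slope, sign_pos h]
    rfl

theorem dir_im_pos (hH : D.H ≠ 0) : 0 < D.dir.im := by
  rw [dir_eq, Complex.I_mul_im, Complex.exp_ofReal_mul_I_re]
  rcases D.signHP_eq hH with ⟨h, -⟩ | ⟨h, -⟩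
  · simp [h]
  · rw [h]
    simp

theorem dir_sq (hH : D.H ≠ 0) : D.dir ^ 2 = -I * D.signHP := by
  have e : ∀ w : ℂ, Complex.exp w ^ 2 = Complex.exp (2 * w) := fun w => by
    rw [← Complex.exp_nat_mul]
    norm_num
  rw [dir, mul_pow, e, Complex.I_sq]
  rcases D.signHP_eq hH with ⟨h, -⟩ | ⟨h, -⟩
  · rw [h, show (2 * (I * π / 4 * ((1 : ℤ) : ℂ)) : ℂ) = π / 2 * I by push_cast; ring,
      Complex.exp_pi_div_two_mul_I]
    simp
  · rw [h, show (2 * (I * π / 4 * ((-1 : ℤ) : ℂ)) : ℂ) = -(π / 2 * I) by push_cast; ring, Complex.exp_neg,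
      Complex.exp_pi_div_two_mul_I, Complex.inv_I]
    simp

theorem signHP_mul_slope (hH : D.H ≠ 0) : (D.signHP : ℚ) * D.slope = |D.slope| := by
  rcases D.signHP_eq hH with ⟨h, h'⟩ | ⟨h, h'⟩
  · rw [h, abs_of_pos h']
    simp
  · rw [h, abs_of_neg h']
    simp

theorem H_div_P : (D.H : ℂ) / D.P = (D.slope : ℂ) := by
  rw [slope]
  push_cast
  rfl

/-- Since `dir² = -i sign(H/P)`, the Gaussian exponent is `-π|H/P| / 2K` times the square of the
parameter. -/
theorem gaussian_re_neg (hH : D.H ≠ 0) {K : ℕ} (hK : 0 < K) :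
    ((-(I * π / (2 * K)) * ((D.H : ℂ) / D.P)) * D.dir ^ 2).re < 0 := by
  have e : (-(I * π / (2 * K)) * ((D.H : ℂ) / D.P)) * D.dir ^ 2 =
      ((-(π / (2 * K) * (|D.slope| : ℚ)) : ℝ) : ℂ) := by
    rw [D.dir_sq hH, D.H_div_P, ← D.signHP_mul_slope hH]
    push_cast
    linear_combination (π / (2 * K) * D.slope * D.signHP : ℂ) * Complex.I_sq
  rw [e, Complex.ofReal_re]
  have h1 : (0 : ℝ) < ((|D.slope| : ℚ) : ℝ) := by
    exact_mod_cast abs_pos.mpr (D.slope_ne_zero hH)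
  have h2 : (0 : ℝ) < K := by exact_mod_cast hK
  have := mul_pos (div_pos Real.pi_pos (mul_pos two_pos h2)) h1
  linarith

/-- The summand of the invariant after the change from sums to integrals. -/
noncomputable def osc (g K l : ℕ) (m' : Fin n → ℚ) (z : ℂ) : ℂ :=
  Complex.exp (-(I * π / (2 * K)) * ((D.H : ℂ) / D.P) * z ^ 2) /
      Complex.sin (π / K * z) ^ ((n : ℤ) + 2 * g - 2) *
    ∏ j, Complex.sin (2 * π * ((D.r j * m' j - z / (2 * K)) / D.p j - 1 / 2 * D.s j * l))

/-- The reflection changes the sign of `n` sines in the numerator and of `n + 2g - 2` factors in the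
denominator, which agree in parity. The term `s_j l / 2`, which is not reflected, is corrected by
whole periods. -/
theorem osc_neg (g K l : ℕ) (m' : Fin n → ℚ) (z : ℂ) : D.osc g K l (-m') (-z) = D.osc g K l m' z := by
  have hs : ∀ j, Complex.sin (2 * π * ((D.r j * ((-m') j : ℚ) - -z / (2 * K)) / D.p j - 1 / 2 * D.s j * l)) =
      -1 * Complex.sin (2 * π * ((D.r j * m' j - z / (2 * K)) / D.p j - 1 / 2 * D.s j * l)) := by
    intro j
    rw [neg_one_mul, ← Complex.sin_neg, ← Complex.sin_add_int_mul_two_pi _ (D.s j * l)]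
    congr 1
    rw [Pi.neg_apply]
    push_cast
    ring
  have hd : (-1 : ℂ) ^ n * (-1) ^ ((n : ℤ) + 2 * g - 2) = 1 := by
    rw [← zpow_natCast, ← zpow_add₀ (by norm_num), Even.neg_one_zpow ⟨n + g - 1, by ring⟩]
  rw [osc, osc]
  simp only [hs, Finset.prod_mul_distrib, Finset.prod_const, Finset.card_univ, Fintype.card_fin]
  rw [mul_neg, Complex.sin_neg, neg_sq, ← neg_one_mul (Complex.sin (π / K * z)), mul_zpow, mul_comm ((-1 : ℂ) ^ _),
    ← div_div]
  have h1 : (-1 : ℂ) ^ ((n : ℤ) + 2 * g - 2) ≠ 0 := zpow_ne_zero _ (by norm_num)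
  have h2 : (-1 : ℂ) ^ n = ((-1) ^ ((n : ℤ) + 2 * g - 2))⁻¹ := eq_inv_of_mul_eq_one_left hd
  have h3 : (-1 : ℂ) ^ n * (-1 : ℂ) ^ n = 1 := by
    rw [← mul_pow]
    norm_num
  rw [h2] at h3
  rw [h2, div_eq_mul_inv _ ((-1 : ℂ) ^ _)]
  linear_combination (Complex.exp (-(I * π / (2 * K)) * ((D.H : ℂ) / D.P) * z ^ 2) /
      Complex.sin (π / K * z) ^ ((n : ℤ) + 2 * g - 2) *
    ∏ j, Complex.sin (2 * π * ((D.r j * m' j - z / (2 * K)) / D.p j - 1 / 2 * D.s j * l))) * h3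

theorem differentiableAt_osc (g K l : ℕ) (m' : Fin n → ℚ) {z : ℂ} (hz : Complex.sin (π / K * z) ≠ 0) :
    DifferentiableAt ℂ (D.osc g K l m') z := by
  unfold osc
  refine DifferentiableAt.mul (DifferentiableAt.div (by fun_prop) ?_ (zpow_ne_zero _ hz)) (by fun_prop)
  exact DifferentiableAt.zpow (by fun_prop) (Or.inl hz)

theorem meromorphicAt_osc (g K l : ℕ) (m' : Fin n → ℚ) (z : ℂ) : MeromorphicAt (D.osc g K l m') z := by
  unfold osc
  have h1 : AnalyticAt ℂ (fun z : ℂ => Complex.exp (-(I * π / (2 * K)) * ((D.H : ℂ) / D.P) * z ^ 2)) z := by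
    fun_prop
  have h2 : AnalyticAt ℂ (fun z : ℂ => Complex.sin (π / K * z)) z := by fun_prop
  have h3 : AnalyticAt ℂ (fun z : ℂ => ∏ j, Complex.sin (2 * π * ((D.r j * m' j - z / (2 * K)) / D.p j -
      1 / 2 * D.s j * l))) z := by fun_prop
  exact (h1.meromorphicAt.div (h2.meromorphicAt.zpow _)).mul h3.meromorphicAt

theorem osc_mul_decay (hH : D.H ≠ 0) (g : ℕ) {K : ℕ} (hK : 0 < K) (l : ℕ) (m' : Fin n → ℚ) {f : ℂ → ℂ}
    (hf : ExpGrowth D.dir f) : LineDecay D.dir fun z => D.osc g K l m' z * f z := by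
  have hv := D.dir_im_pos hH
  have hKr : (0 : ℝ) < K := by exact_mod_cast hK
  have h1 : ExpGrowth D.dir fun z => (Complex.sin (π / K * z))⁻¹ := by
    have := ExpGrowth.inv_sin hv (div_pos Real.pi_pos hKr)
    push_cast at this
    exact this
  have h2 : ExpGrowth D.dir fun z => Complex.sin (π / K * z) := by
    simpa using ExpGrowth.sin D.dir (π / K) 0
  have h3 : ExpGrowth D.dir fun z => (Complex.sin (π / K * z))⁻¹ ^ ((n : ℤ) + 2 * g - 2) :=
    h1.zpow (by simpa using h2) _
  have h4 : ExpGrowth D.dir fun z : ℂ => ∏ j, Complex.sin (2 * π * ((D.r j * m' j - z / (2 * K)) / D.p j -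
      1 / 2 * D.s j * l)) := by
    refine ExpGrowth.prod _ fun j _ => ?_
    have := ExpGrowth.sin D.dir (-(2 * π / (2 * K) / D.p j))
      (2 * π * ((D.r j * m' j) / D.p j - 1 / 2 * D.s j * l))
    have e : (fun z : ℂ => Complex.sin (2 * π * ((D.r j * m' j - z / (2 * K)) / D.p j - 1 / 2 * D.s j * l))) =
        fun z => Complex.sin (-(2 * π / (2 * K) / D.p j) * z +
          2 * π * ((D.r j * m' j) / D.p j - 1 / 2 * D.s j * l)) := by
      ext z
      congr 1
      ring
    rwa [e]
  refine (ExpGrowth.gaussian_mul (D.gaussian_re_neg hH hK) ((h3.mul h4).mul hf)).mono fun z => ?_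
  rw [osc, inv_zpow]
  ring

theorem _root_.SeifertWRT.ExpGrowth.sawNum (v : ℂ) (a : ℚ) : ExpGrowth v (sawNum a) := by
  have h := (((ExpGrowth.cexp v (2 * π * I * ⌈a⌉) 0).add (ExpGrowth.cexp v (2 * π * I * (⌊a⌋ + 1 : ℤ)) 0)).mul
    (ExpGrowth.const v (1 / 2)))
  refine (funext fun z => ?_ : _ = SeifertWRT.sawNum a) ▸ h
  rw [SeifertWRT.sawNum, add_zero, add_zero]
  ring

/-- `∑_j m'_j / p_j`. -/
noncomputable def shift (m' : Fin n → ℚ) : ℚ := ∑ j, m' j / D.p j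

/-- The integers between `c` and `c + H / 2P`. -/
noncomputable def stripIndex (c : ℚ) : Finset ℤ :=
  Finset.Icc ⌈min c (c + D.slope / 2)⌉ ⌊max c (c + D.slope / 2)⌋

/-- In terms of the stationary phase point, the strip is `0 ≤ φ ≤ 1/2`, for either sign of `H / P`.
-/
theorem mem_stripIndex (hH : D.H ≠ 0) {c : ℚ} {m₀ : ℤ} :
    m₀ ∈ D.stripIndex c ↔ 0 ≤ (m₀ - c) / D.slope ∧ (m₀ - c) / D.slope ≤ 1 / 2 := by
  rw [stripIndex, Finset.mem_Icc, Int.ceil_le, Int.le_floor]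
  rcases D.signHP_eq hH with ⟨-, h⟩ | ⟨-, h⟩
  · rw [min_eq_left (by linarith), max_eq_right (by linarith), le_div_iff₀ h, div_le_iff₀ h]
    constructor <;> rintro ⟨h1, h2⟩ <;> constructor <;> linarith
  · rw [min_eq_right (by linarith), max_eq_left (by linarith), le_div_iff_of_neg h, div_le_iff_of_neg h]
    constructor <;> rintro ⟨h1, h2⟩ <;> constructor <;> linarith

theorem sawNum_sub (hH : D.H ≠ 0) (c : ℚ) {z : ℂ} (hz : 1 - Complex.exp (2 * π * I * z) ≠ 0) :
    (sawNum (c + D.slope / 2) z - sawNum c z) / (1 - Complex.exp (2 * π * I * z)) =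
      -(D.signHP * ∑ m ∈ D.stripIndex c, (if (m : ℚ) = c ∨ (m : ℚ) = c + D.slope / 2 then 1 / 2 else 1 : ℂ) *
        Complex.exp (2 * π * I * m * z)) := by
  rw [stripIndex]
  rcases D.signHP_eq hH with ⟨hs, h⟩ | ⟨hs, h⟩
  · rw [min_eq_left (by linarith), max_eq_right (by linarith), hs, Int.cast_one, one_mul]
    exact sawNum_sub_of_lt (by linarith) hz
  · rw [min_eq_right (by linarith), max_eq_left (by linarith), hs, Int.cast_neg, Int.cast_one, neg_one_mul,
      neg_neg, ← neg_inj]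
    have := sawNum_sub_of_lt (b := c) (c := c + D.slope / 2) (by linarith) hz
    simp only [or_comm (b := _ = c)] at this
    rw [← this]
    ring

theorem strip_sin_ne_zero (hH : D.H ≠ 0) {K : ℕ} {a b : ℝ} (ha : 0 < a) (hb : b < K) :
    ∀ x ∈ Set.Icc a b, ∀ y : ℝ, (x : ℂ) + D.dir * y ∈ {z : ℂ | Complex.sin (π / K * z) ≠ 0} := by
  intro x hx y
  have h1 : 0 < x := ha.trans_le hx.1
  have h2 : x < K := hx.2.trans_lt hb
  have hK : 0 < K := by exact_mod_cast h1.trans h2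
  exact sin_line_ne_zero (D.dir_im_pos hH) hK (ne_int_mul_of_mem_Ioo h1 h2) y

theorem isOpen_sin_ne_zero (K : ℕ) : IsOpen {z : ℂ | Complex.sin (π / K * z) ≠ 0} :=
  isOpen_ne_fun (by fun_prop) continuous_const

theorem lineInt_osc_mul_cexp (hH : D.H ≠ 0) (g : ℕ) {K : ℕ} (l : ℕ) (m' : Fin n → ℚ)
    (t : ℂ) {a b : ℝ} (ha : 0 < a) (hab : a < b) (hb : b < K) :
    lineInt D.dir (fun z => D.osc g K l m' z * Complex.exp (t * z)) a =
      lineInt D.dir (fun z => D.osc g K l m' z * Complex.exp (t * z)) b := by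
  have hK : 0 < K := by exact_mod_cast (ha.trans hab).trans hb
  refine lineInt_eq_lineInt (D.dir_im_pos hH) hab (isOpen_sin_ne_zero K) ?_ (D.strip_sin_ne_zero hH ha hb) ?_
  · intro z hz
    exact ((D.differentiableAt_osc g K l m' hz).mul (by fun_prop)).differentiableWithinAt
  · exact D.osc_mul_decay hH g hK l m' (by simpa using ExpGrowth.cexp D.dir t 0)

/-- A sum over `0 < β < K` as a difference of integrals along two lines, up to stationary phase
contributions and contributions of the boundary. -/
theorem sum_osc_eq (hH : D.H ≠ 0) (g : ℕ) {K : ℕ} (hK : 2 ≤ K) (l : ℕ) (m' : Fin n → ℚ) (c : ℚ) :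
    ∑ β ∈ Finset.Icc 1 (K - 1), D.osc g K l m' β * Complex.exp (-(2 * π * I) * c * β) =
      D.dir * lineInt D.dir (fun z => D.osc g K l m' z * sawKernel c z) (1 / 2) -
      D.dir * lineInt D.dir (fun z => D.osc g K l m' z * (Complex.exp (-(2 * π * I) * c * z) *
        sawNum (c + D.slope / 2) z / (1 - Complex.exp (2 * π * I * z)))) (K - 1 / 2) -
      D.dir * D.signHP * ∑ m₀ ∈ D.stripIndex c,
        (if (m₀ : ℚ) = c ∨ (m₀ : ℚ) = c + D.slope / 2 then 1 / 2 else 1 : ℂ) *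
        lineInt D.dir (fun z => D.osc g K l m' z * Complex.exp (2 * π * I * (m₀ - c) * z)) (1 / 2) := by
  have hK0 : 0 < K := by omega
  have hKr : (2 : ℝ) ≤ K := by exact_mod_cast hK
  have hv := D.dir_im_pos hH
  have hgr : ∀ a : ℚ, ExpGrowth D.dir fun z => Complex.exp (-(2 * π * I) * c * z) * sawNum a z := fun a =>
    ExpGrowth.mul (by simpa using ExpGrowth.cexp D.dir (-(2 * π * I) * c) 0) (ExpGrowth.sawNum _ a)
  have hgr' : ∀ a : ℚ, ExpGrowth D.dir fun z => Complex.exp (-(2 * π * I) * c * z) * sawNum a z /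
      (1 - Complex.exp (2 * π * I * z)) := fun a => by
    simpa only [div_eq_mul_inv] using (hgr a).mul (ExpGrowth.kernel hv)
  have hdiffS : ∀ a : ℚ, Differentiable ℂ (sawNum a) := fun a => by
    unfold sawNum
    fun_prop
  -- The factor `sawNum c` is `1` at the integers and does not disturb the sum.
  have hks := lineInt_kernel_sum hv (isOpen_sin_ne_zero K)
    (N := fun z => D.osc g K l m' z * (Complex.exp (-(2 * π * I) * c * z) * sawNum c z)) (by
      intro z hz
      exact ((D.differentiableAt_osc g K l m' hz).mul
        (by have := hdiffS c; fun_prop)).differentiableWithinAt) 1 (K - 1)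
    (D.strip_sin_ne_zero hH (by norm_num) (by
      rw [Nat.cast_sub (by omega)]
      push_cast
      linarith))
    ((D.osc_mul_decay hH g hK0 l m' (hgr' c)).mono fun z => by rw [mul_div_assoc])
  have hsum : ∑ i ∈ Finset.range (K - 1), (fun z : ℂ => D.osc g K l m' z *
        (Complex.exp (-(2 * π * I) * c * z) * sawNum c z)) ((1 + i : ℤ) : ℂ) =
      ∑ β ∈ Finset.Icc 1 (K - 1), D.osc g K l m' β * Complex.exp (-(2 * π * I) * c * β) := by
    rw [show Finset.Icc 1 (K - 1) = Finset.Ico 1 K by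
      ext x; simp only [Finset.mem_Icc, Finset.mem_Ico]; omega, Finset.sum_Ico_eq_sum_range]
    refine Finset.sum_congr rfl fun i _ => ?_
    beta_reduce
    rw [sawNum_int, mul_one]
    push_cast
    rfl
  rw [hsum] at hks
  have e1 : (((1 : ℤ) : ℝ) + ((K - 1 : ℕ) : ℝ) - 1 / 2) = K - 1 / 2 := by
    rw [Nat.cast_sub (by omega)]
    push_cast
    ring
  have e2 : (((1 : ℤ) : ℝ) - 1 / 2) = 1 / 2 := by norm_num
  rw [e1, e2] at hks
  -- the line through `K - 1/2`
  have hline : ∀ y : ℝ, Complex.sin (π / K * (((K - 1 / 2 : ℝ) : ℂ) + D.dir * y)) ≠ 0 := fun y =>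
    D.strip_sin_ne_zero hH (a := K - 1 / 2) (b := K - 1 / 2) (by linarith) (by linarith) _
      (by simp) y
  have hker : ∀ y : ℝ, 1 - Complex.exp (2 * π * I * (((K - 1 / 2 : ℝ) : ℂ) + D.dir * y)) ≠ 0 := by
    intro y
    refine one_sub_cexp_ne_zero fun k hk => ?_
    have hk' : ((K - 1 / 2 : ℝ) : ℂ) + D.dir * y = ((k : ℝ) : ℂ) := by rw [hk]; simp
    obtain ⟨-, h2⟩ := line_eq_real hv hk'
    have h3 : (2 * K - 1 : ℤ) = 2 * k := by
      have : (2 * K - 1 : ℝ) = 2 * k := by linarith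
      exact_mod_cast this
    omega
  have hint : ∀ a : ℚ, Integrable fun y : ℝ => (fun z => D.osc g K l m' z * (Complex.exp (-(2 * π * I) * c * z) *
      sawNum a z / (1 - Complex.exp (2 * π * I * z)))) (((K - 1 / 2 : ℝ) : ℂ) + D.dir * y) := by
    intro a
    refine (D.osc_mul_decay hH g hK0 l m' (hgr' a)).integrable fun y => ?_
    refine (D.differentiableAt_osc g K l m' (hline y)).mul (DifferentiableAt.div ?_ (by fun_prop) (hker y))
    have := hdiffS a
    fun_prop
  have hint2 : ∀ m₀ : ℤ, Integrable fun y : ℝ => (fun z => D.osc g K l m' z *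
      Complex.exp (2 * π * I * (m₀ - c) * z)) (((K - 1 / 2 : ℝ) : ℂ) + D.dir * y) := by
    intro m₀
    refine LineDecay.integrable (f := fun z => D.osc g K l m' z * Complex.exp (2 * π * I * (m₀ - c) * z))
      (D.osc_mul_decay hH g hK0 l m' ?_) fun y => ?_
    · simpa using ExpGrowth.cexp D.dir (2 * π * I * (m₀ - c)) 0
    · exact (D.differentiableAt_osc g K l m' (hline y)).mul (by fun_prop)
  -- On the line through `K - 1/2` the numerator of `c` is exchanged for that of `c + H/2P`, the one
  -- that fits after translation by `K`. The denominator divides the difference, so entire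
  -- exponentials remain.
  have hdiff : lineInt D.dir (fun z => D.osc g K l m' z * (Complex.exp (-(2 * π * I) * c * z) *
        sawNum (c + D.slope / 2) z / (1 - Complex.exp (2 * π * I * z)))) (K - 1 / 2) -
      lineInt D.dir (fun z => D.osc g K l m' z * (Complex.exp (-(2 * π * I) * c * z) *
        sawNum c z / (1 - Complex.exp (2 * π * I * z)))) (K - 1 / 2) =
      -(D.signHP * ∑ m₀ ∈ D.stripIndex c,
        (if (m₀ : ℚ) = c ∨ (m₀ : ℚ) = c + D.slope / 2 then 1 / 2 else 1 : ℂ) *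
        lineInt D.dir (fun z => D.osc g K l m' z * Complex.exp (2 * π * I * (m₀ - c) * z)) (K - 1 / 2)) := by
    rw [lineInt, lineInt, ← integral_sub (hint _) (hint _)]
    simp only [lineInt]
    rw [Finset.sum_congr rfl fun m₀ _ => (integral_const_mul _ _).symm,
      ← integral_finsetSum _ fun m₀ _ => (hint2 m₀).const_mul _, ← integral_const_mul, ← integral_neg]
    refine integral_congr_ae (Eventually.of_forall fun y => ?_)
    beta_reduce
    have hs := D.sawNum_sub hH c (hker y)
    set z := ((K - 1 / 2 : ℝ) : ℂ) + D.dir * y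
    have e : D.osc g K l m' z * (Complex.exp (-(2 * π * I) * c * z) *
        sawNum (c + D.slope / 2) z / (1 - Complex.exp (2 * π * I * z))) -
        D.osc g K l m' z * (Complex.exp (-(2 * π * I) * c * z) *
        sawNum c z / (1 - Complex.exp (2 * π * I * z))) =
        D.osc g K l m' z * Complex.exp (-(2 * π * I) * c * z) *
        ((sawNum (c + D.slope / 2) z - sawNum c z) / (1 - Complex.exp (2 * π * I * z))) := by ring
    rw [e, hs, mul_neg, neg_inj, Finset.mul_sum, Finset.mul_sum, Finset.mul_sum]
    refine Finset.sum_congr rfl fun m₀ _ => ?_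
    have : Complex.exp (2 * π * I * (m₀ - c) * z) =
        Complex.exp (-(2 * π * I) * c * z) * Complex.exp (2 * π * I * m₀ * z) := by
      rw [← Complex.exp_add]
      ring_nf
    rw [this]
    ring
  -- Without the kernel there is no pole between `0` and `K`, so these integrals may be moved back
  -- to `1/2`.
  have hsh : ∀ m₀ : ℤ, lineInt D.dir (fun z => D.osc g K l m' z * Complex.exp (2 * π * I * (m₀ - c) * z)) (1 / 2) =
      lineInt D.dir (fun z => D.osc g K l m' z * Complex.exp (2 * π * I * (m₀ - c) * z)) (K - 1 / 2) := fun m₀ =>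
    D.lineInt_osc_mul_cexp hH g l m' _ (by norm_num) (by linarith) (by linarith)
  simp only [hsh]
  simp only [sawKernel]
  simp only [mul_div_assoc] at hks hdiff ⊢
  linear_combination hks + D.dir * hdiff

end SeifertData

/-! ### Translation by `K` and the boundary terms -/

namespace SeifertData

variable {n : ℕ} (D : SeifertData n)

/-- The half-integral vector `m + q / 2`. -/
def halfShift (m : Fin n → ℤ) (l : ℕ) (j : Fin n) : ℚ := m j + D.q j * l / 2

theorem shift_halfShift (m : Fin n → ℤ) (l : ℕ) :
    D.shift (D.halfShift m l) = D.shift (D.halfShift m 0) + D.slope * l / 2 := by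
  rw [shift, shift, slope_eq_sum, Finset.sum_mul, Finset.sum_div, ← Finset.sum_add_distrib]
  refine Finset.sum_congr rfl fun j _ => ?_
  simp only [halfShift]
  push_cast
  ring

/-- The cross term of `(K + w)²` in the Gaussian replaces `c` by `c + H/2P`. In the sines, `r_j(m_j
+ q_j/2)/p_j - s_j/2` equals `r_j m_j/p_j - 1/2p_j` by the determinant condition, so `m` becomes `m
+ q/2`. The sign comes from `sin(πz/K)` changing sign under translation. -/
theorem primePhase_mul_osc_add (g : ℕ) {K : ℕ} (hK : 0 < K) (m : Fin n → ℤ) (w : ℂ) :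
    D.primePhase K 0 (D.halfShift m 0) * (D.osc g K 0 (D.halfShift m 0) (K + w) *
      Complex.exp (-(2 * π * I) * D.shift (D.halfShift m 0) * (K + w))) =
    (-1) ^ n * D.primePhase K 1 (D.halfShift m 1) * (D.osc g K 1 (D.halfShift m 1) w *
      Complex.exp (-(2 * π * I) * D.shift (D.halfShift m 1) * w)) := by
  have hK' : (K : ℂ) ≠ 0 := by exact_mod_cast hK.ne'
  have hp : ∀ j, (D.p j : ℂ) ≠ 0 := fun j => by exact_mod_cast D.p_ne_zero j
  have hdet : ∀ j, (D.p j : ℂ) * D.s j - D.q j * D.r j = 1 := fun j => by exact_mod_cast D.det_eq_one j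
  have hprod : ∀ j, Complex.sin (2 * π * ((D.r j * D.halfShift m 0 j - (K + w) / (2 * K)) / D.p j -
      1 / 2 * D.s j * (0 : ℕ))) =
      Complex.sin (2 * π * ((D.r j * D.halfShift m 1 j - w / (2 * K)) / D.p j - 1 / 2 * D.s j * (1 : ℕ))) := by
    intro j
    congr 1
    simp only [halfShift]
    have := hp j
    push_cast
    field_simp
    linear_combination K * hdet j
  have hsin : Complex.sin (π / K * (K + w)) = -1 * Complex.sin (π / K * w) := by
    rw [show (π / K * (K + w) : ℂ) = π / K * w + π by field_simp; ring, Complex.sin_add_pi, neg_one_mul]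
  have hd : ((-1 : ℂ) ^ ((n : ℤ) + 2 * g - 2))⁻¹ = (-1) ^ n := by
    rw [← zpow_neg, ← zpow_natCast, ← mul_inv_eq_one₀ (zpow_ne_zero _ (by norm_num)), ← zpow_neg,
      ← zpow_add₀ (by norm_num)]
    exact Even.neg_one_zpow ⟨-(n + g - 1), by ring⟩
  have hquad : ∑ j, ((D.r j : ℂ) / D.p j * (D.halfShift m 1 j : ℂ) ^ 2 - 1 / 4 * D.s j * D.q j * ((1 : ℕ) : ℂ) ^ 2) =
      ∑ j, ((D.r j : ℂ) / D.p j * (D.halfShift m 0 j : ℂ) ^ 2 - 1 / 4 * D.s j * D.q j * ((0 : ℕ) : ℂ) ^ 2) +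
      ((∑ j, m j * D.s j : ℤ) : ℂ) - D.shift (D.halfShift m 0) - D.slope / 4 := by
    rw [slope_eq_sum, shift]
    push_cast
    rw [Finset.sum_div, ← Finset.sum_add_distrib, ← Finset.sum_sub_distrib, ← Finset.sum_sub_distrib]
    refine Finset.sum_congr rfl fun j _ => ?_
    simp only [halfShift]
    have := hp j
    push_cast
    field_simp
    linear_combination (-4 * (D.q j : ℂ) - 16 * m j) * hdet j
  have hexp : D.primePhase K 0 (D.halfShift m 0) *
      (Complex.exp (-(I * π / (2 * K)) * ((D.H : ℂ) / D.P) * (K + w) ^ 2) *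
        Complex.exp (-(2 * π * I) * D.shift (D.halfShift m 0) * (K + w))) =
      D.primePhase K 1 (D.halfShift m 1) *
      (Complex.exp (-(I * π / (2 * K)) * ((D.H : ℂ) / D.P) * w ^ 2) *
        Complex.exp (-(2 * π * I) * D.shift (D.halfShift m 1) * w)) := by
    rw [primePhase, primePhase, hquad, H_div_P, shift_halfShift D m 1]
    simp only [← Complex.exp_add]
    refine cexp_congr (-(K * ∑ j, m j * D.s j)) ?_
    push_cast
    field_simp
    ring_nf
  rw [osc, osc]
  simp only [hprod]
  rw [hsin, mul_zpow, mul_comm ((-1 : ℂ) ^ _), ← div_div, div_eq_mul_inv _ ((-1 : ℂ) ^ _), hd]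
  linear_combination ((-1) ^ n / Complex.sin (π / K * w) ^ ((n : ℤ) + 2 * g - 2) *
    ∏ j, Complex.sin (2 * π * ((D.r j * D.halfShift m 1 j - w / (2 * K)) / D.p j - 1 / 2 * D.s j * (1 : ℕ)))) * hexp

theorem _root_.SeifertWRT.lineInt_add (v : ℂ) (f : ℂ → ℂ) (a x : ℝ) :
    lineInt v f (a + x) = lineInt v (fun w => f (a + w)) x := by
  rw [lineInt, lineInt]
  push_cast
  simp only [add_assoc]

theorem _root_.SeifertWRT.lineInt_neg (v : ℂ) (f : ℂ → ℂ) (x : ℝ) :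
    lineInt v f (-x) = lineInt v (fun w => f (-w)) x := by
  rw [lineInt, lineInt, ← integral_neg_eq_self]
  push_cast
  congr 1
  ext y
  congr 1
  ring

theorem _root_.SeifertWRT.lineInt_const_mul (v c : ℂ) (f : ℂ → ℂ) (x : ℝ) :
    lineInt v (fun z => c * f z) x = c * lineInt v f x :=
  integral_const_mul _ _

open scoped Classical in
/-- The contribution of the line through `x`, for `x = ±1/2`. -/
noncomputable def boundaryTerm (g K l : ℕ) (x : ℝ) (m' : Fin n → ℚ) : ℂ :=
  2 * x * D.dir * lineInt D.dir (fun z => D.osc g K l m' z * sawKernel (D.shift m') z) x -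
    1 / 2 * D.dir * D.signHP * if ∃ a : ℤ, D.shift m' = a then lineInt D.dir (D.osc g K l m') x else 0

theorem phiSt_eq (m : Fin n → ℤ) (m₀ : ℤ) :
    D.phiSt m m₀ = (m₀ - D.shift (D.halfShift m 0)) / D.slope := by
  rw [phiSt, shift, slope, div_div_eq_mul_div, mul_comm, mul_div_assoc]
  congr 2
  · simp [halfShift]

/-- Of the integers in the strip, those with `0 < φ < 1/2` stay as stationary phase integrals. The
end points `c` and `c + H/2P`, when integral, carry the weight `1/2` and join the lines through
`1/2` and, after translation by `K`, through `-1/2`. -/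
theorem primePhase_mul_sum_osc (hH : D.H ≠ 0) (g : ℕ) {K : ℕ} (hK : 2 ≤ K) (m : Fin n → ℤ) :
    D.primePhase K 0 (D.halfShift m 0) * ∑ β ∈ Finset.Icc 1 (K - 1), D.osc g K 0 (D.halfShift m 0) β *
      Complex.exp (-(2 * π * I) * D.shift (D.halfShift m 0) * β) =
      -(D.dir * D.signHP * ∑ m₀ ∈ (D.stripIndex (D.shift (D.halfShift m 0))).filter
          (fun m₀ => 0 < D.phiSt m m₀ ∧ D.phiSt m m₀ < 1 / 2),
        D.primePhase K 0 (D.halfShift m 0) * lineInt D.dir (fun z => D.osc g K 0 (D.halfShift m 0) z *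
          Complex.exp (2 * π * I * (m₀ - D.shift (D.halfShift m 0)) * z)) (1 / 2)) +
      D.primePhase K 0 (D.halfShift m 0) * D.boundaryTerm g K 0 (1 / 2) (D.halfShift m 0) +
      (-1) ^ n * (D.primePhase K 1 (D.halfShift m 1) * D.boundaryTerm g K 1 (-1 / 2) (D.halfShift m 1)) := by
  classical
  have hK0 : 0 < K := by omega
  have hKr : (2 : ℝ) ≤ K := by exact_mod_cast hK
  have hs0 := D.slope_ne_zero hH
  have hshift := D.shift_halfShift m 1
  rw [Nat.cast_one, mul_one] at hshift
  set c := D.shift (D.halfShift m 0) with hc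
  set b := D.shift (D.halfShift m 1) with hb
  set W₀ := D.primePhase K 0 (D.halfShift m 0) with hW₀
  have e1 : (K - 1 / 2 : ℝ) = K + -1 / 2 := by ring
  rw [D.sum_osc_eq hH g hK 0 _ c, ← hshift]
  have h1 : W₀ * lineInt D.dir (fun z => D.osc g K 0 (D.halfShift m 0) z * (Complex.exp (-(2 * π * I) * c * z) *
        sawNum b z / (1 - Complex.exp (2 * π * I * z)))) (K - 1 / 2) =
      (-1) ^ n * D.primePhase K 1 (D.halfShift m 1) *
        lineInt D.dir (fun z => D.osc g K 1 (D.halfShift m 1) z * sawKernel b z) (-1 / 2) := by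
    rw [e1, lineInt_add, ← lineInt_const_mul, ← lineInt_const_mul]
    congr 1
    ext w
    have h := D.primePhase_mul_osc_add g hK0 m w
    rw [← hc, ← hb, ← hW₀] at h
    rw [sawKernel, Complex.ofReal_natCast, ← Int.cast_natCast K, sawNum_add_int, Int.cast_natCast,
      cexp_congr K (a := 2 * π * I * (K + w)) (b := 2 * π * I * w) (by push_cast; ring)]
    linear_combination sawNum b w / (1 - Complex.exp (2 * π * I * w)) * h
  -- At this end point the exponential cancels the one produced by the translation, and `osc` with
  -- `l = 1` remains alone.
  have h2 : ∀ m₀ : ℤ, (m₀ : ℚ) = b → W₀ * lineInt D.dir (fun z => D.osc g K 0 (D.halfShift m 0) z *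
        Complex.exp (2 * π * I * (m₀ - c) * z)) (1 / 2) =
      (-1) ^ n * D.primePhase K 1 (D.halfShift m 1) * lineInt D.dir (D.osc g K 1 (D.halfShift m 1)) (-1 / 2) := by
    intro m₀ hm₀
    rw [D.lineInt_osc_mul_cexp hH g 0 _ _ (b := K - 1 / 2) (by norm_num) (by linarith) (by linarith), e1, lineInt_add,
      ← lineInt_const_mul, ← lineInt_const_mul]
    congr 1
    ext w
    have h := D.primePhase_mul_osc_add g hK0 m w
    rw [← hc, ← hb, ← hW₀] at h
    have hm₀' : (m₀ : ℂ) = (b : ℂ) := by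
      rw [← hm₀]
      simp
    have e2 : Complex.exp (2 * π * I * (m₀ - c) * (K + w)) =
        Complex.exp (-(2 * π * I) * c * (K + w)) * Complex.exp (2 * π * I * b * w) := by
      rw [← Complex.exp_add, ← hm₀']
      refine cexp_congr (m₀ * K) ?_
      push_cast
      ring
    have e3 : Complex.exp (-(2 * π * I) * b * w) * Complex.exp (2 * π * I * b * w) = 1 := by
      rw [← Complex.exp_add, ← Complex.exp_zero]
      congr 1
      ring
    rw [Complex.ofReal_natCast, e2]
    linear_combination Complex.exp (2 * π * I * b * w) * h + (-1) ^ n * D.primePhase K 1 (D.halfShift m 1) *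
      D.osc g K 1 (D.halfShift m 1) w * e3
  -- the contributions of the end points of the strip
  set L : ℤ → ℂ := fun m₀ => lineInt D.dir (fun z => D.osc g K 0 (D.halfShift m 0) z *
        Complex.exp (2 * π * I * (m₀ - c) * z)) (1 / 2) with hL
  have hcb : c ≠ b := by
    rw [hshift]
    intro h
    apply hs0
    linarith
  -- An end point is hit by at most one integer, which belongs to the closed strip whenever it
  -- exists.
  have hend : ∀ t : ℚ, (t = c ∨ t = b) → ∑ m₀ ∈ D.stripIndex c, (if (m₀ : ℚ) = t then W₀ * L m₀ else 0) =
      if h : ∃ a : ℤ, t = a then W₀ * L h.choose else 0 := by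
    intro t ht
    split_ifs with h
    · have hch := h.choose_spec
      rw [Finset.sum_eq_single h.choose]
      · rw [if_pos hch.symm]
      · intro m₀ _ hne
        rw [if_neg]
        intro h'
        exact hne (by exact_mod_cast h'.trans hch)
      · intro hn
        refine absurd ((D.mem_stripIndex hH).mpr ?_) hn
        rw [← hch]
        rcases ht with ht | ht
        · rw [ht]
          norm_num
        · rw [ht, hshift, add_sub_cancel_left, div_div, mul_comm, ← div_div, div_self hs0]
          norm_num
    · refine Finset.sum_eq_zero fun m₀ _ => ?_
      rw [if_neg]
      intro h'
      exact h ⟨m₀, h'.symm⟩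
  have hsplit : W₀ * ∑ m₀ ∈ D.stripIndex c, (if (m₀ : ℚ) = c ∨ (m₀ : ℚ) = b then 1 / 2 else 1 : ℂ) * L m₀ =
      ∑ m₀ ∈ (D.stripIndex c).filter (fun m₀ => 0 < D.phiSt m m₀ ∧ D.phiSt m m₀ < 1 / 2), W₀ * L m₀ +
      1 / 2 * (∑ m₀ ∈ D.stripIndex c, (if (m₀ : ℚ) = c then W₀ * L m₀ else 0)) +
      1 / 2 * (∑ m₀ ∈ D.stripIndex c, (if (m₀ : ℚ) = b then W₀ * L m₀ else 0)) := by
    rw [Finset.mul_sum, Finset.mul_sum, Finset.mul_sum, Finset.sum_filter, ← Finset.sum_add_distrib,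
      ← Finset.sum_add_distrib]
    refine Finset.sum_congr rfl fun m₀ hm₀ => ?_
    rw [D.mem_stripIndex hH] at hm₀
    rw [D.phiSt_eq, ← hc]
    have i1 : 0 < (m₀ - c) / D.slope ↔ (m₀ : ℚ) ≠ c := by
      rw [lt_iff_le_and_ne, and_iff_right hm₀.1, ne_comm, Ne, div_eq_zero_iff, or_iff_left hs0, sub_eq_zero]
    have i2 : (m₀ - c) / D.slope < 1 / 2 ↔ (m₀ : ℚ) ≠ b := by
      rw [lt_iff_le_and_ne, and_iff_right hm₀.2, Ne, div_eq_iff hs0, sub_eq_iff_eq_add, hshift]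
      rw [show 1 / 2 * D.slope + c = c + D.slope / 2 by ring]
    have i3 := and_congr i1 i2
    by_cases hmc : (m₀ : ℚ) = c
    · have hmb : ¬ (m₀ : ℚ) = b := fun h => hcb (hmc.symm.trans h)
      rw [if_pos (Or.inl hmc), if_neg (fun h => (i3.mp h).1 hmc), if_pos hmc, if_neg hmb]
      ring
    · by_cases hmb : (m₀ : ℚ) = b
      · rw [if_pos (Or.inr hmb), if_neg (fun h => (i3.mp h).2 hmb), if_neg hmc, if_pos hmb]
        ring
      · rw [if_neg (by tauto), if_pos (i3.mpr ⟨hmc, hmb⟩), if_neg hmc, if_neg hmb]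
        ring
  rw [hend c (Or.inl rfl), hend b (Or.inr rfl)] at hsplit
  have hc' : (if h : ∃ a : ℤ, c = a then W₀ * L h.choose else 0) =
      W₀ * if ∃ a : ℤ, c = a then lineInt D.dir (D.osc g K 0 (D.halfShift m 0)) (1 / 2) else 0 := by
    split_ifs with h
    · have hch : (c : ℂ) = (h.choose : ℂ) := by
        conv_lhs => rw [h.choose_spec]
        simp
      rw [hL]
      simp only [← hch, sub_self, mul_zero, zero_mul, Complex.exp_zero, mul_one]
    · simp
  have hb' : (if h : ∃ a : ℤ, b = a then W₀ * L h.choose else 0) = (-1) ^ n * D.primePhase K 1 (D.halfShift m 1) *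
      if ∃ a : ℤ, b = a then lineInt D.dir (D.osc g K 1 (D.halfShift m 1)) (-1 / 2) else 0 := by
    split_ifs with h
    · exact h2 _ h.choose_spec.symm
    · simp
  rw [hc', hb'] at hsplit
  rw [boundaryTerm, boundaryTerm, ← hc, ← hb]
  push_cast
  linear_combination (-D.dir) * h1 - D.dir * D.signHP * hsplit

end SeifertData

/-! ### The residues as a sum over signs -/

theorem eventually_one_sub_cexp_ne_zero : ∀ᶠ z : ℂ in 𝓝[≠] 0, 1 - Complex.exp (2 * π * I * z) ≠ 0 := by
  filter_upwards [self_mem_nhdsWithin, mem_nhdsWithin_of_mem_nhds (Metric.ball_mem_nhds (0 : ℂ) one_pos)]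
    with z h0 h1
  refine one_sub_cexp_ne_zero fun k hk => ?_
  rw [hk, mem_ball_zero_iff, Complex.norm_intCast] at h1
  have : k = 0 := by
    have h2 : |k| < 1 := by exact_mod_cast h1
    exact Int.abs_lt_one_iff.mp h2
  exact h0 (by simp [hk, this])

theorem meromorphicAt_cot (z : ℂ) : MeromorphicAt (fun z : ℂ => Complex.cot (π * z)) z := by
  have h1 : AnalyticAt ℂ (fun z : ℂ => Complex.cos (π * z)) z := by fun_prop
  have h2 : AnalyticAt ℂ (fun z : ℂ => Complex.sin (π * z)) z := by fun_prop
  exact h1.meromorphicAt.div h2.meromorphicAt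

theorem sawNum_differentiable (a : ℚ) : Differentiable ℂ (sawNum a) := by
  unfold sawNum
  fun_prop

theorem meromorphicAt_sawKernel (a : ℚ) (z : ℂ) : MeromorphicAt (sawKernel a) z := by
  have h1 : AnalyticAt ℂ (fun z : ℂ => Complex.exp (-(2 * π * I) * a * z) * sawNum a z) z :=
    AnalyticAt.mul (by fun_prop) ((sawNum_differentiable a).analyticAt z)
  have h2 : AnalyticAt ℂ (fun z : ℂ => 1 - Complex.exp (2 * π * I * z)) z := by fun_prop
  exact h1.meromorphicAt.div h2.meromorphicAt

theorem sum_signs_eq_prod {n : ℕ} (f : Fin n → ℤˣ → ℂ) :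
    ∑ μ : Fin n → ℤˣ, ∏ j, f j (μ j) = ∏ j, (f j 1 + f j (-1)) := by
  have h : ∀ j, f j 1 + f j (-1) = ∑ e : ℤˣ, f j e := fun j =>
    (Fintype.sum_eq_add (1 : ℤˣ) (-1) (by decide) (by
      rintro x ⟨h1, h2⟩
      exact absurd (Int.units_eq_one_or x) (by tauto))).symm
  simp only [h]
  rw [Finset.prod_univ_sum, Fintype.piFinset_univ]

namespace SeifertData

variable {n : ℕ} (D : SeifertData n)

/-- The vector with components `μ_j m'_j`. -/
def _root_.SeifertWRT.signMul (μ : Fin n → ℤˣ) (m' : Fin n → ℚ) (j : Fin n) : ℚ := ((μ j : ℤ) : ℚ) * m' j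

theorem osc_signMul (g K l : ℕ) (μ : Fin n → ℤˣ) (m' : Fin n → ℚ) (z : ℂ) :
    D.osc g K l (signMul μ m') z = Complex.exp (-(I * π / (2 * K)) * ((D.H : ℂ) / D.P) * z ^ 2) /
      Complex.sin (π / K * z) ^ ((n : ℤ) + 2 * g - 2) * ∏ j, ((μ j : ℤ) : ℂ) *
        Complex.sin (2 * π * (D.angle l m' j - z / (2 * K) * (((μ j : ℤ) : ℂ) / D.p j))) := by
  rw [osc]
  congr 1
  refine Finset.prod_congr rfl fun j _ => ?_
  rw [angle, signMul]
  rcases Int.units_eq_one_or (μ j) with h | h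
  · rw [h]
    simp only [Units.val_one, Int.cast_one, one_mul]
    congr 1
    ring
  · rw [h]
    simp only [Units.val_neg, Units.val_one, Int.cast_neg, Int.cast_one, neg_one_mul]
    rw [← Complex.sin_neg, ← Complex.sin_sub_int_mul_two_pi _ (-(D.s j * l))]
    congr 1
    push_cast
    ring

/-- The sum factorizes over `j`. The two signs give `sin(A - B) exp(-iC) - sin(A + B) exp(iC)`,
which is `-2` times the bracket by the addition theorems. -/
theorem sum_signs_mul_cexp (K l : ℕ) (m' : Fin n → ℚ) (z : ℂ) :
    ∑ μ : Fin n → ℤˣ, (∏ j, ((μ j : ℤ) : ℂ) *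
        Complex.sin (2 * π * (D.angle l m' j - z / (2 * K) * (((μ j : ℤ) : ℂ) / D.p j)))) *
        Complex.exp (-(2 * π * I) * D.signedSum m' μ * z) =
      (-2) ^ n * ∏ j, (I * Complex.sin (2 * π * D.angle l m' j) * Complex.cos (π / K * (z / D.p j)) *
          Complex.sin (2 * π * z * (m' j / D.p j)) +
        Complex.cos (2 * π * D.angle l m' j) * Complex.sin (π / K * (z / D.p j)) *
          Complex.cos (2 * π * z * (m' j / D.p j))) := by
  have hexp : ∀ μ : Fin n → ℤˣ, Complex.exp (-(2 * π * I) * D.signedSum m' μ * z) =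
      ∏ j, Complex.exp (-((μ j : ℤ) : ℂ) * (2 * π * z * (m' j / D.p j)) * I) := by
    intro μ
    rw [← Complex.exp_sum, signedSum]
    push_cast
    rw [Finset.mul_sum, Finset.sum_mul]
    congr 1
    refine Finset.sum_congr rfl fun j _ => ?_
    ring
  simp only [hexp, ← Finset.prod_mul_distrib]
  rw [sum_signs_eq_prod (fun j e => ((e : ℤ) : ℂ) *
        Complex.sin (2 * π * (D.angle l m' j - z / (2 * K) * (((e : ℤ) : ℂ) / D.p j))) *
        Complex.exp (-((e : ℤ) : ℂ) * (2 * π * z * (m' j / D.p j)) * I))]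
  have hpow : (-2 : ℂ) ^ n = ∏ _j : Fin n, (-2 : ℂ) := by simp
  rw [hpow, ← Finset.prod_mul_distrib]
  refine Finset.prod_congr rfl fun j _ => ?_
  simp only [Units.val_one, Units.val_neg, Int.cast_one, Int.cast_neg, neg_neg, one_mul, neg_one_mul]
  rw [Complex.exp_mul_I, Complex.exp_mul_I, Complex.cos_neg, Complex.sin_neg]
  have e1 : 2 * π * (D.angle l m' j - z / (2 * K) * (1 / D.p j)) =
      2 * π * D.angle l m' j - π / K * (z / D.p j) := by ring
  have e2 : 2 * π * (D.angle l m' j - z / (2 * K) * (-1 / D.p j)) =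
      2 * π * D.angle l m' j + π / K * (z / D.p j) := by ring
  rw [e1, e2, Complex.sin_sub, Complex.sin_add]
  ring

/-- `sawKernel_eq` splits each kernel into a cotangent and exponentials. The cotangent is common to
all signs, so their sum can be carried out under the residue and yields the product of brackets. The
exponentials are the singular residues term by term. -/
theorem irrResidue_eq (g K l : ℕ) (m' : Fin n → ℚ) :
    D.irrResidue g K l m' = ∑ μ : Fin n → ℤˣ,
      residue (fun z => D.osc g K l (signMul μ m') z * sawKernel (D.signedSum m' μ) z) 0 := by
  have hB : MeromorphicAt (fun z : ℂ => Complex.exp (-(I * π / (2 * K)) * ((D.H : ℂ) / D.P) * z ^ 2) /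
      Complex.sin (π / K * z) ^ ((n : ℤ) + 2 * g - 2)) 0 := by
    have h1 : AnalyticAt ℂ (fun z : ℂ => Complex.exp (-(I * π / (2 * K)) * ((D.H : ℂ) / D.P) * z ^ 2)) 0 := by
      fun_prop
    have h2 : AnalyticAt ℂ (fun z : ℂ => Complex.sin (π / K * z)) 0 := by fun_prop
    exact h1.meromorphicAt.div (h2.meromorphicAt.zpow _)
  set B : ℂ → ℂ := fun z => Complex.exp (-(I * π / (2 * K)) * ((D.H : ℂ) / D.P) * z ^ 2) /
      Complex.sin (π / K * z) ^ ((n : ℤ) + 2 * g - 2) with hBdef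
  set S : (Fin n → ℤˣ) → ℂ → ℂ := fun μ z => ∏ j, ((μ j : ℤ) : ℂ) *
        Complex.sin (2 * π * (D.angle l m' j - z / (2 * K) * (((μ j : ℤ) : ℂ) / D.p j))) with hS
  have hSm : ∀ μ, MeromorphicAt (S μ) 0 := fun μ => by
    have : AnalyticAt ℂ (S μ) 0 := by
      rw [hS]
      fun_prop
    exact this.meromorphicAt
  have hE : ∀ t : ℂ, MeromorphicAt (fun z : ℂ => Complex.exp (t * z)) 0 := fun t => by
    have : AnalyticAt ℂ (fun z : ℂ => Complex.exp (t * z)) 0 := by fun_prop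
    exact this.meromorphicAt
  set c : (Fin n → ℤˣ) → ℕ → ℂ := fun μ m₀ => ((SignType.sign (D.signedSum m' μ) : ℤ) : ℂ) /
      ((symPM m₀ : ℂ) * (symPM (m₀ - |D.signedSum m' μ|) : ℂ)) with hc
  set t : (Fin n → ℤˣ) → ℕ → ℂ := fun μ m₀ => 2 * π * I * ((SignType.sign (D.signedSum m' μ) : ℤ) : ℂ) *
      (m₀ - ((|D.signedSum m' μ| : ℚ) : ℂ)) with ht
  have hA : ∀ μ, MeromorphicAt (fun z => B z * S μ z * Complex.exp (-(2 * π * I) * D.signedSum m' μ * z) *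
      (I / 2 * Complex.cot (π * z))) 0 := fun μ =>
    (((hB.mul (hSm μ)).mul (hE _)).mul ((MeromorphicAt.const (I / 2) 0).mul (meromorphicAt_cot 0)))
  have hC : ∀ μ m₀, MeromorphicAt (fun z => B z * S μ z * Complex.exp (t μ m₀ * z)) 0 := fun μ m₀ =>
    ((hB.mul (hSm μ)).mul (hE _))
  have hres : ∀ μ, residue (fun z => D.osc g K l (signMul μ m') z * sawKernel (D.signedSum m' μ) z) 0 =
      residue (fun z => B z * S μ z * Complex.exp (-(2 * π * I) * D.signedSum m' μ * z) *
        (I / 2 * Complex.cot (π * z))) 0 +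
      ∑ m₀ ∈ Finset.range (⌊|D.signedSum m' μ|⌋₊ + 1), -c μ m₀ *
        residue (fun z => B z * S μ z * Complex.exp (t μ m₀ * z)) 0 := by
    intro μ
    have h1 : ∑ m₀ ∈ Finset.range (⌊|D.signedSum m' μ|⌋₊ + 1), -c μ m₀ *
        residue (fun z => B z * S μ z * Complex.exp (t μ m₀ * z)) 0 =
        residue (fun z => ∑ m₀ ∈ Finset.range (⌊|D.signedSum m' μ|⌋₊ + 1), -c μ m₀ *
          (B z * S μ z * Complex.exp (t μ m₀ * z))) 0 := by
      rw [residue_sum _ (f := fun m₀ z => -c μ m₀ * (B z * S μ z * Complex.exp (t μ m₀ * z)))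
        fun m₀ _ => (MeromorphicAt.const (-c μ m₀) 0).mul (hC μ m₀)]
      exact Finset.sum_congr rfl fun m₀ _ => (residue_const_mul (hC μ m₀) _).symm
    have hsm : MeromorphicAt (fun z => ∑ m₀ ∈ Finset.range (⌊|D.signedSum m' μ|⌋₊ + 1), -c μ m₀ *
          (B z * S μ z * Complex.exp (t μ m₀ * z))) 0 :=
      MeromorphicAt.fun_sum fun m₀ _ => (MeromorphicAt.const (-c μ m₀) 0).mul (hC μ m₀)
    rw [h1, ← residue_add (hA μ) hsm]
    refine residue_congr ((D.meromorphicAt_osc g K l _ 0).mul (meromorphicAt_sawKernel _ 0)) ?_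
    filter_upwards [eventually_one_sub_cexp_ne_zero] with z hz
    rw [osc_signMul, sawKernel_eq _ hz, mul_sub, Finset.mul_sum, sub_eq_add_neg, ← Finset.sum_neg_distrib]
    congr 1
    · rw [mul_assoc]
      simp only [hBdef, hS]
      ring
    · refine Finset.sum_congr rfl fun m₀ _ => ?_
      simp only [hBdef, hS, hc, ht]
      rw [show 2 * π * I * z * ((SignType.sign (D.signedSum m' μ) : ℤ) : ℂ) *
        (m₀ - ((|D.signedSum m' μ| : ℚ) : ℂ)) = 2 * π * I * ((SignType.sign (D.signedSum m' μ) : ℤ) : ℂ) *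
        (m₀ - ((|D.signedSum m' μ| : ℚ) : ℂ)) * z by ring]
      ring
  simp only [hres]
  rw [Finset.sum_add_distrib, irrResidue]
  congr 1
  · rw [← residue_sum _ fun μ _ => hA μ, regularResidue, ← residue_const_mul]
    · congr 1
      ext z
      have h := D.sum_signs_mul_cexp K l m' z
      have : ∑ μ : Fin n → ℤˣ, B z * S μ z * Complex.exp (-(2 * π * I) * D.signedSum m' μ * z) *
        (I / 2 * Complex.cot (π * z)) = B z * (I / 2 * Complex.cot (π * z)) * ∑ μ : Fin n → ℤˣ, S μ z *
          Complex.exp (-(2 * π * I) * D.signedSum m' μ * z) := by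
        rw [Finset.mul_sum]
        exact Finset.sum_congr rfl fun μ _ => by ring
      rw [this, hS, h]
      simp only [hBdef]
      ring
    · have h3 : AnalyticAt ℂ (fun z : ℂ => ∏ j, (I * Complex.sin (2 * π * D.angle l m' j) *
          Complex.cos (π / K * (z / D.p j)) * Complex.sin (2 * π * z * (m' j / D.p j)) +
        Complex.cos (2 * π * D.angle l m' j) * Complex.sin (π / K * (z / D.p j)) *
          Complex.cos (2 * π * z * (m' j / D.p j)))) 0 := by fun_prop
      exact (hB.mul (meromorphicAt_cot 0)).mul h3.meromorphicAt
  · rw [singularResidue, ← Finset.sum_neg_distrib]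
    refine Finset.sum_congr rfl fun μ _ => ?_
    rw [← Finset.sum_neg_distrib]
    refine Finset.sum_congr rfl fun m₀ _ => ?_
    rw [neg_mul (c μ m₀), neg_inj]
    congr 2
    ext z
    simp only [hBdef, hS, ht]
    rw [Complex.exp_add]
    rw [show 2 * π * I * z * ((SignType.sign (D.signedSum m' μ) : ℤ) : ℂ) *
        (m₀ - ((|D.signedSum m' μ| : ℚ) : ℂ)) = 2 * π * I * ((SignType.sign (D.signedSum m' μ) : ℤ) : ℂ) *
        (m₀ - ((|D.signedSum m' μ| : ℚ) : ℂ)) * z by ring]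
    ring

end SeifertData

/-! ### Folding sums over residue classes by the reflections -/

/-- The elements of `ℤ + q l / 2` in the interval `[0, |p| / 2]`. -/
noncomputable def coordIndex (p q : ℤ) (l : ℕ) : Finset ℚ :=
  ((Finset.Icc (-(|q| * l)) (|p| + |q| * l)).image fun a : ℤ => (a : ℚ) + q * l / 2).filter
    fun x => 0 ≤ x ∧ x ≤ |(p : ℚ)| / 2

theorem mem_coordIndex {p q : ℤ} {l : ℕ} {x : ℚ} :
    x ∈ coordIndex p q l ↔ 0 ≤ x ∧ x ≤ |(p : ℚ)| / 2 ∧ ∃ a : ℤ, x = a + (q : ℚ) * l / 2 := by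
  rw [coordIndex, Finset.mem_filter, Finset.mem_image]
  constructor
  · rintro ⟨⟨a, -, rfl⟩, h1, h2⟩
    exact ⟨h1, h2, a, rfl⟩
  · rintro ⟨h1, h2, a, rfl⟩
    refine ⟨⟨a, ?_, rfl⟩, h1, h2⟩
    have hl : (0 : ℚ) ≤ l := l.cast_nonneg
    have h3 : (q : ℚ) * l ≤ |(q : ℚ)| * l := mul_le_mul_of_nonneg_right (le_abs_self _) hl
    have h4 : -(|(q : ℚ)| * l) ≤ (q : ℚ) * l := by
      rw [← neg_mul]
      exact mul_le_mul_of_nonneg_right (neg_abs_le _) hl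
    have h5 : 0 ≤ |(q : ℚ)| * l := by positivity
    have h6 : 0 ≤ |(p : ℚ)| := abs_nonneg _
    rw [Finset.mem_Icc]
    constructor
    · have : -(|(q : ℚ)| * l) ≤ a := by linarith
      exact_mod_cast this
    · have : (a : ℚ) ≤ |(p : ℚ)| + |(q : ℚ)| * l := by linarith
      exact_mod_cast this

/-- Uniqueness of representatives: `[0, |p|/2]` is a fundamental domain for the group generated by
`x ↦ -x` and translation by `p`. -/
theorem eq_of_reflection {p : ℤ} (hp : p ≠ 0) {U x y : ℚ} (hx0 : 0 ≤ x) (hx : x ≤ |(p : ℚ)| / 2)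
    (hy0 : 0 ≤ y) (hy : y ≤ |(p : ℚ)| / 2) (h : (∃ k : ℤ, x = U + k * p) ∨ ∃ k : ℤ, -x = U + k * p)
    (h' : (∃ k : ℤ, y = U + k * p) ∨ ∃ k : ℤ, -y = U + k * p) : x = y := by
  have hp0 : 0 < |(p : ℚ)| := abs_pos.mpr (by exact_mod_cast hp)
  have hsub : ∀ m : ℤ, x - y = m * p → x = y := by
    intro m hm
    have h1 : |(m : ℚ)| * |(p : ℚ)| ≤ |(p : ℚ)| / 2 := by
      rw [← abs_mul, ← hm, abs_le]
      constructor <;> linarith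
    have h2 : |(m : ℚ)| < 1 := by
      by_contra! h3
      nlinarith
    have h3 : |m| < 1 := by exact_mod_cast h2
    rw [Int.abs_lt_one_iff.mp h3] at hm
    simp only [Int.cast_zero, zero_mul] at hm
    linarith
  have hadd : ∀ m : ℤ, x + y = m * p → x = y := by
    intro m hm
    have h0 : |(m : ℚ)| * |(p : ℚ)| = x + y := by rw [← abs_mul, ← hm, abs_of_nonneg (by linarith)]
    rcases eq_or_ne m 0 with rfl | hm0
    · simp only [Int.cast_zero, abs_zero, zero_mul] at h0
      linarith
    · have h1 : (1 : ℚ) ≤ |(m : ℚ)| := by exact_mod_cast Int.one_le_abs hm0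
      have h2 : |(p : ℚ)| ≤ x + y := by nlinarith
      linarith
  rcases h with ⟨k, hk⟩ | ⟨k, hk⟩ <;> rcases h' with ⟨k', hk'⟩ | ⟨k', hk'⟩
  · exact hsub (k - k') (by push_cast; linarith)
  · exact hadd (k - k') (by push_cast; linarith)
  · exact hadd (k' - k) (by push_cast; linarith)
  · exact hsub (k' - k) (by push_cast; linarith)

-- Every class modulo `p` has, up to sign, one representative in `[0, |p|/2]`. Both indicators fire
-- exactly when the representative is fixed by a reflection of the class, that is `2x ∈ pℤ`, and
-- then the symmetry factor `2` compensates.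
open scoped Classical in
theorem sum_coordIndex {p : ℤ} (hp : p ≠ 0) (q : ℤ) (l : ℕ) (u : ℤ) :
    ∑ x ∈ coordIndex p q l, ((symZPM (x / p) : ℂ)⁻¹ *
        (if ∃ k : ℤ, x = (u + (q : ℚ) * l / 2) + k * p then 1 else 0) +
      (symZPM (x / p) : ℂ)⁻¹ * (if ∃ k : ℤ, -x = (u + (q : ℚ) * l / 2) + k * p then 1 else 0)) = 1 := by
  have hpq : (p : ℚ) ≠ 0 := by exact_mod_cast hp
  have hp0 : 0 < |(p : ℚ)| := abs_pos.mpr hpq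
  set U : ℚ := u + (q : ℚ) * l / 2 with hU
  have hterm : ∀ x : ℚ, ((symZPM (x / p) : ℂ)⁻¹ * (if ∃ k : ℤ, x = U + k * p then 1 else 0) +
      (symZPM (x / p) : ℂ)⁻¹ * (if ∃ k : ℤ, -x = U + k * p then 1 else 0)) =
      if (∃ k : ℤ, x = U + k * p) ∨ ∃ k : ℤ, -x = U + k * p then 1 else 0 := by
    intro x
    rw [symZPM_eq]
    have hiff : (∃ a : ℤ, 2 * (x / p) = a) ↔ ∃ a : ℤ, 2 * x = a * p := by
      refine exists_congr fun a => ?_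
      rw [← mul_div_assoc, div_eq_iff hpq]
    simp only [hiff]
    by_cases hA : ∃ k : ℤ, x = U + k * p <;> by_cases hB : ∃ k : ℤ, -x = U + k * p
    · have h2 : ∃ a : ℤ, 2 * x = a * p := by
        obtain ⟨k, hk⟩ := hA
        obtain ⟨k', hk'⟩ := hB
        exact ⟨k - k', by push_cast; linarith⟩
      rw [if_pos hA, if_pos hB, if_pos h2, if_pos (Or.inl hA)]
      norm_num
    · have h2 : ¬ ∃ a : ℤ, 2 * x = a * p := by
        rintro ⟨a, ha⟩
        obtain ⟨k, hk⟩ := hA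
        exact hB ⟨k - a, by push_cast; linarith⟩
      rw [if_pos hA, if_neg hB, if_neg h2, if_pos (Or.inl hA)]
      norm_num
    · have h2 : ¬ ∃ a : ℤ, 2 * x = a * p := by
        rintro ⟨a, ha⟩
        obtain ⟨k, hk⟩ := hB
        exact hA ⟨k + a, by push_cast; linarith⟩
      rw [if_neg hA, if_pos hB, if_neg h2, if_pos (Or.inr hB)]
      norm_num
    · rw [if_neg hA, if_neg hB, mul_zero, add_zero, if_neg (not_or.mpr ⟨hA, hB⟩)]
  simp only [hterm]
  obtain ⟨e, he⟩ : ∃ e : ℤ, |(p : ℚ)| = e * p := by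
    rcases abs_choice (p : ℚ) with h | h
    · exact ⟨1, by rw [h]; simp⟩
    · exact ⟨-1, by rw [h]; simp⟩
  have heZ : |p| = e * p := by exact_mod_cast he
  set k₀ := ⌊U / |(p : ℚ)|⌋ with hk₀
  have hf0 : 0 ≤ U - k₀ * |(p : ℚ)| := by
    have := Int.floor_le (U / |(p : ℚ)|)
    rw [le_div_iff₀ hp0] at this
    linarith
  have hf1 : U - k₀ * |(p : ℚ)| < |(p : ℚ)| := by
    have := Int.lt_floor_add_one (U / |(p : ℚ)|)
    rw [div_lt_iff₀ hp0] at this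
    linarith
  -- The representative is the remainder of `U` modulo `|p|`, or `|p|` minus it if it exceeds
  -- `|p|/2`; `e = ±1` converts between `p` and `|p|`.
  obtain ⟨x₀, hx₀, hxU⟩ : ∃ x₀ ∈ coordIndex p q l, (∃ k : ℤ, x₀ = U + k * p) ∨ ∃ k : ℤ, -x₀ = U + k * p := by
    rcases le_or_gt (U - k₀ * |(p : ℚ)|) (|(p : ℚ)| / 2) with h | h
    · refine ⟨U - k₀ * |(p : ℚ)|, mem_coordIndex.mpr ⟨hf0, h, u - k₀ * |p|, ?_⟩, Or.inl ⟨-k₀ * e, ?_⟩⟩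
      · rw [hU]
        push_cast
        ring
      · rw [he]
        push_cast
        ring
    · refine ⟨|(p : ℚ)| - (U - k₀ * |(p : ℚ)|), mem_coordIndex.mpr ⟨by linarith, by linarith,
        |p| + k₀ * |p| - u - q * l, ?_⟩, Or.inr ⟨-(k₀ + 1) * e, ?_⟩⟩
      · rw [hU]
        push_cast
        ring
      · rw [he]
        push_cast
        ring
  rw [Finset.sum_eq_single x₀, if_pos hxU]
  · intro y hy hne
    rw [if_neg]
    intro h
    rw [mem_coordIndex] at hy hx₀
    exact hne (eq_of_reflection hp hy.1 hy.2.1 hx₀.1 hx₀.2.1 h hxU)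
  · exact fun h => absurd hx₀ h

namespace SeifertData

variable {n : ℕ} (D : SeifertData n)

/-- The integer vectors with `0 ≤ m_j < |p_j|`. -/
noncomputable def box : Finset (Fin n → ℤ) := Fintype.piFinset fun j => Finset.Ico 0 |D.p j|

/-- The finite set `primeIndex`. -/
noncomputable def primeFinset (l : ℕ) : Finset (Fin n → ℚ) := Fintype.piFinset fun j => coordIndex (D.p j) (D.q j) l

theorem mem_primeFinset {l : ℕ} {m' : Fin n → ℚ} : m' ∈ D.primeFinset l ↔ m' ∈ D.primeIndex l := by
  rw [primeFinset, Fintype.mem_piFinset]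
  simp only [mem_coordIndex]
  rfl

theorem exists_signMul_eq_halfShift {l : ℕ} {m' : Fin n → ℚ} (hm' : m' ∈ D.primeFinset l) (μ : Fin n → ℤˣ) :
    ∃ w : Fin n → ℤ, signMul μ m' = D.halfShift w l := by
  rw [mem_primeFinset] at hm'
  have : ∀ j, ∃ w : ℤ, ((μ j : ℤ) : ℚ) * m' j = w + D.q j * l / 2 := by
    intro j
    obtain ⟨-, -, a, ha⟩ := hm' j
    rcases Int.units_eq_one_or (μ j) with h | h
    · exact ⟨a, by rw [h, ha]; simp⟩
    · refine ⟨-a - D.q j * l, ?_⟩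
      rw [h, ha]
      push_cast
      ring
  choose w hw using this
  exact ⟨w, funext hw⟩

/-- `sum_coordIndex`, multiplied over `j`, is a partition of unity on the box. Inserting it and
exchanging the sums moves the weight to the pairs `(m', μ)`. -/
theorem sum_fold (l : ℕ) (Ψ : (Fin n → ℚ) → ℂ)
    (hΨ : ∀ m k : Fin n → ℤ, Ψ (D.halfShift (fun j => m j + k j * D.p j) l) = Ψ (D.halfShift m l)) :
    ∑ m ∈ D.box, Ψ (D.halfShift m l) =
      ∑ m' ∈ D.primeFinset l, (D.symFactor m')⁻¹ * ∑ μ : Fin n → ℤˣ, Ψ (signMul μ m') := by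
  classical
  -- The indicators select the one vector of the box congruent to `μ m'`; periodicity of `Ψ` permits
  -- the reduction.
  have hA : ∀ m' ∈ D.primeFinset l, ∀ μ : Fin n → ℤˣ, Ψ (signMul μ m') = ∑ m ∈ D.box,
      (∏ j, if ∃ k : ℤ, ((μ j : ℤ) : ℚ) * m' j = (m j + (D.q j : ℚ) * l / 2) + k * D.p j then (1 : ℂ) else 0) *
        Ψ (D.halfShift m l) := by
    intro m' hm' μ
    obtain ⟨w, hw⟩ := D.exists_signMul_eq_halfShift hm' μ
    have hwj : ∀ j, ((μ j : ℤ) : ℚ) * m' j = w j + D.q j * l / 2 := fun j => congrFun hw j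
    rw [Finset.sum_eq_single fun j => w j % D.p j]
    · rw [Finset.prod_eq_one, one_mul, ← hΨ (fun j => w j % D.p j) fun j => w j / D.p j, hw]
      · congr 2
        ext j
        have := Int.emod_add_mul_ediv (w j) (D.p j)
        linarith
      · intro j _
        rw [if_pos]
        refine ⟨w j / D.p j, ?_⟩
        rw [hwj]
        have : ((w j % D.p j + D.p j * (w j / D.p j) : ℤ) : ℚ) = w j := by rw [Int.emod_add_mul_ediv]
        push_cast at this
        linarith
    · intro m hm hne
      obtain ⟨j, hj⟩ := Function.ne_iff.mp hne
      rw [Finset.prod_eq_zero (Finset.mem_univ j), zero_mul]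
      rw [if_neg]
      rintro ⟨k, hk⟩
      apply hj
      rw [box, Fintype.mem_piFinset] at hm
      have hmj := hm j
      rw [Finset.mem_Ico] at hmj
      rw [hwj] at hk
      have h1 : (w j : ℚ) = m j + k * D.p j := by linarith
      have h2 : w j = m j + k * D.p j := by exact_mod_cast h1
      rw [h2, Int.add_mul_emod_self_right, ← Int.emod_abs, Int.emod_eq_of_lt hmj.1 hmj.2]
    · intro h
      refine absurd ?_ h
      rw [box, Fintype.mem_piFinset]
      intro j
      rw [Finset.mem_Ico]
      exact ⟨Int.emod_nonneg _ (D.p_ne_zero j), Int.emod_lt_abs _ (D.p_ne_zero j)⟩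
  have hone : ∀ m : Fin n → ℤ, ∑ m' ∈ D.primeFinset l, ∑ μ : Fin n → ℤˣ, ∏ j, ((symZPM (m' j / D.p j) : ℂ)⁻¹ *
      if ∃ k : ℤ, ((μ j : ℤ) : ℚ) * m' j = (m j + (D.q j : ℚ) * l / 2) + k * D.p j then (1 : ℂ) else 0) = 1 := by
    intro m
    simp only [fun m' : Fin n → ℚ => sum_signs_eq_prod (fun j (e : ℤˣ) => ((symZPM (m' j / D.p j) : ℂ)⁻¹ *
      if ∃ k : ℤ, ((e : ℤ) : ℚ) * m' j = (m j + (D.q j : ℚ) * l / 2) + k * D.p j then (1 : ℂ) else 0))]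
    rw [primeFinset, ← Finset.prod_univ_sum (fun j => coordIndex (D.p j) (D.q j) l) fun j x =>
      (((symZPM (x / D.p j) : ℂ)⁻¹ *
        if ∃ k : ℤ, (((1 : ℤˣ) : ℤ) : ℚ) * x = (m j + (D.q j : ℚ) * l / 2) + k * D.p j then (1 : ℂ) else 0) +
      ((symZPM (x / D.p j) : ℂ)⁻¹ *
        if ∃ k : ℤ, (((-1 : ℤˣ) : ℤ) : ℚ) * x = (m j + (D.q j : ℚ) * l / 2) + k * D.p j then (1 : ℂ) else 0))]
    refine Finset.prod_eq_one fun j _ => ?_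
    refine (Finset.sum_congr rfl fun x _ => ?_).trans (sum_coordIndex (D.p_ne_zero j) (D.q j) l (m j))
    simp only [Units.val_one, Units.val_neg, Int.cast_one, Int.cast_neg, one_mul, neg_one_mul]
  symm
  calc ∑ m' ∈ D.primeFinset l, (D.symFactor m')⁻¹ * ∑ μ : Fin n → ℤˣ, Ψ (signMul μ m')
      = ∑ m' ∈ D.primeFinset l, ∑ μ : Fin n → ℤˣ, ∑ m ∈ D.box, (∏ j, ((symZPM (m' j / D.p j) : ℂ)⁻¹ *
      if ∃ k : ℤ, ((μ j : ℤ) : ℚ) * m' j = (m j + (D.q j : ℚ) * l / 2) + k * D.p j then (1 : ℂ) else 0)) *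
        Ψ (D.halfShift m l) := by
        refine Finset.sum_congr rfl fun m' hm' => ?_
        rw [Finset.mul_sum]
        refine Finset.sum_congr rfl fun μ _ => ?_
        rw [hA m' hm' μ, Finset.mul_sum]
        refine Finset.sum_congr rfl fun m _ => ?_
        rw [Finset.prod_mul_distrib, symFactor, ← Finset.prod_inv_distrib, mul_assoc]
    _ = ∑ m ∈ D.box, (∑ m' ∈ D.primeFinset l, ∑ μ : Fin n → ℤˣ, (∏ j, ((symZPM (m' j / D.p j) : ℂ)⁻¹ *
      if ∃ k : ℤ, ((μ j : ℤ) : ℚ) * m' j = (m j + (D.q j : ℚ) * l / 2) + k * D.p j then (1 : ℂ) else 0))) *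
        Ψ (D.halfShift m l) := by
        simp only [Finset.sum_mul]
        rw [Finset.sum_comm]
        simp only [Finset.sum_comm (s := D.box)]
        rw [Finset.sum_comm]
    _ = ∑ m ∈ D.box, Ψ (D.halfShift m l) := by
        refine Finset.sum_congr rfl fun m _ => ?_
        rw [hone, one_mul]

end SeifertData

/-! ### The exact formula -/

theorem fiberSum_eq (K : ℕ) (p q r : ℤ) (β : ℂ) :
    fiberSum K p q r β = ∑ m ∈ Finset.Ico 0 |p|, Complex.exp (-(π * I) * q * β ^ 2 / (2 * K * p)) *
      Complex.exp (2 * π * I * (K * r * (m : ℂ) ^ 2 - β * m) / p) *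
      Complex.sin (2 * π / p * (r * m - β / (2 * K))) := by
  rw [fiberSum]
  refine Finset.sum_nbij (fun m : ℕ => (m : ℤ)) ?_ ?_ ?_ ?_
  · intro m hm
    rw [Finset.mem_range] at hm
    rw [Finset.mem_Ico, Int.abs_eq_natAbs]
    omega
  · intro x _ y _ hxy
    exact Int.ofNat.inj hxy
  · intro m hm
    rw [Finset.coe_Ico, Set.mem_Ico, Int.abs_eq_natAbs] at hm
    refine ⟨m.natAbs, ?_, ?_⟩
    · rw [Finset.coe_range, Set.mem_Iio]
      omega
    · simpa using hm.1
  · intro m _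
    rw [Int.cast_natCast]

namespace SeifertData

variable {n : ℕ} (D : SeifertData n)

/-- Expanding the product gives one term for each `m` in the box, and the Gaussian exponents add up
through `∑ q_j/p_j = H/P`. -/
theorem prod_fiberSum_div (g K : ℕ) (β : ℂ) :
    (∏ j, fiberSum K (D.p j) (D.q j) (D.r j) β) / Complex.sin (π / K * β) ^ ((n : ℤ) + 2 * g - 2) =
      ∑ m ∈ D.box, D.primePhase K 0 (D.halfShift m 0) * (D.osc g K 0 (D.halfShift m 0) β *
        Complex.exp (-(2 * π * I) * D.shift (D.halfShift m 0) * β)) := by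
  simp only [fiberSum_eq]
  rw [Finset.prod_univ_sum, Finset.sum_div, box]
  refine Finset.sum_congr rfl fun m _ => ?_
  rw [Finset.prod_mul_distrib, Finset.prod_mul_distrib, ← Complex.exp_sum, ← Complex.exp_sum, osc, primePhase]
  have hsin : ∀ j, Complex.sin (2 * π / D.p j * (D.r j * m j - β / (2 * K))) =
      Complex.sin (2 * π * ((D.r j * D.halfShift m 0 j - β / (2 * K)) / D.p j - 1 / 2 * D.s j * (0 : ℕ))) := by
    intro j
    congr 1
    simp only [halfShift]
    push_cast
    ring
  simp only [hsin]
  have hexp : Complex.exp (∑ j, -(π * I) * D.q j * β ^ 2 / (2 * K * D.p j)) *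
      Complex.exp (∑ j, 2 * π * I * (K * D.r j * (m j : ℂ) ^ 2 - β * m j) / D.p j) =
      Complex.exp (2 * π * I * K * ∑ j, ((D.r j : ℂ) / D.p j * (D.halfShift m 0 j : ℂ) ^ 2 -
        1 / 4 * D.s j * D.q j * ((0 : ℕ) : ℂ) ^ 2)) *
      (Complex.exp (-(I * π / (2 * K)) * ((D.H : ℂ) / D.P) * β ^ 2) *
      Complex.exp (-(2 * π * I) * D.shift (D.halfShift m 0) * β)) := by
    rw [← Complex.exp_add, ← Complex.exp_add, ← Complex.exp_add, H_div_P, slope_eq_sum, shift]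
    congr 1
    push_cast
    simp only [Finset.mul_sum, Finset.sum_mul, ← Finset.sum_add_distrib]
    refine Finset.sum_congr rfl fun j _ => ?_
    simp only [halfShift]
    push_cast
    field_simp
    ring
  linear_combination (∏ j, Complex.sin (2 * π * ((D.r j * D.halfShift m 0 j - β / (2 * K)) / D.p j -
    1 / 2 * D.s j * (0 : ℕ)))) / Complex.sin (π / K * β) ^ ((n : ℤ) + 2 * g - 2) * hexp

theorem primePhase_add_mul (K l : ℕ) (m k : Fin n → ℤ) :
    D.primePhase K l (D.halfShift (fun j => m j + k j * D.p j) l) = D.primePhase K l (D.halfShift m l) := by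
  rw [primePhase, primePhase]
  refine cexp_congr (K * ∑ j, (2 * D.r j * m j * k j + D.r j * D.q j * l * k j + D.r j * k j ^ 2 * D.p j)) ?_
  push_cast
  rw [← mul_assoc, ← mul_add, ← Finset.sum_add_distrib]
  congr 1
  refine Finset.sum_congr rfl fun j _ => ?_
  have : (D.p j : ℂ) ≠ 0 := by exact_mod_cast D.p_ne_zero j
  simp only [halfShift]
  push_cast
  field_simp
  ring

theorem osc_add_mul (g K l : ℕ) (m k : Fin n → ℤ) (z : ℂ) :
    D.osc g K l (D.halfShift (fun j => m j + k j * D.p j) l) z = D.osc g K l (D.halfShift m l) z := by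
  rw [osc, osc]
  congr 1
  refine Finset.prod_congr rfl fun j _ => ?_
  rw [← Complex.sin_sub_int_mul_two_pi _ (D.r j * k j)]
  congr 1
  have : (D.p j : ℂ) ≠ 0 := by exact_mod_cast D.p_ne_zero j
  simp only [halfShift]
  push_cast
  field_simp
  ring

theorem shift_add_mul (l : ℕ) (m k : Fin n → ℤ) :
    D.shift (D.halfShift (fun j => m j + k j * D.p j) l) = D.shift (D.halfShift m l) + (∑ j, k j : ℤ) := by
  rw [shift, shift]
  push_cast
  rw [← Finset.sum_add_distrib]
  refine Finset.sum_congr rfl fun j _ => ?_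
  have : (D.p j : ℚ) ≠ 0 := by exact_mod_cast D.p_ne_zero j
  simp only [halfShift]
  push_cast
  field_simp
  ring

/-- Here the adapted kernel pays off: adding `p_j` to `m_j` changes the shift by an integer, which
`sawKernel` does not see. This is the hypothesis of `sum_fold`. -/
theorem boundaryTerm_add_mul (g K l : ℕ) (x : ℝ) (m k : Fin n → ℤ) :
    D.boundaryTerm g K l x (D.halfShift (fun j => m j + k j * D.p j) l) =
      D.boundaryTerm g K l x (D.halfShift m l) := by
  rw [boundaryTerm, boundaryTerm, funext (D.osc_add_mul g K l m k), shift_add_mul]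
  have hiff : (∃ a : ℤ, D.shift (D.halfShift m l) + ((∑ j, k j : ℤ) : ℚ) = a) ↔
      ∃ a : ℤ, D.shift (D.halfShift m l) = a := by
    constructor
    · rintro ⟨a, ha⟩
      exact ⟨a - ∑ j, k j, by push_cast at ha ⊢; linarith⟩
    · rintro ⟨a, ha⟩
      exact ⟨a + ∑ j, k j, by push_cast at ha ⊢; linarith⟩
  simp only [sawKernel_add_int]
  by_cases h : ∃ a : ℤ, D.shift (D.halfShift m l) = a
  · rw [if_pos h, if_pos (hiff.mpr h)]
  · rw [if_neg h, if_neg (mt hiff.mp h)]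

theorem primePhase_signMul (K l : ℕ) (μ : Fin n → ℤˣ) (m' : Fin n → ℚ) :
    D.primePhase K l (signMul μ m') = D.primePhase K l m' := by
  rw [primePhase, primePhase]
  congr 2
  refine Finset.sum_congr rfl fun j _ => ?_
  rw [signMul]
  rcases Int.units_eq_one_or (μ j) with h | h <;> rw [h] <;> simp

theorem signMul_neg (μ : Fin n → ℤˣ) (m' : Fin n → ℚ) : signMul (-μ) m' = -signMul μ m' := by
  ext j
  simp [signMul]

theorem signedSum_neg (m' : Fin n → ℚ) (μ : Fin n → ℤˣ) : D.signedSum m' (-μ) = -D.signedSum m' μ := by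
  rw [signedSum, signedSum, ← Finset.sum_neg_distrib]
  refine Finset.sum_congr rfl fun j _ => ?_
  simp only [Pi.neg_apply, Units.val_neg, Int.cast_neg]
  ring

open scoped Classical in
/-- The sum of the integrals which are singular for integral signed sums. -/
noncomputable def singularLine (g K l : ℕ) (m' : Fin n → ℚ) : ℂ :=
  ∑ μ ∈ (Finset.univ : Finset (Fin n → ℤˣ)).filter (fun μ => ∃ a : ℤ, D.signedSum m' μ = a),
    lineInt D.dir (D.osc g K l (signMul μ m')) (1 / 2)

theorem sub_lineInt_osc_mul_sawKernel (hH : D.H ≠ 0) (g : ℕ) {K : ℕ} (hK : 0 < K) (l : ℕ) (m' : Fin n → ℚ) (a : ℚ) :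
    D.dir * (lineInt D.dir (fun z => D.osc g K l m' z * sawKernel a z) (1 / 2) -
      lineInt D.dir (fun z => D.osc g K l m' z * sawKernel a z) (-(1 / 2))) =
    2 * π * I * residue (fun z => D.osc g K l m' z * sawKernel a z) 0 := by
  have hv := D.dir_im_pos hH
  have hK1 : (1 : ℝ) ≤ K := by exact_mod_cast hK
  have h := lineInt_sub_lineInt hv (f := fun z => D.osc g K l m' z * sawKernel a z) (a := -(1 / 2))
    (b := 1 / 2) (z₀ := 0) (by norm_num) (by norm_num)
  rw [Complex.ofReal_zero] at h
  refine h ((D.meromorphicAt_osc g K l m' 0).mul (meromorphicAt_sawKernel a 0)) ?_ ?_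
  · intro x hx y hne
    have hreal : ∀ t : ℝ, (x : ℂ) + D.dir * y = t → |t| ≤ 1 / 2 ∧ t ≠ 0 := by
      intro t ht
      obtain ⟨hy, hxt⟩ := line_eq_real hv ht
      refine ⟨abs_le.mpr ⟨hxt ▸ hx.1, hxt ▸ hx.2⟩, ?_⟩
      rintro rfl
      exact hne (by rw [ht]; simp)
    refine (D.differentiableAt_osc g K l m' ?_).mul ?_
    · intro hs
      obtain ⟨k, hk⟩ := Complex.sin_eq_zero_iff.mp hs
      have hK' : (K : ℂ) ≠ 0 := by exact_mod_cast hK.ne'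
      have hpi : (π : ℂ) ≠ 0 := by exact_mod_cast Real.pi_ne_zero
      obtain ⟨h1, h2⟩ := hreal (k * K) (by
        push_cast
        field_simp at hk
        linear_combination hk)
      have h3 : k ≠ 0 := by
        rintro rfl
        simp at h2
      have h4 : (1 : ℝ) ≤ |(k : ℝ)| := by exact_mod_cast Int.one_le_abs h3
      rw [abs_mul, abs_of_pos (by linarith : (0 : ℝ) < K)] at h1
      nlinarith
    · refine DifferentiableAt.div ?_ (by fun_prop) (one_sub_cexp_ne_zero fun k hk => ?_)
      · have := sawNum_differentiable a
        fun_prop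
      · obtain ⟨h1, h2⟩ := hreal k (by rw [hk]; simp)
        have h3 : k ≠ 0 := by
          rintro rfl
          simp at h2
        have h4 : (1 : ℝ) ≤ |(k : ℝ)| := by exact_mod_cast Int.one_le_abs h3
        linarith
  · refine (D.osc_mul_decay hH g hK l m' (f := sawKernel a) ?_)
    have h1 := ((ExpGrowth.cexp D.dir (-(2 * π * I) * a) 0).mul (ExpGrowth.sawNum D.dir a)).mul (ExpGrowth.kernel hv)
    simp only [add_zero, ← div_eq_mul_inv] at h1
    exact h1

/-- The substitution `z ↦ -z`, `μ ↦ -μ` shows that the integrals through `1/2` and `-1/2`, summed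
over the signs, are opposite. Each is half of their difference, which the residue theorem evaluates;
hence `πi` instead of `2πi`, and the same value for both lines. -/
theorem sum_boundaryTerm (hH : D.H ≠ 0) (g : ℕ) {K : ℕ} (hK : 0 < K) (l : ℕ) (m' : Fin n → ℚ) {x : ℝ}
    (hx : x = 1 / 2 ∨ x = -1 / 2) :
    ∑ μ : Fin n → ℤˣ, D.boundaryTerm g K l x (signMul μ m') =
      π * I * D.irrResidue g K l m' - 1 / 2 * D.dir * D.signHP * D.singularLine g K l m' := by
  classical
  set A : (Fin n → ℤˣ) → ℂ := fun μ =>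
    lineInt D.dir (fun z => D.osc g K l (signMul μ m') z * sawKernel (D.signedSum m' μ) z) (1 / 2) with hA
  set B : (Fin n → ℤˣ) → ℂ := fun μ =>
    lineInt D.dir (fun z => D.osc g K l (signMul μ m') z * sawKernel (D.signedSum m' μ) z) (-(1 / 2)) with hB
  have hneg : ∑ μ, B μ = -∑ μ, A μ := by
    rw [← Equiv.sum_comp (Equiv.neg (Fin n → ℤˣ)), ← Finset.sum_neg_distrib]
    refine Finset.sum_congr rfl fun μ _ => ?_
    simp only [hA, hB, Equiv.neg_apply]
    rw [lineInt_neg]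
    refine Eq.trans ?_ ((lineInt_const_mul D.dir (-1) _ _).trans (neg_one_mul _))
    congr 1
    ext z
    rw [signMul_neg, signedSum_neg, osc_neg, sawKernel_neg]
    ring
  have hres : D.dir * (∑ μ, A μ - ∑ μ, B μ) = 2 * π * I * D.irrResidue g K l m' := by
    rw [irrResidue_eq, ← Finset.sum_sub_distrib, Finset.mul_sum, Finset.mul_sum]
    exact Finset.sum_congr rfl fun μ _ => D.sub_lineInt_osc_mul_sawKernel hH g hK l _ _
  have hsing : ∑ μ : Fin n → ℤˣ, (if ∃ a : ℤ, D.signedSum m' μ = a then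
      lineInt D.dir (D.osc g K l (signMul μ m')) (-1 / 2) else 0) = D.singularLine g K l m' := by
    rw [singularLine, Finset.sum_filter, ← Equiv.sum_comp (Equiv.neg (Fin n → ℤˣ))]
    refine Finset.sum_congr rfl fun μ _ => ?_
    rw [Equiv.neg_apply, signedSum_neg]
    have hiff : (∃ a : ℤ, -D.signedSum m' μ = a) ↔ ∃ a : ℤ, D.signedSum m' μ = a := by
      constructor
      · rintro ⟨a, ha⟩
        exact ⟨-a, by push_cast; linarith⟩
      · rintro ⟨a, ha⟩
        exact ⟨-a, by push_cast; linarith⟩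
    rw [if_congr hiff rfl rfl]
    congr 1
    rw [neg_div, lineInt_neg]
    congr 1
    ext z
    rw [signMul_neg, osc_neg]
  have hb : ∀ μ, D.boundaryTerm g K l x (signMul μ m') = 2 * x * D.dir * lineInt D.dir
      (fun z => D.osc g K l (signMul μ m') z * sawKernel (D.signedSum m' μ) z) x - 1 / 2 * D.dir * D.signHP *
      if ∃ a : ℤ, D.signedSum m' μ = a then lineInt D.dir (D.osc g K l (signMul μ m')) x else 0 := fun μ => rfl
  simp only [hb]
  rw [Finset.sum_sub_distrib, ← Finset.mul_sum, ← Finset.mul_sum]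
  rcases hx with rfl | rfl
  · rw [← Finset.sum_filter, ← singularLine]
    push_cast
    linear_combination (1 / 2 : ℂ) * hres + (1 / 2 : ℂ) * D.dir * hneg
  · rw [hsing]
    rw [neg_div]
    push_cast
    linear_combination (1 / 2 : ℂ) * hres - (1 / 2 : ℂ) * D.dir * hneg

/-- An exact formula for every `K ≥ 2`: stationary phase integrals, residues, and the integrals
attached to integral signed sums. The line through `1/2` accounts for `l = 0` and the one through
`-1/2` for `l = 1`. -/
theorem invariant_eq (hH : D.H ≠ 0) (g : ℕ) {K : ℕ} (hK : 2 ≤ K) :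
    D.invariant g K = D.amplitude g K *
      (∑ m ∈ D.box, ∑ m₀ ∈ (D.stripIndex (D.shift (D.halfShift m 0))).filter
          (fun m₀ => 0 < D.phiSt m m₀ ∧ D.phiSt m m₀ < 1 / 2),
        -(D.dir * D.signHP) * (D.primePhase K 0 (D.halfShift m 0) *
          lineInt D.dir (fun z => D.osc g K 0 (D.halfShift m 0) z *
          Complex.exp (2 * π * I * (m₀ - D.shift (D.halfShift m 0)) * z)) (1 / 2)) +
      ∑ l ∈ Finset.range 2, (-1) ^ (n * l) * ∑ m' ∈ D.primeFinset l, (D.symFactor m')⁻¹ *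
        (D.primePhase K l m' *
          (π * I * D.irrResidue g K l m' - 1 / 2 * D.dir * D.signHP * D.singularLine g K l m'))) := by
  have hK0 : 0 < K := by omega
  rw [D.invariant_eq_sum_fiberSum g hK]
  congr 1
  simp only [prod_fiberSum_div]
  rw [Finset.sum_comm]
  simp only [← Finset.mul_sum, D.primePhase_mul_sum_osc hH g hK]
  have hfold : ∀ (l : ℕ) (x : ℝ), (x = 1 / 2 ∨ x = -1 / 2) →
      ∑ m ∈ D.box, D.primePhase K l (D.halfShift m l) * D.boundaryTerm g K l x (D.halfShift m l) =
      ∑ m' ∈ D.primeFinset l, (D.symFactor m')⁻¹ * (D.primePhase K l m' *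
          (π * I * D.irrResidue g K l m' - 1 / 2 * D.dir * D.signHP * D.singularLine g K l m')) := by
    intro l x hx
    rw [D.sum_fold l (fun m' => D.primePhase K l m' * D.boundaryTerm g K l x m') fun m k => by
      rw [primePhase_add_mul, boundaryTerm_add_mul]]
    refine Finset.sum_congr rfl fun m' _ => ?_
    simp only [primePhase_signMul]
    rw [← Finset.mul_sum, D.sum_boundaryTerm hH g hK0 l m' hx]
  rw [Finset.sum_add_distrib, Finset.sum_add_distrib, hfold 0 _ (Or.inl rfl), ← Finset.mul_sum, hfold 1 _ (Or.inr rfl),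
    Finset.sum_range_succ, Finset.sum_range_one, mul_zero, pow_zero, one_mul, mul_one, add_assoc]
  congr 1
  rw [Finset.mul_sum]
  exact Finset.sum_congr rfl fun m _ => (neg_mul _ _).symm

end SeifertData

/-! ### Gaussian integrals of functions vanishing at the origin -/

/-- Near zero this is the assumed order of vanishing. For `|t| ≥ δ` the factor `t^(2N) / δ^(2N)` is
at least `1` and can be inserted into the exponential bound. -/
theorem exists_bound_of_isBigO {ρ : ℝ → ℂ} (hc : Continuous ρ) (N : ℕ)
    (h0 : ρ =O[𝓝 0] fun t : ℝ => t ^ (2 * N)) {C c : ℝ} (hg : ∀ t, 1 ≤ |t| → ‖ρ t‖ ≤ C * Real.exp (c * |t|)) :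
    ∃ C' c' : ℝ, 0 ≤ C' ∧ 0 ≤ c' ∧ ∀ t, ‖ρ t‖ ≤ C' * (t ^ (2 * N) * Real.exp (c' * |t|)) := by
  obtain ⟨A, hA⟩ := h0.bound
  obtain ⟨δ, hδ, hb⟩ := Metric.eventually_nhds_iff.mp hA
  obtain ⟨B, hB⟩ := (isCompact_Icc (a := (-1 : ℝ)) (b := 1)).exists_bound_of_continuousOn hc.continuousOn
  have hpow : ∀ t : ℝ, 0 ≤ t ^ (2 * N) := fun t => (even_two_mul N).pow_nonneg t
  have hcc : ∀ t : ℝ, ‖ρ t‖ ≤ (|B| + |C|) * Real.exp (|c| * |t|) := by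
    intro t
    have h1 : 1 ≤ Real.exp (|c| * |t|) := Real.one_le_exp (by positivity)
    rcases le_total 1 |t| with ht | ht
    · refine (hg t ht).trans ?_
      have h2 : Real.exp (c * |t|) ≤ Real.exp (|c| * |t|) :=
        Real.exp_le_exp.mpr (mul_le_mul_of_nonneg_right (le_abs_self c) (abs_nonneg t))
      refine mul_le_mul ((le_abs_self C).trans (by linarith [abs_nonneg B])) h2 (Real.exp_pos _).le (by positivity)
    · have := (hB t (abs_le.mp ht)).trans (le_abs_self B)
      refine this.trans ?_
      have h3 : |B| + |C| ≤ (|B| + |C|) * Real.exp (|c| * |t|) := le_mul_of_one_le_right (by positivity) h1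
      linarith [abs_nonneg C]
  refine ⟨|A| + (|B| + |C|) / δ ^ (2 * N), |c|, by positivity, abs_nonneg c, fun t => ?_⟩
  rcases lt_or_ge |t| δ with ht | ht
  · have h1 := hb (y := t) (by rwa [Real.dist_eq, sub_zero])
    rw [Real.norm_of_nonneg (hpow t)] at h1
    have h2 : 1 ≤ Real.exp (|c| * |t|) := Real.one_le_exp (by positivity)
    calc ‖ρ t‖ ≤ |A| * t ^ (2 * N) := h1.trans (mul_le_mul_of_nonneg_right (le_abs_self A) (hpow t))
      _ ≤ |A| * (t ^ (2 * N) * Real.exp (|c| * |t|)) :=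
        mul_le_mul_of_nonneg_left (le_mul_of_one_le_right (hpow t) h2) (abs_nonneg A)
      _ ≤ _ := mul_le_mul_of_nonneg_right (le_add_of_nonneg_right (by positivity))
        (mul_nonneg (hpow t) (Real.exp_pos _).le)
  · have h1 : δ ^ (2 * N) ≤ t ^ (2 * N) := by
      rw [← (even_two_mul N).pow_abs t]
      exact pow_le_pow_left₀ hδ.le ht _
    have h2 : 1 ≤ t ^ (2 * N) / δ ^ (2 * N) := (one_le_div (by positivity)).mpr h1
    calc ‖ρ t‖ ≤ (|B| + |C|) * Real.exp (|c| * |t|) := hcc t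
      _ ≤ (|B| + |C|) * Real.exp (|c| * |t|) * (t ^ (2 * N) / δ ^ (2 * N)) :=
        le_mul_of_one_le_right (by positivity) h2
      _ = (|B| + |C|) / δ ^ (2 * N) * (t ^ (2 * N) * Real.exp (|c| * |t|)) := by ring
      _ ≤ _ := mul_le_mul_of_nonneg_right (le_add_of_nonneg_left (abs_nonneg A))
        (mul_nonneg (hpow t) (Real.exp_pos _).le)

theorem integral_pow_mul_gaussian_scale (N : ℕ) {L : ℝ} (hL : 0 < L) :
    ∫ t : ℝ, t ^ (2 * N) * Real.exp (-(L / 2) * t ^ 2) =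
      L ^ (-(N : ℝ) - 1 / 2) * ∫ t : ℝ, t ^ (2 * N) * Real.exp (-(1 / 2) * t ^ 2) := by
  have hs : 0 < √L := Real.sqrt_pos.mpr hL
  have h := Measure.integral_comp_mul_left (fun s : ℝ => s ^ (2 * N) * Real.exp (-(1 / 2) * s ^ 2)) (√L)
  have e : ∀ t : ℝ, (√L * t) ^ (2 * N) * Real.exp (-(1 / 2) * (√L * t) ^ 2) =
      L ^ N * (t ^ (2 * N) * Real.exp (-(L / 2) * t ^ 2)) := by
    intro t
    rw [mul_pow, mul_pow, pow_mul, Real.sq_sqrt hL.le]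
    ring_nf
  simp only [e] at h
  rw [integral_const_mul, abs_of_pos (inv_pos.mpr hs), smul_eq_mul] at h
  have hLN : L ^ N ≠ 0 := (pow_pos hL N).ne'
  rw [← mul_right_inj' hLN, h, ← mul_assoc]
  congr 1
  rw [Real.rpow_sub hL, Real.rpow_neg hL.le, Real.rpow_natCast, Real.sqrt_eq_rpow]
  field_simp

/-- Half of the Gaussian is spent on the exponential growth; the other half is integrated against
`t^(2N)`, and scaling by `√L` produces the power of `L`. -/
theorem isBigO_integral_gaussian_mul {ρ : ℝ → ℂ} (hc : Continuous ρ) (N : ℕ)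
    (h0 : ρ =O[𝓝 0] fun t : ℝ => t ^ (2 * N)) {C c : ℝ} (hg : ∀ t, 1 ≤ |t| → ‖ρ t‖ ≤ C * Real.exp (c * |t|)) :
    (fun L : ℝ => ∫ t : ℝ, Complex.exp (-(L * t ^ 2)) * ρ t) =O[atTop] fun L : ℝ => L ^ (-(N : ℝ) - 1 / 2) := by
  obtain ⟨C', c', hC', hc', hb⟩ := exists_bound_of_isBigO hc N h0 hg
  refine Asymptotics.IsBigO.of_bound
    (C' * Real.exp (c' ^ 2 / 2) * ∫ t : ℝ, t ^ (2 * N) * Real.exp (-(1 / 2) * t ^ 2)) ?_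
  filter_upwards [eventually_ge_atTop 1] with L hL
  have hL0 : 0 < L := by linarith
  have hint : Integrable fun t : ℝ => C' * Real.exp (c' ^ 2 / 2) * (t ^ (2 * N) * Real.exp (-(L / 2) * t ^ 2)) := by
    have := integrable_rpow_mul_exp_neg_mul_sq (b := L / 2) (by linarith) (s := ((2 * N : ℕ) : ℝ))
      (by have : (0 : ℝ) ≤ ((2 * N : ℕ) : ℝ) := Nat.cast_nonneg _
          linarith)
    simp only [Real.rpow_natCast] at this
    exact this.const_mul _
  have hle := norm_integral_le_of_norm_le (f := fun t : ℝ => Complex.exp (-(L * t ^ 2)) * ρ t) hint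
    (Eventually.of_forall fun t => ?_)
  · refine hle.trans ?_
    rw [integral_const_mul, integral_pow_mul_gaussian_scale N hL0,
      Real.norm_of_nonneg (Real.rpow_nonneg hL0.le _)]
    exact (by ring : _ = _).le
  · have hpow : 0 ≤ t ^ (2 * N) := (even_two_mul N).pow_nonneg t
    rw [norm_mul, Complex.norm_exp]
    have e1 : (-((L : ℂ) * (t : ℂ) ^ 2)).re = -(L * t ^ 2) := by
      rw [← Complex.ofReal_pow, ← Complex.ofReal_mul, ← Complex.ofReal_neg, Complex.ofReal_re]
    rw [e1]
    -- This is `c'|t| ≤ c'²/2 + t²/2`, together with `L ≥ 1`.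
    have e2 : Real.exp (-(L * t ^ 2)) * Real.exp (c' * |t|) ≤
        Real.exp (c' ^ 2 / 2) * Real.exp (-(L / 2) * t ^ 2) := by
      rw [← Real.exp_add, ← Real.exp_add]
      apply Real.exp_le_exp.mpr
      have h1 : t ^ 2 ≤ L * t ^ 2 := le_mul_of_one_le_left (sq_nonneg t) hL
      have h2 := sq_nonneg (c' - |t|)
      have h3 := sq_abs t
      nlinarith
    calc Real.exp (-(L * t ^ 2)) * ‖ρ t‖
        ≤ Real.exp (-(L * t ^ 2)) * (C' * (t ^ (2 * N) * Real.exp (c' * |t|))) :=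
          mul_le_mul_of_nonneg_left (hb t) (Real.exp_pos _).le
      _ = C' * t ^ (2 * N) * (Real.exp (-(L * t ^ 2)) * Real.exp (c' * |t|)) := by ring
      _ ≤ C' * t ^ (2 * N) * (Real.exp (c' ^ 2 / 2) * Real.exp (-(L / 2) * t ^ 2)) :=
          mul_le_mul_of_nonneg_left e2 (mul_nonneg hC' hpow)
      _ = _ := by ring

/-! ### Moments of Gaussians along lines -/

theorem ExpGrowth.id (v : ℂ) : ExpGrowth v fun z => z := by
  refine ExpGrowth.of_le fun R => ⟨|R| + ‖v‖, 1, fun x y hx hy => ?_⟩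
  have h1 : ‖(x : ℂ) + v * y‖ ≤ |R| + ‖v‖ * |y| := by
    refine (norm_add_le _ _).trans ?_
    rw [norm_mul, Complex.norm_real, Complex.norm_real, Real.norm_eq_abs, Real.norm_eq_abs]
    linarith [le_abs_self R]
  have h2 : |y| ≤ Real.exp (1 * |y|) := by
    rw [one_mul]
    linarith [Real.add_one_le_exp |y|]
  have h3 : (1 : ℝ) ≤ Real.exp (1 * |y|) := Real.one_le_exp (by positivity)
  have := mul_le_mul_of_nonneg_left h2 (norm_nonneg v)
  have := mul_le_mul_of_nonneg_left h3 (abs_nonneg R)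
  linarith

theorem ExpGrowth.inv_id {v : ℂ} (hv : 0 < v.im) : ExpGrowth v fun z => z⁻¹ := by
  refine ExpGrowth.of_le fun R => ⟨v.im⁻¹, 0, fun x y hx hy => ?_⟩
  rw [zero_mul, Real.exp_zero, mul_one, norm_inv]
  refine inv_anti₀ hv ((?_ : _ ≤ _).trans (Complex.abs_im_le_norm _))
  have : ((x : ℂ) + v * y).im = v.im * y := by simp
  rw [this, abs_mul, abs_of_pos hv]
  exact le_mul_of_one_le_right hv.le hy

theorem ExpGrowth.zpow_id {v : ℂ} (hv : 0 < v.im) (j : ℤ) : ExpGrowth v fun z => z ^ j :=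
  (ExpGrowth.id v).zpow (ExpGrowth.inv_id hv) j

theorem line_ne_zero_or {v : ℂ} (hv : 0 < v.im) {x : ℝ} {j : ℤ} (h : x ≠ 0 ∨ 0 ≤ j) (y : ℝ) :
    (x : ℂ) + v * y ≠ 0 ∨ 0 ≤ j := by
  refine h.imp (fun hx h0 => ?_) fun h => h
  obtain ⟨-, h2⟩ := line_eq_real hv (t := 0) (by simpa using h0)
  exact hx h2

theorem integrable_zpow_mul_gaussian {v a : ℂ} (hv : 0 < v.im) (ha : (a * v ^ 2).re < 0) {x : ℝ} {j : ℤ}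
    (h : x ≠ 0 ∨ 0 ≤ j) :
    Integrable fun y : ℝ => ((x : ℂ) + v * y) ^ j * Complex.exp (a * ((x : ℂ) + v * y) ^ 2) := by
  have hd := (ExpGrowth.gaussian_mul ha (ExpGrowth.zpow_id hv j)).mono
    (g := fun z => z ^ j * Complex.exp (a * z ^ 2)) fun z => mul_comm _ _
  refine hd.integrable fun y => ?_
  exact (differentiableAt_zpow.mpr (line_ne_zero_or hv h y)).mul (by fun_prop)

/-- Integrate the derivative of `z^(j+1) exp(az²)` along the line. Negative `j` is allowed as long
as the line avoids the origin. -/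
theorem lineInt_zpow_mul_gaussian_add_two {v a : ℂ} (hv : 0 < v.im) (ha : (a * v ^ 2).re < 0) {x : ℝ} {j : ℤ}
    (h : x ≠ 0 ∨ 0 ≤ j) :
    2 * a * lineInt v (fun z => z ^ (j + 2) * Complex.exp (a * z ^ 2)) x =
      -(j + 1) * lineInt v (fun z => z ^ j * Complex.exp (a * z ^ 2)) x := by
  have hv0 : v ≠ 0 := by
    rintro rfl
    simp at hv
  have h1 : x ≠ 0 ∨ 0 ≤ j + 1 := h.imp_right fun h => by omega
  have h2 : x ≠ 0 ∨ 0 ≤ j + 2 := h.imp_right fun h => by omega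
  have hder : ∀ y : ℝ, HasDerivAt (fun y : ℝ => ((x : ℂ) + v * y) ^ (j + 1) * Complex.exp (a * ((x : ℂ) + v * y) ^ 2))
      (v * (j + 1) * (((x : ℂ) + v * y) ^ j * Complex.exp (a * ((x : ℂ) + v * y) ^ 2)) +
        v * (2 * a) * (((x : ℂ) + v * y) ^ (j + 2) * Complex.exp (a * ((x : ℂ) + v * y) ^ 2))) y := by
    intro y
    have hl : HasDerivAt (fun y : ℝ => (x : ℂ) + v * y) v y := by
      have := hasDerivAt_line x v y
      simpa only [mul_comm] using this
    have hz := (hasDerivAt_zpow (j + 1) ((x : ℂ) + v * y) (line_ne_zero_or hv h1 y)).comp y hl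
    have hq : HasDerivAt (fun z : ℂ => Complex.exp (a * z ^ 2))
        (Complex.exp (a * ((x : ℂ) + v * y) ^ 2) * (a * (2 * ((x : ℂ) + v * y)))) ((x : ℂ) + v * y) := by
      have := ((hasDerivAt_pow 2 ((x : ℂ) + v * y)).const_mul a).cexp
      simpa using this
    have he := hq.comp y hl
    refine (hz.mul he).congr_deriv ?_
    have e1 : ((x : ℂ) + v * y) ^ (j + 1 - 1) = ((x : ℂ) + v * y) ^ j := by rw [add_sub_cancel_right]
    have e2 : ((x : ℂ) + v * y) ^ (j + 2) = ((x : ℂ) + v * y) ^ (j + 1) * ((x : ℂ) + v * y) := by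
      rcases eq_or_ne ((x : ℂ) + v * y) 0 with h0 | h0
      · have hj := (line_ne_zero_or hv h y).resolve_left (not_not.mpr h0)
        rw [h0, mul_zero, zero_zpow _ (by omega)]
      · rw [← zpow_add_one₀ h0]
        congr 1
        ring
    rw [e1, e2]
    simp only [Function.comp_apply]
    push_cast
    ring
  have hi0 := integrable_zpow_mul_gaussian hv ha h
  have hi1 := integrable_zpow_mul_gaussian hv ha h1
  have hi2 := integrable_zpow_mul_gaussian hv ha h2
  have hz := integral_eq_zero_of_hasDerivAt_of_integrable hder
    ((hi0.const_mul _).add (hi2.const_mul _)) hi1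
  rw [integral_add (hi0.const_mul _) (hi2.const_mul _), integral_const_mul, integral_const_mul] at hz
  rw [lineInt, lineInt]
  refine mul_left_cancel₀ hv0 ?_
  linear_combination hz

theorem lineInt_odd_pow_mul_gaussian (v a : ℂ) {j : ℤ} (hj : Odd j) :
    lineInt v (fun z => z ^ j * Complex.exp (a * z ^ 2)) 0 = 0 := by
  have h := lineInt_neg v (fun z => z ^ j * Complex.exp (a * z ^ 2)) 0
  have e : (fun w : ℂ => (-w) ^ j * Complex.exp (a * (-w) ^ 2)) =
      fun w => -1 * (w ^ j * Complex.exp (a * w ^ 2)) := by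
    ext w
    rw [hj.neg_zpow, neg_sq]
    ring
  rw [neg_zero, e, lineInt_const_mul] at h
  linear_combination (1 / 2 : ℂ) * h

theorem isBigO_sub_taylor {A : ℂ → ℂ} {x : ℂ} (hA : AnalyticAt ℂ A x) (M : ℕ) :
    (fun ξ : ℂ => A (x + ξ) - ∑ j ∈ Finset.range M, iteratedDeriv j A x / (Nat.factorial j : ℂ) * ξ ^ j)
      =O[𝓝 0] fun ξ : ℂ => ‖ξ‖ ^ M := by
  have h := hA.hasFPowerSeriesAt.isBigO_sub_partialSum_pow M
  refine h.congr_left fun ξ => ?_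
  congr 1
  rw [FormalMultilinearSeries.partialSum]
  refine Finset.sum_congr rfl fun j _ => ?_
  rw [FormalMultilinearSeries.ofScalars_apply_eq, smul_eq_mul]

theorem sum_range_two_mul_of_odd {f : ℕ → ℂ} (hf : ∀ k, f (2 * k + 1) = 0) (N : ℕ) :
    ∑ j ∈ Finset.range (2 * N), f j = ∑ k ∈ Finset.range N, f (2 * k) := by
  induction N with
  | zero => simp
  | succ N ih =>
    rw [show 2 * (N + 1) = 2 * N + 1 + 1 by ring, Finset.sum_range_succ, Finset.sum_range_succ, ih, hf, add_zero,
      Finset.sum_range_succ]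

/-! ### The size of the prefactor, the moments, and the integral at a stationary point -/

namespace SeifertData

variable {n : ℕ} (D : SeifertData n)

theorem norm_framingFactor (K : ℕ) : ‖D.framingFactor K‖ = 1 := by
  rw [framingFactor]
  have : -(I * π / (2 * K)) * (3 * D.signHP + ∑ j, (12 * (dedekindSum (D.q j) (D.p j) : ℂ) -
      (D.q j : ℂ) / D.p j)) = ((-(π / (2 * K)) * (3 * D.signHP + ∑ j, (12 * dedekindSum (D.q j) (D.p j) -
      (D.q j : ℝ) / D.p j)) : ℝ) : ℂ) * I := by
    push_cast
    ring
  rw [this, Complex.norm_exp_ofReal_mul_I]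

theorem norm_primePhase (K l : ℕ) (m' : Fin n → ℚ) : ‖D.primePhase K l m'‖ = 1 := by
  rw [primePhase]
  have : 2 * π * I * K * ∑ j, ((D.r j : ℂ) / D.p j * (m' j : ℂ) ^ 2 - 1 / 4 * D.s j * D.q j * (l : ℂ) ^ 2) =
      ((2 * π * K * ∑ j, ((D.r j : ℝ) / D.p j * (m' j : ℝ) ^ 2 - 1 / 4 * D.s j * D.q j * (l : ℝ) ^ 2) : ℝ) : ℂ) *
        I := by
    push_cast
    ring
  rw [this, Complex.norm_exp_ofReal_mul_I]

theorem isBigO_amplitude (g : ℕ) :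
    (fun k : ℕ => D.amplitude g (k + 2)) =O[atTop] fun k : ℕ => ((k + 2 : ℕ) : ℝ) ^ ((g : ℝ) - 1) := by
  refine Asymptotics.IsBigO.of_bound (‖(-1 : ℂ) ^ n * (D.signP / ((√|(D.P : ℝ)| : ℝ) : ℂ)) *
    Complex.exp (I * (3 / 4) * π * D.signHP)‖ * ((2 : ℝ) ^ ((g : ℤ) - 1))⁻¹) (Eventually.of_forall fun k => ?_)
  have hK : (0 : ℝ) < ((k + 2 : ℕ) : ℝ) := by positivity
  have e : ‖(((k + 2 : ℕ) : ℂ) / 2) ^ ((g : ℤ) - 1)‖ =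
      ((2 : ℝ) ^ ((g : ℤ) - 1))⁻¹ * ‖((k + 2 : ℕ) : ℝ) ^ ((g : ℝ) - 1)‖ := by
    rw [Real.norm_of_nonneg (Real.rpow_nonneg hK.le _), norm_zpow, norm_div, Complex.norm_natCast, div_zpow,
      show ((g : ℝ) - 1) = (((g : ℤ) - 1 : ℤ) : ℝ) by push_cast; rfl, Real.rpow_intCast, Complex.norm_ofNat,
      div_eq_inv_mul]
  rw [amplitude, norm_mul, norm_mul, norm_framingFactor, mul_one, e]
  exact (mul_assoc _ _ _).ge

/-- The amplitude of the oscillating integral near a stationary point. -/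
noncomputable def redAmplitude (g : ℕ) (m : Fin n → ℤ) (φ : ℂ) : ℂ :=
  (∏ j, Complex.sin (2 * π / D.p j * (D.r j * m j - φ))) / Complex.sin (2 * π * φ) ^ ((n : ℤ) + 2 * g - 2)

/-- The rate `2πK |H / P|` of decay. -/
noncomputable def rate (K : ℕ) : ℝ := 2 * π * K * (|D.slope| : ℚ)

theorem rate_pos (hH : D.H ≠ 0) {K : ℕ} (hK : 0 < K) : 0 < D.rate K := by
  have h1 : (0 : ℝ) < ((|D.slope| : ℚ) : ℝ) := by exact_mod_cast abs_pos.mpr (D.slope_ne_zero hH)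
  have h2 : (0 : ℝ) < K := by exact_mod_cast hK
  rw [rate]
  positivity

theorem gaussian_rate (hH : D.H ≠ 0) (K : ℕ) : -(2 * π * I * K * D.slope) * D.dir ^ 2 = -(D.rate K : ℂ) := by
  rw [D.dir_sq hH, rate, ← D.signHP_mul_slope hH]
  push_cast
  linear_combination (2 * π * K * D.slope * D.signHP : ℂ) * Complex.I_sq

theorem gaussian_rate_re (hH : D.H ≠ 0) {K : ℕ} (hK : 0 < K) :
    (-(2 * π * I * K * D.slope) * D.dir ^ 2 : ℂ).re < 0 := by
  rw [D.gaussian_rate hH, Complex.neg_re, Complex.ofReal_re]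
  linarith [D.rate_pos hH hK]

/-- The moments of the Gaussian along the line through `x`. -/
noncomputable def moment (K : ℕ) (x : ℝ) (j : ℤ) : ℂ :=
  lineInt D.dir (fun z => z ^ j * Complex.exp (-(2 * π * I * K * D.slope) * z ^ 2)) x

theorem moment_add_two (hH : D.H ≠ 0) {K : ℕ} (hK : 0 < K) {x : ℝ} {j : ℤ} (h : x ≠ 0 ∨ 0 ≤ j) :
    4 * π * I * K * D.slope * D.moment K x (j + 2) = (j + 1) * D.moment K x j := by
  have := lineInt_zpow_mul_gaussian_add_two (D.dir_im_pos hH) (D.gaussian_rate_re hH hK) h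
  rw [moment, moment]
  linear_combination (-1 : ℂ) * this

theorem moment_zero (hH : D.H ≠ 0) {K : ℕ} (hK : 0 < K) (x : ℝ) :
    D.moment K x 0 = ((√(π / D.rate K) : ℝ) : ℂ) := by
  have h := integral_line_gaussian (D.gaussian_rate_re hH hK) 0 x
  rw [moment]
  simp only [zero_mul, add_zero] at h
  simp only [zpow_zero, one_mul]
  rw [h, D.gaussian_rate hH, neg_neg, zero_pow two_ne_zero, zero_div, neg_zero, Complex.exp_zero, mul_one,
    ← cpow_half_ofReal (div_nonneg Real.pi_pos.le (D.rate_pos hH hK).le)]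
  push_cast
  rfl

theorem slope_cast_ne_zero (hH : D.H ≠ 0) : (D.slope : ℂ) ≠ 0 := by
  exact_mod_cast D.slope_ne_zero hH

theorem moment_two_mul (hH : D.H ≠ 0) {K : ℕ} (hK : 0 < K) (x : ℝ) (l : ℕ) :
    D.moment K x (2 * l : ℕ) = (Nat.factorial (2 * l) : ℂ) / (Nat.factorial l : ℂ) *
      (1 / (8 * π * I * K * D.slope)) ^ l * ((√(π / D.rate K) : ℝ) : ℂ) := by
  have hs := D.slope_cast_ne_zero hH
  have hK' : (K : ℂ) ≠ 0 := by exact_mod_cast hK.ne'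
  have hpi : (π : ℂ) ≠ 0 := by exact_mod_cast Real.pi_ne_zero
  have hI := Complex.I_ne_zero
  induction l with
  | zero =>
    rw [mul_zero, Nat.cast_zero, D.moment_zero hH hK]
    simp
  | succ l ih =>
    have h := D.moment_add_two hH hK (x := x) (j := (2 * l : ℕ)) (Or.inr (by positivity))
    have h4 : (4 * π * I * K * D.slope : ℂ) ≠ 0 := by
      repeat' apply mul_ne_zero
      all_goals first | assumption | norm_num
    rw [ih] at h
    refine mul_left_cancel₀ h4 ?_
    rw [show ((2 * (l + 1) : ℕ) : ℤ) = ((2 * l : ℕ) : ℤ) + 2 by push_cast; ring, h, pow_succ,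
      show 2 * (l + 1) = 2 * l + 1 + 1 by ring, Nat.factorial_succ, Nat.factorial_succ, Nat.factorial_succ]
    have hl : (Nat.factorial l : ℂ) ≠ 0 := by exact_mod_cast Nat.factorial_ne_zero l
    have hl1 : (l + 1 : ℂ) ≠ 0 := by exact_mod_cast Nat.succ_ne_zero l
    push_cast
    field_simp
    ring

/-- Move the line to the stationary point `2Kφ`, substitute `z = 2K(φ + dir · t)` and complete the
square. The amplitude no longer depends on `K`. -/
theorem lineInt_stationary (hH : D.H ≠ 0) (g : ℕ) {K : ℕ} (hK : 0 < K) (m : Fin n → ℤ) (m₀ : ℤ)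
    (h0 : 0 < D.phiSt m m₀) (h1 : D.phiSt m m₀ < 1 / 2) :
    lineInt D.dir (fun z => D.osc g K 0 (D.halfShift m 0) z *
      Complex.exp (2 * π * I * (m₀ - D.shift (D.halfShift m 0)) * z)) (1 / 2) =
    2 * K * Complex.exp (2 * π * I * K * (D.slope * (D.phiSt m m₀ : ℂ) ^ 2)) *
      ∫ t : ℝ, Complex.exp (-(D.rate K * t ^ 2)) * D.redAmplitude g m (D.phiSt m m₀ + D.dir * t) := by
  have hK' : (K : ℂ) ≠ 0 := by exact_mod_cast hK.ne'
  have hKr : (0 : ℝ) < K := by exact_mod_cast hK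
  have hφ : (m₀ : ℂ) - D.shift (D.halfShift m 0) = D.slope * (D.phiSt m m₀ : ℂ) := by
    have := D.phiSt_eq m m₀
    rw [eq_div_iff (D.slope_ne_zero hH)] at this
    have h2 : ((D.phiSt m m₀ * D.slope : ℚ) : ℂ) = ((m₀ - D.shift (D.halfShift m 0) : ℚ) : ℂ) := by rw [this]
    push_cast at h2
    linear_combination -h2
  have h0r : (0 : ℝ) < (D.phiSt m m₀ : ℝ) := by exact_mod_cast h0
  have h1r : (D.phiSt m m₀ : ℝ) < 1 / 2 := by
    have : ((D.phiSt m m₀ : ℚ) : ℝ) < ((1 / 2 : ℚ) : ℝ) := by exact_mod_cast h1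
    simpa using this
  set φ : ℝ := (D.phiSt m m₀ : ℝ) with hφdef
  have hφc : (D.phiSt m m₀ : ℂ) = (φ : ℂ) := by
    rw [hφdef]
    simp
  rw [hφc] at hφ ⊢
  -- The condition `0 < φ < 1/2` puts the stationary point between the poles `0` and `K`.
  have hmove : ∀ b : ℝ, 0 < b → b < K → lineInt D.dir (fun z => D.osc g K 0 (D.halfShift m 0) z *
      Complex.exp (2 * π * I * (m₀ - D.shift (D.halfShift m 0)) * z)) (1 / 2) =
      lineInt D.dir (fun z => D.osc g K 0 (D.halfShift m 0) z *
      Complex.exp (2 * π * I * (m₀ - D.shift (D.halfShift m 0)) * z)) b := by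
    intro b hb0 hb1
    have hK1 : (1 : ℝ) ≤ K := by exact_mod_cast hK
    rcases lt_trichotomy (1 / 2 : ℝ) b with h | h | h
    · exact D.lineInt_osc_mul_cexp hH g 0 _ _ (by norm_num) h hb1
    · rw [h]
    · exact (D.lineInt_osc_mul_cexp hH g 0 _ _ hb0 h (by linarith)).symm
  rw [hmove (2 * K * φ) (by positivity) (by nlinarith), lineInt]
  have hscale := Measure.integral_comp_mul_left (fun y : ℝ => D.osc g K 0 (D.halfShift m 0)
    (((2 * K * φ : ℝ) : ℂ) + D.dir * y) * Complex.exp (2 * π * I * (m₀ - D.shift (D.halfShift m 0)) *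
    (((2 * K * φ : ℝ) : ℂ) + D.dir * y))) (2 * K)
  rw [abs_of_pos (by positivity), Complex.real_smul] at hscale
  have h2K : (((2 * K : ℝ)⁻¹ : ℝ) : ℂ) = (2 * K : ℂ)⁻¹ := by push_cast; rfl
  rw [h2K, eq_inv_mul_iff_mul_eq₀ (by simpa using hK')] at hscale
  rw [← hscale, mul_assoc (2 * (K : ℂ))]
  congr 1
  rw [← integral_const_mul]
  congr 1
  ext t
  rw [hφ, osc, redAmplitude]
  have e1 : (((2 * K * φ : ℝ) : ℂ) + D.dir * ((2 * K * t : ℝ) : ℂ)) = 2 * K * (φ + D.dir * t) := by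
    push_cast
    ring
  rw [e1]
  have hsin : (π / K * (2 * K * (φ + D.dir * t)) : ℂ) = 2 * π * (φ + D.dir * t) := by
    field_simp
  have hprod : ∀ j, Complex.sin (2 * π * ((D.r j * D.halfShift m 0 j - 2 * K * (φ + D.dir * t) / (2 * K)) / D.p j -
      1 / 2 * D.s j * (0 : ℕ))) = Complex.sin (2 * π / D.p j * (D.r j * m j - (φ + D.dir * t))) := by
    intro j
    congr 1
    simp only [halfShift]
    push_cast
    field_simp
    ring
  simp only [hprod]
  have hexp : Complex.exp (-(I * π / (2 * K)) * ((D.H : ℂ) / D.P) * (2 * K * (φ + D.dir * t)) ^ 2) *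
      Complex.exp (2 * π * I * (D.slope * φ) * (2 * K * (φ + D.dir * t))) =
      Complex.exp (2 * π * I * K * (D.slope * (φ : ℂ) ^ 2)) * Complex.exp (-(D.rate K * (t : ℂ) ^ 2)) := by
    rw [← Complex.exp_add, ← Complex.exp_add, H_div_P]
    congr 1
    have := D.gaussian_rate hH K
    field_simp
    linear_combination (t : ℂ) ^ 2 * this
  rw [hsin]
  linear_combination ((∏ j, Complex.sin (2 * π / D.p j * (D.r j * m j - (φ + D.dir * t)))) /
    Complex.sin (2 * π * (φ + D.dir * t)) ^ ((n : ℤ) + 2 * g - 2)) * hexp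

end SeifertData

/-! ### Stationary phase -/

theorem ExpGrowth.comp_const_add {v : ℂ} {f : ℂ → ℂ} (hf : ExpGrowth v f) (x₀ : ℝ) :
    ExpGrowth v fun z => f (x₀ + z) := by
  intro R
  obtain ⟨C, h⟩ := hf (|x₀| + R)
  refine ⟨C, fun x y hx hy => ?_⟩
  have := h (x₀ + x) y ((abs_add_le _ _).trans (by linarith)) hy
  push_cast at this
  rwa [add_assoc] at this

theorem ExpGrowth.congr {v : ℂ} {f g : ℂ → ℂ} (hf : ExpGrowth v f) (h : ∀ z, f z = g z) : ExpGrowth v g :=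
  funext h ▸ hf

theorem ExpGrowth.neg {v : ℂ} {f : ℂ → ℂ} (hf : ExpGrowth v f) : ExpGrowth v fun z => -f z := by
  intro R
  obtain ⟨C, h⟩ := hf R
  exact ⟨C, fun x y hx hy => (norm_neg _).trans_le (h x y hx hy)⟩

theorem ExpGrowth.bound_line {v : ℂ} {f : ℂ → ℂ} (hf : ExpGrowth v f) :
    ∃ c : ℝ, ∀ t : ℝ, 1 ≤ |t| → ‖f (v * t)‖ ≤ 1 * Real.exp (c * |t|) := by
  obtain ⟨c, h⟩ := hf 0
  refine ⟨c, fun t ht => ?_⟩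
  simpa using h 0 t (by simp) ht

namespace SeifertData

variable {n : ℕ} (D : SeifertData n)

theorem gaussian_line (hH : D.H ≠ 0) (K : ℕ) (t : ℝ) :
    Complex.exp (-(2 * π * I * K * D.slope) * (D.dir * t) ^ 2) = Complex.exp (-(D.rate K * t ^ 2)) := by
  congr 1
  rw [mul_pow, ← mul_assoc, D.gaussian_rate hH, neg_mul]

theorem isBigO_rate (hH : D.H ≠ 0) (N : ℕ) {f : ℝ → ℂ}
    (hf : f =O[atTop] fun L : ℝ => L ^ (-(N : ℝ) - 1 / 2)) :
    (fun k : ℕ => f (D.rate (k + 2))) =O[atTop] fun k : ℕ => ((k + 2 : ℕ) : ℝ) ^ (-(N : ℝ) - 1 / 2) := by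
  have hc : (0 : ℝ) < 2 * π * (|D.slope| : ℚ) := by
    have h1 : (0 : ℝ) < ((|D.slope| : ℚ) : ℝ) := by exact_mod_cast abs_pos.mpr (D.slope_ne_zero hH)
    positivity
  have e : ∀ k : ℕ, D.rate (k + 2) = 2 * π * (|D.slope| : ℚ) * ((k + 2 : ℕ) : ℝ) := fun k => by
    rw [rate]
    ring
  have ht : Tendsto (fun k : ℕ => D.rate (k + 2)) atTop atTop := by
    simp only [e]
    exact (tendsto_natCast_atTop_atTop.comp (tendsto_add_atTop_nat 2)).const_mul_atTop hc
  refine (hf.comp_tendsto ht).trans ?_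
  refine Asymptotics.IsBigO.of_bound ((2 * π * (|D.slope| : ℚ) : ℝ) ^ (-(N : ℝ) - 1 / 2))
    (Eventually.of_forall fun k => le_of_eq ?_)
  rw [Function.comp_apply, e, Real.mul_rpow hc.le (by positivity), norm_mul,
    Real.norm_of_nonneg (Real.rpow_nonneg hc.le _)]

/-- Laplace's method along the line of steepest descent. -/
theorem isBigO_laplace (hH : D.H ≠ 0) {A : ℂ → ℂ} (hA : AnalyticAt ℂ A 0) (hc : Continuous fun t : ℝ => A (D.dir * t))
    (hg : ExpGrowth D.dir A) (N : ℕ) :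
    (fun k : ℕ => (∫ t : ℝ, Complex.exp (-(D.rate (k + 2) * t ^ 2)) * A (D.dir * t)) -
      (∑ l ∈ Finset.range N, iteratedDeriv (2 * l) A 0 / (Nat.factorial l : ℂ) *
        (1 / (8 * π * I * (k + 2 : ℕ) * D.slope)) ^ l) * ((√(π / D.rate (k + 2)) : ℝ) : ℂ))
      =O[atTop] fun k : ℕ => ((k + 2 : ℕ) : ℝ) ^ (-(N : ℝ) - 1 / 2) := by
  set b : ℕ → ℂ := fun j => iteratedDeriv j A 0 / (Nat.factorial j : ℂ) with hb
  set T : ℂ → ℂ := fun z => ∑ j ∈ Finset.range (2 * N), b j * z ^ j with hT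
  have hTc : Continuous T := by
    rw [hT]
    fun_prop
  have hTg : ExpGrowth D.dir T :=
    ExpGrowth.sum _ fun j _ => (ExpGrowth.const _ (b j)).mul ((ExpGrowth.id _).pow j)
  set ρ : ℝ → ℂ := fun t => A (D.dir * t) - T (D.dir * t) with hρ
  have hρc : Continuous ρ := hc.sub (hTc.comp (by fun_prop))
  have hρ0 : ρ =O[𝓝 0] fun t : ℝ => t ^ (2 * N) := by
    have h := (isBigO_sub_taylor hA (2 * N)).comp_tendsto
      (show Tendsto (fun t : ℝ => D.dir * (t : ℂ)) (𝓝 0) (𝓝 0) from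
        Continuous.tendsto' (by fun_prop) _ _ (by simp))
    refine (h.congr_left fun t => ?_).trans_eventuallyEq (Eventually.of_forall fun t => ?_)
    · simp [hρ, hT, hb]
    · simp [D.norm_dir, (even_two_mul N).pow_abs]
  obtain ⟨c, hgr⟩ := (hg.add hTg.neg).bound_line
  have hO := D.isBigO_rate hH N (isBigO_integral_gaussian_mul hρc N hρ0 (C := 1) (c := c) fun t ht => by
    simpa [hρ, sub_eq_add_neg] using hgr t ht)
  refine hO.congr_left fun k => ?_
  have hK : 0 < k + 2 := by omega
  have hint : ∀ j : ℕ, Integrable fun t : ℝ => Complex.exp (-(D.rate (k + 2) * (t : ℂ) ^ 2)) * (b j * (D.dir * t) ^ j) := by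
    intro j
    have := (integrable_zpow_mul_gaussian (x := 0) (j := j) (D.dir_im_pos hH) (D.gaussian_rate_re hH hK)
      (Or.inr (by positivity))).const_mul (b j)
    refine this.congr (Eventually.of_forall fun t => ?_)
    simp only [Complex.ofReal_zero, zero_add, zpow_natCast]
    rw [D.gaussian_line hH]
    ring
  have hval : ∀ j : ℕ, ∫ t : ℝ, Complex.exp (-(D.rate (k + 2) * (t : ℂ) ^ 2)) * (b j * (D.dir * t) ^ j) =
      b j * D.moment (k + 2) 0 j := by
    intro j
    rw [moment, lineInt, ← integral_const_mul]
    congr 1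
    ext t
    simp only [Complex.ofReal_zero, zero_add, zpow_natCast]
    rw [D.gaussian_line hH]
    ring
  have hTsum : ∀ t : ℝ, Complex.exp (-(D.rate (k + 2) * (t : ℂ) ^ 2)) * T (D.dir * t) =
      ∑ j ∈ Finset.range (2 * N), Complex.exp (-(D.rate (k + 2) * (t : ℂ) ^ 2)) * (b j * (D.dir * t) ^ j) := by
    intro t
    rw [hT, Finset.mul_sum]
  have hTint : Integrable fun t : ℝ => Complex.exp (-(D.rate (k + 2) * (t : ℂ) ^ 2)) * T (D.dir * t) := by
    simp only [hTsum]
    exact integrable_finsetSum _ fun j _ => hint j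
  have hAint : Integrable fun t : ℝ => Complex.exp (-(D.rate (k + 2) * (t : ℂ) ^ 2)) * A (D.dir * t) := by
    obtain ⟨C, c, hc0, hd⟩ := ExpGrowth.gaussian_mul (D.gaussian_rate_re hH hK) hg 0
    refine integrable_of_continuous_of_decay (.mul (by fun_prop) hc) hc0 (C := C) fun t ht => ?_
    have := hd 0 t (by simp) ht
    simp only [Complex.ofReal_zero, zero_add] at this
    rwa [D.gaussian_line hH] at this
  have hsplit : ∫ t : ℝ, Complex.exp (-(D.rate (k + 2) * (t : ℂ) ^ 2)) * ρ t =
      (∫ t : ℝ, Complex.exp (-(D.rate (k + 2) * (t : ℂ) ^ 2)) * A (D.dir * t)) -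
      ∫ t : ℝ, Complex.exp (-(D.rate (k + 2) * (t : ℂ) ^ 2)) * T (D.dir * t) := by
    rw [← integral_sub hAint hTint]
    simp only [hρ, mul_sub]
  rw [hsplit]
  congr 1
  simp only [hTsum]
  rw [integral_finsetSum _ fun j _ => hint j]
  simp only [hval]
  -- Odd moments vanish, so the `2N` Taylor coefficients leave `N` terms.
  rw [sum_range_two_mul_of_odd (f := fun j : ℕ => b j * D.moment (k + 2) 0 j), Finset.sum_mul]
  · refine Finset.sum_congr rfl fun l _ => ?_
    rw [D.moment_two_mul hH hK, hb]
    have h2 : (Nat.factorial (2 * l) : ℂ) ≠ 0 := by exact_mod_cast Nat.factorial_ne_zero _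
    field_simp
  · intro j
    rw [moment, lineInt_odd_pow_mul_gaussian, mul_zero]
    exact ⟨j, by push_cast; ring⟩

theorem redAmplitude_expGrowth (hH : D.H ≠ 0) (g : ℕ) (m : Fin n → ℤ) : ExpGrowth D.dir (D.redAmplitude g m) := by
  have hv := D.dir_im_pos hH
  have h1 : ExpGrowth D.dir fun z => (Complex.sin (2 * π * z))⁻¹ := by
    have := ExpGrowth.inv_sin hv (a := 2 * π) (by positivity)
    push_cast at this
    exact this
  have h2 : ExpGrowth D.dir fun z => Complex.sin (2 * π * z) := by
    simpa using ExpGrowth.sin D.dir (2 * π) 0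
  have h3 : ExpGrowth D.dir fun z => (Complex.sin (2 * π * z))⁻¹ ^ ((n : ℤ) + 2 * g - 2) :=
    h1.zpow (by simpa using h2) _
  have h4 : ExpGrowth D.dir fun φ : ℂ => ∏ j, Complex.sin (2 * π / D.p j * (D.r j * m j - φ)) := by
    refine ExpGrowth.prod _ fun j _ => ?_
    refine (ExpGrowth.sin D.dir (-(2 * π / D.p j)) (2 * π / D.p j * (D.r j * m j))).congr fun z => ?_
    congr 1
    ring
  refine (h4.mul h3).congr fun z => ?_
  rw [redAmplitude, inv_zpow, div_eq_mul_inv]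

theorem differentiableAt_redAmplitude (g : ℕ) (m : Fin n → ℤ) {z : ℂ} (hz : Complex.sin (2 * π * z) ≠ 0) :
    DifferentiableAt ℂ (D.redAmplitude g m) z := by
  unfold redAmplitude
  refine DifferentiableAt.div (by fun_prop) ?_ (zpow_ne_zero _ hz)
  exact DifferentiableAt.zpow (by fun_prop) (Or.inl hz)

theorem sin_two_pi_line_ne_zero (hH : D.H ≠ 0) {x : ℝ} (h0 : 0 < x) (h1 : x < 1 / 2) (y : ℝ) :
    Complex.sin (2 * π * (x + D.dir * y)) ≠ 0 := by
  have := sin_line_ne_zero (D.dir_im_pos hH) one_pos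
    (ne_int_mul_of_mem_Ioo (K := 1) (x := 2 * x) (by linarith) (by push_cast; linarith)) (2 * y)
  convert this using 2
  push_cast
  ring

theorem cexp_dir (hH : D.H ≠ 0) :
    Complex.exp (I * (3 / 4) * π * D.signHP) * -(D.dir * D.signHP) = Complex.exp (I * π / 2 * D.signHP) := by
  rw [dir, show Complex.exp (I * (3 / 4) * π * D.signHP) * -(I * Complex.exp (I * π / 4 * D.signHP) * D.signHP) =
    -(I * D.signHP) * (Complex.exp (I * (3 / 4) * π * D.signHP) * Complex.exp (I * π / 4 * D.signHP)) by ring,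
    ← Complex.exp_add]
  rcases D.signHP_eq hH with ⟨h, -⟩ | ⟨h, -⟩
  · rw [h, show I * (3 / 4) * π * ((1 : ℤ) : ℂ) + I * π / 4 * ((1 : ℤ) : ℂ) = π * I by push_cast; ring,
      show I * π / 2 * ((1 : ℤ) : ℂ) = π / 2 * I by push_cast; ring, Complex.exp_pi_mul_I, Complex.exp_pi_div_two_mul_I]
    push_cast
    ring
  · rw [h, show I * (3 / 4) * π * ((-1 : ℤ) : ℂ) + I * π / 4 * ((-1 : ℤ) : ℂ) = -(π * I) by push_cast; ring,
      show I * π / 2 * ((-1 : ℤ) : ℂ) = -(π / 2 * I) by push_cast; ring, Complex.exp_neg, Complex.exp_neg,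
      Complex.exp_pi_mul_I, Complex.exp_pi_div_two_mul_I, Complex.inv_I]
    push_cast
    ring

theorem two_mul_sqrt_rate {K : ℕ} (hK : 0 < K) :
    2 * K * √(π / D.rate K) = 2 * √((K : ℝ) / 2) / √((|D.slope| : ℚ) : ℝ) := by
  have hK' : (0 : ℝ) < K := by exact_mod_cast hK
  have e : π / D.rate K = ((K : ℝ) / 2) * ((K : ℝ)⁻¹) ^ 2 / ((|D.slope| : ℚ) : ℝ) := by
    rw [rate]
    field_simp
  rw [e, Real.sqrt_div (by positivity), Real.sqrt_mul (by positivity), Real.sqrt_sq (by positivity)]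
  field_simp

theorem sqrt_abs_H : √|(D.H : ℝ)| = √|(D.P : ℝ)| * √((|D.slope| : ℚ) : ℝ) := by
  rw [← Real.sqrt_mul (abs_nonneg _)]
  have hP : (D.P : ℚ) ≠ 0 := by exact_mod_cast D.P_ne_zero
  have : |D.H| = |(D.P : ℚ)| * |D.slope| := by
    rw [← abs_mul, slope, mul_div_cancel₀ _ hP]
  have h2 : ((|D.H| : ℚ) : ℝ) = ((|(D.P : ℚ)| * |D.slope| : ℚ) : ℝ) := by rw [this]
  push_cast at h2 ⊢
  rw [h2]

theorem rpow_half (g : ℕ) {x : ℝ} (hx : 0 < x) : ((x ^ ((g : ℝ) - 1 / 2) : ℝ) : ℂ) =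
    (x : ℂ) ^ ((g : ℤ) - 1) * ((√x : ℝ) : ℂ) := by
  rw [show (g : ℝ) - 1 / 2 = (((g : ℤ) - 1 : ℤ) : ℝ) + 1 / 2 by push_cast; ring, Real.rpow_add hx, Real.rpow_intCast,
    Real.sqrt_eq_rpow]
  push_cast
  rfl

/-- The normalizations agree because `2K √(π/rate) = 2 √(K/2) / √|H/P|` and `√|H| = √|P| √|H/P|`;
the phases agree by `cexp_dir`. -/
theorem zRed_eq (hH : D.H ≠ 0) (g : ℕ) {K : ℕ} (hK : 0 < K) (N : ℕ) (m : Fin n → ℤ) (m₀ : ℤ) :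
    D.zRed g K N m m₀ = D.amplitude g K * (-(D.dir * D.signHP) * (D.primePhase K 0 (D.halfShift m 0) *
      (2 * K * Complex.exp (2 * π * I * K * (D.slope * (D.phiSt m m₀ : ℂ) ^ 2)) *
        ((∑ l ∈ Finset.range N, iteratedDeriv (2 * l) (D.redAmplitude g m) (D.phiSt m m₀) / (Nat.factorial l : ℂ) *
        (1 / (8 * π * I * K * D.slope)) ^ l) * ((√(π / D.rate K) : ℝ) : ℂ))))) := by
  have hs := D.slope_cast_ne_zero hH
  have hPH : (D.P : ℂ) / D.H = (D.slope : ℂ)⁻¹ := by rw [← D.H_div_P, inv_div]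
  have hK' : (0 : ℝ) < K := by exact_mod_cast hK
  have hsum : ∑ l' ∈ Finset.range N, 1 / (Nat.factorial l' : ℂ) *
      (1 / (8 * π * I * K) * ((D.P : ℂ) / D.H)) ^ l' *
      iteratedDeriv (2 * l')
        (fun φ : ℂ => (∏ j, Complex.sin (2 * π / D.p j * (D.r j * m j - φ))) /
          Complex.sin (2 * π * φ) ^ ((n : ℤ) + 2 * g - 2))
        (D.phiSt m m₀ : ℂ) = ∑ l ∈ Finset.range N, iteratedDeriv (2 * l) (D.redAmplitude g m) (D.phiSt m m₀) /
          (Nat.factorial l : ℂ) * (1 / (8 * π * I * K * D.slope)) ^ l := by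
    refine Finset.sum_congr rfl fun l _ => ?_
    rw [hPH, show (1 / (8 * π * I * K) * (D.slope : ℂ)⁻¹ : ℂ) = 1 / (8 * π * I * K * D.slope) by
      rw [one_div, one_div, ← mul_inv]]
    have : (fun φ : ℂ => (∏ j, Complex.sin (2 * π / D.p j * (D.r j * m j - φ))) /
          Complex.sin (2 * π * φ) ^ ((n : ℤ) + 2 * g - 2)) = D.redAmplitude g m := rfl
    rw [this]
    ring
  have hphase : Complex.exp (2 * π * I * K * (∑ j, (D.r j : ℂ) / D.p j * (m j : ℂ) ^ 2 +
      (D.P : ℂ) / D.H * (m₀ - ∑ j, (m j : ℂ) / D.p j) ^ 2)) = D.primePhase K 0 (D.halfShift m 0) *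
      Complex.exp (2 * π * I * K * (D.slope * (D.phiSt m m₀ : ℂ) ^ 2)) := by
    rw [primePhase, ← Complex.exp_add, hPH, phiSt, ← mul_add]
    congr 3
    · refine Finset.sum_congr rfl fun j _ => ?_
      simp [halfShift]
    · push_cast
      rw [hPH]
      field_simp
  rw [zRed, hsum, hphase, amplitude]
  have h1 := rpow_half g (x := (K : ℝ) / 2) (by positivity)
  have h2 : (2 * K : ℂ) * ((√(π / D.rate K) : ℝ) : ℂ) = 2 * ((√((K : ℝ) / 2) : ℝ) : ℂ) / ((√((|D.slope| : ℚ) : ℝ) : ℝ) : ℂ) := by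
    exact_mod_cast D.two_mul_sqrt_rate hK
  rw [h1, D.sqrt_abs_H, ← D.cexp_dir hH]
  push_cast at h2 ⊢
  linear_combination (-((-1 : ℂ) ^ n * (D.signP / ((√|(D.P : ℝ)| : ℝ) : ℂ)) *
    Complex.exp (I * (3 / 4) * π * D.signHP) * D.framingFactor K * (K / 2 : ℂ) ^ ((g : ℤ) - 1) *
    (-(D.dir * D.signHP)) * D.primePhase K 0 (D.halfShift m 0) *
    Complex.exp (2 * π * I * K * (D.slope * (D.phiSt m m₀ : ℂ) ^ 2)) *
    (∑ l ∈ Finset.range N, iteratedDeriv (2 * l) (D.redAmplitude g m) (D.phiSt m m₀) / (Nat.factorial l : ℂ) *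
        (1 / (8 * π * I * K * D.slope)) ^ l))) * h2

/-- The count of powers: `K^(g-1)` from the prefactor, `K` from the substitution, and `K^(-N-1/2)`
from Laplace's method. -/
theorem isBigO_of_amplitude_mul (g N : ℕ) {c f : ℕ → ℂ} (hc : ∀ k, ‖c k‖ ≤ 2 * (k + 2 : ℕ))
    (hf : f =O[atTop] fun k : ℕ => ((k + 2 : ℕ) : ℝ) ^ (-(N : ℝ) - 1 / 2)) :
    (fun k : ℕ => D.amplitude g (k + 2) * (c k * f k)) =O[atTop]
      fun k : ℕ => ((k + 2 : ℕ) : ℝ) ^ ((g : ℝ) - 1 / 2 - (N : ℝ)) := by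
  have h2 : c =O[atTop] fun k : ℕ => ((k + 2 : ℕ) : ℝ) := by
    refine Asymptotics.IsBigO.of_bound 2 (Eventually.of_forall fun k => ?_)
    rw [Real.norm_of_nonneg (by positivity)]
    exact hc k
  refine ((D.isBigO_amplitude g).mul (h2.mul hf)).trans_eventuallyEq (Eventually.of_forall fun k => ?_)
  have hK : (0 : ℝ) < ((k + 2 : ℕ) : ℝ) := by positivity
  simp only
  nth_rw 2 [← Real.rpow_one ((k + 2 : ℕ) : ℝ)]
  rw [← Real.rpow_add hK, ← Real.rpow_add hK]
  congr 1
  ring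

theorem norm_signHP (hH : D.H ≠ 0) : ‖(D.signHP : ℂ)‖ = 1 := by
  rcases D.signHP_eq hH with ⟨h, -⟩ | ⟨h, -⟩ <;> simp [h]

theorem isBigO_sub_zRed (hH : D.H ≠ 0) (g N : ℕ) (m : Fin n → ℤ) (m₀ : ℤ)
    (h0 : 0 < D.phiSt m m₀) (h1 : D.phiSt m m₀ < 1 / 2) :
    (fun k : ℕ => D.amplitude g (k + 2) * (-(D.dir * D.signHP) * (D.primePhase (k + 2) 0 (D.halfShift m 0) *
      lineInt D.dir (fun z => D.osc g (k + 2) 0 (D.halfShift m 0) z *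
        Complex.exp (2 * π * I * (m₀ - D.shift (D.halfShift m 0)) * z)) (1 / 2))) - D.zRed g (k + 2) N m m₀)
      =O[atTop] fun k : ℕ => ((k + 2 : ℕ) : ℝ) ^ ((g : ℝ) - 1 / 2 - (N : ℝ)) := by
  have h0r : (0 : ℝ) < (D.phiSt m m₀ : ℝ) := by exact_mod_cast h0
  have h1r : (D.phiSt m m₀ : ℝ) < 1 / 2 := by
    have : ((D.phiSt m m₀ : ℚ) : ℝ) < ((1 / 2 : ℚ) : ℝ) := by exact_mod_cast h1
    simpa using this
  set φ : ℝ := (D.phiSt m m₀ : ℝ) with hφdef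
  have hφc : (D.phiSt m m₀ : ℂ) = (φ : ℂ) := by
    rw [hφdef]
    simp
  have hU : IsOpen {z : ℂ | Complex.sin (2 * π * z) ≠ 0} := isOpen_ne_fun (by fun_prop) continuous_const
  have hd : ∀ z : ℂ, Complex.sin (2 * π * z) ≠ 0 → AnalyticAt ℂ (D.redAmplitude g m) z := fun z hz =>
    DifferentiableOn.analyticAt (s := {z : ℂ | Complex.sin (2 * π * z) ≠ 0})
      (fun w hw => (D.differentiableAt_redAmplitude g m hw).differentiableWithinAt) (hU.mem_nhds hz)
  have hφ0 : Complex.sin (2 * π * (φ + D.dir * (0 : ℝ))) ≠ 0 := D.sin_two_pi_line_ne_zero hH h0r h1r 0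
  have hlap := D.isBigO_laplace hH (A := fun z => D.redAmplitude g m (φ + z))
    (AnalyticAt.fun_comp (by simpa using hd _ hφ0) (by fun_prop))
    (continuous_iff_continuousAt.mpr fun t =>
      ContinuousAt.comp (f := fun t : ℝ => (φ : ℂ) + D.dir * t)
        (hd _ (D.sin_two_pi_line_ne_zero hH h0r h1r t)).continuousAt (by fun_prop))
    ((D.redAmplitude_expGrowth hH g m).comp_const_add φ) N
  refine (D.isBigO_of_amplitude_mul g N (c := fun k => -(D.dir * D.signHP) * (D.primePhase (k + 2) 0 (D.halfShift m 0) *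
    (2 * (k + 2 : ℕ) * Complex.exp (2 * π * I * (k + 2 : ℕ) * (D.slope * (D.phiSt m m₀ : ℂ) ^ 2)))))
    (fun k => ?_) hlap).congr_left fun k => ?_
  · have : 2 * π * I * (k + 2 : ℕ) * (D.slope * (D.phiSt m m₀ : ℂ) ^ 2) =
        ((2 * π * (k + 2 : ℕ) * (D.slope * φ ^ 2) : ℝ) : ℂ) * I := by
      rw [hφc]
      push_cast
      ring
    rw [norm_mul, norm_neg, norm_mul, D.norm_dir, D.norm_signHP hH, norm_mul, D.norm_primePhase, norm_mul, this,
      Complex.norm_exp_ofReal_mul_I, norm_mul, Complex.norm_natCast, Complex.norm_ofNat]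
    simp
  · have hder : ∀ j, iteratedDeriv j (fun z => D.redAmplitude g m (φ + z)) 0 = iteratedDeriv j (D.redAmplitude g m) φ := by
      intro j
      rw [iteratedDeriv_comp_const_add]
      simp
    rw [D.lineInt_stationary hH g (by omega) m m₀ h0 h1, D.zRed_eq hH g (by omega), hφc]
    simp only [hder]
    ring

end SeifertData

/-! ### Divided differences -/

theorem ExpGrowth.congr_of_ne {v : ℂ} (hv : 0 < v.im) {f g : ℂ → ℂ} (hf : ExpGrowth v f)
    (h : ∀ z, z ≠ 0 → f z = g z) : ExpGrowth v g := by
  intro R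
  obtain ⟨C, h1⟩ := hf R
  refine ⟨C, fun x y hx hy => ?_⟩
  rw [← h]
  · exact h1 x y hx hy
  · intro h0
    obtain ⟨rfl, -⟩ := line_eq_real hv (t := 0) (by simpa using h0)
    norm_num at hy

theorem ExpGrowth.dslope {v : ℂ} (hv : 0 < v.im) {f : ℂ → ℂ} (hf : ExpGrowth v f) :
    ExpGrowth v (dslope f 0) := by
  refine ((ExpGrowth.inv_id hv).mul (hf.add (ExpGrowth.const v (-f 0)))).congr_of_ne hv fun z hz => ?_
  rw [dslope_of_ne _ hz, slope_def_field]
  field_simp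
  ring

theorem ExpGrowth.iterate_dslope {v : ℂ} (hv : 0 < v.im) {f : ℂ → ℂ} (hf : ExpGrowth v f) (j : ℕ) :
    ExpGrowth v ((fun f => _root_.dslope f 0)^[j] f) := by
  induction j with
  | zero => exact hf
  | succ j ih =>
    rw [Function.iterate_succ_apply']
    exact ExpGrowth.dslope hv ih

theorem differentiableOn_iterate_dslope {f : ℂ → ℂ} {U : Set ℂ} (hU : IsOpen U) (hf : DifferentiableOn ℂ f U)
    (h0 : (0 : ℂ) ∈ U) (j : ℕ) : DifferentiableOn ℂ ((fun f => dslope f 0)^[j] f) U := by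
  induction j with
  | zero => exact hf
  | succ j ih =>
    rw [Function.iterate_succ_apply']
    exact (Complex.differentiableOn_dslope (hU.mem_nhds h0)).mpr ih

theorem iterate_dslope_zero {f : ℂ → ℂ} (hf : AnalyticAt ℂ f 0) (j : ℕ) :
    (fun f => dslope f 0)^[j] f 0 = iteratedDeriv j f 0 / (Nat.factorial j : ℂ) := by
  have h := (hf.hasFPowerSeriesAt.has_fpower_series_iterate_dslope_fslope j).coeff_zero 1
  have h2 := FormalMultilinearSeries.coeff_iterate_fslope (p := FormalMultilinearSeries.ofScalars ℂ
    (fun n => iteratedDeriv n f 0 / (Nat.factorial n : ℂ))) j 0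
  rw [zero_add, FormalMultilinearSeries.coeff_ofScalars] at h2
  rw [← h2]
  exact h.symm

/-- Taylor's formula with an exact remainder. The iterated divided difference inherits holomorphy on
the whole domain of `f`, so integrals of the remainder can be moved between lines. -/
theorem eq_sum_add_pow_mul_iterate_dslope {f : ℂ → ℂ} (hf : AnalyticAt ℂ f 0) (M : ℕ) (z : ℂ) :
    f z = ∑ j ∈ Finset.range M, iteratedDeriv j f 0 / (Nat.factorial j : ℂ) * z ^ j +
      z ^ M * (fun f => dslope f 0)^[M] f z := by
  induction M with
  | zero => simp
  | succ M ih =>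
    rw [Finset.sum_range_succ, ← iterate_dslope_zero hf M, Function.iterate_succ_apply']
    have := sub_smul_dslope ((fun f => dslope f 0)^[M] f) 0 z
    rw [smul_eq_mul, sub_zero] at this
    rw [pow_succ, mul_assoc, this]
    linear_combination ih

/-- The entire function `sin(2πz) / z`. -/
noncomputable def sinQuotient : ℂ → ℂ := dslope (fun z => Complex.sin (2 * π * z)) 0

theorem differentiable_sinQuotient : Differentiable ℂ sinQuotient := by
  rw [← differentiableOn_univ]
  exact (Complex.differentiableOn_dslope Filter.univ_mem).mpr (by fun_prop)

theorem sinQuotient_zero : sinQuotient 0 = 2 * π := by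
  have h : HasDerivAt (fun z : ℂ => Complex.sin (2 * π * z)) (Complex.cos (2 * π * 0) * (2 * π * 1)) 0 :=
    ((hasDerivAt_id (0 : ℂ)).const_mul (2 * π : ℂ)).csin
  rw [sinQuotient, dslope_same, h.deriv]
  simp

theorem sinQuotient_of_ne {z : ℂ} (hz : z ≠ 0) : sinQuotient z = Complex.sin (2 * π * z) / z := by
  rw [sinQuotient, dslope_of_ne _ hz, slope_def_field]
  simp

theorem overSin_eq (z : ℂ) : SeifertData.overSin z = 2 * π / sinQuotient z := by
  rw [SeifertData.overSin]
  split_ifs with h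
  · rw [h, sinQuotient_zero, div_self]
    simp [Real.pi_ne_zero]
  · rw [sinQuotient_of_ne h, div_div_eq_mul_div]

theorem differentiableAt_overSin {z : ℂ} (hz : sinQuotient z ≠ 0) : DifferentiableAt ℂ SeifertData.overSin z := by
  rw [funext overSin_eq]
  exact (differentiableAt_const _).div (differentiable_sinQuotient z) hz

theorem overSin_ne_zero {z : ℂ} (hz : sinQuotient z ≠ 0) : SeifertData.overSin z ≠ 0 := by
  rw [overSin_eq]
  exact div_ne_zero (by simp [Real.pi_ne_zero]) hz

theorem overSin_neg (z : ℂ) : SeifertData.overSin (-z) = SeifertData.overSin z := by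
  simp only [SeifertData.overSin, neg_eq_zero, mul_neg, Complex.sin_neg, neg_div_neg_eq]

/-- The zeros of `sin(2πz)/z` are the nonzero half-integers `k/2`, all real, and the line meets the
real axis only at `x`. -/
theorem sinQuotient_line_ne_zero {v : ℂ} (hv : 0 < v.im) {x : ℝ} (h0 : 0 ≤ x) (h1 : x < 1 / 2) (y : ℝ) :
    sinQuotient (x + v * y) ≠ 0 := by
  by_cases hz : (x : ℂ) + v * y = 0
  · rw [hz, sinQuotient_zero]
    simp [Real.pi_ne_zero]
  rw [sinQuotient_of_ne hz]
  refine div_ne_zero (fun h => hz ?_) hz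
  obtain ⟨k, hk⟩ := Complex.sin_eq_zero_iff.mp h
  have hpi : (π : ℂ) ≠ 0 := by exact_mod_cast Real.pi_ne_zero
  have e : (x : ℂ) + v * y = ((k / 2 : ℝ) : ℂ) := by
    push_cast
    refine mul_left_cancel₀ (mul_ne_zero two_ne_zero hpi) ?_
    linear_combination hk
  obtain ⟨-, h2⟩ := line_eq_real hv e
  have h3 : 0 ≤ k := by
    have : (0 : ℝ) ≤ k := by linarith
    exact_mod_cast this
  have h4 : k < 1 := by
    have : (k : ℝ) < 1 := by linarith
    exact_mod_cast this
  have h5 : k = 0 := by omega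
  rw [e, h5]
  simp

/-! ### The singular line -/

namespace SeifertData

variable {n : ℕ} (D : SeifertData n)

/-- The product of the sines in the summand. -/
noncomputable def sinProd (l : ℕ) (m' : Fin n → ℚ) (x : ℂ) : ℂ :=
  ∏ j, Complex.sin (2 * π * ((D.r j * m' j - x) / D.p j - 1 / 2 * D.s j * l))

theorem sinProd_neg (l : ℕ) (m' : Fin n → ℚ) (x : ℂ) :
    D.sinProd l (-m') (-x) = (-1) ^ n * D.sinProd l m' x := by
  have hs : ∀ j, Complex.sin (2 * π * ((D.r j * ((-m') j : ℚ) - -x) / D.p j - 1 / 2 * D.s j * l)) =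
      -1 * Complex.sin (2 * π * ((D.r j * m' j - x) / D.p j - 1 / 2 * D.s j * l)) := by
    intro j
    rw [neg_one_mul, ← Complex.sin_neg, ← Complex.sin_add_int_mul_two_pi _ (D.s j * l)]
    congr 1
    simp only [Pi.neg_apply]
    push_cast
    ring
  simp only [sinProd, hs]
  rw [Finset.prod_mul_distrib, Finset.prod_const, Finset.card_univ, Fintype.card_fin]

open scoped Classical in
/-- The signs for which the signed sum is an integer. -/
noncomputable def integralSigns (m' : Fin n → ℚ) : Finset (Fin n → ℤˣ) :=
  Finset.univ.filter fun μ => ∃ a : ℤ, D.signedSum m' μ = a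

theorem mem_integralSigns {m' : Fin n → ℚ} {μ : Fin n → ℤˣ} :
    μ ∈ D.integralSigns m' ↔ ∃ a : ℤ, D.signedSum m' μ = a := by
  simp [integralSigns]

theorem neg_mem_integralSigns {m' : Fin n → ℚ} {μ : Fin n → ℤˣ} (hμ : μ ∈ D.integralSigns m') :
    -μ ∈ D.integralSigns m' := by
  obtain ⟨a, ha⟩ := D.mem_integralSigns.mp hμ
  exact D.mem_integralSigns.mpr ⟨-a, by rw [signedSum_neg, ha, Int.cast_neg]⟩

/-- The amplitude of the singular oscillating integral. -/
noncomputable def spAmplitude (g l : ℕ) (m' : Fin n → ℚ) (x : ℂ) : ℂ :=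
  overSin x ^ ((n : ℤ) + 2 * g - 2) * ∑ μ ∈ D.integralSigns m', D.sinProd l (signMul μ m') x

theorem differentiable_sinProd (l : ℕ) (m' : Fin n → ℚ) : Differentiable ℂ (D.sinProd l m') := by
  unfold sinProd
  fun_prop

theorem spAmplitude_neg (g l : ℕ) (m' : Fin n → ℚ) (x : ℂ) :
    D.spAmplitude g l m' (-x) = (-1) ^ n * D.spAmplitude g l m' x := by
  rw [spAmplitude, spAmplitude, overSin_neg, mul_left_comm]
  congr 1
  rw [Finset.mul_sum]
  refine Finset.sum_nbij' (fun μ => -μ) (fun μ => -μ) (fun μ => D.neg_mem_integralSigns)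
    (fun μ => D.neg_mem_integralSigns) ?_ ?_ ?_
  · simp
  · simp
  · intro μ _
    rw [← D.sinProd_neg, signMul_neg, neg_neg]

/-- By `spAmplitude_neg` the amplitude has the parity of `n`. This explains the restriction to `l' -
n` even, and it means that only moments of even order occur. -/
theorem iteratedDeriv_spAmplitude_eq_zero (g l : ℕ) (m' : Fin n → ℚ) {j : ℕ} (hj : ¬ Even (j + n)) :
    iteratedDeriv j (D.spAmplitude g l m') 0 = 0 := by
  have h := iteratedDeriv_comp_neg j (D.spAmplitude g l m') 0
  simp only [spAmplitude_neg, neg_zero] at h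
  rw [iteratedDeriv_const_mul_field, smul_eq_mul] at h
  rw [Nat.not_even_iff_odd, Nat.odd_add] at hj
  rcases Nat.even_or_odd n with hn | hn
  · rw [hn.neg_one_pow, (hj.mpr hn).neg_one_pow] at h
    have : (2 : ℂ) * iteratedDeriv j (D.spAmplitude g l m') 0 = 0 := by linear_combination h
    simpa using this
  · have hj' : Even j := by
      rw [← Nat.not_odd_iff_even, hj, Nat.not_even_iff_odd]
      exact hn
    rw [hn.neg_one_pow, hj'.neg_one_pow] at h
    have : (2 : ℂ) * iteratedDeriv j (D.spAmplitude g l m') 0 = 0 := by linear_combination -h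
    simpa using this

theorem differentiableOn_spAmplitude (g l : ℕ) (m' : Fin n → ℚ) :
    DifferentiableOn ℂ (D.spAmplitude g l m') {z | sinQuotient z ≠ 0} := by
  intro z hz
  refine DifferentiableAt.differentiableWithinAt ?_
  unfold spAmplitude
  refine DifferentiableAt.mul ((differentiableAt_overSin hz).zpow (Or.inl (overSin_ne_zero hz))) ?_
  exact DifferentiableAt.fun_sum fun μ _ => D.differentiable_sinProd l _ z

theorem isOpen_sinQuotient_ne_zero : IsOpen {z | sinQuotient z ≠ 0} :=
  isOpen_ne_fun differentiable_sinQuotient.continuous continuous_const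

theorem zero_mem_sinQuotient_ne_zero : (0 : ℂ) ∈ {z | sinQuotient z ≠ 0} := by
  simp [sinQuotient_zero, Real.pi_ne_zero]

theorem analyticAt_spAmplitude (g l : ℕ) (m' : Fin n → ℚ) : AnalyticAt ℂ (D.spAmplitude g l m') 0 :=
  (D.differentiableOn_spAmplitude g l m').analyticAt
    (isOpen_sinQuotient_ne_zero.mem_nhds zero_mem_sinQuotient_ne_zero)

theorem expGrowth_sinProd (l : ℕ) (m' : Fin n → ℚ) : ExpGrowth D.dir (D.sinProd l m') := by
  refine ExpGrowth.prod _ fun j _ => ?_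
  refine (ExpGrowth.sin D.dir (-(2 * π / D.p j))
    (2 * π * ((D.r j * m' j) / D.p j - 1 / 2 * D.s j * l))).congr fun z => ?_
  congr 1
  ring

theorem overSin_zpow {z : ℂ} (hz : z ≠ 0) (d : ℤ) :
    overSin z ^ d = (2 * π) ^ d * z ^ d * (Complex.sin (2 * π * z))⁻¹ ^ d := by
  rw [overSin, if_neg hz, div_eq_mul_inv, mul_zpow, mul_zpow]

theorem expGrowth_spAmplitude (hH : D.H ≠ 0) (g l : ℕ) (m' : Fin n → ℚ) :
    ExpGrowth D.dir (D.spAmplitude g l m') := by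
  have hv := D.dir_im_pos hH
  have h1 : ExpGrowth D.dir fun z => (Complex.sin (2 * π * z))⁻¹ := by
    have := ExpGrowth.inv_sin hv (a := 2 * π) (by positivity)
    push_cast at this
    exact this
  have h2 : ExpGrowth D.dir fun z => Complex.sin (2 * π * z) := by
    simpa using ExpGrowth.sin D.dir (2 * π) 0
  have h3 : ExpGrowth D.dir fun z => (Complex.sin (2 * π * z))⁻¹ ^ ((n : ℤ) + 2 * g - 2) :=
    h1.zpow (by simpa using h2) _
  have h4 : ExpGrowth D.dir fun z => ∑ μ ∈ D.integralSigns m', D.sinProd l (signMul μ m') z :=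
    ExpGrowth.sum _ fun μ _ => D.expGrowth_sinProd l _
  refine ((((ExpGrowth.const _ ((2 * π : ℂ) ^ ((n : ℤ) + 2 * g - 2))).mul
    (ExpGrowth.zpow_id hv ((n : ℤ) + 2 * g - 2))).mul h3).mul h4).congr_of_ne hv fun z hz => ?_
  rw [spAmplitude, overSin_zpow hz]

end SeifertData

namespace SeifertData

variable {n : ℕ} (D : SeifertData n)

theorem osc_eq_sinProd (g K l : ℕ) (m' : Fin n → ℚ) (z : ℂ) :
    D.osc g K l m' z = Complex.exp (-(I * π / (2 * K)) * ((D.H : ℂ) / D.P) * z ^ 2) /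
      Complex.sin (π / K * z) ^ ((n : ℤ) + 2 * g - 2) * D.sinProd l m' (z / (2 * K)) := rfl

theorem lineInt_osc_move (hH : D.H ≠ 0) (g : ℕ) {K : ℕ} (hK : 2 ≤ K) (l : ℕ) (m' : Fin n → ℚ) :
    lineInt D.dir (D.osc g K l m') (1 / 2) = lineInt D.dir (D.osc g K l m') (K / 4) := by
  have hKr : (2 : ℝ) ≤ K := by exact_mod_cast hK
  rcases hKr.eq_or_lt with h | h
  · rw [← h]
    norm_num
  · have := D.lineInt_osc_mul_cexp hH g l m' 0 (a := 1 / 2) (b := K / 4) (K := K) (by norm_num) (by linarith)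
      (by linarith)
    simpa using this

theorem _root_.SeifertWRT.lineInt_scale (v : ℂ) (f : ℂ → ℂ) {c : ℝ} (hc : 0 < c) (x : ℝ) :
    lineInt v f (c * x) = c * lineInt v (fun z => f (c * z)) x := by
  have h := Measure.integral_comp_mul_left (fun y : ℝ => f (((c * x : ℝ) : ℂ) + v * y)) c
  rw [abs_of_pos (by positivity), Complex.real_smul, Complex.ofReal_inv,
    eq_inv_mul_iff_mul_eq₀ (by exact_mod_cast hc.ne')] at h
  rw [lineInt, lineInt, ← h]
  congr 2
  ext y
  congr 1
  push_cast
  ring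

/-- The line is moved to `K/4` before scaling by `2K`, so that it ends at `1/8` for every `K`. -/
theorem lineInt_osc_scale (hH : D.H ≠ 0) (g : ℕ) {K : ℕ} (hK : 2 ≤ K) (l : ℕ) (m' : Fin n → ℚ) :
    lineInt D.dir (D.osc g K l m') (1 / 2) = 2 * K * lineInt D.dir (fun x =>
      Complex.exp (-(2 * π * I * K * D.slope) * x ^ 2) *
        ((Complex.sin (2 * π * x))⁻¹ ^ ((n : ℤ) + 2 * g - 2) * D.sinProd l m' x)) (1 / 8) := by
  have hK' : (K : ℂ) ≠ 0 := by exact_mod_cast (by omega : K ≠ 0)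
  have hKr : (2 : ℝ) ≤ K := by exact_mod_cast hK
  rw [D.lineInt_osc_move hH g hK, show (K / 4 : ℝ) = 2 * K * (1 / 8) by ring,
    lineInt_scale _ _ (show (0 : ℝ) < 2 * K by linarith)]
  push_cast
  congr 2
  ext z
  rw [osc_eq_sinProd, H_div_P, inv_zpow]
  have e1 : -(I * π / (2 * K)) * D.slope * (2 * K * z) ^ 2 = -(2 * π * I * K * D.slope) * z ^ 2 := by
    field_simp
  have e2 : (π / K * (2 * K * z) : ℂ) = 2 * π * z := by
    field_simp
  have e3 : (2 * K * z / (2 * K) : ℂ) = z := by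
    field_simp
  rw [e1, e2, e3]
  ring

theorem eighth_line_ne_zero (hH : D.H ≠ 0) (y : ℝ) : (((1 / 8 : ℝ) : ℂ) + D.dir * y) ≠ 0 := by
  intro h
  obtain ⟨-, h2⟩ := line_eq_real (D.dir_im_pos hH) (x := 1 / 8) (t := 0) (h.trans Complex.ofReal_zero.symm)
  norm_num at h2

/-- The power of `x` is taken out of the power of the sine, so that what remains is the amplitude,
analytic at the origin. -/
theorem singularLine_eq (hH : D.H ≠ 0) (g : ℕ) {K : ℕ} (hK : 2 ≤ K) (l : ℕ) (m' : Fin n → ℚ) :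
    D.singularLine g K l m' = 2 * K * (((2 * π : ℂ) ^ ((n : ℤ) + 2 * g - 2))⁻¹ *
      lineInt D.dir (fun x => Complex.exp (-(2 * π * I * K * D.slope) * x ^ 2) *
        ((x ^ ((n : ℤ) + 2 * g - 2))⁻¹ * D.spAmplitude g l m' x)) (1 / 8)) := by
  have hv := D.dir_im_pos hH
  have hK0 : 0 < K := by omega
  have h1 : D.singularLine g K l m' = ∑ μ ∈ D.integralSigns m',
    lineInt D.dir (D.osc g K l (signMul μ m')) (1 / 2) := rfl
  rw [h1]
  simp only [D.lineInt_osc_scale hH g hK]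
  rw [← Finset.mul_sum]
  congr 1
  simp only [lineInt]
  rw [← integral_const_mul, ← integral_finsetSum]
  · congr 1
    ext y
    have hz := D.eighth_line_ne_zero hH y
    set z : ℂ := ((1 / 8 : ℝ) : ℂ) + D.dir * y with hzdef
    have hpi : (2 * π : ℂ) ^ ((n : ℤ) + 2 * g - 2) ≠ 0 := zpow_ne_zero _ (by simp [Real.pi_ne_zero])
    have hz' : z ^ ((n : ℤ) + 2 * g - 2) ≠ 0 := zpow_ne_zero _ hz
    rw [spAmplitude, overSin_zpow hz, ← Finset.mul_sum, ← Finset.mul_sum]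
    field_simp
  · intro μ _
    have h1 : ExpGrowth D.dir fun z => (Complex.sin (2 * π * z))⁻¹ := by
      have := ExpGrowth.inv_sin hv (a := 2 * π) (by positivity)
      push_cast at this
      exact this
    have h2 : ExpGrowth D.dir fun z => Complex.sin (2 * π * z) := by
      simpa using ExpGrowth.sin D.dir (2 * π) 0
    have h3 : ExpGrowth D.dir fun z => (Complex.sin (2 * π * z))⁻¹ ^ ((n : ℤ) + 2 * g - 2) :=
      h1.zpow (by simpa using h2) _
    refine (ExpGrowth.gaussian_mul (D.gaussian_rate_re hH hK0)
      (h3.mul (D.expGrowth_sinProd l (signMul μ m')))).integrable fun y => ?_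
    have hs := D.sin_two_pi_line_ne_zero hH (x := 1 / 8) (by norm_num) (by norm_num) y
    refine DifferentiableAt.mul (by fun_prop) (DifferentiableAt.mul ?_ (D.differentiable_sinProd l _ _))
    exact DifferentiableAt.zpow (DifferentiableAt.inv (by fun_prop) hs) (Or.inl (inv_ne_zero hs))

/-- The number of Taylor coefficients of the amplitude which contribute. -/
def spOrder (_ : SeifertData n) (g N : ℕ) : ℕ := (2 * N + ((n : ℤ) + 2 * g - 2)).toNat

/-- The remainder of the Taylor expansion of the amplitude. -/
noncomputable def spRemainder (g l N : ℕ) (m' : Fin n → ℚ) (x : ℂ) : ℂ :=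
  x ^ (D.spOrder g N - ((n : ℤ) + 2 * g - 2)).toNat *
    (fun f => dslope f 0)^[D.spOrder g N] (D.spAmplitude g l m') x

/-- If `2N + n + 2g - 2` is negative, the truncation to `0` only raises the order, so the remainder
always vanishes to order at least `2N`. -/
theorem spOrder_ge (g N : ℕ) : 2 * N ≤ (D.spOrder g N - ((n : ℤ) + 2 * g - 2)).toNat ∧
    ((D.spOrder g N - ((n : ℤ) + 2 * g - 2)).toNat : ℤ) = D.spOrder g N - ((n : ℤ) + 2 * g - 2) := by
  rw [spOrder]
  omega

theorem zpow_mul_spAmplitude (g l N : ℕ) (m' : Fin n → ℚ) {x : ℂ} (hx : x ≠ 0) :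
    (x ^ ((n : ℤ) + 2 * g - 2))⁻¹ * D.spAmplitude g l m' x =
      ∑ j ∈ Finset.range (D.spOrder g N), iteratedDeriv j (D.spAmplitude g l m') 0 / (Nat.factorial j : ℂ) *
        x ^ ((j : ℤ) - ((n : ℤ) + 2 * g - 2)) + D.spRemainder g l N m' x := by
  conv_lhs => rw [eq_sum_add_pow_mul_iterate_dslope (D.analyticAt_spAmplitude g l m') (D.spOrder g N) x]
  rw [mul_add, Finset.mul_sum]
  congr 1
  · refine Finset.sum_congr rfl fun j _ => ?_
    rw [zpow_sub₀ hx (j : ℤ), zpow_natCast]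
    ring
  · rw [spRemainder, ← zpow_natCast x (Int.toNat _), (D.spOrder_ge g N).2,
      zpow_sub₀ hx (D.spOrder g N : ℤ), zpow_natCast]
    ring

theorem differentiableOn_spRemainder (g l N : ℕ) (m' : Fin n → ℚ) :
    DifferentiableOn ℂ (D.spRemainder g l N m') {z | sinQuotient z ≠ 0} := by
  unfold spRemainder
  exact DifferentiableOn.mul (by fun_prop) (differentiableOn_iterate_dslope isOpen_sinQuotient_ne_zero
    (D.differentiableOn_spAmplitude g l m') zero_mem_sinQuotient_ne_zero _)

theorem expGrowth_spRemainder (hH : D.H ≠ 0) (g l N : ℕ) (m' : Fin n → ℚ) :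
    ExpGrowth D.dir (D.spRemainder g l N m') :=
  ((ExpGrowth.id _).pow _).mul ((D.expGrowth_spAmplitude hH g l m').iterate_dslope (D.dir_im_pos hH) _)

theorem differentiableAt_gaussian_mul_spRemainder (g l N : ℕ) (m' : Fin n → ℚ) (a : ℂ) {z : ℂ}
    (hz : sinQuotient z ≠ 0) :
    DifferentiableAt ℂ (fun x => Complex.exp (a * x ^ 2) * D.spRemainder g l N m' x) z :=
  DifferentiableAt.mul (by fun_prop)
    ((D.differentiableOn_spRemainder g l N m').differentiableAt (isOpen_sinQuotient_ne_zero.mem_nhds hz))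

/-- The remainder has no pole at the origin, so unlike the Taylor terms it can be moved from `1/8`
onto the line through the stationary point. -/
theorem lineInt_spRemainder (hH : D.H ≠ 0) (g l N : ℕ) (m' : Fin n → ℚ) {K : ℕ} (hK : 0 < K) :
    lineInt D.dir (fun x => Complex.exp (-(2 * π * I * K * D.slope) * x ^ 2) * D.spRemainder g l N m' x) (1 / 8) =
      ∫ t : ℝ, Complex.exp (-(D.rate K * t ^ 2)) * D.spRemainder g l N m' (D.dir * t) := by
  have hv := D.dir_im_pos hH
  rw [← lineInt_eq_lineInt hv (a := 0) (by norm_num) isOpen_sinQuotient_ne_zero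
    (fun z hz => (D.differentiableAt_gaussian_mul_spRemainder g l N m' _ hz).differentiableWithinAt)
    (fun x hx y => sinQuotient_line_ne_zero hv hx.1 (by linarith [hx.2]) y)
    (ExpGrowth.gaussian_mul (D.gaussian_rate_re hH hK) (D.expGrowth_spRemainder hH g l N m')), lineInt]
  congr 1
  ext t
  rw [Complex.ofReal_zero, zero_add, D.gaussian_line hH]

theorem lineInt_spAmplitude (hH : D.H ≠ 0) (g l N : ℕ) (m' : Fin n → ℚ) {K : ℕ} (hK : 0 < K) :
    lineInt D.dir (fun x => Complex.exp (-(2 * π * I * K * D.slope) * x ^ 2) *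
        ((x ^ ((n : ℤ) + 2 * g - 2))⁻¹ * D.spAmplitude g l m' x)) (1 / 8) =
      ∑ j ∈ Finset.range (D.spOrder g N), iteratedDeriv j (D.spAmplitude g l m') 0 / (Nat.factorial j : ℂ) *
        D.moment K (1 / 8) ((j : ℤ) - ((n : ℤ) + 2 * g - 2)) +
      ∫ t : ℝ, Complex.exp (-(D.rate K * t ^ 2)) * D.spRemainder g l N m' (D.dir * t) := by
  have hv := D.dir_im_pos hH
  rw [← D.lineInt_spRemainder hH g l N m' hK]
  simp only [lineInt, moment]
  have hi := D.gaussian_rate_re hH hK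
  have hint : ∀ j : ℤ, Integrable fun y : ℝ => (((1 / 8 : ℝ) : ℂ) + D.dir * y) ^ j *
      Complex.exp (-(2 * π * I * K * D.slope) * (((1 / 8 : ℝ) : ℂ) + D.dir * y) ^ 2) := fun j =>
    integrable_zpow_mul_gaussian hv hi (Or.inl (by norm_num))
  have hint2 : Integrable fun y : ℝ => Complex.exp (-(2 * π * I * K * D.slope) * (((1 / 8 : ℝ) : ℂ) + D.dir * y) ^ 2) *
      D.spRemainder g l N m' (((1 / 8 : ℝ) : ℂ) + D.dir * y) :=
    (ExpGrowth.gaussian_mul hi (D.expGrowth_spRemainder hH g l N m')).integrable fun y =>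
      D.differentiableAt_gaussian_mul_spRemainder g l N m' _
        (sinQuotient_line_ne_zero hv (by norm_num) (by norm_num) y)
  simp only [← integral_const_mul]
  rw [← integral_finsetSum _ fun j _ => (hint _).const_mul _, ← integral_add
    (integrable_finsetSum _ fun j _ => (hint _).const_mul _) hint2]
  congr 1
  ext y
  rw [D.zpow_mul_spAmplitude g l N m' (D.eighth_line_ne_zero hH y), mul_add, Finset.mul_sum]
  congr 1
  refine Finset.sum_congr rfl fun j _ => ?_
  ring

theorem isBigO_spRemainder (hH : D.H ≠ 0) (g l N : ℕ) (m' : Fin n → ℚ) :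
    (fun k : ℕ => ∫ t : ℝ, Complex.exp (-(D.rate (k + 2) * t ^ 2)) * D.spRemainder g l N m' (D.dir * t))
      =O[atTop] fun k : ℕ => ((k + 2 : ℕ) : ℝ) ^ (-(N : ℝ) - 1 / 2) := by
  have hv := D.dir_im_pos hH
  have hd : ∀ t : ℝ, ContinuousAt (D.spRemainder g l N m') (D.dir * t) := fun t =>
    ((D.differentiableOn_spRemainder g l N m').differentiableAt (isOpen_sinQuotient_ne_zero.mem_nhds
      (by simpa using sinQuotient_line_ne_zero hv le_rfl (by norm_num) t))).continuousAt
  obtain ⟨c, hc⟩ := (D.expGrowth_spRemainder hH g l N m').bound_line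
  refine D.isBigO_rate hH N (isBigO_integral_gaussian_mul
    (ρ := fun t : ℝ => D.spRemainder g l N m' (D.dir * t)) (continuous_iff_continuousAt.mpr fun t =>
      ContinuousAt.comp (f := fun t : ℝ => D.dir * (t : ℂ)) (hd t) (by fun_prop)) N ?_ hc)
  have hG : ContinuousAt (fun t : ℝ => (fun f => dslope f 0)^[D.spOrder g N] (D.spAmplitude g l m') (D.dir * t)) 0 := by
    refine ContinuousAt.comp (f := fun t : ℝ => D.dir * (t : ℂ)) ?_ (by fun_prop)
    refine ((differentiableOn_iterate_dslope isOpen_sinQuotient_ne_zero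
      (D.differentiableOn_spAmplitude g l m') zero_mem_sinQuotient_ne_zero _).differentiableAt
      (isOpen_sinQuotient_ne_zero.mem_nhds ?_)).continuousAt
    simpa using zero_mem_sinQuotient_ne_zero
  have hp : (fun t : ℝ => (D.dir * (t : ℂ)) ^ (D.spOrder g N - ((n : ℤ) + 2 * g - 2)).toNat) =O[𝓝 0]
      fun t : ℝ => t ^ (2 * N) := by
    refine Asymptotics.IsBigO.of_bound 1 ?_
    filter_upwards [Metric.ball_mem_nhds (0 : ℝ) one_pos] with t ht
    rw [norm_pow, norm_mul, D.norm_dir, one_mul, one_mul, Complex.norm_real, norm_pow]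
    exact pow_le_pow_of_le_one (norm_nonneg _) (mem_ball_zero_iff.mp ht).le (D.spOrder_ge g N).1
  simpa [spRemainder] using hp.mul (hG.isBigO_one ℝ)

/-- The Gaussian moments of even, possibly negative, order. -/
theorem moment_even (hH : D.H ≠ 0) {K : ℕ} (hK : 0 < K) {x : ℝ} (hx : x ≠ 0) (i : ℤ) :
    D.moment K x (2 * i) = Complex.exp (I * π / 4 * D.signHP) * (Complex.Gamma (i + 1 / 2) *
      (1 / (2 * π * I * K * D.slope)) ^ ((i : ℂ) + 1 / 2)) := by
  have hs := D.slope_cast_ne_zero hH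
  have hK' : (K : ℂ) ≠ 0 := by exact_mod_cast hK.ne'
  have hpi : (π : ℂ) ≠ 0 := by exact_mod_cast Real.pi_ne_zero
  have hI := Complex.I_ne_zero
  have hb : (1 / (2 * π * I * K * D.slope) : ℂ) ≠ 0 := by
    refine one_div_ne_zero ?_
    repeat' apply mul_ne_zero
    all_goals first | assumption | norm_num
  have h4 : (4 * π * I * K * D.slope : ℂ) ≠ 0 := by
    repeat' apply mul_ne_zero
    all_goals first | assumption | norm_num
  have hhalf : ∀ i : ℤ, (i : ℂ) + 1 / 2 ≠ 0 := by
    intro i h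
    have h2 : ((2 * i + 1 : ℤ) : ℂ) = ((0 : ℤ) : ℂ) := by
      push_cast
      linear_combination 2 * h
    have := Int.cast_injective h2
    omega
  set V : ℤ → ℂ := fun i => Complex.exp (I * π / 4 * D.signHP) * (Complex.Gamma (i + 1 / 2) *
      (1 / (2 * π * I * K * D.slope)) ^ ((i : ℂ) + 1 / 2)) with hV
  have hrec : ∀ i, 4 * π * I * K * D.slope * V (i + 1) = (2 * i + 1) * V i := by
    intro i
    simp only [hV]
    rw [show (((i + 1 : ℤ) : ℂ) + 1 / 2) = (i + 1 / 2) + 1 by push_cast; ring, Complex.Gamma_add_one _ (hhalf i),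
      Complex.cpow_add _ _ hb, Complex.cpow_one]
    field_simp
    ring
  have hmom : ∀ i : ℤ, 4 * π * I * K * D.slope * D.moment K x (2 * (i + 1)) = (2 * i + 1) * D.moment K x (2 * i) := by
    intro i
    have := D.moment_add_two hH hK (x := x) (j := 2 * i) (Or.inl hx)
    rw [mul_add, mul_one, this]
    push_cast
    rfl
  have hbase : D.moment K x (2 * 0) = V 0 := by
    have hr := D.rate_pos hH hK
    rw [mul_zero, D.moment_zero hH hK]
    simp only [hV]
    have e : (1 / (2 * π * I * K * D.slope) : ℂ) = (((D.rate K)⁻¹ : ℝ) : ℂ) * Complex.exp (((-(π / 2 * D.signHP) : ℝ) : ℂ) * I) := by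
      have e2 : Complex.exp (((-(π / 2 * D.signHP) : ℝ) : ℂ) * I) = -I * D.signHP := by
        rcases D.signHP_eq hH with ⟨h, -⟩ | ⟨h, -⟩
        · rw [h, show (((-(π / 2 * ((1 : ℤ) : ℝ)) : ℝ) : ℂ) * I) = -(π / 2 * I) by push_cast; ring, Complex.exp_neg,
            Complex.exp_pi_div_two_mul_I, Complex.inv_I]
          simp
        · rw [h, show (((-(π / 2 * ((-1 : ℤ) : ℝ)) : ℝ) : ℂ) * I) = π / 2 * I by push_cast; ring,
            Complex.exp_pi_div_two_mul_I]
          simp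
      have h1 := D.gaussian_rate hH K
      rw [D.dir_sq hH] at h1
      rw [e2, Complex.ofReal_inv, ← neg_neg (D.rate K : ℂ), ← h1]
      have hσ : (D.signHP : ℂ) ≠ 0 := by
        rcases D.signHP_eq hH with ⟨h, -⟩ | ⟨h, -⟩ <;> simp [h]
      field_simp
    -- The base has argument `-π sign(H/P) / 2`, inside the principal range, so the principal root
    -- has half that argument.
    have e3 : (1 / (2 * π * I * K * D.slope) : ℂ) ^ (1 / 2 : ℂ) =
        ((√((D.rate K)⁻¹) : ℝ) : ℂ) * Complex.exp (-(I * π / 4 * D.signHP)) := by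
      rw [e]
      have hr' := inv_pos.mpr hr
      have hσ : |(D.signHP : ℝ)| = 1 := by
        rcases D.signHP_eq hH with ⟨h, -⟩ | ⟨h, -⟩ <;> simp [h]
      have hσ1 := abs_le.mp hσ.le
      rw [Real.sqrt_eq_rpow, Real.rpow_def_of_pos hr']
      nth_rw 1 [← Real.exp_log hr']
      rw [Complex.ofReal_exp, Complex.ofReal_exp, ← Complex.exp_add, ← Complex.exp_add,
        Complex.cpow_def_of_ne_zero (Complex.exp_ne_zero _), Complex.log_exp]
      · congr 1
        push_cast
        ring
      · simp only [Complex.add_im, Complex.ofReal_im, Complex.im_ofReal_mul, Complex.I_im]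
        nlinarith [Real.pi_pos]
      · simp only [Complex.add_im, Complex.ofReal_im, Complex.im_ofReal_mul, Complex.I_im]
        nlinarith [Real.pi_pos]
    rw [Int.cast_zero, zero_add, e3, Complex.Gamma_one_half_eq, cpow_half_ofReal Real.pi_pos.le, Real.sqrt_inv,
      Real.sqrt_div Real.pi_pos.le, Complex.exp_neg]
    have hr' : ((√(D.rate K) : ℝ) : ℂ) ≠ 0 := by exact_mod_cast (Real.sqrt_pos.mpr hr).ne'
    have he := Complex.exp_ne_zero (I * π / 4 * D.signHP)
    push_cast
    field_simp
  -- Moments and claimed values satisfy the same recursion. It can be run downwards as well, since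
  -- `2i + 1` is never zero.
  induction i using Int.induction_on with
  | zero => exact hbase
  | succ i ih =>
    refine mul_left_cancel₀ h4 ?_
    rw [hmom, ih]
    exact (hrec _).symm
  | pred i ih =>
    have h1 := hmom (-(i : ℤ) - 1)
    have h2 := hrec (-(i : ℤ) - 1)
    rw [sub_add_cancel] at h1 h2
    have h5 : (2 * ((-(i : ℤ) - 1 : ℤ) : ℂ) + 1) ≠ 0 := by
      have := hhalf (-(i : ℤ) - 1)
      intro h
      apply this
      linear_combination h / 2
    refine mul_left_cancel₀ h5 ?_
    rw [← h1, ih]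
    exact h2

theorem lt_spOrder_iff (g N l' : ℕ) : l' < D.spOrder g N ↔
    l' < 2 * N + n + 2 * g ∧ l' + 2 < 2 * N + n + 2 * g := by
  rw [spOrder]
  omega

theorem neg_dir_mul_cexp (hH : D.H ≠ 0) : -(D.dir * D.signHP) * Complex.exp (I * π / 4 * D.signHP) = 1 := by
  have h := D.dir_sq hH
  have hd : Complex.exp (I * π / 4 * D.signHP) = -I * D.dir := by
    rw [dir]
    linear_combination Complex.exp (I * π / 4 * D.signHP) * Complex.I_sq
  have hσ : (D.signHP : ℂ) ^ 2 = 1 := by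
    rcases D.signHP_eq hH with ⟨h, -⟩ | ⟨h, -⟩ <;> simp [h]
  rw [hd]
  linear_combination (I * D.signHP) * h - hσ * I ^ 2 - Complex.I_sq

/-- The truncated series is the sum of Taylor coefficients against moments: with `2i = l' - (n + 2g
- 2)`, `moment_even` gives the Gamma function at `(l' - n - 2g + 3)/2`. Its phase is cancelled by
`-(dir · sign(H/P))`. -/
theorem zIrrSp_eq (hH : D.H ≠ 0) (g N l : ℕ) (m' : Fin n → ℚ) {K : ℕ} (hK : 0 < K) :
    D.zIrrSp g K N l m' = D.zIrr g K l m' + D.amplitude g K * ((-1) ^ (n * l) * ((D.symFactor m')⁻¹ *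
      (D.primePhase K l m' * (-(1 / 2 * D.dir * D.signHP) * (2 * K * (((2 * π : ℂ) ^ ((n : ℤ) + 2 * g - 2))⁻¹ *
      ∑ j ∈ Finset.range (D.spOrder g N), iteratedDeriv j (D.spAmplitude g l m') 0 / (Nat.factorial j : ℂ) *
        D.moment K (1 / 8) ((j : ℤ) - ((n : ℤ) + 2 * g - 2)))))))) := by
  have hPH : (D.P : ℂ) / D.H = (D.slope : ℂ)⁻¹ := by rw [← D.H_div_P, inv_div]
  have hK' : (K : ℂ) ≠ 0 := by exact_mod_cast hK.ne'
  have hpi : (π : ℂ) ≠ 0 := by exact_mod_cast Real.pi_ne_zero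
  set S : ℂ := ∑ l' ∈ (Finset.range (2 * N + n + 2 * g)).filter
          (fun l' : ℕ => Even (l' + n) ∧ l' + 2 < 2 * N + n + 2 * g),
        (1 / (2 * π * I * K) * ((D.P : ℂ) / D.H)) ^ (((l' : ℂ) - n - 2 * g + 3) / 2) *
          (Complex.Gamma (((l' : ℂ) - n - 2 * g + 3) / 2) / (Nat.factorial l' : ℂ)) *
          iteratedDeriv l' (D.spAmplitude g l m') 0 with hS
  have hsum : ∑ j ∈ Finset.range (D.spOrder g N), iteratedDeriv j (D.spAmplitude g l m') 0 / (Nat.factorial j : ℂ) *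
        D.moment K (1 / 8) ((j : ℤ) - ((n : ℤ) + 2 * g - 2)) = Complex.exp (I * π / 4 * D.signHP) *
      S := by
    have hf : (Finset.range (2 * N + n + 2 * g)).filter
          (fun l' : ℕ => Even (l' + n) ∧ l' + 2 < 2 * N + n + 2 * g) =
        (Finset.range (D.spOrder g N)).filter fun l' => Even (l' + n) := by
      ext l'
      rw [Finset.mem_filter, Finset.mem_filter, Finset.mem_range, Finset.mem_range, lt_spOrder_iff]
      tauto
    rw [hS, hf, Finset.sum_filter, Finset.mul_sum]
    refine Finset.sum_congr rfl fun j _ => ?_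
    split_ifs with hj
    · obtain ⟨i, hi⟩ : ∃ i : ℤ, (j : ℤ) - ((n : ℤ) + 2 * g - 2) = 2 * i := by
        obtain ⟨a, ha⟩ := hj
        exact ⟨a - n - g + 1, by omega⟩
      have hic : ((j : ℂ) - n - 2 * g + 3) / 2 = (i : ℂ) + 1 / 2 := by
        have : (((j : ℤ) - ((n : ℤ) + 2 * g - 2) : ℤ) : ℂ) = ((2 * i : ℤ) : ℂ) := by rw [hi]
        push_cast at this
        linear_combination this / 2
      rw [hi, D.moment_even hH hK (by norm_num), hic, hPH,
        show (1 / (2 * π * I * K) * (D.slope : ℂ)⁻¹ : ℂ) = 1 / (2 * π * I * K * D.slope) by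
          rw [one_div, one_div, ← mul_inv]]
      ring
    · rw [D.iteratedDeriv_spAmplitude_eq_zero g l m' hj, zero_div, zero_mul, mul_zero]
  have hB : (fun φ : ℂ => overSin φ ^ ((n : ℤ) + 2 * g - 2) * ∑ μ ∈ D.integralSigns m',
      ∏ j, Complex.sin (2 * π * ((D.r j * ((μ j : ℤ) : ℂ) * (m' j : ℂ) - φ) / D.p j - 1 / 2 * D.s j * l))) =
      D.spAmplitude g l m' := by
    ext φ
    rw [spAmplitude]
    congr 1
    refine Finset.sum_congr rfl fun μ _ => ?_
    rw [sinProd]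
    refine Finset.prod_congr rfl fun j _ => ?_
    rw [signMul]
    push_cast
    rw [← mul_assoc (D.r j : ℂ)]
  have hz : D.zIrrSp g K N l m' = D.zIrr g K l m' +
    (-1) ^ (n * (l + 1)) * (K : ℂ) ^ g /
        ((2 : ℂ) ^ ((n : ℤ) + 3 * g - 3) * (π : ℂ) ^ ((n : ℤ) + 2 * g - 2)) *
      (D.signP / ((√|(D.P : ℝ)| : ℝ) : ℂ)) *
      (Complex.exp (I * (3 / 4) * π * D.signHP) / D.symFactor m') *
      D.primePhase K l m' * D.framingFactor K * S := by
    rw [zIrrSp, hS, ← hB, integralSigns]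
  rw [hsum, hz]
  congr 1
  -- The powers of `2` split as `(n + 2g - 2) + (g - 1)`, between the sine power and `(K/2)^(g-1)`.
  have hconst : (K : ℂ) ^ g / ((2 : ℂ) ^ ((n : ℤ) + 3 * g - 3) * (π : ℂ) ^ ((n : ℤ) + 2 * g - 2)) =
      (K / 2 : ℂ) ^ ((g : ℤ) - 1) * (K * ((2 * π : ℂ) ^ ((n : ℤ) + 2 * g - 2))⁻¹) := by
    rw [div_zpow, mul_zpow, zpow_sub_one₀ hK', zpow_natCast,
      show ((n : ℤ) + 3 * g - 3) = ((n : ℤ) + 2 * g - 2) + ((g : ℤ) - 1) by ring,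
      zpow_add₀ two_ne_zero]
    have h1 : (2 : ℂ) ^ ((n : ℤ) + 2 * g - 2) ≠ 0 := zpow_ne_zero _ two_ne_zero
    have h2 : (2 : ℂ) ^ ((g : ℤ) - 1) ≠ 0 := zpow_ne_zero _ two_ne_zero
    have h3 : (π : ℂ) ^ ((n : ℤ) + 2 * g - 2) ≠ 0 := zpow_ne_zero _ hpi
    generalize (2 : ℂ) ^ ((n : ℤ) + 2 * g - 2) = x at *
    generalize (2 : ℂ) ^ ((g : ℤ) - 1) = y at *
    generalize (π : ℂ) ^ ((n : ℤ) + 2 * g - 2) = w at *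
    field_simp
  rw [mul_div_assoc, hconst, amplitude, mul_add, mul_one, pow_add, div_eq_mul_inv _ (D.symFactor m')]
  have h4 := D.neg_dir_mul_cexp hH
  linear_combination (-((-1 : ℂ) ^ (n * l) * (-1) ^ n * (K / 2 : ℂ) ^ ((g : ℤ) - 1) *
    (K * ((2 * π : ℂ) ^ ((n : ℤ) + 2 * g - 2))⁻¹) * (D.signP / ((√|(D.P : ℝ)| : ℝ) : ℂ)) *
    Complex.exp (I * (3 / 4) * π * D.signHP) * (D.symFactor m')⁻¹ * D.primePhase K l m' * D.framingFactor K * S)) * h4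

/-- The difference is exactly the prefactor times the integral of the Taylor remainder. -/
theorem isBigO_sub_zIrrSp (hH : D.H ≠ 0) (g N l : ℕ) (m' : Fin n → ℚ) :
    (fun k : ℕ => D.amplitude g (k + 2) * ((-1) ^ (n * l) * ((D.symFactor m')⁻¹ *
      (D.primePhase (k + 2) l m' * (-(1 / 2 * D.dir * D.signHP) * D.singularLine g (k + 2) l m')))) -
      (D.zIrrSp g (k + 2) N l m' - D.zIrr g (k + 2) l m'))
      =O[atTop] fun k : ℕ => ((k + 2 : ℕ) : ℝ) ^ ((g : ℝ) - 1 / 2 - (N : ℝ)) := by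
  set c : ℂ := (D.symFactor m')⁻¹ * ((2 * π : ℂ) ^ ((n : ℤ) + 2 * g - 2))⁻¹ with hc
  refine (D.isBigO_of_amplitude_mul g N (c := fun k => (-1) ^ (n * l) *
    (D.primePhase (k + 2) l m' * (-(1 / 2 * D.dir * D.signHP) * (2 * (k + 2 : ℕ)))))
    (fun k => ?_) ((D.isBigO_spRemainder hH g l N m').const_mul_left c)).congr_left fun k => ?_
  · rw [norm_mul, norm_pow, norm_neg, norm_one, one_pow, norm_mul, D.norm_primePhase, norm_mul, norm_neg, norm_mul,
      norm_mul, D.norm_dir, D.norm_signHP hH, norm_mul, Complex.norm_natCast, Complex.norm_ofNat]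
    have : (0 : ℝ) ≤ ((k + 2 : ℕ) : ℝ) := by positivity
    norm_num
    push_cast at this
    linarith
  · rw [D.zIrrSp_eq hH g N l m' (by omega), D.singularLine_eq hH g (by omega), D.lineInt_spAmplitude hH g l N m' (by omega)]
    ring

end SeifertData

/-! ### The residues as functions of the level -/

theorem analyticAt_iterate_dslope {f : ℂ → ℂ} (hf : AnalyticAt ℂ f 0) (j : ℕ) :
    AnalyticAt ℂ ((fun f => dslope f 0)^[j] f) 0 :=
  (hf.hasFPowerSeriesAt.has_fpower_series_iterate_dslope_fslope j).analyticAt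

/-- Replace `exp` and `B` by Taylor polynomials of an order `M` that exceeds the pole of `κ`. Powers
of `u` come only with powers of `z`, and the remainders carry `z^M`, which cancels the pole. A
finite sum of monomials in `u` is left. -/
theorem exists_polynomial_residue (α : ℂ) {B κ : ℂ → ℂ} (hB : AnalyticAt ℂ B 0) (hκ : MeromorphicAt κ 0) :
    ∃ Q : Polynomial ℂ, ∀ u : ℂ,
      residue (fun z => Complex.exp (α * u * z ^ 2) * B (u * z) * κ z) 0 = Q.eval u := by
  obtain ⟨M, hM⟩ := id hκ
  have hE : AnalyticAt ℂ Complex.exp 0 := by fun_prop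
  set e : ℕ → ℂ := fun i => iteratedDeriv i Complex.exp 0 / (Nat.factorial i : ℂ) with he
  set b : ℕ → ℂ := fun i => iteratedDeriv i B 0 / (Nat.factorial i : ℂ) with hb
  set G := (fun f => dslope f 0)^[M] Complex.exp with hG
  set G' := (fun f => dslope f 0)^[M] B with hG'
  have hmer : ∀ j : ℕ, MeromorphicAt (fun z => z ^ j * κ z) 0 := fun j =>
    ((by fun_prop : AnalyticAt ℂ (fun z : ℂ => z ^ j) 0).meromorphicAt).mul hκ
  have hmer' : ∀ (c : ℂ) (j : ℕ), MeromorphicAt (fun z => c * (z ^ j * κ z)) 0 := fun c j =>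
    (MeromorphicAt.const c 0).mul (hmer j)
  refine ⟨∑ i ∈ Finset.range M, ∑ j ∈ Finset.range M,
    Polynomial.C (e i * b j * α ^ i * residue (fun z => z ^ (2 * i + j) * κ z) 0) * Polynomial.X ^ (i + j),
    fun u => ?_⟩
  -- For the exponential the remainder carries `z^(2M)`; only `z^M` is needed against `κ`, and the
  -- rest stays in the analytic factor.
  have hsplit : (fun z => Complex.exp (α * u * z ^ 2) * B (u * z) * κ z) = fun z =>
      (∑ i ∈ Finset.range M, ∑ j ∈ Finset.range M, e i * b j * α ^ i * u ^ (i + j) * (z ^ (2 * i + j) * κ z)) +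
      ((∑ i ∈ Finset.range M, e i * (α * u * z ^ 2) ^ i) * u ^ M * G' (u * z) +
        (α * u * z) ^ M * G (α * u * z ^ 2) * B (u * z)) * ((z - 0) ^ M • κ z) := by
    ext z
    have h1 := eq_sum_add_pow_mul_iterate_dslope hE M (α * u * z ^ 2)
    have h2 := eq_sum_add_pow_mul_iterate_dslope hB M (u * z)
    rw [← hG] at h1
    rw [← hG'] at h2
    have h3 : ∑ i ∈ Finset.range M, ∑ j ∈ Finset.range M, e i * b j * α ^ i * u ^ (i + j) * (z ^ (2 * i + j) * κ z) =
        (∑ i ∈ Finset.range M, e i * (α * u * z ^ 2) ^ i) * (∑ j ∈ Finset.range M, b j * (u * z) ^ j) * κ z := by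
      rw [Finset.sum_mul_sum, Finset.sum_mul]
      refine Finset.sum_congr rfl fun i _ => ?_
      rw [Finset.sum_mul]
      refine Finset.sum_congr rfl fun j _ => ?_
      ring
    rw [h3, smul_eq_mul, sub_zero]
    generalize hX : Complex.exp (α * u * z ^ 2) = X at *
    generalize hY : B (u * z) = Y at *
    generalize hS : ∑ i ∈ Finset.range M, e i * (α * u * z ^ 2) ^ i = S at *
    generalize hT : ∑ j ∈ Finset.range M, b j * (u * z) ^ j = T at *
    have h1' : X = S + (α * u * z ^ 2) ^ M * G (α * u * z ^ 2) := h1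
    have h2' : Y = T + (u * z) ^ M * G' (u * z) := h2
    have e1 : (α * u * z ^ 2) ^ M = (α * u * z) ^ M * z ^ M := by rw [← mul_pow]; ring
    have e2 : (u * z) ^ M = u ^ M * z ^ M := mul_pow _ _ _
    rw [e1] at h1'
    rw [e2] at h2'
    linear_combination (Y * κ z) * h1' + (S * κ z) * h2'
  have han : AnalyticAt ℂ (fun z => ((∑ i ∈ Finset.range M, e i * (α * u * z ^ 2) ^ i) * u ^ M * G' (u * z) +
        (α * u * z) ^ M * G (α * u * z ^ 2) * B (u * z)) * ((z - 0) ^ M • κ z)) 0 := by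
    have a1 : AnalyticAt ℂ (fun z : ℂ => G' (u * z)) 0 :=
      (analyticAt_iterate_dslope hB M).fun_comp_of_eq (by fun_prop) (by simp)
    have a2 : AnalyticAt ℂ (fun z : ℂ => G (α * u * z ^ 2)) 0 :=
      (analyticAt_iterate_dslope hE M).fun_comp_of_eq (by fun_prop) (by simp)
    have a3 : AnalyticAt ℂ (fun z : ℂ => B (u * z)) 0 := hB.fun_comp_of_eq (by fun_prop) (by simp)
    have a4 : AnalyticAt ℂ (fun z : ℂ => ∑ i ∈ Finset.range M, e i * (α * u * z ^ 2) ^ i) 0 := by fun_prop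
    have a5 : AnalyticAt ℂ (fun z : ℂ => (α * u * z) ^ M) 0 := by fun_prop
    exact ((((a4.mul analyticAt_const).mul a1).add ((a5.mul a2).mul a3))).mul hM
  have hin : ∀ i, MeromorphicAt (fun z => ∑ j ∈ Finset.range M, e i * b j * α ^ i * u ^ (i + j) *
      (z ^ (2 * i + j) * κ z)) 0 := fun i => MeromorphicAt.fun_sum fun j _ => hmer' _ _
  rw [hsplit, residue_add (MeromorphicAt.fun_sum fun i _ => hin i) han.meromorphicAt,
    residue_eq_zero_of_analyticAt han, add_zero, residue_sum _ fun i _ => hin i, Polynomial.eval_finsetSum]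
  refine Finset.sum_congr rfl fun i _ => ?_
  rw [residue_sum _ fun j _ => hmer' _ _, Polynomial.eval_finsetSum]
  refine Finset.sum_congr rfl fun j _ => ?_
  rw [residue_const_mul (hmer _), Polynomial.eval_mul, Polynomial.eval_C, Polynomial.eval_pow, Polynomial.eval_X]
  ring

namespace SeifertData

variable {n : ℕ} (D : SeifertData n)

/-- With `u = 1/K` the Gaussian depends on `u z²` and the sines on `u z`. Writing the power of `1 /
sin(πz/K)` as an analytic function of `u z` times the same power of `K / πz` exhibits the factor
`K^(n+2g-2)`. -/
theorem exists_polynomial_residue_osc (g l : ℕ) (m' : Fin n → ℚ) (c : ℚ) :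
    ∃ Q : Polynomial ℂ, ∀ K : ℕ, 2 ≤ K →
      residue (fun z => D.osc g K l m' z * sawKernel c z) 0 =
        (K : ℂ) ^ ((n : ℤ) + 2 * g - 2) * Q.eval (K : ℂ)⁻¹ := by
  have hB : AnalyticAt ℂ (fun x : ℂ => overSin (x / 2) ^ ((n : ℤ) + 2 * g - 2) *
      D.sinProd l m' (x / 2)) 0 := by
    have h1 : DifferentiableOn ℂ overSin {z | sinQuotient z ≠ 0} := fun z hz =>
      (differentiableAt_overSin hz).differentiableWithinAt
    have h2 : AnalyticAt ℂ (fun x : ℂ => overSin x) 0 :=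
      h1.analyticAt (isOpen_sinQuotient_ne_zero.mem_nhds zero_mem_sinQuotient_ne_zero)
    have h3 : AnalyticAt ℂ (fun x : ℂ => overSin (x / 2)) 0 :=
      h2.fun_comp_of_eq (by fun_prop) (by simp)
    have h4 : AnalyticAt ℂ (fun x : ℂ => D.sinProd l m' (x / 2)) 0 :=
      ((D.differentiable_sinProd l m').comp
        (by fun_prop : Differentiable ℂ fun x : ℂ => x / 2)).analyticAt 0
    exact (h3.zpow (by simp [overSin])).mul h4
  have hκ : MeromorphicAt (fun z : ℂ => (π * z) ^ (-((n : ℤ) + 2 * g - 2)) * sawKernel c z) 0 := by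
    refine MeromorphicAt.mul (MeromorphicAt.zpow ?_ _) (meromorphicAt_sawKernel _ _)
    exact (by fun_prop : AnalyticAt ℂ (fun z : ℂ => π * z) 0).meromorphicAt
  obtain ⟨Q, hQ⟩ := exists_polynomial_residue (-(I * π * D.slope / 2)) hB hκ
  refine ⟨Q, fun K hK => ?_⟩
  have hK' : (K : ℂ) ≠ 0 := by exact_mod_cast (by omega : K ≠ 0)
  have hpi : (π : ℂ) ≠ 0 := by exact_mod_cast Real.pi_ne_zero
  have hmer : MeromorphicAt (fun z => Complex.exp (-(I * π * D.slope / 2) * (K : ℂ)⁻¹ * z ^ 2) *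
      (overSin ((K : ℂ)⁻¹ * z / 2) ^ ((n : ℤ) + 2 * g - 2) * D.sinProd l m' ((K : ℂ)⁻¹ * z / 2)) *
      ((π * z) ^ (-((n : ℤ) + 2 * g - 2)) * sawKernel c z)) 0 := by
    refine MeromorphicAt.mul (MeromorphicAt.mul ?_ ?_) hκ
    · exact (by fun_prop : AnalyticAt ℂ (fun z : ℂ =>
        Complex.exp (-(I * π * D.slope / 2) * (K : ℂ)⁻¹ * z ^ 2)) 0).meromorphicAt
    · exact (hB.fun_comp_of_eq (f := fun z : ℂ => (K : ℂ)⁻¹ * z) (by fun_prop) (by simp)).meromorphicAt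
  rw [← hQ, ← residue_const_mul hmer]
  refine residue_congr ((D.meromorphicAt_osc g K l _ 0).mul (meromorphicAt_sawKernel _ _)) ?_
  filter_upwards [self_mem_nhdsWithin] with z hz
  have hz' : z ≠ 0 := hz
  have hx : (K : ℂ)⁻¹ * z / 2 ≠ 0 := by simp [hK', hz']
  have e1 : -(I * π / (2 * K)) * D.slope * z ^ 2 = -(I * π * D.slope / 2) * (K : ℂ)⁻¹ * z ^ 2 := by
    field_simp
  have e2 : (2 * π * ((K : ℂ)⁻¹ * z / 2) : ℂ) = π / K * z := by
    field_simp
  have e3 : z / (2 * K) = (K : ℂ)⁻¹ * z / 2 := by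
    field_simp
  have e4 : (K : ℂ) ^ ((n : ℤ) + 2 * g - 2) * ((π / K * z) ^ ((n : ℤ) + 2 * g - 2) *
      (π * z) ^ (-((n : ℤ) + 2 * g - 2))) = 1 := by
    rw [zpow_neg, ← mul_assoc, ← mul_zpow, show (K : ℂ) * (π / K * z) = π * z by field_simp]
    exact mul_inv_cancel₀ (zpow_ne_zero _ (mul_ne_zero hpi hz'))
  rw [osc_eq_sinProd, H_div_P, e1, e3, overSin_zpow hx, ← mul_zpow (2 * π : ℂ), e2, inv_zpow]
  linear_combination (-(Complex.exp (-(I * π * D.slope / 2) * (K : ℂ)⁻¹ * z ^ 2) *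
    (Complex.sin (π / K * z) ^ ((n : ℤ) + 2 * g - 2))⁻¹ * D.sinProd l m' ((K : ℂ)⁻¹ * z / 2) *
    sawKernel c z)) * e4

theorem exists_polynomial_irrResidue (g l : ℕ) (m' : Fin n → ℚ) :
    ∃ Q : Polynomial ℂ, ∀ K : ℕ, 2 ≤ K →
      D.irrResidue g K l m' = (K : ℂ) ^ ((n : ℤ) + 2 * g - 2) * Q.eval (K : ℂ)⁻¹ := by
  choose Q hQ using fun μ : Fin n → ℤˣ => D.exists_polynomial_residue_osc g l (signMul μ m') (D.signedSum m' μ)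
  refine ⟨∑ μ, Q μ, fun K hK => ?_⟩
  rw [irrResidue_eq, Polynomial.eval_finsetSum, Finset.mul_sum]
  exact Finset.sum_congr rfl fun μ _ => hQ μ K hK

/-! ### The index sets -/

theorem mem_redIndex_iff (hH : D.H ≠ 0) (x : (Fin n → ℤ) × ℤ) : x ∈ D.redIndex ↔
    x.1 ∈ D.box ∧ x.2 ∈ (D.stripIndex (D.shift (D.halfShift x.1 0))).filter
      (fun m₀ => 0 < D.phiSt x.1 m₀ ∧ D.phiSt x.1 m₀ < 1 / 2) := by
  rw [Finset.mem_filter, D.mem_stripIndex hH, ← phiSt_eq, box, Fintype.mem_piFinset]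
  simp only [Finset.mem_Ico]
  constructor
  · rintro ⟨h1, h2, h3⟩
    exact ⟨h1, ⟨h2.le, h3.le⟩, h2, h3⟩
  · rintro ⟨h1, -, h2, h3⟩
    exact ⟨h1, h2, h3⟩

theorem coe_redIndex (hH : D.H ≠ 0) : (↑((D.box.sigma fun m => (D.stripIndex (D.shift (D.halfShift m 0))).filter
      (fun m₀ => 0 < D.phiSt m m₀ ∧ D.phiSt m m₀ < 1 / 2)).map
        (Equiv.sigmaEquivProd (Fin n → ℤ) ℤ).toEmbedding) : Set ((Fin n → ℤ) × ℤ)) = D.redIndex := by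
  ext x
  rw [D.mem_redIndex_iff hH, Finset.mem_coe, Finset.mem_map_equiv, Finset.mem_sigma]
  rfl

theorem redIndex_finite (hH : D.H ≠ 0) : D.redIndex.Finite := by
  rw [← D.coe_redIndex hH]
  exact Finset.finite_toSet _

theorem finsum_redIndex (hH : D.H ≠ 0) (f : (Fin n → ℤ) → ℤ → ℂ) : ∑ᶠ x ∈ D.redIndex, f x.1 x.2 =
    ∑ m ∈ D.box, ∑ m₀ ∈ (D.stripIndex (D.shift (D.halfShift m 0))).filter
      (fun m₀ => 0 < D.phiSt m m₀ ∧ D.phiSt m m₀ < 1 / 2), f m m₀ := by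
  rw [← D.coe_redIndex hH]
  have := finsum_mem_coe_finset (fun x : (Fin n → ℤ) × ℤ => f x.1 x.2)
    ((D.box.sigma fun m => (D.stripIndex (D.shift (D.halfShift m 0))).filter
      (fun m₀ => 0 < D.phiSt m m₀ ∧ D.phiSt m m₀ < 1 / 2)).map (Equiv.sigmaEquivProd (Fin n → ℤ) ℤ).toEmbedding)
  rw [this, Finset.sum_map, Finset.sum_sigma]
  rfl

open scoped Classical in
theorem coe_irrIndex (l : ℕ) : (↑((D.primeFinset l).filter fun m' => m' ∉ D.irrSpIndex l) : Set (Fin n → ℚ)) =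
    D.irrIndex l := by
  ext m'
  rw [Finset.mem_coe, Finset.mem_filter, mem_primeFinset, irrIndex, irrSpIndex]
  simp only [Set.mem_ofPred_eq]
  push Not
  tauto

open scoped Classical in
theorem coe_irrSpIndex (l : ℕ) : (↑((D.primeFinset l).filter fun m' => m' ∈ D.irrSpIndex l) : Set (Fin n → ℚ)) =
    D.irrSpIndex l := by
  ext m'
  rw [Finset.mem_coe, Finset.mem_filter, mem_primeFinset]
  exact ⟨fun h => h.2, fun h => ⟨h.1, h⟩⟩

theorem irrIndex_finite (l : ℕ) : (D.irrIndex l).Finite := by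
  classical
  rw [← D.coe_irrIndex]
  exact Finset.finite_toSet _

theorem irrSpIndex_finite (l : ℕ) : (D.irrSpIndex l).Finite := by
  classical
  rw [← D.coe_irrSpIndex]
  exact Finset.finite_toSet _

open scoped Classical in
theorem finsum_irrIndex_add (l : ℕ) (f f' : (Fin n → ℚ) → ℂ) :
    ∑ᶠ m' ∈ D.irrIndex l, f m' + ∑ᶠ m' ∈ D.irrSpIndex l, f' m' =
      ∑ m' ∈ D.primeFinset l, if m' ∈ D.irrSpIndex l then f' m' else f m' := by
  rw [← Finset.sum_filter_add_sum_filter_not (D.primeFinset l) (fun m' => m' ∈ D.irrSpIndex l), add_comm]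
  congr 1
  · have := finsum_mem_coe_finset f' ((D.primeFinset l).filter fun m' => m' ∈ D.irrSpIndex l)
    rw [D.coe_irrSpIndex] at this
    rw [this]
    exact Finset.sum_congr rfl fun m' hm => (if_pos (Finset.mem_filter.mp hm).2).symm
  · have := finsum_mem_coe_finset f ((D.primeFinset l).filter fun m' => m' ∉ D.irrSpIndex l)
    rw [D.coe_irrIndex] at this
    rw [this]
    exact Finset.sum_congr rfl fun m' hm => (if_neg (Finset.mem_filter.mp hm).2).symm

/-! ### Assembly of the expansion -/

theorem singularLine_eq_zero (g K l : ℕ) {m' : Fin n → ℚ} (hm : ∀ μ, ¬ ∃ a : ℤ, D.signedSum m' μ = a) :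
    D.singularLine g K l m' = 0 := by
  classical
  rw [singularLine, Finset.filter_false_of_mem fun μ _ => hm μ, Finset.sum_empty]

theorem zIrr_eq (g K l : ℕ) (m' : Fin n → ℚ) : D.zIrr g K l m' =
    D.amplitude g K * ((-1) ^ (n * l) * ((D.symFactor m')⁻¹ * (D.primePhase K l m' *
      (π * I * D.irrResidue g K l m')))) := by
  rw [zIrr, amplitude, mul_add, mul_one, pow_add, div_eq_mul_inv _ (D.symFactor m')]
  ring

-- For an index without integral signed sum the error is exactly zero; only the special indices need
-- an estimate.
open scoped Classical in
theorem isBigO_sub_irr (hH : D.H ≠ 0) (g N l : ℕ) {m' : Fin n → ℚ} (hm : m' ∈ D.primeFinset l) :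
    (fun k : ℕ => D.amplitude g (k + 2) * ((-1) ^ (n * l) * ((D.symFactor m')⁻¹ * (D.primePhase (k + 2) l m' *
      (π * I * D.irrResidue g (k + 2) l m' - 1 / 2 * D.dir * D.signHP * D.singularLine g (k + 2) l m')))) -
      if m' ∈ D.irrSpIndex l then D.zIrrSp g (k + 2) N l m' else D.zIrr g (k + 2) l m')
      =O[atTop] fun k : ℕ => ((k + 2 : ℕ) : ℝ) ^ ((g : ℝ) - 1 / 2 - (N : ℝ)) := by
  by_cases h : m' ∈ D.irrSpIndex l
  · simp only [if_pos h]
    refine (D.isBigO_sub_zIrrSp hH g N l m').congr_left fun k => ?_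
    rw [zIrr_eq]
    ring
  · simp only [if_neg h]
    refine (Asymptotics.isBigO_zero _ _).congr_left fun k => ?_
    rw [D.singularLine_eq_zero g (k + 2) l fun μ hμ => h ⟨(D.mem_primeFinset).mp hm, μ, hμ⟩, zIrr_eq]
    ring

/-- The exact formula `invariant_eq` is compared term by term with the contributions; the index sets
do not depend on `K`, so finitely many errors of the same order are added. -/
theorem isBigO_invariant_sub (hH : D.H ≠ 0) (g N : ℕ) :
    (fun k : ℕ => D.invariant g (k + 2) -
        ((∑ᶠ x ∈ D.redIndex, D.zRed g (k + 2) N x.1 x.2) +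
          (∑ l ∈ Finset.range 2, ∑ᶠ m' ∈ D.irrIndex l, D.zIrr g (k + 2) l m') +
          (∑ l ∈ Finset.range 2, ∑ᶠ m' ∈ D.irrSpIndex l, D.zIrrSp g (k + 2) N l m')))
      =O[atTop] fun k : ℕ => ((k + 2 : ℕ) : ℝ) ^ ((g : ℝ) - 1 / 2 - (N : ℝ)) := by
  classical
  have hred := Asymptotics.IsBigO.fun_sum (l := atTop) (s := D.box) fun m _ =>
    Asymptotics.IsBigO.fun_sum (l := atTop) (s := (D.stripIndex (D.shift (D.halfShift m 0))).filter
      (fun m₀ => 0 < D.phiSt m m₀ ∧ D.phiSt m m₀ < 1 / 2)) fun m₀ hm₀ =>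
      D.isBigO_sub_zRed hH g N m m₀ (Finset.mem_filter.mp hm₀).2.1 (Finset.mem_filter.mp hm₀).2.2
  have hirr := Asymptotics.IsBigO.fun_sum (l := atTop) (s := Finset.range 2) fun l _ =>
    Asymptotics.IsBigO.fun_sum (l := atTop) (s := D.primeFinset l) fun m' hm' => D.isBigO_sub_irr hH g N l hm'
  refine (hred.add hirr).congr_left fun k => ?_
  rw [D.invariant_eq hH g (by omega), D.finsum_redIndex hH (D.zRed g (k + 2) N), add_assoc,
    ← Finset.sum_add_distrib]
  simp only [finsum_irrIndex_add, Finset.sum_sub_distrib]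
  rw [mul_add, Finset.mul_sum, Finset.mul_sum]
  simp only [Finset.mul_sum]
  ring

end SeifertData

end SeifertWRT

theorem proposition3p1p1 {n : ℕ} (g : ℕ) (D : SeifertWRT.SeifertData n) (hH : D.H ≠ 0) :
    -- the sums below are finite
    D.redIndex.Finite ∧
    (∀ l ∈ Finset.range 2, (D.irrIndex l).Finite ∧ (D.irrSpIndex l).Finite) ∧
    -- the residue part of `Z^{(irr.)}` is a finite polynomial in `1/K` times a power of `K`
    (∀ l ∈ Finset.range 2, ∀ m' ∈ D.irrIndex l ∪ D.irrSpIndex l,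
      ∃ Q : Polynomial ℂ, ∀ K : ℕ, 2 ≤ K →
        D.irrResidue g K l m' = (K : ℂ) ^ ((n : ℤ) + 2 * g - 2) * Q.eval (K : ℂ)⁻¹) ∧
    -- the asymptotic expansion to all orders, with `K = k + 2`
    ∀ N : ℕ,
      (fun k : ℕ => D.invariant g (k + 2) -
        ((∑ᶠ x ∈ D.redIndex, D.zRed g (k + 2) N x.1 x.2) +
          (∑ l ∈ Finset.range 2, ∑ᶠ m' ∈ D.irrIndex l, D.zIrr g (k + 2) l m') +
          (∑ l ∈ Finset.range 2, ∑ᶠ m' ∈ D.irrSpIndex l, D.zIrrSp g (k + 2) N l m')))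
      =O[Filter.atTop] (fun k : ℕ => ((k + 2 : ℕ) : ℝ) ^ ((g : ℝ) - 1 / 2 - (N : ℝ))) := by
  exact ⟨D.redIndex_finite hH, fun l _ => ⟨D.irrIndex_finite l, D.irrSpIndex_finite l⟩,
    fun l _ m' _ => D.exists_polynomial_irrResidue g l m', fun N => D.isBigO_invariant_sub hH g N⟩
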